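/- Conventions. Tropical polynomials are max-plus: $P(x)=\max_{i\in A}(a_i+\langle i,x\rangle)$ with $A\subset\mathbb{Z}^N$ finite and non-empty; the hypersurface $V(P)\subset\mathbb{R}^N$ is the set of points where the maximum is attained at least twice. It is a polyhedral complex dual to the subdivision of the Newton polytope of $P$ whose cells are the convex hulls of the sets of exponents attaining the maximum at a given point; its facets are its cells of dimension $N-1$. For tropical polynomials $f,g$ in two variables, the tropical modification $\mathbb{R}^2_{f/g}$ of $\mathbb{R}^2$ along the tropical rational function $f/g$ is the hypersurface in $\mathbb{R}^3$ of the tropical polynomial $\max(z+g(x,y),f(x,y))$, and for a tropical polynomial $P$ one puts $\mathbb{R}^2_P=V(\max(z,P))$. Two hypersurfaces in $\mathbb{R}^3$ intersect transversely if every top-dimensional cell of their intersection is of the form $A\cap B$ with $A$, $B$ facets of the two hypersurfaces whose relative interiors meet and whose directions span $\mathbb{R}^3$. A tropical curve in $\mathbb{R}^N$ is a finite, positively weighted, balanced rational polyhedral complex of pure dimension one. Let $\pi:\mathbb{R}^3\to\mathbb{R}^2$ be the projection on the first two coordinates. Lift. Let $C\subset\mathbb{R}^2$ be a tropical curve, some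 of whose vertices are $2$-valent marked points $x_1,\dots,x_k$. A tropical curve $\tilde C\subset\mathbb{R}^3$ is a lift of $(C,x_1,\dots,x_k)$ if: $\pi(\tilde C)=C$; every infinite vertical edge of $\tilde C$ is a downward ray $\{x\}\times(-\infty,r]$; an edge $e$ of $\tilde C$ is infinite vertical if and only if $\pi(e)\subset\{x_1,\dots,x_k\}$, and over every $x_i$ there is such an edge; and for every point $x$ in the interior of an edge $e$ of $C$ such that $\pi^{-1}(x)\cap\tilde C$ is finite, $w(e)=\sum_f w(f)\,[\Lambda_e:\Lambda_f]$, where $f$ runs over the edges of $\tilde C$ meeting $\pi^{-1}(x)$, $w$ denotes weights, and $\Lambda_e$ (resp. $\Lambda_f$) is the sublattice of $\mathbb{Z}^3$ generated by $(0,0,1)$ and a primitive vector in the direction of $e$ (resp. $f$). It is a lift to $S\subset\mathbb{R}^3$ if moreover $\tilde C\subset S$. Data. Let $n\ge 1$. Let $P_n,Q_n,f_n,g$ be tropical polynomials in two variables, $D_n=V(P_n)$, $C_n=V(Q_n)$, $F_n=V(f_n)$, $E=V(g)$, and let $x_1,\dots,x_{2n}$ be points of $C_n$, such that the following holds (with $0\le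 k\le n-1$ in the first two items). 1. The triangles of the dual subdivision of $P_n$ are $\Delta_n^k=\mathrm{Conv}((k,0),(0,1),(k+1,0))$; those of $Q_n$ are $K_n^k=\mathrm{Conv}((k,0),(k,1),(k+1,0))$, $L_n^k=\mathrm{Conv}((k,1),(k+1,0),(k+1,1))$ and $M_n^k=\mathrm{Conv}((k,1),(0,2),(k+1,1))$; those of $f_n$ are $G_n^k=\Delta_n^k$, $H_n^k=\mathrm{Conv}((k,1),(k+1,1),(n,0))$ and $I_n^k=M_n^k$. The Newton polytope of $g$ is $[(0,0),(0,1)]$, and so $E$ is a horizontal line. 2. The vertex of $D_n$ dual to $\Delta_n^k$ is the vertex of $C_n$ dual to $M_n^k$. 3. For $1\le k\le n$, $x_k$ lies in the relative interior of the edge of $C_n$ dual to $[(k-1,1),(0,2)]$ and has the same first coordinate as the vertex of $C_n$ dual to $K_n^{k-1}$; for $n+1\le k\le 2n$, $x_k$ lies in the relative interior of the edge of $C_n$ dual to $[(0,2),(n,1)]$. 4. $E$ is strictly below every vertex of $C_n$. 5. The following points lie in the relative interiors of the following edges of $F_n$: $x_k$, for $1\le k\le n$, of the edge dual to $[(k-1,0),(k,0)]$;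 $x_{n+1}$ of the edge dual to $[(1,1),(n,0)]$; and $x_{n+k+1}$, for $1\le k\le n-1$, of the edge dual to $[(k,1),(k+1,1)]$. Equip $C_n$ with its lattice-length weights and consider the $x_i$ as additional vertices of $C_n$. Put $X_n=\mathbb{R}^2_{P_n}$ and, for $\lambda\in\mathbb{R}$, $Y_n^\lambda=\mathbb{R}^2_{(\lambda+f_n)/g}$. Statement. The marked curve $(C_n,x_1,\dots,x_{2n})$ has a unique lift $\tilde C_n$ to $X_n$; there is $\lambda_0\in\mathbb{R}$ such that $\tilde C_n$ is also a lift of it to $Y_n^{\lambda_0}$; and for every such $\lambda_0$, with $Y_n=Y_n^{\lambda_0}$, the surfaces $X_n$ and $Y_n$ intersect transversely and $\tilde C_n=X_n\cap Y_n$ (as subsets of $\mathbb{R}^3$). -/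

import Mathlib

/-! ## Tropical polynomials (max-plus convention) and their hypersurfaces -/

/-- A tropical polynomial `max_{i ∈ support} (coeff i + ⟨i, x⟩)` in `N` variables.
The values of `coeff` outside `support` play no role. -/
structure TropPoly (N : ℕ) where
  support : Finset (Fin N → ℤ)
  nonempty : support.Nonempty
  coeff : (Fin N → ℤ) → ℝ

/-- The real vector attached to an integer vector. -/
def toReal {N : ℕ} (m : Fin N → ℤ) : Fin N → ℝ := fun i => (m i : ℝ)

/-- The dimension of (the affine span of) a set. -/
noncomputable def setDim {N : ℕ} (S : Set (Fin N → ℝ)) : ℕ :=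
  Module.finrank ℝ (vectorSpan ℝ S)

namespace TropPoly

variable {N : ℕ}

/-- The value at `x` of the monomial with exponent `m`. -/
def term (P : TropPoly N) (m : Fin N → ℤ) (x : Fin N → ℝ) : ℝ :=
  P.coeff m + ∑ i, (m i : ℝ) * x i

/-- The exponents of the monomials that realize the maximum at `x`. -/
def maxTerms (P : TropPoly N) (x : Fin N → ℝ) : Set (Fin N → ℤ) :=
  {m | m ∈ P.support ∧ ∀ m' ∈ P.support, P.term m' x ≤ P.term m x}

/-- The tropical hypersurface `V(P)`: the maximum is attained at least twice. -/
def hypersurface (P : TropPoly N) : Set (Fin N → ℝ) :=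
  {x | (P.maxTerms x).Nontrivial}

/-- The Newton polytope of `P`. -/
def newtonPolytope (P : TropPoly N) : Set (Fin N → ℝ) :=
  convexHull ℝ (toReal '' (P.support : Set (Fin N → ℤ)))

/-- The cell of the dual subdivision of `P` which is dual to the (relatively open) cell
containing `x`.  Thus `P.dualCell v = T`, with `T` a polygon, says that `v` is the vertex of
`V(P)` dual to `T`, and `P.dualCell x = segment ℝ a b` says that `x` lies in the relative
interior of the edge of `V(P)` dual to `[a, b]` (two-variable case). -/
def dualCell (P : TropPoly N) (x : Fin N → ℝ) : Set (Fin N → ℝ) :=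
  convexHull ℝ (toReal '' P.maxTerms x)

/-- The full-dimensional cells of the dual subdivision of `P` are exactly the members of `T`. -/
def HasDualSubdivision (P : TropPoly N) (T : Set (Set (Fin N → ℝ))) : Prop :=
  {S | (∃ x, P.dualCell x = S) ∧ (interior S).Nonempty} = T

/-- The closed polyhedron whose relative interior contains `x` in the subdivision of `ℝ^N`
induced by `P`. -/
def cellAt (P : TropPoly N) (x : Fin N → ℝ) : Set (Fin N → ℝ) :=
  {y | P.maxTerms x ⊆ P.maxTerms y}

/-- The cells of the polyhedral complex `V(P)`. -/
def cells (P : TropPoly N) : Set (Set (Fin N → ℝ)) :=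
  {c | ∃ x ∈ P.hypersurface, c = P.cellAt x}

/-- The facets of `V(P)`, that is its cells of codimension one in `ℝ^N`. -/
def facets (P : TropPoly N) : Set (Set (Fin N → ℝ)) :=
  {c | c ∈ P.cells ∧ setDim c + 1 = N}

/-- The tropical constant polynomial `0` (the tropical multiplicative unit). -/
def unit (N : ℕ) : TropPoly N where
  support := {0}
  nonempty := Finset.singleton_nonempty 0
  coeff := fun _ => 0

/-- The tropical product of the polynomial `f` with the constant `l`. -/
def scale (l : ℝ) (f : TropPoly N) : TropPoly N where
  support := f.support
  nonempty := f.nonempty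
  coeff := fun m => l + f.coeff m

/-- The tropical polynomial `x_{N+1} g(x) + f(x)` in `N + 1` variables.  Its hypersurface is the
tropical modification of `ℝ^N` along the tropical rational function `f / g`. -/
def modification (f g : TropPoly N) : TropPoly (N + 1) where
  support :=
    f.support.image (fun m => Fin.snoc (α := fun _ => ℤ) m 0) ∪
      g.support.image (fun m => Fin.snoc (α := fun _ => ℤ) m 1)
  nonempty := (f.nonempty.image _).mono Finset.subset_union_left
  coeff := fun m =>
    if m (Fin.last N) = 0 then f.coeff (fun i => m i.castSucc) else g.coeff (fun i => m i.castSucc)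

end TropPoly

/-- The cells of the intersection of the polyhedral complexes `V(P)` and `V(Q)`: the nonempty
intersections of a cell of `V(P)` with a cell of `V(Q)`. -/
def commonCells {N : ℕ} (P Q : TropPoly N) : Set (Set (Fin N → ℝ)) :=
  {c | c.Nonempty ∧ ∃ a ∈ P.cells, ∃ b ∈ Q.cells, c = a ∩ b}

/-- `V(P)` and `V(Q)` intersect transversely: every cell of top dimension of their intersection
is a transverse intersection `A ∩ B` of a facet `A` of `V(P)` and a facet `B` of `V(Q)`, meaning
that the relative interiors of `A` and `B` meet and that their directions span `ℝ^N`. -/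
def IntersectTransversely {N : ℕ} (P Q : TropPoly N) : Prop :=
  ∀ c ∈ commonCells P Q, (∀ c' ∈ commonCells P Q, setDim c' ≤ setDim c) →
    ∃ A ∈ P.facets, ∃ B ∈ Q.facets, c = A ∩ B ∧
      (intrinsicInterior ℝ A ∩ intrinsicInterior ℝ B).Nonempty ∧
      vectorSpan ℝ A ⊔ vectorSpan ℝ B = ⊤

/-! ## Tropical curves in `ℝ^N` -/

/-- A weighted one-dimensional complex, given by the function that sends each edge to its weight
and every set that is not an edge to `0`. -/
abbrev WeightedEdges (N : ℕ) := Set (Fin N → ℝ) → ℕ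

namespace WeightedEdges

variable {N : ℕ}

/-- The edges: the sets of nonzero weight. -/
def edges (w : WeightedEdges N) : Set (Set (Fin N → ℝ)) := {e | w e ≠ 0}

/-- The underlying set. -/
def carrier (w : WeightedEdges N) : Set (Fin N → ℝ) := ⋃₀ w.edges

end WeightedEdges

/-- Primitive integer vectors. -/
def IsPrimitiveVec {N : ℕ} (u : Fin N → ℤ) : Prop :=
  ∀ d : ℤ, (∀ i, d ∣ u i) → IsUnit d

/-- A closed segment, ray or line with rational direction (not reduced to a point). -/
def IsRationalEdge {N : ℕ} (e : Set (Fin N → ℝ)) : Prop :=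
  ∃ (p : Fin N → ℝ) (u : Fin N → ℤ) (I : Set ℝ), IsPrimitiveVec u ∧ IsClosed I ∧
    I.OrdConnected ∧ I.Nontrivial ∧ e = (fun t : ℝ => p + t • toReal u) '' I

/-- `u` is the primitive integer vector pointing from `v` along `e`. -/
def IsOutgoing {N : ℕ} (v : Fin N → ℝ) (e : Set (Fin N → ℝ)) (u : Fin N → ℤ) : Prop :=
  IsPrimitiveVec u ∧ ∃ t : ℝ, 0 < t ∧ v + t • toReal u ∈ e

/-- A tropical curve in `ℝ^N`: a finite weighted rational polyhedral complex of pure dimension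
one (two edges meet at most in a common end point) that is balanced at each vertex. -/
structure IsTropicalCurve {N : ℕ} (w : WeightedEdges N) : Prop where
  finite : w.edges.Finite
  rational : ∀ e ∈ w.edges, IsRationalEdge e
  complex : ∀ e ∈ w.edges, ∀ e' ∈ w.edges, e ≠ e' → ∀ v ∈ e ∩ e',
    v ∈ e.extremePoints ℝ ∧ v ∈ e'.extremePoints ℝ
  balanced : ∀ e ∈ w.edges, ∀ v ∈ e.extremePoints ℝ,
    ∃ u : Set (Fin N → ℝ) → (Fin N → ℤ),
      (∀ e' ∈ w.edges, v ∈ e' → IsOutgoing v e' (u e')) ∧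
      ∑ᶠ e' ∈ {e' | e' ∈ w.edges ∧ v ∈ e'}, w e' • u e' = 0

/-- The lattice length of a lattice segment. -/
noncomputable def latticeLength {N : ℕ} (S : Set (Fin N → ℝ)) : ℕ :=
  {m : Fin N → ℤ | toReal m ∈ S}.ncard - 1

/-- The part of the edge through `p` of the planar curve `V(Q)` that is cut out around `p` by the
points of `M`. -/
def edgePiece (Q : TropPoly 2) (M : Set (Fin 2 → ℝ)) (p : Fin 2 → ℝ) : Set (Fin 2 → ℝ) :=
  {q | q ∈ Q.cellAt p ∧ Disjoint (openSegment ℝ p q) M}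

/-- The planar tropical curve `V(Q)` in which the points of `M` are additional vertices: each edge
is refined at the points of `M` lying on it, and has as weight the lattice length of the dual
segment.  (The set below has one element if `e` is an edge, and is empty, with
supremum `0`, otherwise.) -/
noncomputable def markedCurve (Q : TropPoly 2) (M : Set (Fin 2 → ℝ)) : WeightedEdges 2 :=
  fun e => sSup {l | ∃ p, p ∉ M ∧ Q.cellAt p ∈ Q.facets ∧ e = edgePiece Q M p ∧
    l = latticeLength (Q.dualCell p)}

/-! ## Lifts of marked planar curves to `ℝ³` -/

/-- The vertical projection. -/
def proj (p : Fin 3 → ℝ) : Fin 2 → ℝ := ![p 0, p 1]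

/-- Infinite vertical edges. -/
def IsInfiniteVertical (e : Set (Fin 3 → ℝ)) : Prop :=
  (∃ x, proj '' e = {x}) ∧ ¬ Bornology.IsBounded e

/-- For an edge `f` in `ℝ³`: the sublattice of `ℤ³` generated by a primitive vector in the
direction of `f` and by `(0, 0, 1)`. -/
def edgeLattice (f : Set (Fin 3 → ℝ)) : AddSubgroup (Fin 3 → ℤ) :=
  AddSubgroup.closure ({u | IsPrimitiveVec u ∧ toReal u ∈ vectorSpan ℝ f} ∪ {![0, 0, 1]})

/-- A planar edge placed in the horizontal plane of `ℝ³`. -/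
def horizontalCopy (e : Set (Fin 2 → ℝ)) : Set (Fin 3 → ℝ) :=
  {p | proj p ∈ e ∧ p 2 = 0}

/-- `L` is a lift of the planar tropical curve `C` with set of marked points `M`. -/
structure IsLift (C : WeightedEdges 2) (M : Set (Fin 2 → ℝ)) (L : WeightedEdges 3) : Prop where
  curve : IsTropicalCurve L
  projection : proj '' L.carrier = C.carrier
  downward : ∀ e ∈ L.edges, IsInfiniteVertical e →
    ∃ (x : Fin 2 → ℝ) (r : ℝ), e = {p | proj p = x ∧ p 2 ≤ r}
  vertical_iff : ∀ e ∈ L.edges, (IsInfiniteVertical e ↔ proj '' e ⊆ M)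
  /-- every marked point lifts to an infinite vertical edge -/
  marked : ∀ x ∈ M, ∃ e ∈ L.edges, IsInfiniteVertical e ∧ proj '' e = {x}
  weight : ∀ e ∈ C.edges, ∀ x ∈ intrinsicInterior ℝ e, (proj ⁻¹' {x} ∩ L.carrier).Finite →
    C e = ∑ᶠ f ∈ {f | f ∈ L.edges ∧ x ∈ proj '' f},
      L f * (edgeLattice f).relIndex (edgeLattice (horizontalCopy e))

/-- `L` is a lift of `(C, M)` to the set `S` (a tropical modification of the plane). -/
def IsLiftTo (C : WeightedEdges 2) (M : Set (Fin 2 → ℝ)) (S : Set (Fin 3 → ℝ))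
    (L : WeightedEdges 3) : Prop :=
  IsLift C M L ∧ L.carrier ⊆ S

/-! ## The subdivisions -/

/-- The point `(i, j)` of the plane. -/
def pt (i j : ℕ) : Fin 2 → ℝ := ![(i : ℝ), (j : ℝ)]

/-- The triangle with the given vertices. -/
def triangle (a b c : Fin 2 → ℝ) : Set (Fin 2 → ℝ) := convexHull ℝ {a, b, c}

/-- The triangles `Δ^k` (and `G^k`), subdividing `Conv((0,0), (n,0), (0,1))`. -/
def triDelta (k : ℕ) : Set (Fin 2 → ℝ) := triangle (pt k 0) (pt 0 1) (pt (k + 1) 0)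

def triK (k : ℕ) : Set (Fin 2 → ℝ) := triangle (pt k 0) (pt k 1) (pt (k + 1) 0)

def triL (k : ℕ) : Set (Fin 2 → ℝ) := triangle (pt k 1) (pt (k + 1) 0) (pt (k + 1) 1)

/-- The triangles `M^k` (and `I^k`). -/
def triM (k : ℕ) : Set (Fin 2 → ℝ) := triangle (pt k 1) (pt 0 2) (pt (k + 1) 1)

def triH (n k : ℕ) : Set (Fin 2 → ℝ) := triangle (pt k 1) (pt (k + 1) 1) (pt n 0)

/-!
A lift of a marked planar curve is determined by a height function on the curve. The planar curve
`V(Q)` is smooth: its dual triangles are unimodular, so all its weights are one, and at each of its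
points the primitive outgoing directions add up to zero while no proper part of them does
(`markedCurve_germCurve`). Over each edge the weight condition leaves room for one edge of the lift
only, of weight one, and by the minimality of the directions the edges of the lift over the germs of
the curve at a point all end at the same height. Hence a lift is the graph of a function with
integer slopes, together with one vertical ray below each marked point; by the balancing condition
the slopes of the function at a point add up to zero, or to the weight of the ray if the point is
marked (`lift_structure`). Conversely, a function on the curve whose slopes add up to zero, and to
one at the marked points, gives a lift (`graphCurve_isLift`).

The dual subdivisions and the positions of the marked points put all the data into a normal form
(`exists_model`). The curve `V(Q)` consists of the graphs of two functions of the first coordinate,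
the lower boundary `ℓ` and the upper boundary `u`, of vertical rays below the first and of vertical
segments between the two. The upper boundary is the graph of the row `0` of `P`, so that
`P = c + max u y`, while `ℓ + u` is the row `0` of `f` up to a constant. All marked points lie on
the upper boundary, some straight above the rays and the others to the right of all segments. The height of the lift is, up to a constant, `u` on the
lower boundary and the rays, `ℓ + u - y` on the segments, and on the upper boundary the function
`top = ℓ + s`, where `s` is the convex function that gains one unit of slope above each of the last
marked points. Its slopes are as required (`Config.IsModel.isHarmonic`). Thanks to the position of
the marked points on `V(f)`, `top` is the maximum of `ℓ` and of the row `1` of `f`, suitably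
normalized.

A lift to the modification along `P` has the height of `P` off the curve `V(P)`, which consists of
the upper boundary and of the vertical lines below its breaks. Hence the difference of two height
functions vanishes on the lower boundary and the rays. Balancing at the lower ends of the segments
then makes it vanish on the segments. So its restriction to the upper boundary has slopes that
change at marked points only, where they increase, because the rays have positive weight: it is
convex. It is also bounded above, because the lift lies below the graph of `P`, and `top - u` is
bounded below. A bounded above convex function on the line is constant, and the segments fix the
constant (`Config.IsModel.eq_zero_of_slopes`, `Config.IsModel.eq_liftCurve`).

The line `V(g)` lies below the curve, apart from the rays, so that the equation of the second
modification above it is `z = λ + f - y` up to walls over `V(f)`. Comparing the three rows of `f`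
with `u` shows that the intersection of the two modifications is the lift
(`Config.IsModel.meetType`, `Config.IsModel.carrier_liftCurve`) when the constant `λ` is the right
one, and the height of one point of the lift determines `λ` (`Config.IsModel.const_of_subset`). At
each point of the intersection either exactly two exponents are maximal for each of the two
polynomials, with linearly independent differences, and then two facets meet transversely, or the
differences of maximal exponents span the space, and then the point is a cell of its own and not of top dimension
(`Config.MeetType.independentOrSpanning`, `Config.IsModel.transverse`).
-/


/-! ### Integer vectors and rational lines -/

section IntegerVectors

variable {N : ℕ}

lemma toReal_injective : Function.Injective (toReal : (Fin N → ℤ) → Fin N → ℝ) := by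
  intro a b h
  funext i
  have : (a i : ℝ) = b i := congrFun h i
  exact_mod_cast this

lemma toReal_zsmul (k : ℤ) (v : Fin N → ℤ) : toReal (k • v) = (k : ℝ) • toReal v := by
  funext i; simp [toReal]

lemma toReal_neg (v : Fin N → ℤ) : toReal (-v) = -toReal v := by
  funext i; simp [toReal]

lemma toReal_ne_zero {v : Fin N → ℤ} (hv : v ≠ 0) : toReal v ≠ 0 := by
  intro h
  apply hv
  apply toReal_injective
  rw [h]; funext i; simp [toReal]

lemma IsPrimitiveVec.ne_zero {v : Fin N → ℤ} (hv : IsPrimitiveVec v) : v ≠ 0 := by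
  rintro rfl
  have := hv 0 (by simp)
  simp at this

lemma IsPrimitiveVec.neg {v : Fin N → ℤ} (hv : IsPrimitiveVec v) : IsPrimitiveVec (-v) := by
  intro d hd
  exact hv d fun i => by simpa using hd i

lemma isPrimitiveVec_of_isUnit {v : Fin N → ℤ} (i : Fin N) (h : IsUnit (v i)) :
    IsPrimitiveVec v :=
  fun _ hd => isUnit_of_dvd_unit (hd i) h

lemma IsPrimitiveVec.exists_bezout {v : Fin N → ℤ} (hv : IsPrimitiveVec v) :
    ∃ a : Fin N → ℤ, ∑ i, a i * v i = 1 := by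
  rw [← Ideal.mem_span_range_iff_exists_fun]
  obtain ⟨d, hd⟩ := (IsPrincipalIdealRing.principal (Ideal.span (Set.range v))).principal
  have hdv : ∀ i, d ∣ v i := by
    intro i
    have : v i ∈ Ideal.span (Set.range v) := Ideal.subset_span ⟨i, rfl⟩
    rw [hd] at this
    exact Ideal.mem_span_singleton.1 this
  have hu := hv d hdv
  rw [hd]
  exact Ideal.mem_span_singleton.2 hu.dvd

/-- An integer vector on the line of a primitive vector is an integer multiple of it. -/
lemma IsPrimitiveVec.exists_int_mul {u v : Fin N → ℤ} (hv : IsPrimitiveVec v) {r : ℝ}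
    (h : toReal u = r • toReal v) : ∃ k : ℤ, r = k ∧ u = k • v := by
  obtain ⟨a, ha⟩ := hv.exists_bezout
  have hr : r = ((∑ i, a i * u i : ℤ) : ℝ) := by
    have h1 : ((∑ i, a i * v i : ℤ) : ℝ) = 1 := by rw [ha]; simp
    push_cast at h1 ⊢
    calc r = r * ∑ i, (a i : ℝ) * v i := by rw [h1, mul_one]
      _ = ∑ i, (a i : ℝ) * u i := by
        rw [Finset.mul_sum]
        refine Finset.sum_congr rfl fun i _ => ?_
        have := congrFun h i
        simp only [toReal, Pi.smul_apply, smul_eq_mul] at this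
        rw [this]; ring
  refine ⟨_, hr, toReal_injective ?_⟩
  rw [toReal_zsmul, ← hr, h]

lemma IsPrimitiveVec.eq_or_neg {u v : Fin N → ℤ} (hu : IsPrimitiveVec u) (hv : IsPrimitiveVec v)
    {r : ℝ} (h : toReal u = r • toReal v) : (r = 1 ∧ u = v) ∨ (r = -1 ∧ u = -v) := by
  obtain ⟨k, hk, hkv⟩ := hv.exists_int_mul h
  have hunit := hu k fun i => by rw [hkv]; simp
  rcases Int.isUnit_iff.1 hunit with rfl | rfl
  · left; exact ⟨by simpa using hk, by simpa using hkv⟩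
  · right; exact ⟨by simpa using hk, by simpa using hkv⟩

lemma IsPrimitiveVec.eq_of_pos {u v : Fin N → ℤ} (hu : IsPrimitiveVec u) (hv : IsPrimitiveVec v)
    {r : ℝ} (hr : 0 < r) (h : toReal u = r • toReal v) : u = v := by
  rcases hu.eq_or_neg hv h with h | h
  · exact h.2
  · linarith [h.1]

/-- The point of parameter `t` on the line through `p` of direction `v`. -/
def linePt (p : Fin N → ℝ) (v : Fin N → ℤ) (t : ℝ) : Fin N → ℝ := p + t • toReal v

lemma linePt_zero (p : Fin N → ℝ) (v : Fin N → ℤ) : linePt p v 0 = p := by simp [linePt]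

lemma linePt_linePt (p : Fin N → ℝ) (v : Fin N → ℤ) (s t : ℝ) :
    linePt (linePt p v s) v t = linePt p v (s + t) := by
  simp only [linePt, add_smul, add_assoc]

lemma linePt_neg (p : Fin N → ℝ) (v : Fin N → ℤ) (t : ℝ) :
    linePt p (-v) t = linePt p v (-t) := by
  simp [linePt, toReal_neg]

lemma linePt_injective (p : Fin N → ℝ) {v : Fin N → ℤ} (hv : v ≠ 0) :
    Function.Injective (linePt p v) := by
  intro s t h
  have h1 : s • toReal v = t • toReal v := add_left_cancel h
  exact smul_left_injective ℝ (toReal_ne_zero hv) h1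

lemma linePt_eq_self_iff (p : Fin N → ℝ) {v : Fin N → ℤ} (hv : v ≠ 0) {t : ℝ} :
    linePt p v t = p ↔ t = 0 := by
  constructor
  · intro h
    apply linePt_injective p hv
    rw [h, linePt_zero]
  · rintro rfl; exact linePt_zero p v

lemma continuous_linePt (p : Fin N → ℝ) (v : Fin N → ℤ) : Continuous (linePt p v) := by
  unfold linePt; fun_prop

lemma isClosed_linePt_image (p : Fin N → ℝ) {v : Fin N → ℤ} (hv : v ≠ 0) {I : Set ℝ}
    (hI : IsClosed I) : IsClosed (linePt p v '' I) := by
  have h1 := (isClosedEmbedding_smul_left (𝕜 := ℝ) (toReal_ne_zero hv)).isClosedMap _ hI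
  have h2 := (Homeomorph.addLeft p).isClosedMap _ h1
  have : linePt p v '' I = (Homeomorph.addLeft p) '' ((fun c : ℝ => c • toReal v) '' I) := by
    rw [Set.image_image]; rfl
  rw [this]; exact h2

lemma linePt_combo (p : Fin N → ℝ) (v : Fin N → ℤ) {a b s t : ℝ} (hab : a + b = 1) :
    a • linePt p v s + b • linePt p v t = linePt p v (a * s + b * t) := by
  funext i
  simp only [linePt, Pi.add_apply, Pi.smul_apply, smul_eq_mul]
  linear_combination (p i) * hab

lemma convex_linePt_image (p : Fin N → ℝ) (v : Fin N → ℤ) {I : Set ℝ} (hI : I.OrdConnected) :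
    Convex ℝ (linePt p v '' I) := by
  rintro _ ⟨s, hs, rfl⟩ _ ⟨t, ht, rfl⟩ a b ha hb hab
  rw [linePt_combo p v hab]
  exact ⟨_, hI.convex hs ht ha hb hab, rfl⟩

/-- `t` lies strictly between two points of `I`. -/
def IsInner (I : Set ℝ) (t : ℝ) : Prop := ∃ a ∈ I, ∃ b ∈ I, a < t ∧ t < b

lemma IsInner.mem {I : Set ℝ} (hI : I.OrdConnected) {t : ℝ} (h : IsInner I t) : t ∈ I := by
  obtain ⟨a, ha, b, hb, h1, h2⟩ := h
  exact hI.out ha hb ⟨h1.le, h2.le⟩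

lemma exists_isInner {I : Set ℝ} (hI : I.Nontrivial) : ∃ t, IsInner I t := by
  obtain ⟨a, ha, b, hb, hab⟩ := hI.exists_lt
  exact ⟨(a + b) / 2, a, ha, b, hb, by linarith, by linarith⟩

lemma mem_extremePoints_linePt_image (p : Fin N → ℝ) {v : Fin N → ℤ} (hv : v ≠ 0) {I : Set ℝ}
    {t : ℝ} (ht : t ∈ I) :
    linePt p v t ∈ (linePt p v '' I).extremePoints ℝ ↔ ¬ IsInner I t := by
  rw [mem_extremePoints]
  constructor
  · rintro ⟨-, h⟩ ⟨a, ha, b, hb, h1, h2⟩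
    have := (h _ ⟨a, ha, rfl⟩ _ ⟨b, hb, rfl⟩ ?_).1
    · have := linePt_injective p hv this
      linarith
    · refine ⟨(b - t) / (b - a), (t - a) / (b - a), ?_, ?_, ?_, ?_⟩
      · apply div_pos <;> linarith
      · apply div_pos <;> linarith
      · rw [← add_div, div_eq_one_iff_eq] <;> linarith
      · rw [linePt_combo]
        · congr 1
          have : b - a ≠ 0 := by linarith
          field_simp; ring
        · rw [← add_div, div_eq_one_iff_eq] <;> linarith
  · intro h
    refine ⟨⟨t, ht, rfl⟩, ?_⟩
    rintro _ ⟨a, ha, rfl⟩ _ ⟨b, hb, rfl⟩ ⟨α, β, hα, hβ, hαβ, hc⟩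
    rw [linePt_combo p v hαβ] at hc
    have hc := linePt_injective p hv hc
    have key : a = b := by
      by_contra hne
      apply h
      have hα' : α = 1 - β := by linarith
      subst hα'
      rcases lt_or_gt_of_ne hne with hlt | hlt
      · have h1 := mul_pos hα (sub_pos.2 hlt)
        have h2 := mul_pos hβ (sub_pos.2 hlt)
        exact ⟨a, ha, b, hb, by linarith, by linarith⟩
      · have h1 := mul_pos hα (sub_pos.2 hlt)
        have h2 := mul_pos hβ (sub_pos.2 hlt)
        exact ⟨b, hb, a, ha, by linarith, by linarith⟩
    subst key
    have : t = a := by rw [← hc, ← add_mul, hαβ, one_mul]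
    subst this
    exact ⟨rfl, rfl⟩

lemma vectorSpan_linePt_image (p : Fin N → ℝ) (v : Fin N → ℤ) {I : Set ℝ} (hI : I.Nontrivial) :
    vectorSpan ℝ (linePt p v '' I) = ℝ ∙ toReal v := by
  obtain ⟨a, ha, b, hb, hab⟩ := hI
  apply le_antisymm
  · rw [vectorSpan_def, Submodule.span_le]
    rintro _ ⟨_, ⟨s, _, rfl⟩, _, ⟨t, _, rfl⟩, rfl⟩
    rw [SetLike.mem_coe, Submodule.mem_span_singleton]
    exact ⟨s - t, by simp [linePt, sub_smul]⟩
  · rw [Submodule.span_singleton_le_iff_mem]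
    have h1 : linePt p v a -ᵥ linePt p v b ∈ vectorSpan ℝ (linePt p v '' I) :=
      vsub_mem_vectorSpan ℝ ⟨a, ha, rfl⟩ ⟨b, hb, rfl⟩
    have h2 : linePt p v a -ᵥ linePt p v b = (a - b) • toReal v := by
      simp [linePt, sub_smul]
    rw [h2] at h1
    have h3 := Submodule.smul_mem _ (a - b)⁻¹ h1
    rwa [smul_smul, inv_mul_cancel₀ (sub_ne_zero.2 hab), one_smul] at h3

/-- A point of `s` near which `s` fills its affine span is in the relative interior. -/
lemma mem_intrinsicInterior_of_nhds {s : Set (Fin N → ℝ)} {x : Fin N → ℝ} (hx : x ∈ s)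
    {U : Set (Fin N → ℝ)} (hU : IsOpen U) (hxU : x ∈ U)
    (h : ∀ y ∈ U, y ∈ affineSpan ℝ s → y ∈ s) : x ∈ intrinsicInterior ℝ s := by
  rw [mem_intrinsicInterior]
  refine ⟨⟨x, subset_affineSpan ℝ s hx⟩, ?_, rfl⟩
  have hV : IsOpen ((↑) ⁻¹' U : Set (affineSpan ℝ s)) := hU.preimage continuous_subtype_val
  refine mem_interior.2 ⟨_, ?_, hV, ?_⟩
  · rintro ⟨y, hy⟩ hyU
    exact h y hyU hy
  · exact hxU

lemma mem_intrinsicInterior_linePt_image (p : Fin N → ℝ) {v : Fin N → ℤ} (hv : v ≠ 0)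
    {I : Set ℝ} (hI : I.OrdConnected) {t : ℝ} (h : IsInner I t) :
    linePt p v t ∈ intrinsicInterior ℝ (linePt p v '' I) := by
  have htI := h.mem hI
  obtain ⟨a, ha, b, hb, h1, h2⟩ := h
  obtain ⟨i, hi⟩ : ∃ i, v i ≠ 0 := by
    by_contra hcon; push Not at hcon; exact hv (funext hcon)
  have hi' : (v i : ℝ) ≠ 0 := by exact_mod_cast hi
  refine mem_intrinsicInterior_of_nhds ⟨t, htI, rfl⟩
    (U := {y | a < (y i - p i) / v i ∧ (y i - p i) / v i < b}) ?_ ?_ ?_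
  · have hc : Continuous fun y : Fin N → ℝ => (y i - p i) / v i := by fun_prop
    exact (isOpen_lt continuous_const hc).inter (isOpen_lt hc continuous_const)
  · have : (linePt p v t i - p i) / v i = t := by
      simp [linePt, toReal]; field_simp
    simp only [Set.mem_ofPred_eq, this]; exact ⟨h1, h2⟩
  · intro y hy hys
    have h3 : y -ᵥ linePt p v t ∈ vectorSpan ℝ (linePt p v '' I) := by
      rw [← direction_affineSpan]
      exact AffineSubspace.vsub_mem_direction hys (subset_affineSpan ℝ _ ⟨t, htI, rfl⟩)
    rw [vectorSpan_linePt_image p v ⟨a, ha, b, hb, (h1.trans h2).ne⟩,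
      Submodule.mem_span_singleton] at h3
    obtain ⟨r, hr⟩ := h3
    have hy2 : y = linePt p v (t + r) := by
      have : y = r • toReal v + linePt p v t := by rw [hr]; simp
      rw [this]; simp only [linePt, add_smul]; abel
    have : (linePt p v (t + r) i - p i) / v i = t + r := by
      simp [linePt, toReal]; field_simp
    rw [hy2, Set.mem_ofPred_eq, this] at hy
    rw [hy2]
    exact ⟨_, hI.out ha hb ⟨hy.1.le, hy.2.le⟩, rfl⟩

lemma isInner_of_mem_intrinsicInterior_linePt_image (p : Fin N → ℝ) {v : Fin N → ℤ} (hv : v ≠ 0)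
    {I : Set ℝ} (hI : I.Nontrivial) {t : ℝ}
    (h : linePt p v t ∈ intrinsicInterior ℝ (linePt p v '' I)) : IsInner I t := by
  obtain ⟨⟨y, hy⟩, hint, hyx⟩ := mem_intrinsicInterior.1 h
  simp only at hyx
  subst hyx
  have hmem : ∀ s : ℝ, linePt p v s ∈ affineSpan ℝ (linePt p v '' I) := by
    intro s
    have h1 : (s - t) • toReal v ∈ (affineSpan ℝ (linePt p v '' I)).direction := by
      rw [direction_affineSpan, vectorSpan_linePt_image p v hI]
      exact Submodule.smul_mem _ _ (Submodule.mem_span_singleton_self _)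
    have h2 := AffineSubspace.vadd_mem_of_mem_direction h1 hy
    convert h2 using 1
    simp only [linePt, vadd_eq_add, sub_smul]; abel
  let φ : ℝ → affineSpan ℝ (linePt p v '' I) := fun s => ⟨linePt p v s, hmem s⟩
  have hφ : Continuous φ := Continuous.subtype_mk (continuous_linePt p v) _
  have hφt : φ ⁻¹' ((↑) ⁻¹' (linePt p v '' I)) ∈ nhds t :=
    hφ.continuousAt.preimage_mem_nhds (mem_interior_iff_mem_nhds.1 hint)
  obtain ⟨ε, hε, hball⟩ := Metric.mem_nhds_iff.1 hφt
  have hin : ∀ s, |s - t| < ε → s ∈ I := by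
    intro s hs
    have : s ∈ φ ⁻¹' ((↑) ⁻¹' (linePt p v '' I)) := hball (by simpa [Real.dist_eq] using hs)
    obtain ⟨s', hs', he⟩ := this
    rwa [← linePt_injective p hv he]
  refine ⟨t - ε / 2, hin _ ?_, t + ε / 2, hin _ ?_, by linarith, by linarith⟩
  · rw [show t - ε / 2 - t = -(ε / 2) by ring, abs_neg, abs_of_pos] <;> linarith
  · rw [show t + ε / 2 - t = ε / 2 by ring, abs_of_pos] <;> linarith

/-- A closed interval is determined by one of its points and by a set `W`, not containing that
point, whose trace on the interval is the set of end points. -/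
lemma interval_eq_of_endpoints {I I' W : Set ℝ} {t : ℝ} (hI : IsClosed I) (hI' : IsClosed I')
    (hc : I.OrdConnected) (hc' : I'.OrdConnected) (ht : t ∈ I) (ht' : t ∈ I') (htW : t ∉ W)
    (h : ∀ s ∈ I, s ∈ W ↔ ¬ IsInner I s) (h' : ∀ s ∈ I', s ∈ W ↔ ¬ IsInner I' s) : I = I' := by
  have key : ∀ {I I' : Set ℝ}, IsClosed I' → I.OrdConnected → I'.OrdConnected → t ∈ I → t ∈ I' →
      (∀ s ∈ I, s ∈ W ↔ ¬ IsInner I s) → (∀ s ∈ I', s ∈ W ↔ ¬ IsInner I' s) → I ⊆ I' := by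
    intro I I' hI' hc hc' ht ht' h h' s hs
    by_contra hsI'
    obtain ⟨a, ha, b, hb, h1, h2⟩ : IsInner I t := by
      by_contra hcon; exact htW ((h t ht).2 hcon)
    -- the point of `I'` closest to `s` would be an end point of `I'` and an inner point of `I`
    rcases lt_trichotomy s t with hlt | rfl | hlt
    · obtain ⟨m, ⟨hm, hm1, hm2⟩, hmin⟩ := (isCompact_Icc.inter_left hI').exists_isLeast
        (⟨t, ht', hlt.le, le_rfl⟩ : (I' ∩ Set.Icc s t).Nonempty)
      have hsm : s < m := lt_of_le_of_ne hm1 fun e => hsI' (e ▸ hm)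
      have hmI : IsInner I m := ⟨s, hs, b, hb, hsm, by linarith⟩
      obtain ⟨c, hc1, d, hd1, h3, h4⟩ : IsInner I' m := by
        by_contra hcon; exact (h m (hmI.mem hc)).1 ((h' m hm).2 hcon) hmI
      have : max c s ∈ I' := hc'.out hc1 hm ⟨le_max_left _ _, max_le h3.le hsm.le⟩
      exact absurd (hmin ⟨this, le_max_right _ _, (max_le h3.le hsm.le).trans hm2⟩)
        (not_le.2 (max_lt h3 hsm))
    · exact hsI' ht'
    · obtain ⟨m, ⟨hm, hm1, hm2⟩, hmax⟩ := (isCompact_Icc.inter_left hI').exists_isGreatest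
        (⟨t, ht', le_rfl, hlt.le⟩ : (I' ∩ Set.Icc t s).Nonempty)
      have hsm : m < s := lt_of_le_of_ne hm2 fun e => hsI' (e ▸ hm)
      have hmI : IsInner I m := ⟨a, ha, s, hs, by linarith, hsm⟩
      obtain ⟨c, hc1, d, hd1, h3, h4⟩ : IsInner I' m := by
        by_contra hcon; exact (h m (hmI.mem hc)).1 ((h' m hm).2 hcon) hmI
      have : min d s ∈ I' := hc'.out hm hd1 ⟨le_min h4.le hsm.le, min_le_left _ _⟩
      exact absurd (hmax ⟨this, hm1.trans (le_min h4.le hsm.le), min_le_right _ _⟩)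
        (not_le.2 (lt_min h4 hsm))
  exact Set.Subset.antisymm (key hI' hc hc' ht ht' h h') (key hI hc' hc ht' ht h' h)

end IntegerVectors


/-! ### Lines in space over lines in the plane -/

section Lifting

/-- The point of `ℝ³` above `x` at height `z`. -/
def pt3 (x : Fin 2 → ℝ) (z : ℝ) : Fin 3 → ℝ := ![x 0, x 1, z]

/-- The integer vector above `d` with last coordinate `s`. -/
def vec3 (d : Fin 2 → ℤ) (s : ℤ) : Fin 3 → ℤ := ![d 0, d 1, s]

/-- The horizontal part of an integer vector. -/
def hpart (v : Fin 3 → ℤ) : Fin 2 → ℤ := ![v 0, v 1]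

@[simp] lemma proj_pt3 (x : Fin 2 → ℝ) (z : ℝ) : proj (pt3 x z) = x := by
  funext i; fin_cases i <;> simp [proj, pt3]

@[simp] lemma pt3_two (x : Fin 2 → ℝ) (z : ℝ) : pt3 x z 2 = z := by simp [pt3]

@[simp] lemma hpart_vec3 (d : Fin 2 → ℤ) (s : ℤ) : hpart (vec3 d s) = d := by
  funext i; fin_cases i <;> simp [hpart, vec3]

@[simp] lemma vec3_two (d : Fin 2 → ℤ) (s : ℤ) : vec3 d s 2 = s := by simp [vec3]

lemma pt3_proj (p : Fin 3 → ℝ) : pt3 (proj p) (p 2) = p := by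
  funext i; fin_cases i <;> simp [proj, pt3]

lemma vec3_hpart (v : Fin 3 → ℤ) : vec3 (hpart v) (v 2) = v := by
  funext i; fin_cases i <;> simp [hpart, vec3]

lemma point_ext {p q : Fin 3 → ℝ} (h : proj p = proj q) (h2 : p 2 = q 2) : p = q := by
  rw [← pt3_proj p, ← pt3_proj q, h, h2]

lemma vector_ext {p q : Fin 3 → ℤ} (h : hpart p = hpart q) (h2 : p 2 = q 2) : p = q := by
  rw [← vec3_hpart p, ← vec3_hpart q, h, h2]

lemma proj_linePt (q : Fin 3 → ℝ) (v : Fin 3 → ℤ) (t : ℝ) :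
    proj (linePt q v t) = linePt (proj q) (hpart v) t := by
  funext i; fin_cases i <;> simp [proj, linePt, toReal, hpart]

lemma linePt_two (q : Fin 3 → ℝ) (v : Fin 3 → ℤ) (t : ℝ) :
    linePt q v t 2 = q 2 + t * v 2 := by
  simp [linePt, toReal]

lemma linePt_pt3 (x : Fin 2 → ℝ) (z : ℝ) (d : Fin 2 → ℤ) (s : ℤ) (t : ℝ) :
    linePt (pt3 x z) (vec3 d s) t = pt3 (linePt x d t) (z + t * s) := by
  apply point_ext
  · rw [proj_linePt]; simp
  · rw [linePt_two]; simp

lemma proj_image_linePt (q : Fin 3 → ℝ) (v : Fin 3 → ℤ) (I : Set ℝ) :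
    proj '' (linePt q v '' I) = linePt (proj q) (hpart v) '' I := by
  rw [Set.image_image]; simp only [proj_linePt]

lemma isPrimitiveVec_vec3 {d : Fin 2 → ℤ} (hd : IsPrimitiveVec d) (s : ℤ) :
    IsPrimitiveVec (vec3 d s) := by
  intro k hk
  refine hd k fun i => ?_
  fin_cases i
  · simpa [vec3] using hk 0
  · simpa [vec3] using hk 1

lemma hpart_sum {ι : Type*} (s : Finset ι) (f : ι → Fin 3 → ℤ) :
    hpart (∑ i ∈ s, f i) = ∑ i ∈ s, hpart (f i) := by
  funext j; fin_cases j <;> simp [hpart, Finset.sum_apply]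

lemma hpart_nsmul (n : ℕ) (v : Fin 3 → ℤ) : hpart (n • v) = n • hpart v := by
  funext j; fin_cases j <;> simp [hpart]

lemma hpart_zero : hpart 0 = 0 := by
  funext j; fin_cases j <;> simp [hpart]

/-- The sublattice generated by a vector and by the vertical direction. -/
def latticeWith (v : Fin 3 → ℤ) : AddSubgroup (Fin 3 → ℤ) := AddSubgroup.closure {v, ![0, 0, 1]}

lemma edgeLattice_linePt (q : Fin 3 → ℝ) {v : Fin 3 → ℤ} (hv : IsPrimitiveVec v) {I : Set ℝ}
    (hI : I.Nontrivial) : edgeLattice (linePt q v '' I) = latticeWith v := by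
  unfold edgeLattice latticeWith
  rw [vectorSpan_linePt_image q v hI]
  apply le_antisymm
  · rw [AddSubgroup.closure_le]
    rintro u (⟨hu, hmem⟩ | hu)
    · obtain ⟨r, hr⟩ := Submodule.mem_span_singleton.1 hmem
      rcases hu.eq_or_neg hv hr.symm with ⟨-, rfl⟩ | ⟨-, rfl⟩
      · exact AddSubgroup.subset_closure (by simp)
      · exact neg_mem (AddSubgroup.subset_closure (by simp))
    · rw [Set.mem_singleton_iff] at hu
      subst hu
      exact AddSubgroup.subset_closure (by simp)
  · apply AddSubgroup.closure_mono
    rintro u (rfl | hu)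
    · exact Or.inl ⟨hv, Submodule.mem_span_singleton_self _⟩
    · exact Or.inr hu

lemma horizontalCopy_linePt (p : Fin 2 → ℝ) (d : Fin 2 → ℤ) (I : Set ℝ) :
    horizontalCopy (linePt p d '' I) = linePt (pt3 p 0) (vec3 d 0) '' I := by
  ext y
  constructor
  · rintro ⟨⟨t, ht, h1⟩, h2⟩
    refine ⟨t, ht, point_ext ?_ ?_⟩
    · rw [proj_linePt]; simpa using h1
    · rw [linePt_two]; simp [h2]
  · rintro ⟨t, ht, rfl⟩
    rw [linePt_pt3]
    exact ⟨⟨t, ht, by simp⟩, by simp⟩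

lemma mem_latticeWith {v u : Fin 3 → ℤ} :
    u ∈ latticeWith v ↔ ∃ m k : ℤ, u = m • v + k • ![0, 0, 1] := by
  unfold latticeWith
  rw [AddSubgroup.mem_closure_pair]
  constructor
  · rintro ⟨m, k, h⟩; exact ⟨m, k, h.symm⟩
  · rintro ⟨m, k, h⟩; exact ⟨m, k, h.symm⟩

lemma latticeWith_vec3_le {v : Fin 3 → ℤ} {d : Fin 2 → ℤ} (h : hpart v = d) :
    latticeWith (vec3 d 0) ≤ latticeWith v := by
  intro u hu
  obtain ⟨m, k, rfl⟩ := mem_latticeWith.1 hu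
  refine mem_latticeWith.2 ⟨m, k - m * v 2, ?_⟩
  subst h
  funext i; fin_cases i <;> simp [vec3, hpart]

lemma relIndex_latticeWith_eq_one {v : Fin 3 → ℤ} {d : Fin 2 → ℤ} (h : hpart v = d) :
    (latticeWith v).relIndex (latticeWith (vec3 d 0)) = 1 :=
  AddSubgroup.relIndex_eq_one.2 (latticeWith_vec3_le h)

lemma relIndex_latticeWith_ne_zero {v : Fin 3 → ℤ} {d : Fin 2 → ℤ} {a : ℤ} (ha : a ≠ 0)
    (h : hpart v = a • d) : (latticeWith v).relIndex (latticeWith (vec3 d 0)) ≠ 0 := by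
  have hfg : AddGroup.FG (latticeWith (vec3 d 0)) := by
    rw [AddGroup.fg_iff_addSubgroup_fg]
    exact ⟨{vec3 d 0, ![0, 0, 1]}, by simp [latticeWith]⟩
  have : AddGroup.FG (latticeWith (vec3 d 0) ⧸
      (latticeWith v).addSubgroupOf (latticeWith (vec3 d 0))) := QuotientAddGroup.fg _
  have htor : IsAddTorsion (latticeWith (vec3 d 0) ⧸
      (latticeWith v).addSubgroupOf (latticeWith (vec3 d 0))) := by
    intro q
    induction q using QuotientAddGroup.induction_on with
    | H z =>
      obtain ⟨u, hu⟩ := z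
      rw [isOfFinAddOrder_iff_zsmul_eq_zero]
      refine ⟨a, ha, ?_⟩
      rw [← QuotientAddGroup.mk_zsmul, QuotientAddGroup.eq_zero_iff,
        AddSubgroup.mem_addSubgroupOf]
      obtain ⟨m, k, rfl⟩ := mem_latticeWith.1 hu
      refine mem_latticeWith.2 ⟨m, a * k - m * v 2, ?_⟩
      rw [AddSubgroup.coe_zsmul]
      have f0 := congrFun h 0
      have f1 := congrFun h 1
      simp [hpart] at f0 f1
      funext i; fin_cases i
      · simp [vec3, f0]; ring
      · simp [vec3, f1]; ring
      · simp [vec3]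
  have := AddCommGroup.finite_of_fg_isAddTorsion _ htor
  exact AddSubgroup.index_ne_zero_of_finite

lemma isUnit_of_relIndex_latticeWith_eq_one {v : Fin 3 → ℤ} {d : Fin 2 → ℤ} {a : ℤ}
    (hd : IsPrimitiveVec d) (h : hpart v = a • d)
    (h1 : (latticeWith v).relIndex (latticeWith (vec3 d 0)) = 1) : IsUnit a := by
  have hle := AddSubgroup.relIndex_eq_one.1 h1
  obtain ⟨m, k, hm⟩ := mem_latticeWith.1
    (hle (AddSubgroup.subset_closure (by simp) : vec3 d 0 ∈ latticeWith (vec3 d 0)))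
  apply hd
  have e0 := congrFun hm 0
  have e1 := congrFun hm 1
  have f0 := congrFun h 0
  have f1 := congrFun h 1
  simp [vec3, hpart] at e0 e1 f0 f1
  rw [Fin.forall_fin_two]
  exact ⟨⟨m * d 0, by rw [f0] at e0; linear_combination e0⟩,
    ⟨m * d 1, by rw [f1] at e1; linear_combination e1⟩⟩

end Lifting


/-! ### Edges seen from one of their points -/

section EdgeAt

variable {N : ℕ}

/-- The edge `e` is the part of the line through its point `v`, of primitive direction `u`, with
parameters in the closed interval `I`. -/
structure EdgeAt (e : Set (Fin N → ℝ)) (v : Fin N → ℝ) (u : Fin N → ℤ) (I : Set ℝ) : Prop where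
  primitive : IsPrimitiveVec u
  closed : IsClosed I
  ordConnected : I.OrdConnected
  nontrivial : I.Nontrivial
  zero_mem : (0 : ℝ) ∈ I
  eq : e = linePt v u '' I

namespace EdgeAt

variable {e : Set (Fin N → ℝ)} {v : Fin N → ℝ} {u : Fin N → ℤ} {I : Set ℝ}

lemma mem_iff (h : EdgeAt e v u I) (t : ℝ) : linePt v u t ∈ e ↔ t ∈ I := by
  rw [h.eq, (linePt_injective v h.primitive.ne_zero).mem_set_image]

lemma base_mem (h : EdgeAt e v u I) : v ∈ e := by
  have := (h.mem_iff 0).2 h.zero_mem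
  rwa [linePt_zero] at this

lemma flip (h : EdgeAt e v u I) : EdgeAt e v (-u) ((fun t => -t) ⁻¹' I) where
  primitive := h.primitive.neg
  closed := h.closed.preimage continuous_neg
  ordConnected := by
    refine ⟨fun a ha b hb t ht => ?_⟩
    exact h.ordConnected.out hb ha ⟨neg_le_neg ht.2, neg_le_neg ht.1⟩
  nontrivial := by
    obtain ⟨a, ha, b, hb, hab⟩ := h.nontrivial
    exact ⟨-a, by simpa using ha, -b, by simpa using hb, by simpa using hab⟩
  zero_mem := by simpa using h.zero_mem
  eq := by
    rw [h.eq]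
    ext y
    constructor
    · rintro ⟨t, ht, rfl⟩
      exact ⟨-t, by simpa using ht, by rw [linePt_neg, neg_neg]⟩
    · rintro ⟨t, ht, rfl⟩
      exact ⟨-t, ht, by rw [linePt_neg]⟩

lemma shift (h : EdgeAt e v u I) {t : ℝ} (ht : t ∈ I) :
    EdgeAt e (linePt v u t) u ((fun s => t + s) ⁻¹' I) where
  primitive := h.primitive
  closed := h.closed.preimage (by fun_prop)
  ordConnected := by
    refine ⟨fun a ha b hb s hs => ?_⟩
    exact h.ordConnected.out ha hb ⟨by simpa using hs.1, by simpa using hs.2⟩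
  nontrivial := by
    obtain ⟨a, ha, b, hb, hab⟩ := h.nontrivial
    exact ⟨a - t, by simpa using ha, b - t, by simpa using hb, by simpa using hab⟩
  zero_mem := by simpa using ht
  eq := by
    rw [h.eq]
    ext y
    constructor
    · rintro ⟨s, hs, rfl⟩
      exact ⟨s - t, by simpa using hs, by rw [linePt_linePt]; congr 1; ring⟩
    · rintro ⟨s, hs, rfl⟩
      exact ⟨t + s, hs, by rw [linePt_linePt]⟩

lemma isClosed (h : EdgeAt e v u I) : IsClosed e := by
  rw [h.eq]; exact isClosed_linePt_image v h.primitive.ne_zero h.closed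

lemma convex (h : EdgeAt e v u I) : Convex ℝ e := by
  rw [h.eq]; exact convex_linePt_image v u h.ordConnected

lemma mem_extremePoints_iff (h : EdgeAt e v u I) {t : ℝ} (ht : t ∈ I) :
    linePt v u t ∈ e.extremePoints ℝ ↔ ¬ IsInner I t := by
  conv_lhs => rw [h.eq]
  exact mem_extremePoints_linePt_image v h.primitive.ne_zero ht

lemma base_mem_extremePoints_iff (h : EdgeAt e v u I) :
    v ∈ e.extremePoints ℝ ↔ ¬ IsInner I 0 := by
  have := h.mem_extremePoints_iff h.zero_mem
  rwa [linePt_zero] at this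

lemma exists_ne_zero (h : EdgeAt e v u I) : ∃ t ∈ I, t ≠ 0 := by
  obtain ⟨a, ha, b, hb, hab⟩ := h.nontrivial
  by_cases h0 : a = 0
  · exact ⟨b, hb, fun hb0 => hab (h0.trans hb0.symm)⟩
  · exact ⟨a, ha, h0⟩

/-- The direction can be replaced by that of any primitive vector pointing into the edge. -/
lemma of_mem (h : EdgeAt e v u I) {u' : Fin N → ℤ} (hu' : IsPrimitiveVec u') {t : ℝ} (ht : t ≠ 0)
    (hmem : linePt v u' t ∈ e) : ∃ I', EdgeAt e v u' I' := by
  have h1 := hmem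
  rw [h.eq] at h1
  obtain ⟨s, hs, hst⟩ := h1
  have h2 : s • toReal u = t • toReal u' := add_left_cancel hst
  have h3 : toReal u' = (t⁻¹ * s) • toReal u := by
    rw [mul_smul, h2, smul_smul, inv_mul_cancel₀ ht, one_smul]
  rcases hu'.eq_or_neg h.primitive h3 with ⟨-, rfl⟩ | ⟨-, rfl⟩
  · exact ⟨_, h⟩
  · exact ⟨_, h.flip⟩

/-- Two edges with a common inner point, the same direction there, and the same set of end points
on their line are equal. -/
lemma eq_of_vertices {e' : Set (Fin N → ℝ)} {I' : Set ℝ} (h : EdgeAt e v u I)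
    (h' : EdgeAt e' v u I') {V : Set (Fin N → ℝ)} (hv : v ∉ V)
    (hV : ∀ y ∈ e, y ∈ V ↔ y ∈ e.extremePoints ℝ)
    (hV' : ∀ y ∈ e', y ∈ V ↔ y ∈ e'.extremePoints ℝ) : e = e' := by
  have : I = I' := by
    refine interval_eq_of_endpoints (W := linePt v u ⁻¹' V) (t := 0) h.closed h'.closed
      h.ordConnected h'.ordConnected h.zero_mem h'.zero_mem ?_ ?_ ?_
    · simpa [linePt_zero] using hv
    · intro s hs
      rw [Set.mem_preimage, hV _ ((h.mem_iff s).2 hs), h.mem_extremePoints_iff hs]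
    · intro s hs
      rw [Set.mem_preimage, hV' _ ((h'.mem_iff s).2 hs), h'.mem_extremePoints_iff hs]
  rw [h.eq, h'.eq, this]

end EdgeAt

lemma IsRationalEdge.edgeAt {e : Set (Fin N → ℝ)} (h : IsRationalEdge e) {v : Fin N → ℝ}
    (hv : v ∈ e) : ∃ u I, EdgeAt e v u I := by
  obtain ⟨p, u, I, hu, hI, hc, hn, rfl⟩ := h
  obtain ⟨t, ht, rfl⟩ := hv
  -- the line of parameters is translated so that `v` gets parameter `0`
  refine ⟨u, (fun s => t + s) ⁻¹' I, hu, hI.preimage (by fun_prop), ?_, ?_, by simpa using ht, ?_⟩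
  · refine ⟨fun a ha b hb s hs => ?_⟩
    exact hc.out ha hb ⟨by simpa using hs.1, by simpa using hs.2⟩
  · obtain ⟨a, ha, b, hb, hab⟩ := hn
    exact ⟨a - t, by simpa using ha, b - t, by simpa using hb, by simpa using hab⟩
  · ext y
    constructor
    · rintro ⟨s, hs, rfl⟩
      exact ⟨s - t, by simpa using hs, by
        change linePt (linePt p u t) u (s - t) = linePt p u s
        rw [linePt_linePt]; congr 1; ring⟩
    · rintro ⟨s, hs, rfl⟩
      exact ⟨t + s, hs, by
        change linePt p u (t + s) = linePt (linePt p u t) u s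
        rw [linePt_linePt]⟩

lemma EdgeAt.isRationalEdge {e : Set (Fin N → ℝ)} {v : Fin N → ℝ} {u : Fin N → ℤ} {I : Set ℝ}
    (h : EdgeAt e v u I) : IsRationalEdge e :=
  ⟨v, u, I, h.primitive, h.closed, h.ordConnected, h.nontrivial, h.eq⟩

lemma IsRationalEdge.nonempty {e : Set (Fin N → ℝ)} (h : IsRationalEdge e) : e.Nonempty := by
  obtain ⟨p, u, I, hu, hI, hc, hn, rfl⟩ := h
  exact hn.nonempty.image _

lemma IsRationalEdge.isClosed {e : Set (Fin N → ℝ)} (h : IsRationalEdge e) : IsClosed e := by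
  obtain ⟨v, hv⟩ := h.nonempty
  obtain ⟨u, I, hI⟩ := h.edgeAt hv
  exact hI.isClosed

lemma IsRationalEdge.exists_not_extreme {e : Set (Fin N → ℝ)} (h : IsRationalEdge e) :
    ∃ v ∈ e, v ∉ e.extremePoints ℝ := by
  obtain ⟨v, hv⟩ := h.nonempty
  obtain ⟨u, I, hI⟩ := h.edgeAt hv
  obtain ⟨t, ht⟩ := exists_isInner hI.nontrivial
  have htI := ht.mem hI.ordConnected
  exact ⟨_, (hI.mem_iff t).2 htI, fun hcon => (hI.mem_extremePoints_iff htI).1 hcon ht⟩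

end EdgeAt

/-! ### Planar curves with prescribed germs -/

/-- A planar curve `C` whose edges have weight one, with set of vertices `V` containing the marked
points `M`, and with set `D x` of outgoing primitive directions at each of its points `x`.  At
every point the outgoing directions sum to zero and no proper nonempty part of them does; at a
vertex that is not marked no two of them are opposite. -/
structure GermCurve (C : WeightedEdges 2) (M V : Set (Fin 2 → ℝ))
    (D : (Fin 2 → ℝ) → Finset (Fin 2 → ℤ)) : Prop where
  finite : C.edges.Finite
  weight_one : ∀ c ∈ C.edges, C c = 1
  rational : ∀ c ∈ C.edges, IsRationalEdge c
  finite_vertices : V.Finite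
  marked_subset : M ⊆ V
  vertices_subset : V ⊆ C.carrier
  vertex_iff : ∀ c ∈ C.edges, ∀ x ∈ c, x ∈ V ↔ x ∈ c.extremePoints ℝ
  unique : ∀ c ∈ C.edges, ∀ c' ∈ C.edges, ∀ x ∈ c, x ∈ c' → x ∉ V → c = c'
  dirs_primitive : ∀ x ∈ C.carrier, ∀ d ∈ D x, IsPrimitiveVec d
  dirs_sum : ∀ x ∈ C.carrier, ∑ d ∈ D x, d = 0
  dirs_minimal : ∀ x ∈ C.carrier, ∀ J ⊆ D x, J.Nonempty → ∑ d ∈ J, d = 0 → J = D x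
  dirs_vertex : ∀ x ∈ V, x ∉ M → ∀ d ∈ D x, -d ∉ D x
  germ_of_edge : ∀ c ∈ C.edges, ∀ x ∈ c, ∀ y ∈ c, y ≠ x → ∃ d ∈ D x, ∃ t > 0, y = linePt x d t
  edge_of_germ : ∀ x ∈ C.carrier, ∀ d ∈ D x, ∃ c ∈ C.edges, x ∈ c ∧ ∃ t > 0, linePt x d t ∈ c

lemma mem_carrier {N : ℕ} {C : WeightedEdges N} {x : Fin N → ℝ} :
    x ∈ C.carrier ↔ ∃ c ∈ C.edges, x ∈ c := Set.mem_sUnion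

namespace GermCurve

variable {C : WeightedEdges 2} {M V : Set (Fin 2 → ℝ)} {D : (Fin 2 → ℝ) → Finset (Fin 2 → ℤ)}

lemma edgeAt_of_germ (hC : GermCurve C M V D) {c : Set (Fin 2 → ℝ)} (hc : c ∈ C.edges)
    {x : Fin 2 → ℝ} (hx : x ∈ c) {d : Fin 2 → ℤ} (hd : IsPrimitiveVec d) {t : ℝ} (ht : t ≠ 0)
    (hmem : linePt x d t ∈ c) : ∃ I, EdgeAt c x d I := by
  obtain ⟨u, I, hI⟩ := (hC.rational c hc).edgeAt hx
  exact hI.of_mem hd ht hmem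

lemma dir_mem (hC : GermCurve C M V D) {c : Set (Fin 2 → ℝ)} (hc : c ∈ C.edges)
    {x : Fin 2 → ℝ} (hx : x ∈ c) {d : Fin 2 → ℤ} (hd : IsPrimitiveVec d) {t : ℝ} (ht : 0 < t)
    (hmem : linePt x d t ∈ c) : d ∈ D x := by
  have hne : linePt x d t ≠ x := fun h => ht.ne' ((linePt_eq_self_iff x hd.ne_zero).1 h)
  obtain ⟨d', hd', s, hs, h⟩ := hC.germ_of_edge c hc x hx _ hmem hne
  have h2 : t • toReal d = s • toReal d' := add_left_cancel h
  have h3 : toReal d = (t⁻¹ * s) • toReal d' := by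
    rw [mul_smul, ← h2, smul_smul, inv_mul_cancel₀ ht.ne', one_smul]
  rwa [hd.eq_of_pos (hC.dirs_primitive x (mem_carrier.2 ⟨c, hc, hx⟩) d' hd') (by positivity) h3]

/-- Near a point, the curve consists of edges through that point. -/
lemma exists_ball (hC : GermCurve C M V D) (x : Fin 2 → ℝ) :
    ∃ U : Set (Fin 2 → ℝ), IsOpen U ∧ x ∈ U ∧ ∀ c ∈ C.edges, ∀ y ∈ c, y ∈ U → x ∈ c := by
  have hcl : IsClosed (⋃₀ {c | c ∈ C.edges ∧ x ∉ c}) := by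
    rw [Set.sUnion_eq_biUnion]
    apply Set.Finite.isClosed_biUnion (hC.finite.subset fun c hc => hc.1)
    rintro c ⟨hc, -⟩
    exact (hC.rational c hc).isClosed
  refine ⟨_, hcl.isOpen_compl, ?_, ?_⟩
  · rintro ⟨c, ⟨hc, hxc⟩, hx⟩
    exact hxc hx
  · intro c hc y hy hyU
    by_contra hx
    exact hyU ⟨c, ⟨hc, hx⟩, hy⟩

lemma exists_small (hC : GermCurve C M V D) {x : Fin 2 → ℝ} (hx : x ∈ C.carrier)
    {d : Fin 2 → ℤ} (hd : d ∈ D x) : ∃ c ∈ C.edges, x ∈ c ∧ ∃ I, EdgeAt c x d I ∧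
      ∃ δ > 0, Set.Icc 0 δ ⊆ I ∧ ∀ t ∈ Set.Ioc 0 δ, linePt x d t ∉ V ∧ d ∈ D (linePt x d t) := by
  obtain ⟨c, hc, hxc, t, ht, htc⟩ := hC.edge_of_germ x hx d hd
  have hdp := hC.dirs_primitive x hx d hd
  obtain ⟨I, hI⟩ := hC.edgeAt_of_germ hc hxc hdp ht.ne' htc
  have htI := (hI.mem_iff t).1 htc
  have hsub : Set.Icc 0 t ⊆ I := fun s hs => hI.ordConnected.out hI.zero_mem htI hs
  refine ⟨c, hc, hxc, I, hI, t / 2, by positivity, ?_, ?_⟩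
  · exact fun s hs => hsub ⟨hs.1, hs.2.trans (by linarith)⟩
  · rintro s ⟨hs1, hs2⟩
    have hsI : s ∈ I := hsub ⟨hs1.le, by linarith⟩
    have hsc := (hI.mem_iff s).2 hsI
    constructor
    · rw [hC.vertex_iff c hc _ hsc, hI.mem_extremePoints_iff hsI, not_not]
      exact ⟨0, hI.zero_mem, t, htI, hs1, by linarith⟩
    · refine hC.dir_mem hc hsc hdp (t := t - s) (by linarith) ?_
      rw [linePt_linePt, show s + (t - s) = t by ring]
      exact htc

lemma dirs_nonempty (hC : GermCurve C M V D) {x : Fin 2 → ℝ} (hx : x ∈ C.carrier) :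
    (D x).Nonempty := by
  obtain ⟨c, hc, hxc⟩ := mem_carrier.1 hx
  obtain ⟨u, I, hI⟩ := (hC.rational c hc).edgeAt hxc
  obtain ⟨t, ht, ht0⟩ := hI.exists_ne_zero
  obtain ⟨d, hd, -⟩ := hC.germ_of_edge c hc x hxc _ ((hI.mem_iff t).2 ht) 
    (fun h => ht0 ((linePt_eq_self_iff x hI.primitive.ne_zero).1 h))
  exact ⟨d, hd⟩

/-- Away from the vertices there are two opposite directions. -/
lemma dirs_of_notMem_vertices (hC : GermCurve C M V D) {x : Fin 2 → ℝ} (hx : x ∈ C.carrier)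
    (hxV : x ∉ V) {d : Fin 2 → ℤ} (hd : d ∈ D x) : D x = {d, -d} := by
  classical
  obtain ⟨c, hc, hxc, I, hI, -⟩ := hC.exists_small hx hd
  rw [hC.vertex_iff c hc x hxc, hI.base_mem_extremePoints_iff, not_not] at hxV
  obtain ⟨a, ha, b, hb, ha0, hb0⟩ := hxV
  have hnd : -d ∈ D x := by
    refine hC.dir_mem hc hxc hI.primitive.neg (t := -a) (by linarith) ?_
    rw [linePt_neg, neg_neg]
    exact (hI.mem_iff a).2 ha
  have hne : d ≠ -d := by
    intro h
    exact hI.primitive.ne_zero (self_eq_neg.1 h)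
  symm
  apply hC.dirs_minimal x hx
  · intro y hy
    rcases Finset.mem_insert.1 hy with rfl | hy
    · exact hd
    · rwa [Finset.mem_singleton.1 hy]
  · exact ⟨d, by simp⟩
  · rw [Finset.sum_pair hne, add_neg_cancel]

end GermCurve


/-! ### Germs of a lift -/

section LiftGerms

variable {C : WeightedEdges 2} {M V : Set (Fin 2 → ℝ)} {D : (Fin 2 → ℝ) → Finset (Fin 2 → ℤ)}
  {L : WeightedEdges 3}

lemma IsLift.edgeAt (hL : IsLift C M L) {f : Set (Fin 3 → ℝ)} (hf : f ∈ L.edges)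
    {v : Fin 3 → ℝ} (hv : v ∈ f) : ∃ u I, EdgeAt f v u I :=
  (hL.curve.rational f hf).edgeAt hv

lemma IsLift.proj_mem (hL : IsLift C M L) {f : Set (Fin 3 → ℝ)} (hf : f ∈ L.edges)
    {v : Fin 3 → ℝ} (hv : v ∈ f) : proj v ∈ C.carrier := by
  rw [← hL.projection]
  exact ⟨v, mem_carrier.2 ⟨f, hf, hv⟩, rfl⟩

lemma EdgeAt.proj_image {f : Set (Fin 3 → ℝ)} {v : Fin 3 → ℝ} {u : Fin 3 → ℤ} {I : Set ℝ}
    (h : EdgeAt f v u I) : proj '' f = linePt (proj v) (hpart u) '' I := by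
  conv_lhs => rw [h.eq]
  exact proj_image_linePt v u I

lemma EdgeAt.vertical_iff {f : Set (Fin 3 → ℝ)} {v : Fin 3 → ℝ} {u : Fin 3 → ℤ} {I : Set ℝ}
    (h : EdgeAt f v u I) : proj '' f = {proj v} ↔ hpart u = 0 := by
  rw [h.proj_image]
  constructor
  · intro hp
    by_contra hu
    obtain ⟨t, ht, ht0⟩ := h.exists_ne_zero
    have : linePt (proj v) (hpart u) t ∈ ({proj v} : Set _) := by rw [← hp]; exact ⟨t, ht, rfl⟩
    exact ht0 ((linePt_eq_self_iff _ hu).1 this)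
  · intro hu
    have : ∀ t, linePt (proj v) (hpart u) t = proj v := by
      intro t
      rw [hu]; funext i; simp [linePt, toReal]
    simp only [this]
    exact h.nontrivial.nonempty.image_const _

/-- A vertical edge projects to each of its points' projection. -/
lemma proj_image_eq_of_mem {f : Set (Fin 3 → ℝ)} {v : Fin 3 → ℝ} {x : Fin 2 → ℝ} (hv : v ∈ f)
    (h : proj '' f = {x}) : proj v = x := by
  have : proj v ∈ proj '' f := ⟨v, hv, rfl⟩
  rwa [h] at this

/-- A non-vertical edge has at most one point over each point of the plane. -/
lemma EdgeAt.eq_of_proj_eq {f : Set (Fin 3 → ℝ)} {v w : Fin 3 → ℝ} {u : Fin 3 → ℤ} {I : Set ℝ}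
    (h : EdgeAt f v u I) (hu : hpart u ≠ 0) (hw : w ∈ f) (hp : proj w = proj v) : w = v := by
  rw [h.eq] at hw
  obtain ⟨t, ht, rfl⟩ := hw
  rw [proj_linePt] at hp
  rw [(linePt_eq_self_iff _ hu).1 hp, linePt_zero]

lemma hpart_ne_zero_of_proj_ne {f : Set (Fin 3 → ℝ)} {v w : Fin 3 → ℝ} {u : Fin 3 → ℤ}
    {I : Set ℝ} (h : EdgeAt f v u I) (hw : w ∈ f) (hp : proj w ≠ proj v) : hpart u ≠ 0 := by
  intro hu
  exact hp (proj_image_eq_of_mem hw (h.vertical_iff.2 hu))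

/-- Every edge of a lift leaves a non-vertical point in one of the directions of the curve. -/
lemma exists_dir (hC : GermCurve C M V D) (hL : IsLift C M L) {f : Set (Fin 3 → ℝ)}
    (hf : f ∈ L.edges) {v w : Fin 3 → ℝ} (hv : v ∈ f) (hw : w ∈ f) (hp : proj w ≠ proj v) :
    ∃ d ∈ D (proj v), ∃ r > 0, proj w = linePt (proj v) d r := by
  obtain ⟨U, hU, hxU, hUc⟩ := hC.exists_ball (proj v)
  obtain ⟨u, I, hI⟩ := hL.edgeAt hf hv
  have hu := hpart_ne_zero_of_proj_ne hI hw hp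
  rw [hI.eq] at hw
  obtain ⟨t, ht, rfl⟩ := hw
  rw [proj_linePt] at hp ⊢
  have ht0 : t ≠ 0 := by rintro rfl; exact hp (linePt_zero _ _)
  -- a point of the edge close to `v`
  have hcont : Continuous fun s : ℝ => linePt (proj v) (hpart u) (s * t) :=
    (continuous_linePt _ _).comp (by fun_prop)
  have hnhds : ∀ᶠ s in nhdsWithin (0 : ℝ) (Set.Ioi 0),
      linePt (proj v) (hpart u) (s * t) ∈ U := by
    apply hcont.continuousWithinAt.eventually_mem
    apply hU.mem_nhds
    simpa [linePt_zero] using hxU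
  obtain ⟨s, hsU, hs0, hs1⟩ : ∃ s : ℝ, linePt (proj v) (hpart u) (s * t) ∈ U ∧ 0 < s ∧ s ≤ 1 := by
    have h1 : ∀ᶠ s in nhdsWithin (0 : ℝ) (Set.Ioi 0), s ∈ Set.Ioc (0 : ℝ) 1 :=
      Ioc_mem_nhdsGT zero_lt_one
    obtain ⟨s, h2, h3⟩ := (hnhds.and h1).exists
    exact ⟨s, h2, h3.1, h3.2⟩
  have hst : s * t ∈ I := by
    have := hI.ordConnected.convex hI.zero_mem ht (a := 1 - s) (b := s) (by linarith) hs0.le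
      (by ring)
    simpa using this
  have hyC : linePt (proj v) (hpart u) (s * t) ∈ C.carrier := by
    rw [← proj_linePt]; exact hL.proj_mem hf ((hI.mem_iff _).2 hst)
  obtain ⟨c, hc, hyc⟩ := mem_carrier.1 hyC
  obtain ⟨d, hd, r, hr, h⟩ := hC.germ_of_edge c hc _ (hUc c hc _ hyc hsU) _ hyc (by
    intro h
    rcases mul_eq_zero.1 ((linePt_eq_self_iff _ hu).1 h) with h | h
    · linarith
    · exact ht0 h)
  refine ⟨d, hd, s⁻¹ * r, by positivity, ?_⟩
  have h2 : (s * t) • toReal (hpart u) = r • toReal d := add_left_cancel h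
  simp only [linePt, mul_smul, ← h2]
  rw [smul_smul s⁻¹ s, inv_mul_cancel₀ hs0.ne', one_smul]

lemma finite_fibre (hL : IsLift C M L) {x : Fin 2 → ℝ} (hx : ∀ f ∈ L.edges, proj '' f ≠ {x}) :
    (proj ⁻¹' {x} ∩ L.carrier).Finite := by
  have : proj ⁻¹' {x} ∩ L.carrier ⊆ ⋃ f ∈ L.edges, (proj ⁻¹' {x} ∩ f) := by
    rintro v ⟨hv, hvL⟩
    obtain ⟨f, hf, hvf⟩ := mem_carrier.1 hvL
    exact Set.mem_biUnion hf ⟨hv, hvf⟩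
  refine Set.Finite.subset (hL.curve.finite.biUnion fun f hf => ?_) this
  apply Set.Subsingleton.finite
  rintro v ⟨hv, hvf⟩ w ⟨hw, hwf⟩
  obtain ⟨u, I, hI⟩ := hL.edgeAt hf hwf
  refine hI.eq_of_proj_eq ?_ hvf (hv.trans hw.symm)
  intro hu
  exact hx f hf (by rw [← hw]; exact hI.vertical_iff.2 hu)

/-- Over a point that is neither a vertex nor the projection of a vertical edge there is exactly
one edge; it has weight one and projects isomorphically on the lattice of the direction. -/
lemma exists_unique_edge (hC : GermCurve C M V D) (hL : IsLift C M L) {x : Fin 2 → ℝ}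
    (hx : x ∈ C.carrier) (hxV : x ∉ V) (hv : ∀ f ∈ L.edges, proj '' f ≠ {x})
    {d : Fin 2 → ℤ} (hd : d ∈ D x) : ∃ f ∈ L.edges, L f = 1 ∧
      (∃ z s I, EdgeAt f (pt3 x z) (vec3 d s) I) ∧ ∀ f' ∈ L.edges, x ∈ proj '' f' → f' = f := by
  classical
  obtain ⟨c, hc, hxc, I, hI, -⟩ := hC.exists_small hx hd
  have hin : IsInner I 0 := by
    rwa [hC.vertex_iff c hc x hxc, hI.base_mem_extremePoints_iff, not_not] at hxV
  have hint : x ∈ intrinsicInterior ℝ c := by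
    have := mem_intrinsicInterior_linePt_image x hI.primitive.ne_zero hI.ordConnected hin
    rwa [linePt_zero, ← hI.eq] at this
  have hw := hL.weight c hc x hint (finite_fibre hL hv)
  have hfin : {f | f ∈ L.edges ∧ x ∈ proj '' f}.Finite :=
    hL.curve.finite.subset fun f hf => hf.1
  rw [hC.weight_one c hc, finsum_mem_eq_finite_toFinset_sum _ hfin] at hw
  have hlat : edgeLattice (horizontalCopy c) = latticeWith (vec3 d 0) := by
    rw [hI.eq, horizontalCopy_linePt]
    exact edgeLattice_linePt _ (isPrimitiveVec_vec3 hI.primitive 0) hI.nontrivial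
  rw [hlat] at hw
  -- every edge over `x` has direction over a nonzero multiple of `d`
  have hedge : ∀ f ∈ L.edges, ∀ v ∈ f, proj v = x → ∃ u J, ∃ a : ℤ, EdgeAt f v u J ∧ a ≠ 0 ∧
      hpart u = a • d := by
    intro f hf v hvf hvx
    obtain ⟨u, J, hJ⟩ := hL.edgeAt hf hvf
    have hu : hpart u ≠ 0 := fun hu => hv f hf (by rw [← hvx]; exact hJ.vertical_iff.2 hu)
    obtain ⟨t, ht, ht0⟩ := hJ.exists_ne_zero
    have hne : proj (linePt v u t) ≠ proj v := by
      rw [proj_linePt]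
      intro h
      exact ht0 ((linePt_eq_self_iff _ hu).1 h)
    obtain ⟨d', hd', r, hr, h⟩ := exists_dir hC hL hf hvf ((hJ.mem_iff t).2 ht) hne
    rw [hvx, hC.dirs_of_notMem_vertices hx hxV hd] at hd'
    rw [proj_linePt] at h
    have h2 : t • toReal (hpart u) = r • toReal d' := add_left_cancel h
    have h3 : ∃ r' : ℝ, toReal (hpart u) = r' • toReal d := by
      rcases Finset.mem_insert.1 hd' with rfl | hd'
      · exact ⟨t⁻¹ * r, by rw [mul_smul, ← h2, smul_smul, inv_mul_cancel₀ ht0, one_smul]⟩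
      · rw [Finset.mem_singleton.1 hd', toReal_neg] at h2
        exact ⟨-(t⁻¹ * r), by
          rw [neg_smul, mul_smul, ← smul_neg, ← smul_neg, ← h2, smul_smul, inv_mul_cancel₀ ht0,
            one_smul]⟩
    obtain ⟨r', hr'⟩ := h3
    obtain ⟨a, -, ha⟩ := hI.primitive.exists_int_mul hr'
    refine ⟨u, J, a, hJ, ?_, ha⟩
    rintro rfl
    exact hu (by simpa using ha)
  have hpos : ∀ f ∈ hfin.toFinset,
      1 ≤ L f * (edgeLattice f).relIndex (latticeWith (vec3 d 0)) := by
    intro f hf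
    obtain ⟨hfL, v, hvf, hvx⟩ := hfin.mem_toFinset.1 hf
    obtain ⟨u, J, a, hJ, ha, hua⟩ := hedge f hfL v hvf hvx
    have h1 : edgeLattice f = latticeWith u := by
      rw [hJ.eq]; exact edgeLattice_linePt _ hJ.primitive hJ.nontrivial
    rw [h1]
    exact Nat.one_le_iff_ne_zero.2 (mul_ne_zero hfL (relIndex_latticeWith_ne_zero ha hua))
  have hcard : hfin.toFinset.card = 1 := by
    apply le_antisymm
    · have := Finset.sum_le_sum hpos
      rw [← hw] at this
      simpa using this
    · rw [Nat.one_le_iff_ne_zero, Ne, Finset.card_eq_zero]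
      intro h
      rw [h] at hw
      simp at hw
  obtain ⟨f, hf⟩ := Finset.card_eq_one.1 hcard
  have hfT : f ∈ hfin.toFinset := by rw [hf]; simp
  obtain ⟨hfL, v, hvf, hvx⟩ := hfin.mem_toFinset.1 hfT
  rw [hf, Finset.sum_singleton, eq_comm, mul_eq_one] at hw
  obtain ⟨u, J, a, hJ, ha, hua⟩ := hedge f hfL v hvf hvx
  have h1 : edgeLattice f = latticeWith u := by
    rw [hJ.eq]; exact edgeLattice_linePt _ hJ.primitive hJ.nontrivial
  rw [h1] at hw
  have haunit := isUnit_of_relIndex_latticeWith_eq_one hI.primitive hua hw.2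
  refine ⟨f, hfL, hw.1, ?_, ?_⟩
  · have hv3 : v = pt3 x (v 2) := by rw [← hvx, pt3_proj]
    rcases Int.isUnit_iff.1 haunit with rfl | rfl
    · refine ⟨v 2, u 2, J, ?_⟩
      rw [← hv3, ← one_smul ℤ d, ← hua, vec3_hpart]
      exact hJ
    · refine ⟨v 2, (-u) 2, (fun t => -t) ⁻¹' J, ?_⟩
      have : d = hpart (-u) := by
        have h5 : hpart (-u) = -hpart u := by funext i; fin_cases i <;> simp [hpart]
        rw [h5, hua]; simp
      rw [← hv3, this, vec3_hpart]
      exact hJ.flip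
  · intro f' hf' hxf'
    have : f' ∈ hfin.toFinset := hfin.mem_toFinset.2 ⟨hf', hxf'⟩
    rw [hf] at this
    exact Finset.mem_singleton.1 this

/-- The edge `f` of `L` is the only one over the germ of direction `d` at `x`; it contains the
point of height `z` over `x` and has slope `s` there. -/
structure GermOf (L : WeightedEdges 3) (x : Fin 2 → ℝ) (d : Fin 2 → ℤ) (f : Set (Fin 3 → ℝ))
    (z : ℝ) (s : ℤ) : Prop where
  mem : f ∈ L.edges
  weight : L f = 1
  edge : ∃ I, EdgeAt f (pt3 x z) (vec3 d s) I ∧ ∃ δ > 0, Set.Icc 0 δ ⊆ I ∧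
    ∀ t ∈ Set.Ioc 0 δ, ∀ f' ∈ L.edges, linePt x d t ∈ proj '' f' → f' = f

lemma exists_germOf (hC : GermCurve C M V D) (hL : IsLift C M L) {x : Fin 2 → ℝ}
    (hx : x ∈ C.carrier) {d : Fin 2 → ℤ} (hd : d ∈ D x) : ∃ f z s, GermOf L x d f z s := by
  obtain ⟨c, hc, hxc, I, hI, δ₀, hδ₀, hδI, hδV⟩ := hC.exists_small hx hd
  -- vertical edges lie over finitely many points
  have hZ : {y : Fin 2 → ℝ | ∃ f ∈ L.edges, proj '' f = {y}}.Finite := by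
    have : {y : Fin 2 → ℝ | ∃ f ∈ L.edges, proj '' f = {y}} =
        ⋃ f ∈ L.edges, {y | proj '' f = {y}} := by
      ext y
      rw [Set.mem_iUnion₂]
      constructor
      · rintro ⟨f, hf, h⟩; exact ⟨f, hf, h⟩
      · rintro ⟨f, hf, h⟩; exact ⟨f, hf, h⟩
    rw [this]
    refine hL.curve.finite.biUnion fun f hf => Set.Subsingleton.finite ?_
    intro y hy y' hy'
    exact Set.singleton_eq_singleton_iff.1 (Eq.trans (Eq.symm hy) hy')
  have hT : (linePt x d ⁻¹' {y : Fin 2 → ℝ | ∃ f ∈ L.edges, proj '' f = {y}} \ {0}).Finite :=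
    (hZ.preimage (linePt_injective x hI.primitive.ne_zero).injOn).subset Set.sdiff_subset
  have hev : ∀ᶠ t in nhdsWithin (0 : ℝ) (Set.Ioi 0),
      t ∈ (linePt x d ⁻¹' {y : Fin 2 → ℝ | ∃ f ∈ L.edges, proj '' f = {y}} \ {0})ᶜ :=
    mem_nhdsWithin_of_mem_nhds (hT.isClosed.isOpen_compl.mem_nhds (by simp))
  obtain ⟨δ₁, hδ₁, hsub⟩ := mem_nhdsGT_iff_exists_Ioc_subset.1
    (hev.and (Ioc_mem_nhdsGT hδ₀ : ∀ᶠ t in nhdsWithin (0 : ℝ) (Set.Ioi 0), t ∈ Set.Ioc 0 δ₀))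
  have hunique : ∀ t ∈ Set.Ioc (0 : ℝ) δ₁, ∃ f ∈ L.edges, L f = 1 ∧
      (∃ z s I, EdgeAt f (pt3 (linePt x d t) z) (vec3 d s) I) ∧
      ∀ f' ∈ L.edges, linePt x d t ∈ proj '' f' → f' = f := by
    intro t ht
    obtain ⟨h1, h2⟩ := hsub ht
    refine exists_unique_edge hC hL ?_ (hδV t h2).1 ?_ (hδV t h2).2
    · exact mem_carrier.2 ⟨c, hc, (hI.mem_iff t).2 (hδI ⟨h2.1.le, h2.2⟩)⟩
    · intro f hf hcon
      exact h1 ⟨⟨f, hf, hcon⟩, fun h0 => ht.1.ne' h0⟩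
  -- one edge is met arbitrarily close to `x`
  obtain ⟨f, hf, hfreq⟩ : ∃ f ∈ L.edges,
      ∃ᶠ t in nhdsWithin (0 : ℝ) (Set.Ioi 0), linePt x d t ∈ proj '' f := by
    by_contra hcon
    push Not at hcon
    have h1 : ∀ᶠ t in nhdsWithin (0 : ℝ) (Set.Ioi 0),
        ∀ f ∈ L.edges, linePt x d t ∉ proj '' f := by
      rw [Filter.eventually_all_finite hL.curve.finite]
      intro f hf
      simpa using hcon f hf
    have h2 : ∀ᶠ t in nhdsWithin (0 : ℝ) (Set.Ioi 0), t ∈ Set.Ioc 0 δ₁ := Ioc_mem_nhdsGT hδ₁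
    obtain ⟨t, h3, h4⟩ := (h1.and h2).exists
    obtain ⟨f, hf, -, ⟨z, s, J, hJ⟩, -⟩ := hunique t h4
    exact h3 f hf ⟨_, hJ.base_mem, by simp⟩
  have h2 : ∀ᶠ t in nhdsWithin (0 : ℝ) (Set.Ioi 0), t ∈ Set.Ioc 0 δ₁ := Ioc_mem_nhdsGT hδ₁
  obtain ⟨t₁, h3, h4⟩ := (hfreq.and_eventually h2).exists
  obtain ⟨f₁, hf₁, hw, ⟨z, s, J, hJ⟩, huf⟩ := hunique t₁ h4
  have hff : f = f₁ := huf f hf h3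
  subst hff
  have hmem : ∀ t, linePt x d t ∈ proj '' f ↔ t - t₁ ∈ J := by
    intro t
    rw [hJ.proj_image, proj_pt3, hpart_vec3, show t = t₁ + (t - t₁) by ring, ← linePt_linePt,
      (linePt_injective _ hI.primitive.ne_zero).mem_set_image]
    simp
  have h0 : -t₁ ∈ J := by
    have hcl : IsClosed ((fun t => t - t₁) ⁻¹' J) := hJ.closed.preimage (by fun_prop)
    have : (0 : ℝ) ∈ closure ((fun t => t - t₁) ⁻¹' J) := by
      rw [mem_closure_iff_frequently]
      refine Filter.Frequently.filter_mono ?_ (nhdsWithin_le_nhds (s := Set.Ioi 0))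
      exact hfreq.mono fun t ht => (hmem t).1 ht
    rw [hcl.closure_eq] at this
    simpa using this
  have hJ0 := hJ.shift h0
  rw [linePt_pt3, linePt_linePt, add_neg_cancel, linePt_zero] at hJ0
  refine ⟨f, _, s, hf, hw, _, hJ0, t₁, h4.1, ?_, ?_⟩
  · intro t ht
    change -t₁ + t ∈ J
    exact hJ.ordConnected.out h0 hJ.zero_mem ⟨by linarith [ht.1], by linarith [ht.2]⟩
  · intro t ht f' hf' hxf'
    obtain ⟨f₂, -, -, -, huf₂⟩ := hunique t ⟨ht.1, ht.2.trans h4.2⟩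
    rw [huf₂ f' hf' hxf', huf₂ f hf]
    rw [hmem]
    exact hJ.ordConnected.out h0 hJ.zero_mem ⟨by linarith [ht.1], by linarith [ht.2]⟩

end LiftGerms


/-! ### The structure of a lift -/

section LiftStructure

variable {C : WeightedEdges 2} {M V : Set (Fin 2 → ℝ)} {D : (Fin 2 → ℝ) → Finset (Fin 2 → ℤ)}
  {L : WeightedEdges 3} {F : (Fin 2 → ℝ) → (Fin 2 → ℤ) → Set (Fin 3 → ℝ)}
  {Z : (Fin 2 → ℝ) → (Fin 2 → ℤ) → ℝ} {S : (Fin 2 → ℝ) → (Fin 2 → ℤ) → ℤ}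

/-- The vertical ray below the point of height `r` over `x`. -/
def vray (x : Fin 2 → ℝ) (r : ℝ) : Set (Fin 3 → ℝ) := {p | proj p = x ∧ p 2 ≤ r}

/-- The part of the graph of `H` over `c`. -/
def graphOver (H : (Fin 2 → ℝ) → ℝ) (c : Set (Fin 2 → ℝ)) : Set (Fin 3 → ℝ) :=
  {p | proj p ∈ c ∧ p 2 = H (proj p)}

/-- A choice of the edges, heights and slopes of a lift over all germs of the curve. -/
def GermChoice (C : WeightedEdges 2) (D : (Fin 2 → ℝ) → Finset (Fin 2 → ℤ)) (L : WeightedEdges 3)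
    (F : (Fin 2 → ℝ) → (Fin 2 → ℤ) → Set (Fin 3 → ℝ)) (Z : (Fin 2 → ℝ) → (Fin 2 → ℤ) → ℝ)
    (S : (Fin 2 → ℝ) → (Fin 2 → ℤ) → ℤ) : Prop :=
  ∀ x d, x ∈ C.carrier → d ∈ D x → GermOf L x d (F x d) (Z x d) (S x d)

lemma exists_germChoice (hC : GermCurve C M V D) (hL : IsLift C M L) :
    ∃ F Z S, GermChoice C D L F Z S := by
  have h : ∀ x d, x ∈ C.carrier → d ∈ D x → ∃ f z s, GermOf L x d f z s :=
    fun x d hx hd => exists_germOf hC hL hx hd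
  choose! F Z S h using h
  exact ⟨F, Z, S, h⟩

/-- An edge leaving `v` non-vertically is the edge over one of the germs at the projection of
`v`, and leaves `v` with the slope of that germ. -/
lemma eq_germ_of_mem (hC : GermCurve C M V D) (hL : IsLift C M L) (hG : GermChoice C D L F Z S)
    {f : Set (Fin 3 → ℝ)} (hf : f ∈ L.edges) {v w : Fin 3 → ℝ} (hv : v ∈ f) (hw : w ∈ f)
    (hp : proj w ≠ proj v) : ∃ d ∈ D (proj v), f = F (proj v) d ∧ v 2 = Z (proj v) d ∧
      ∃ r > 0, w = linePt v (vec3 d (S (proj v) d)) r := by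
  obtain ⟨d, hd, r, hr, hwr⟩ := exists_dir hC hL hf hv hw hp
  have hx := hL.proj_mem hf hv
  obtain ⟨-, -, I, hI, δ, hδ, hsub, huniq⟩ := hG _ d hx hd
  obtain ⟨u, J, hJ⟩ := hL.edgeAt hf hv
  obtain ⟨t, ht, rfl⟩ := (hJ.eq ▸ hw : w ∈ linePt v u '' J)
  rw [proj_linePt] at hwr
  -- a point of the edge over the germ
  obtain ⟨τ, hτ0, hτ1, hτδ⟩ : ∃ τ : ℝ, 0 < τ ∧ τ ≤ 1 ∧ τ * r ≤ δ := by
    refine ⟨min 1 (δ / r), lt_min one_pos (by positivity), min_le_left _ _, ?_⟩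
    calc min 1 (δ / r) * r ≤ δ / r * r := by gcongr; exact min_le_right _ _
      _ = δ := by field_simp
  have hτt : τ * t ∈ J := by
    have := hJ.ordConnected.convex hJ.zero_mem ht (a := 1 - τ) (b := τ) (by linarith) hτ0.le
      (by ring)
    simpa using this
  have h2 : t • toReal (hpart u) = r • toReal d := add_left_cancel hwr
  have hff : f = F (proj v) d := by
    refine huniq (τ * r) ⟨by positivity, hτδ⟩ f hf ⟨_, (hJ.mem_iff _).2 hτt, ?_⟩
    rw [proj_linePt]
    simp only [linePt, mul_smul, h2]
  have hd0 := hC.dirs_primitive _ hx d hd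
  have hzv : pt3 (proj v) (Z (proj v) d) = v := by
    have : hpart u ≠ 0 := hpart_ne_zero_of_proj_ne hJ hw hp
    refine hJ.eq_of_proj_eq this ?_ (by simp)
    rw [hff]; exact hI.base_mem
  refine ⟨d, hd, hff, by rw [← hzv]; simp, r, hr, ?_⟩
  rw [hff, hI.eq, hzv] at hw
  obtain ⟨r', hr', h⟩ := hw
  rw [← h]
  congr 1
  have h3 := congrArg proj h
  rw [proj_linePt, proj_linePt, hpart_vec3, hwr] at h3
  exact linePt_injective _ hd0.ne_zero h3

lemma GermOf.base_mem {x : Fin 2 → ℝ} {d : Fin 2 → ℤ} {f : Set (Fin 3 → ℝ)} {z : ℝ} {s : ℤ}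
    (h : GermOf L x d f z s) : pt3 x z ∈ f := by
  obtain ⟨I, hI, -⟩ := h.edge
  exact hI.base_mem

/-- The part of the balancing condition at an end point `v` that comes from the non-vertical
edges: their germs either are absent or exhaust the germs of the curve. -/
lemma balance_at (hC : GermCurve C M V D) (hL : IsLift C M L) (hG : GermChoice C D L F Z S)
    {e : Set (Fin 3 → ℝ)} (he : e ∈ L.edges) {v : Fin 3 → ℝ} (hv : v ∈ e.extremePoints ℝ) :
    ∃ (u : Set (Fin 3 → ℝ) → Fin 3 → ℤ) (W : Finset (Set (Fin 3 → ℝ))),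
      (∀ f, f ∈ W ↔ f ∈ L.edges ∧ v ∈ f ∧ proj '' f = {proj v}) ∧
      (∀ f ∈ L.edges, v ∈ f → IsOutgoing v f (u f)) ∧
      ((D (proj v)).filter fun d => Z (proj v) d = v 2) ⊆ D (proj v) ∧
      (((D (proj v)).filter fun d => Z (proj v) d = v 2).Nonempty →
        ((D (proj v)).filter fun d => Z (proj v) d = v 2) = D (proj v)) ∧
      ∑ d ∈ (D (proj v)).filter (fun d => Z (proj v) d = v 2), S (proj v) d +
        ∑ f ∈ W, (L f : ℤ) * u f 2 = 0 := by
  classical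
  obtain ⟨u, hu, hsum⟩ := hL.curve.balanced e he v hv
  have hfin : {f | f ∈ L.edges ∧ v ∈ f}.Finite := hL.curve.finite.subset fun f hf => hf.1
  set x := proj v with hx
  set J := (D x).filter fun d => Z x d = v 2 with hJ
  have hxC : x ∈ C.carrier := hL.proj_mem he hv.1
  have hvJ : ∀ d ∈ J, v ∈ F x d := by
    intro d hd
    have hd' := Finset.mem_filter.1 hd
    have := (hG x d hxC hd'.1).base_mem
    rwa [hd'.2, hx, pt3_proj] at this
  have hext : ∀ f ∈ L.edges, v ∈ f → v ∈ f.extremePoints ℝ := by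
    intro f hf hvf
    by_cases hef : e = f
    · rwa [← hef]
    · exact (hL.curve.complex e he f hf hef v ⟨hv.1, hvf⟩).2
  have huJ : ∀ d ∈ J, u (F x d) = vec3 d (S x d) := by
    intro d hd
    have hd' := Finset.mem_filter.1 hd
    obtain ⟨hmem, -, I, hI, δ, hδ, hsub, -⟩ := hG x d hxC hd'.1
    rw [hd'.2, hx, pt3_proj] at hI
    obtain ⟨hprim, t, ht, htm⟩ := hu _ hmem (hvJ d hd)
    have hnin := hI.base_mem_extremePoints_iff.1 (hext _ hmem (hvJ d hd))
    obtain ⟨r, hr, hrt⟩ := hI.eq.subset htm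
    have h1 : r • toReal (vec3 d (S x d)) = t • toReal (u (F x d)) := add_left_cancel hrt
    have hr0 : 0 < r := by
      by_contra hcon
      rcases lt_or_eq_of_le (not_lt.1 hcon) with hlt | rfl
      · exact hnin ⟨r, hr, δ, hsub ⟨hδ.le, le_rfl⟩, hlt, hδ⟩
      · rw [zero_smul] at h1
        rcases smul_eq_zero.1 h1.symm with h | h
        · exact ht.ne' h
        · exact toReal_ne_zero hprim.ne_zero h
    refine hprim.eq_of_pos hI.primitive (r := t⁻¹ * r) (by positivity) ?_
    rw [mul_smul, h1, smul_smul, inv_mul_cancel₀ ht.ne', one_smul]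
  have hvert : ∀ f ∈ L.edges, v ∈ f → (proj '' f = {x} ↔ hpart (u f) = 0) := by
    intro f hf hvf
    obtain ⟨hprim, t, ht, htm⟩ := hu f hf hvf
    obtain ⟨u', I, hI⟩ := hL.edgeAt hf hvf
    obtain ⟨I', hI'⟩ := hI.of_mem hprim ht.ne' htm
    exact hI'.vertical_iff
  rw [finsum_mem_eq_finite_toFinset_sum _ hfin,
    ← Finset.sum_filter_add_sum_filter_not hfin.toFinset fun f => hpart (u f) = 0] at hsum
  -- the non-vertical edges at `v` correspond to the germs through `v`
  have hnv : ∑ f ∈ hfin.toFinset.filter (fun f => ¬ hpart (u f) = 0), L f • u f =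
      ∑ d ∈ J, vec3 d (S x d) := by
    symm
    apply Finset.sum_nbij (fun d => F x d)
    · intro d hd
      have hd' := Finset.mem_filter.1 hd
      rw [Finset.mem_filter, hfin.mem_toFinset, huJ d hd, hpart_vec3]
      exact ⟨⟨(hG x d hxC hd'.1).mem, hvJ d hd⟩, (hC.dirs_primitive x hxC d hd'.1).ne_zero⟩
    · intro d hd d' hd' h
      have h1 := huJ d hd
      simp only at h
      rw [h, huJ d' hd'] at h1
      have := congrArg hpart h1
      simpa using this.symm
    · intro f hf
      have hf' := Finset.mem_filter.1 (Finset.mem_coe.1 hf)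
      obtain ⟨hfL, hvf⟩ := hfin.mem_toFinset.1 hf'.1
      obtain ⟨hprim, t, ht, htm⟩ := hu f hfL hvf
      obtain ⟨d, hd, hfd, hzd, -⟩ := eq_germ_of_mem hC hL hG hfL hvf htm (by
        change proj (linePt v (u f) t) ≠ proj v
        rw [proj_linePt]
        exact fun h => ht.ne' ((linePt_eq_self_iff _ hf'.2).1 h))
      exact ⟨d, by simp only [hJ, Finset.coe_filter]; exact ⟨hd, hzd.symm⟩, hfd.symm⟩
    · intro d hd
      have hd' := Finset.mem_filter.1 hd
      rw [huJ d hd, (hG x d hxC hd'.1).weight, one_smul]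
  rw [hnv] at hsum
  refine ⟨u, hfin.toFinset.filter (fun f => hpart (u f) = 0), ?_, hu, Finset.filter_subset _ _,
    ?_, ?_⟩
  · intro f
    rw [Finset.mem_filter, hfin.mem_toFinset]
    constructor
    · rintro ⟨⟨h1, h2⟩, h3⟩
      exact ⟨h1, h2, (hvert f h1 h2).2 h3⟩
    · rintro ⟨h1, h2, h3⟩
      exact ⟨⟨h1, h2⟩, (hvert f h1 h2).1 h3⟩
  · intro hne
    apply hC.dirs_minimal x hxC J (Finset.filter_subset _ _) hne
    have h1 := congrArg hpart hsum
    have hadd : ∀ a b : Fin 3 → ℤ, hpart (a + b) = hpart a + hpart b := by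
      intro a b; funext i; fin_cases i <;> simp [hpart]
    rw [hadd, hpart_sum, hpart_sum, hpart_zero, Finset.sum_eq_zero, zero_add] at h1
    · simpa using h1
    · intro f hf
      rw [hpart_nsmul, (Finset.mem_filter.1 hf).2, smul_zero]
  · have h1 := congrFun hsum 2
    simp only [Pi.add_apply, Finset.sum_apply, vec3_two, Pi.zero_apply,
      nsmul_eq_mul] at h1
    rw [add_comm]
    exact h1

lemma outgoing_vertical {v : Fin 3 → ℝ} {f : Set (Fin 3 → ℝ)} {u : Fin 3 → ℤ}
    (hu : IsOutgoing v f u) (hf : proj '' f = {proj v}) :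
    u 2 ≠ 0 ∧ ∃ t : ℝ, 0 < t ∧ linePt v u t ∈ f := by
  obtain ⟨hprim, t, ht, htm⟩ := hu
  have h1 : proj (linePt v u t) = proj v := proj_image_eq_of_mem htm hf
  rw [proj_linePt] at h1
  have h2 : hpart u = 0 := by
    by_contra h
    exact ht.ne' ((linePt_eq_self_iff _ h).1 h1)
  refine ⟨fun h => hprim.ne_zero ?_, t, ht, htm⟩
  apply vector_ext
  · rw [h2, hpart_zero]
  · simpa using h

/-- At an end point `v` of a vertical edge such that all vertical edges through `v` lie on the same
side (below it if `σ = 1`, above it if `σ = -1`), all the germs over the projection of `v` meet. -/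
lemma germs_meet_of_vertical (hC : GermCurve C M V D) (hL : IsLift C M L)
    (hG : GermChoice C D L F Z S) {e : Set (Fin 3 → ℝ)} (he : e ∈ L.edges) {v : Fin 3 → ℝ}
    (hv : v ∈ e.extremePoints ℝ) (hev : proj '' e = {proj v}) {σ : ℤ} (hσ : σ = 1 ∨ σ = -1)
    (hside : ∀ f ∈ L.edges, proj '' f = {proj v} → v ∈ f → ∀ p ∈ f, σ * (p 2 - v 2) ≤ 0) :
    ∀ d ∈ D (proj v), Z (proj v) d = v 2 := by
  obtain ⟨u, W, hW, hu, -, hJ, hsum⟩ := balance_at hC hL hG he hv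
  have hneg : ∑ f ∈ W, (L f : ℤ) * (σ * u f 2) < 0 := by
    apply Finset.sum_neg
    · intro f hf
      obtain ⟨hfL, hvf, hfv⟩ := (hW f).1 hf
      obtain ⟨h0, t, ht, htm⟩ := outgoing_vertical (hu f hfL hvf) hfv
      have h1 := hside f hfL hfv hvf _ htm
      rw [linePt_two, add_sub_cancel_left] at h1
      have h2 : ((σ * u f 2 : ℤ) : ℝ) ≤ 0 := by
        push_cast
        by_contra hcon
        push Not at hcon
        have := mul_pos ht hcon
        linarith [show t * ((σ : ℝ) * (u f 2 : ℝ)) = σ * (t * u f 2) by ring]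
      have h3 : σ * u f 2 ≤ 0 := by exact_mod_cast h2
      have h4 : σ * u f 2 ≠ 0 := mul_ne_zero (by rcases hσ with rfl | rfl <;> simp) h0
      have h5 : σ * u f 2 < 0 := lt_of_le_of_ne h3 h4
      have h6 : (0 : ℤ) < L f := by
        have : L f ≠ 0 := hfL
        positivity
      exact mul_neg_of_pos_of_neg h6 h5
    · exact ⟨e, (hW e).2 ⟨he, hv.1, hev⟩⟩
  have hne : ((D (proj v)).filter fun d => Z (proj v) d = v 2).Nonempty := by
    by_contra hcon
    rw [Finset.not_nonempty_iff_eq_empty] at hcon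
    rw [hcon, Finset.sum_empty, zero_add] at hsum
    have : ∑ f ∈ W, (L f : ℤ) * (σ * u f 2) = σ * ∑ f ∈ W, (L f : ℤ) * u f 2 := by
      rw [Finset.mul_sum]; exact Finset.sum_congr rfl fun f _ => by ring
    rw [this, hsum] at hneg
    simp at hneg
  intro d hd
  rw [← hJ hne] at hd
  exact (Finset.mem_filter.1 hd).2

end LiftStructure


section LiftStructure

variable {C : WeightedEdges 2} {M V : Set (Fin 2 → ℝ)} {D : (Fin 2 → ℝ) → Finset (Fin 2 → ℤ)}
  {L : WeightedEdges 3} {F : (Fin 2 → ℝ) → (Fin 2 → ℤ) → Set (Fin 3 → ℝ)}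
  {Z : (Fin 2 → ℝ) → (Fin 2 → ℤ) → ℝ} {S : (Fin 2 → ℝ) → (Fin 2 → ℤ) → ℤ}

/-- A point of a vertical edge that is highest (`σ = 1`) or lowest (`σ = -1`) is an end point. -/
lemma extreme_of_vertical {e : Set (Fin 3 → ℝ)} (he : IsRationalEdge e) {v : Fin 3 → ℝ}
    (hv : v ∈ e) (hev : proj '' e = {proj v}) {σ : ℤ} (hσ : σ = 1 ∨ σ = -1)
    (hside : ∀ p ∈ e, (σ : ℝ) * (p 2 - v 2) ≤ 0) : v ∈ e.extremePoints ℝ := by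
  obtain ⟨u, I, hI⟩ := he.edgeAt hv
  rw [hI.base_mem_extremePoints_iff]
  rintro ⟨a, ha, b, hb, ha0, hb0⟩
  have hu : hpart u = 0 := hI.vertical_iff.1 hev
  have hu2 : (u 2 : ℝ) ≠ 0 := by
    intro h
    apply hI.primitive.ne_zero
    apply vector_ext
    · rw [hu, hpart_zero]
    · simpa using h
  have h1 := hside _ ((hI.mem_iff a).2 ha)
  have h2 := hside _ ((hI.mem_iff b).2 hb)
  rw [linePt_two, add_sub_cancel_left] at h1 h2
  have hne : (σ : ℝ) * u 2 ≠ 0 :=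
    mul_ne_zero (by rcases hσ with rfl | rfl <;> simp) hu2
  rcases lt_or_gt_of_ne hne with h | h
  · have := mul_pos_of_neg_of_neg ha0 h
    linarith [show a * ((σ : ℝ) * u 2) = σ * (a * u 2) by ring]
  · have := mul_pos hb0 h
    linarith [show b * ((σ : ℝ) * u 2) = σ * (b * u 2) by ring]

/-- There are no vertical edges away from the marked points: at the top and at the bottom of the
vertical edges over a point all the germs of the curve would have to meet. -/
lemma not_vertical_of_notMem (hC : GermCurve C M V D) (hL : IsLift C M L)
    (hG : GermChoice C D L F Z S) {x : Fin 2 → ℝ} (hx : x ∉ M) {e : Set (Fin 3 → ℝ)}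
    (he : e ∈ L.edges) : proj '' e ≠ {x} := by
  intro hex
  have hbdd : ∀ f ∈ L.edges, proj '' f = {x} → IsCompact f := by
    intro f hf hfx
    refine Metric.isCompact_of_isClosed_isBounded (hL.curve.rational f hf).isClosed ?_
    by_contra hcon
    have := (hL.vertical_iff f hf).1 ⟨⟨x, hfx⟩, hcon⟩
    rw [hfx, Set.singleton_subset_iff] at this
    exact hx this
  have hK : IsCompact (⋃ f ∈ {f | f ∈ L.edges ∧ proj '' f = {x}}, f) :=
    (hL.curve.finite.subset fun f hf => hf.1).isCompact_biUnion fun f hf => hbdd f hf.1 hf.2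
  have hne : (⋃ f ∈ {f | f ∈ L.edges ∧ proj '' f = {x}}, f).Nonempty := by
    obtain ⟨v, hv⟩ := (hL.curve.rational e he).nonempty
    exact ⟨v, Set.mem_biUnion (show e ∈ {f | f ∈ L.edges ∧ proj '' f = {x}} from ⟨he, hex⟩) hv⟩
  have key : ∀ σ : ℤ, (σ = 1 ∨ σ = -1) → ∃ z, (∀ d ∈ D x, Z x d = z) ∧
      ∀ p ∈ e, (σ : ℝ) * (p 2 - z) ≤ 0 := by
    intro σ hσ
    have hcont : Continuous fun p : Fin 3 → ℝ => (σ : ℝ) * p 2 := by fun_prop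
    obtain ⟨v, hvK, hmax⟩ := hK.exists_isMaxOn hne hcont.continuousOn
    obtain ⟨f, ⟨hf, hfx⟩, hvf⟩ := Set.mem_iUnion₂.1 hvK
    have hvx := proj_image_eq_of_mem hvf hfx
    have hside : ∀ f ∈ L.edges, proj '' f = {x} → ∀ p ∈ f, (σ : ℝ) * (p 2 - v 2) ≤ 0 := by
      intro f hf hfx p hp
      have := hmax (Set.mem_biUnion (show f ∈ {f | f ∈ L.edges ∧ proj '' f = {x}} from
        ⟨hf, hfx⟩) hp)
      simp only [Set.mem_ofPred_eq] at this
      linarith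
    refine ⟨v 2, ?_, hside e he hex⟩
    subst hvx
    exact germs_meet_of_vertical hC hL hG hf
      (extreme_of_vertical (hL.curve.rational f hf) hvf hfx hσ (hside f hf hfx)) hfx hσ
      fun f' hf' hfx' _ => hside f' hf' hfx'
  obtain ⟨z, hz, h1⟩ := key 1 (Or.inl rfl)
  obtain ⟨z', hz', h2⟩ := key (-1) (Or.inr rfl)
  obtain ⟨v, hv⟩ := (hL.curve.rational e he).nonempty
  have hxC : x ∈ C.carrier := by
    rw [← proj_image_eq_of_mem hv hex]; exact hL.proj_mem he hv
  obtain ⟨d, hd⟩ := hC.dirs_nonempty hxC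
  have hzz : z = z' := (hz d hd).symm.trans (hz' d hd)
  subst hzz
  have h3 : ∀ p ∈ e, p 2 = z := by
    intro p hp
    have h4 := h1 p hp
    have h5 := h2 p hp
    push_cast at h4 h5
    linarith
  obtain ⟨u, I, hI⟩ := hL.edgeAt he hv
  obtain ⟨t, ht, ht0⟩ := hI.exists_ne_zero
  have htm := (hI.mem_iff t).2 ht
  have : linePt v u t = v := by
    apply point_ext
    · rw [proj_image_eq_of_mem htm hex, proj_image_eq_of_mem hv hex]
    · rw [h3 _ htm, h3 _ hv]
  exact ht0 ((linePt_eq_self_iff _ hI.primitive.ne_zero).1 this)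

lemma vray_top_extreme (x : Fin 2 → ℝ) (r : ℝ) : pt3 x r ∈ (vray x r).extremePoints ℝ := by
  rw [mem_extremePoints]
  refine ⟨⟨by simp, by simp⟩, ?_⟩
  rintro p ⟨hp1, hp2⟩ q ⟨hq1, hq2⟩ ⟨a, b, ha, hb, hab, h⟩
  have h2 := congrFun h 2
  simp only [Pi.add_apply, Pi.smul_apply, smul_eq_mul, pt3_two] at h2
  have hp : p 2 = r := by
    refine le_antisymm hp2 ?_
    by_contra hcon
    push Not at hcon
    have h3 := mul_pos ha (sub_pos.2 hcon)
    have h4 := mul_nonneg hb.le (sub_nonneg.2 hq2)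
    have h5 : (a + b) * r = r := by rw [hab, one_mul]
    linarith
  have hq : q 2 = r := by
    refine le_antisymm hq2 ?_
    by_contra hcon
    push Not at hcon
    have h3 := mul_pos hb (sub_pos.2 hcon)
    have h4 := mul_nonneg ha.le (sub_nonneg.2 hp2)
    have h5 : (a + b) * r = r := by rw [hab, one_mul]
    linarith
  exact ⟨point_ext (by simpa using hp1) (by simpa using hp),
    point_ext (by simpa using hq1) (by simpa using hq)⟩

lemma vray_extreme_eq {x : Fin 2 → ℝ} {r : ℝ} {v : Fin 3 → ℝ}
    (hv : v ∈ (vray x r).extremePoints ℝ) : v = pt3 x r := by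
  obtain ⟨⟨h1, h2⟩, h3⟩ := mem_extremePoints.1 hv
  apply point_ext
  · simpa using h1
  · by_contra hne
    have hlt : v 2 < r := lt_of_le_of_ne h2 (by simpa using hne)
    have := (h3 (pt3 x (v 2 - (r - v 2))) ⟨by simp, by simp; linarith⟩ (pt3 x r)
      ⟨by simp, by simp⟩ ⟨1 / 2, 1 / 2, by norm_num, by norm_num, by norm_num, ?_⟩).2
    · rw [← this] at hlt; simp at hlt
    · subst h1
      funext i; fin_cases i <;> simp [pt3, proj] <;> ring

lemma proj_image_vray (x : Fin 2 → ℝ) (r : ℝ) : proj '' vray x r = {x} := by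
  apply Set.Subset.antisymm
  · rintro _ ⟨p, hp, rfl⟩; exact hp.1
  · rintro y rfl; exact ⟨pt3 y r, ⟨proj_pt3 _ _, by simp⟩, proj_pt3 _ _⟩

/-- Over a marked point there is exactly one vertical edge, a downward ray; all the germs meet at
its top, and their slopes add up to its weight. -/
lemma marked_structure (hC : GermCurve C M V D) (hL : IsLift C M L)
    (hG : GermChoice C D L F Z S) {x : Fin 2 → ℝ} (hx : x ∈ M) : ∃ r,
      vray x r ∈ L.edges ∧ (∀ e ∈ L.edges, proj '' e = {x} → e = vray x r) ∧
      (∀ d ∈ D x, Z x d = r) ∧ ∑ d ∈ D x, S x d = L (vray x r) := by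
  have hray : ∀ e ∈ L.edges, proj '' e = {x} → ∃ r, e = vray x r := by
    intro e he hex
    have hinf := (hL.vertical_iff e he).2 (by rw [hex]; exact Set.singleton_subset_iff.2 hx)
    obtain ⟨y, r, h⟩ := hL.downward e he hinf
    have hey : e = vray y r := h
    rw [hey, proj_image_vray, Set.singleton_eq_singleton_iff] at hex
    exact ⟨r, by rw [hey, hex]⟩
  obtain ⟨e, he, -, hex⟩ := hL.marked x hx
  obtain ⟨r, rfl⟩ := hray e he hex
  have huniq : ∀ e ∈ L.edges, proj '' e = {x} → e = vray x r := by
    intro e' he' hex'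
    by_contra hne
    obtain ⟨r', rfl⟩ := hray e' he' hex'
    have := (hL.curve.complex _ he' _ he hne (pt3 x (min r r' - 1))
      ⟨⟨by simp, by simp⟩, ⟨by simp, by simp⟩⟩).2
    have h2 := congrFun (vray_extreme_eq this) 2
    simp only [pt3_two] at h2
    linarith [min_le_left r r']
  have hext := vray_top_extreme x r
  have hside : ∀ f ∈ L.edges, proj '' f = {proj (pt3 x r)} → pt3 x r ∈ f → ∀ p ∈ f,
      ((1 : ℤ) : ℝ) * (p 2 - pt3 x r 2) ≤ 0 := by
    intro f hf hfx _ p hp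
    rw [proj_pt3] at hfx
    rw [huniq f hf hfx] at hp
    simpa using hp.2
  have hmeet := germs_meet_of_vertical hC hL hG he hext (by simpa using hex) (Or.inl rfl) hside
  obtain ⟨u, W, hW, hu, -, hJ, hsum⟩ := balance_at hC hL hG he hext
  rw [proj_pt3, pt3_two] at hJ hsum hmeet
  rw [Finset.filter_true_of_mem hmeet] at hsum
  refine ⟨r, he, huniq, hmeet, ?_⟩
  have hWr : W = {vray x r} := by
    ext f
    rw [hW, Finset.mem_singleton, proj_pt3]
    constructor
    · rintro ⟨h1, -, h3⟩; exact huniq f h1 h3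
    · rintro rfl; exact ⟨he, hext.1, hex⟩
  rw [hWr, Finset.sum_singleton] at hsum
  have hout := hu _ he hext.1
  have h2 := outgoing_vertical hout (by simpa using hex)
  have hu2 : u (vray x r) 2 = -1 := by
    obtain ⟨h0, t, ht, htm⟩ := h2
    have hp : proj (linePt (pt3 x r) (u (vray x r)) t) = x := htm.1
    have hz := htm.2
    rw [linePt_two, pt3_two] at hz
    have hh : hpart (u (vray x r)) = 0 := by
      by_contra h
      rw [proj_linePt, proj_pt3] at hp
      exact ht.ne' ((linePt_eq_self_iff _ h).1 hp)
    have hunit : IsUnit (u (vray x r) 2) := by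
      apply hout.1
      intro i
      have h0 := congrFun hh 0
      have h1 := congrFun hh 1
      simp [hpart] at h0 h1
      fin_cases i
      · simp [h0]
      · simp [h1]
      · simp
    rcases Int.isUnit_iff.1 hunit with h | h
    · rw [h] at hz; push_cast at hz; linarith
    · exact h
  rw [hu2] at hsum
  linarith

/-- At a vertex that is not marked, all germs meet and their slopes add up to zero. -/
lemma vertex_structure (hC : GermCurve C M V D) (hL : IsLift C M L)
    (hG : GermChoice C D L F Z S) {x : Fin 2 → ℝ} (hx : x ∈ V) (hxM : x ∉ M) {d : Fin 2 → ℤ}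
    (hd : d ∈ D x) : pt3 x (Z x d) ∈ (F x d).extremePoints ℝ ∧ (∀ d' ∈ D x, Z x d' = Z x d) ∧
      ∑ d' ∈ D x, S x d' = 0 := by
  have hxC := hC.vertices_subset hx
  obtain ⟨hmem, -, I, hI, δ, hδ, hsub, -⟩ := hG x d hxC hd
  have hext : pt3 x (Z x d) ∈ (F x d).extremePoints ℝ := by
    rw [hI.base_mem_extremePoints_iff]
    rintro ⟨a, ha, b, hb, ha0, hb0⟩
    have ham := (hI.mem_iff a).2 ha
    have hdne := (hC.dirs_primitive x hxC d hd).ne_zero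
    obtain ⟨d', hd', -, -, r, hr, h⟩ := eq_germ_of_mem hC hL hG hmem hI.base_mem ham (by
      rw [proj_linePt, hpart_vec3]
      exact fun h => ha0.ne ((linePt_eq_self_iff _ hdne).1 h))
    rw [proj_pt3] at hd'
    have h1 := congrArg proj h
    rw [proj_linePt, proj_linePt, hpart_vec3, hpart_vec3, proj_pt3] at h1
    have h2 : a • toReal d = r • toReal d' := add_left_cancel h1
    have h3 : toReal d' = (r⁻¹ * (-a)) • toReal (-d) := by
      rw [mul_smul, toReal_neg, neg_smul, smul_neg, smul_neg, smul_neg, neg_neg, h2, smul_smul,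
        inv_mul_cancel₀ hr.ne', one_smul]
    have h4 := (hC.dirs_primitive x hxC d' hd').eq_of_pos
      (hC.dirs_primitive x hxC d hd).neg (mul_pos (by positivity) (by linarith)) h3
    exact hC.dirs_vertex x hx hxM d hd (h4 ▸ hd')
  obtain ⟨u, W, hW, hu, -, hJ, hsum⟩ := balance_at hC hL hG hmem hext
  rw [proj_pt3, pt3_two] at hJ hsum
  have hne : ((D x).filter fun d' => Z x d' = Z x d).Nonempty :=
    ⟨d, Finset.mem_filter.2 ⟨hd, rfl⟩⟩
  have hJ := hJ hne
  refine ⟨hext, ?_, ?_⟩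
  · intro d' hd'
    rw [← hJ] at hd'
    exact (Finset.mem_filter.1 hd').2
  · have hW0 : W = ∅ := by
      rw [Finset.eq_empty_iff_forall_notMem]
      intro f hf
      obtain ⟨h1, -, h3⟩ := (hW f).1 hf
      rw [proj_pt3] at h3
      exact not_vertical_of_notMem hC hL hG hxM h1 h3
    rwa [hJ, hW0, Finset.sum_empty, add_zero] at hsum

/-- Away from the vertices, the two germs are the two halves of a germ of a single edge. -/
lemma regular_structure (hC : GermCurve C M V D) (hL : IsLift C M L)
    (hG : GermChoice C D L F Z S) {x : Fin 2 → ℝ} (hxC : x ∈ C.carrier) (hx : x ∉ V)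
    {d : Fin 2 → ℤ} (hd : d ∈ D x) : pt3 x (Z x d) ∉ (F x d).extremePoints ℝ ∧
      (∀ d' ∈ D x, Z x d' = Z x d) ∧ ∑ d' ∈ D x, S x d' = 0 := by
  have hD := hC.dirs_of_notMem_vertices hxC hx hd
  have hnd : -d ∈ D x := by rw [hD]; simp
  have hxM : x ∉ M := fun h => hx (hC.marked_subset h)
  have hdne := (hC.dirs_primitive x hxC d hd).ne_zero
  obtain ⟨f, hf, -, ⟨z, s, I, hI⟩, huniq⟩ := exists_unique_edge hC hL hxC hx
    (fun f hf => not_vertical_of_notMem hC hL hG hxM hf) hd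
  have hF : ∀ d' ∈ D x, F x d' = f := fun d' hd' =>
    huniq _ (hG x d' hxC hd').mem ⟨_, (hG x d' hxC hd').base_mem, by simp⟩
  have hZ : ∀ d' ∈ D x, Z x d' = z := by
    intro d' hd'
    have hb := (hG x d' hxC hd').base_mem
    rw [hF d' hd'] at hb
    have := hI.eq_of_proj_eq (by rw [hpart_vec3]; exact hdne) hb (by simp)
    simpa using congrFun this 2
  -- each of the two germs continues the other one
  obtain ⟨-, -, I₁, hI₁, δ₁, hδ₁, hsub₁, -⟩ := hG x d hxC hd
  obtain ⟨-, -, I₂, hI₂, δ₂, hδ₂, hsub₂, -⟩ := hG x (-d) hxC hnd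
  rw [hF d hd, hZ d hd] at hI₁
  rw [hF _ hnd, hZ _ hnd] at hI₂
  have hm : linePt (pt3 x z) (vec3 (-d) (S x (-d))) δ₂ ∈ f :=
    (hI₂.mem_iff _).2 (hsub₂ ⟨hδ₂.le, le_rfl⟩)
  obtain ⟨r, hr, hrm⟩ := hI₁.eq.subset hm
  have hr2 : r = -δ₂ := by
    have h1 := congrArg proj hrm
    rw [proj_linePt, proj_linePt, hpart_vec3, hpart_vec3, linePt_neg] at h1
    exact linePt_injective _ hdne h1
  have hS : S x (-d) = -S x d := by
    have h1 := congrFun hrm 2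
    rw [linePt_two, linePt_two, vec3_two, vec3_two, hr2] at h1
    have h2 : δ₂ * ((S x (-d) : ℝ) + S x d) = 0 := by linarith
    rcases mul_eq_zero.1 h2 with h | h
    · linarith
    · have : (S x (-d) : ℝ) = ((-S x d : ℤ) : ℝ) := by push_cast; linarith
      exact_mod_cast this
  refine ⟨?_, ?_, ?_⟩
  · rw [hF d hd, hZ d hd, hI₁.base_mem_extremePoints_iff, not_not]
    exact ⟨r, hr, δ₁, hsub₁ ⟨hδ₁.le, le_rfl⟩, by linarith, hδ₁⟩
  · intro d' hd'; rw [hZ d' hd', hZ d hd]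
  · rw [hD, Finset.sum_pair, hS, add_neg_cancel]
    exact fun h => hdne (self_eq_neg.1 h)

/-- A lift consists of the graph of a function `H` over the curve, which is affine with integer
slope along each germ, and of vertical rays below the marked points; the slopes of `H` at a point
add up to the weight of the ray below it, or to zero if the point is not marked. -/
theorem lift_structure (hC : GermCurve C M V D) (hL : IsLift C M L) :
    ∃ (H : (Fin 2 → ℝ) → ℝ) (S : (Fin 2 → ℝ) → (Fin 2 → ℤ) → ℤ),
      (∀ x ∈ C.carrier, ∀ d ∈ D x, ∃ δ > 0, ∀ t ∈ Set.Icc 0 δ,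
        linePt x d t ∈ C.carrier ∧ H (linePt x d t) = H x + t * S x d) ∧
      (∀ x ∈ C.carrier, x ∉ M → ∑ d ∈ D x, S x d = 0) ∧
      (∀ x ∈ M, vray x (H x) ∈ L.edges ∧ ∑ d ∈ D x, S x d = L (vray x (H x))) ∧
      (∀ e ∈ L.edges, (∃ x ∈ M, e = vray x (H x)) ∨ L e = 1 ∧ ∃ c ∈ C.edges, e = graphOver H c) ∧
      ∀ c ∈ C.edges, graphOver H c ∈ L.edges := by
  obtain ⟨F, Z, S, hG⟩ := exists_germChoice hC hL
  have hMC : ∀ x ∈ M, x ∈ C.carrier := fun x hx => hC.vertices_subset (hC.marked_subset hx)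
  have hH : ∀ x, ∃ z, x ∈ C.carrier → ∀ d ∈ D x, Z x d = z := by
    intro x
    by_cases hxC : x ∈ C.carrier
    · obtain ⟨d, hd⟩ := hC.dirs_nonempty hxC
      by_cases hxM : x ∈ M
      · obtain ⟨r, -, -, h, -⟩ := marked_structure hC hL hG hxM
        exact ⟨r, fun _ => h⟩
      · by_cases hxV : x ∈ V
        · exact ⟨_, fun _ => (vertex_structure hC hL hG hxV hxM hd).2.1⟩
        · exact ⟨_, fun _ => (regular_structure hC hL hG hxC hxV hd).2.1⟩
    · exact ⟨0, fun h => absurd h hxC⟩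
  choose H hH using hH
  have hmark : ∀ x ∈ M, vray x (H x) ∈ L.edges ∧
      (∀ e ∈ L.edges, proj '' e = {x} → e = vray x (H x)) ∧
      ∑ d ∈ D x, S x d = L (vray x (H x)) := by
    intro x hxM
    obtain ⟨r, h1, h2, h3, h4⟩ := marked_structure hC hL hG hxM
    obtain ⟨d, hd⟩ := hC.dirs_nonempty (hMC x hxM)
    have : H x = r := (hH x (hMC x hxM) d hd).symm.trans (h3 d hd)
    rw [this]
    exact ⟨h1, h2, h4⟩
  -- non-vertical edges lie in the graph
  have hleave : ∀ f ∈ L.edges, (∀ x, proj '' f ≠ {x}) → ∀ v ∈ f, ∃ d ∈ D (proj v),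
      f = F (proj v) d ∧ v 2 = H (proj v) := by
    intro f hf hnv v hv
    obtain ⟨u, I, hI⟩ := hL.edgeAt hf hv
    have hu : hpart u ≠ 0 := fun h => hnv _ (hI.vertical_iff.2 h)
    obtain ⟨t, ht, ht0⟩ := hI.exists_ne_zero
    obtain ⟨d, hd, hfd, hz, -⟩ := eq_germ_of_mem hC hL hG hf hv ((hI.mem_iff t).2 ht) (by
      rw [proj_linePt]
      exact fun h => ht0 ((linePt_eq_self_iff _ hu).1 h))
    exact ⟨d, hd, hfd, hz.trans (hH _ (hL.proj_mem hf hv) d hd)⟩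
  have hFnv : ∀ x ∈ C.carrier, ∀ d ∈ D x, ∀ y, proj '' F x d ≠ {y} := by
    intro x hx d hd y hy
    obtain ⟨hmem, -, I, hI, -⟩ := hG x d hx hd
    have h1 := proj_image_eq_of_mem hI.base_mem hy
    rw [← h1] at hy
    have := hI.vertical_iff.1 hy
    rw [hpart_vec3] at this
    exact (hC.dirs_primitive x hx d hd).ne_zero this
  have hgraph : ∀ f ∈ L.edges, (∀ x, proj '' f ≠ {x}) → f = graphOver H (proj '' f) := by
    intro f hf hnv
    ext p
    constructor
    · intro hp
      obtain ⟨-, -, -, h⟩ := hleave f hf hnv p hp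
      exact ⟨⟨p, hp, rfl⟩, h⟩
    · rintro ⟨⟨q, hq, hqp⟩, hp⟩
      obtain ⟨-, -, -, h⟩ := hleave f hf hnv q hq
      have : p = q := point_ext hqp.symm (by rw [hp, h, hqp])
      rwa [this]
  -- the end points of the non-vertical edges are the points over the vertices
  have hext : ∀ f ∈ L.edges, (∀ x, proj '' f ≠ {x}) → ∀ v ∈ f,
      (proj v ∈ V ↔ v ∈ f.extremePoints ℝ) := by
    intro f hf hnv v hv
    have hxC := hL.proj_mem hf hv
    obtain ⟨d, hd, hfd, hz⟩ := hleave f hf hnv v hv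
    have hvp : v = pt3 (proj v) (Z (proj v) d) := by
      rw [hH _ hxC d hd, ← hz, pt3_proj]
    constructor
    · intro hV
      by_cases hxM : proj v ∈ M
      · have hne : vray (proj v) (H (proj v)) ≠ f := by
          intro h
          exact hnv _ (by rw [← h]; exact proj_image_vray _ _)
        refine (hL.curve.complex _ (hmark _ hxM).1 f hf hne v ⟨⟨rfl, hz.le⟩, hv⟩).2
      · have := (vertex_structure hC hL hG hV hxM hd).1
        rwa [← hvp, ← hfd] at this
    · intro hve
      by_contra hV
      have := (regular_structure hC hL hG hxC hV hd).1
      rw [← hvp, ← hfd] at this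
      exact this hve
  -- a non-vertical edge projects to the edge of the curve through any of its inner points
  have hproj : ∀ x ∈ C.carrier, x ∉ V → ∀ d ∈ D x, ∀ c ∈ C.edges, x ∈ c → proj '' F x d = c := by
    intro x hx hxV d hd c hc hxc
    obtain ⟨hmem, -, I, hI, δ, hδ, hsub, -⟩ := hG x d hx hd
    have hnv := hFnv x hx d hd
    have hdp := hC.dirs_primitive x hx d hd
    have hpe : EdgeAt (proj '' F x d) x d I :=
      ⟨hdp, hI.closed, hI.ordConnected, hI.nontrivial, hI.zero_mem, by
        rw [hI.proj_image, proj_pt3, hpart_vec3]⟩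
    obtain ⟨c', hc', hxc', t, ht, htc'⟩ := hC.edge_of_germ x hx d hd
    have hcc : c' = c := hC.unique c' hc' c hc x hxc' hxc hxV
    subst hcc
    obtain ⟨I', hI'⟩ := hC.edgeAt_of_germ hc' hxc' hdp ht.ne' htc'
    refine hpe.eq_of_vertices hI' hxV ?_ (hC.vertex_iff c' hc')
    rintro y hy
    obtain ⟨s, hs, rfl⟩ := hpe.eq.subset hy
    have h1 := hext _ hmem hnv _ ((hI.mem_iff s).2 hs)
    rw [proj_linePt, proj_pt3, hpart_vec3, hI.mem_extremePoints_iff hs] at h1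
    rw [h1, hpe.mem_extremePoints_iff hs]
  refine ⟨H, S, ?_, ?_, fun x hx => ⟨(hmark x hx).1, (hmark x hx).2.2⟩, ?_, ?_⟩
  · intro x hx d hd
    obtain ⟨hmem, -, I, hI, δ, hδ, hsub, -⟩ := hG x d hx hd
    refine ⟨δ, hδ, fun t ht => ?_⟩
    have h1 := (hI.mem_iff t).2 (hsub ht)
    have h2 := hL.proj_mem hmem h1
    obtain ⟨-, -, -, h3⟩ := hleave _ hmem (hFnv x hx d hd) _ h1
    rw [linePt_pt3, proj_pt3] at h2 h3
    rw [pt3_two, hH x hx d hd] at h3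
    exact ⟨h2, h3.symm⟩
  · intro x hx hxM
    obtain ⟨d, hd⟩ := hC.dirs_nonempty hx
    by_cases hxV : x ∈ V
    · exact (vertex_structure hC hL hG hxV hxM hd).2.2
    · exact (regular_structure hC hL hG hx hxV hd).2.2
  · intro e he
    by_cases hv : ∃ x, proj '' e = {x}
    · obtain ⟨x, hx⟩ := hv
      left
      by_cases hxM : x ∈ M
      · exact ⟨x, hxM, (hmark x hxM).2.1 e he hx⟩
      · exact absurd hx (not_vertical_of_notMem hC hL hG hxM he)
    · right
      push Not at hv
      obtain ⟨v, hve, hvx⟩ := (hL.curve.rational e he).exists_not_extreme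
      have hxC := hL.proj_mem he hve
      have hxV : proj v ∉ V := fun h => hvx ((hext e he hv v hve).1 h)
      obtain ⟨d, hd, hed, -⟩ := hleave e he hv v hve
      obtain ⟨c, hc, hxc⟩ := mem_carrier.1 hxC
      refine ⟨?_, c, hc, ?_⟩
      · rw [hed]; exact (hG _ d hxC hd).weight
      · have h1 := hproj _ hxC hxV d hd c hc hxc
        rw [← hed] at h1
        rw [← h1]
        exact hgraph e he hv
  · intro c hc
    obtain ⟨x, hxc, hx⟩ := (hC.rational c hc).exists_not_extreme
    have hxC : x ∈ C.carrier := mem_carrier.2 ⟨c, hc, hxc⟩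
    have hxV : x ∉ V := fun h => hx ((hC.vertex_iff c hc x hxc).1 h)
    obtain ⟨d, hd⟩ := hC.dirs_nonempty hxC
    have h1 := hproj x hxC hxV d hd c hc hxc
    have h2 := hgraph _ (hG x d hxC hd).mem (hFnv x hxC d hd)
    rw [h1] at h2
    rw [← h2]
    exact (hG x d hxC hd).mem

end LiftStructure


/-! ### Construction of a lift -/

section LiftConstruction

variable {C : WeightedEdges 2} {M V : Set (Fin 2 → ℝ)} {D : (Fin 2 → ℝ) → Finset (Fin 2 → ℤ)}
  {H : (Fin 2 → ℝ) → ℝ} {S : (Fin 2 → ℝ) → (Fin 2 → ℤ) → ℤ}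

open Classical in
/-- The curve in space, with all weights equal to one, consisting of the graph of `H` over the
planar curve `C` and of the vertical rays below the marked points. -/
noncomputable def graphCurve (C : WeightedEdges 2) (M : Set (Fin 2 → ℝ)) (H : (Fin 2 → ℝ) → ℝ) :
    WeightedEdges 3 := fun e =>
  if (∃ c ∈ C.edges, e = graphOver H c) ∨ ∃ x ∈ M, e = vray x (H x) then 1 else 0

lemma mem_edges_graphCurve {e : Set (Fin 3 → ℝ)} : e ∈ (graphCurve C M H).edges ↔
    (∃ c ∈ C.edges, e = graphOver H c) ∨ ∃ x ∈ M, e = vray x (H x) := by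
  change graphCurve C M H e ≠ 0 ↔ _
  unfold graphCurve
  split_ifs with h <;> simp [h]

lemma graphCurve_of_mem {e : Set (Fin 3 → ℝ)} (h : e ∈ (graphCurve C M H).edges) :
    graphCurve C M H e = 1 := by
  rw [mem_edges_graphCurve] at h
  unfold graphCurve
  rw [if_pos h]

lemma mem_carrier_graphCurve {p : Fin 3 → ℝ} : p ∈ (graphCurve C M H).carrier ↔
    (proj p ∈ C.carrier ∧ p 2 = H (proj p)) ∨ (proj p ∈ M ∧ p 2 ≤ H (proj p)) := by
  rw [mem_carrier]
  simp only [mem_edges_graphCurve]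
  constructor
  · rintro ⟨_, ⟨c, hc, rfl⟩ | ⟨x, hx, rfl⟩, hp⟩
    · exact Or.inl ⟨mem_carrier.2 ⟨c, hc, hp.1⟩, hp.2⟩
    · obtain ⟨rfl, h⟩ := hp
      exact Or.inr ⟨hx, h⟩
  · rintro (⟨h1, h2⟩ | ⟨h1, h2⟩)
    · obtain ⟨c, hc, hpc⟩ := mem_carrier.1 h1
      exact ⟨_, Or.inl ⟨c, hc, rfl⟩, hpc, h2⟩
    · exact ⟨_, Or.inr ⟨_, h1, rfl⟩, rfl, h2⟩

/-- The function `H` has slope `S x d` along the edge of the curve leaving `x` in direction `d`. -/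
def HasSlopes (C : WeightedEdges 2) (D : (Fin 2 → ℝ) → Finset (Fin 2 → ℤ))
    (H : (Fin 2 → ℝ) → ℝ) (S : (Fin 2 → ℝ) → (Fin 2 → ℤ) → ℤ) : Prop :=
  ∀ c ∈ C.edges, ∀ x ∈ c, ∀ d ∈ D x, ∀ t > 0, linePt x d t ∈ c →
    H (linePt x d t) = H x + t * S x d

/-- Slopes adding up to zero, except at the marked points, where they add up to one. -/
def IsHarmonic (C : WeightedEdges 2) (M : Set (Fin 2 → ℝ)) (D : (Fin 2 → ℝ) → Finset (Fin 2 → ℤ))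
    (S : (Fin 2 → ℝ) → (Fin 2 → ℤ) → ℤ) : Prop :=
  (∀ x ∈ C.carrier, x ∉ M → ∑ d ∈ D x, S x d = 0) ∧ ∀ x ∈ M, ∑ d ∈ D x, S x d = 1

lemma GermCurve.exists_dir_edgeAt (hC : GermCurve C M V D) {c : Set (Fin 2 → ℝ)}
    (hc : c ∈ C.edges) {x : Fin 2 → ℝ} (hx : x ∈ c) :
    ∃ d ∈ D x, ∃ I, EdgeAt c x d I ∧ ∃ t ∈ I, 0 < t := by
  obtain ⟨u, I, hI⟩ := (hC.rational c hc).edgeAt hx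
  obtain ⟨t, ht, ht0⟩ := hI.exists_ne_zero
  have htm := (hI.mem_iff t).2 ht
  obtain ⟨d, hd, r, hr, h⟩ := hC.germ_of_edge c hc x hx _ htm
    (fun h => ht0 ((linePt_eq_self_iff _ hI.primitive.ne_zero).1 h))
  rw [h] at htm
  obtain ⟨I', hI'⟩ := hI.of_mem (hC.dirs_primitive x (mem_carrier.2 ⟨c, hc, hx⟩) d hd) hr.ne' htm
  exact ⟨d, hd, I', hI', r, (hI'.mem_iff r).1 htm, hr⟩

lemma graphOver_edgeAt (hC : GermCurve C M V D) (hH : HasSlopes C D H S)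
    (hS : IsHarmonic C M D S) {c : Set (Fin 2 → ℝ)} (hc : c ∈ C.edges) {x : Fin 2 → ℝ}
    {d : Fin 2 → ℤ} (hd : d ∈ D x) {I : Set ℝ} (hI : EdgeAt c x d I) {t₀ : ℝ} (ht₀ : t₀ ∈ I)
    (ht₀' : 0 < t₀) : EdgeAt (graphOver H c) (pt3 x (H x)) (vec3 d (S x d)) I := by
  have hx := hI.base_mem
  have hxC : x ∈ C.carrier := mem_carrier.2 ⟨c, hc, hx⟩
  have haff : ∀ t ∈ I, H (linePt x d t) = H x + t * S x d := by
    intro t ht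
    rcases lt_trichotomy t 0 with h | rfl | h
    · have hxV : x ∉ V := by
        rw [hC.vertex_iff c hc x hx, hI.base_mem_extremePoints_iff, not_not]
        exact ⟨t, ht, t₀, ht₀, h, ht₀'⟩
      have hD := hC.dirs_of_notMem_vertices hxC hxV hd
      have hsum := hS.1 x hxC fun h => hxV (hC.marked_subset h)
      rw [hD, Finset.sum_pair fun h => hI.primitive.ne_zero (self_eq_neg.1 h)] at hsum
      have h1 := hH c hc x hx (-d) (by rw [hD]; simp) (-t) (by linarith) (by
        rw [linePt_neg, neg_neg]; exact (hI.mem_iff t).2 ht)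
      rw [linePt_neg, neg_neg] at h1
      have h2 : (S x (-d) : ℝ) = -S x d := by
        have : S x (-d) = -S x d := by linarith
        rw [this]; push_cast; ring
      rw [h1, h2]; ring
    · rw [linePt_zero]; ring
    · exact hH c hc x hx d hd t h ((hI.mem_iff t).2 ht)
  refine ⟨isPrimitiveVec_vec3 hI.primitive _, hI.closed, hI.ordConnected, hI.nontrivial,
    hI.zero_mem, ?_⟩
  ext p
  constructor
  · rintro ⟨hp, hp2⟩
    obtain ⟨t, ht, htp⟩ := hI.eq.subset hp
    refine ⟨t, ht, ?_⟩
    rw [linePt_pt3]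
    apply point_ext
    · simpa using htp
    · rw [pt3_two, hp2, ← haff t ht, htp]
  · rintro ⟨t, ht, rfl⟩
    rw [linePt_pt3]
    exact ⟨by simpa using (hI.mem_iff t).2 ht, by simpa using (haff t ht).symm⟩

lemma isPrimitiveVec_vertical : IsPrimitiveVec (vec3 0 1) :=
  isPrimitiveVec_of_isUnit 2 (by simp)

lemma vray_edgeAt (x : Fin 2 → ℝ) (r : ℝ) : EdgeAt (vray x r) (pt3 x r) (vec3 0 1) (Set.Iic 0) := by
  refine ⟨isPrimitiveVec_vertical, isClosed_Iic, Set.ordConnected_Iic,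
    ⟨-1, by simp, 0, by simp, by norm_num⟩, by simp, ?_⟩
  have h0 : ∀ t, linePt x 0 t = x := by
    intro t; funext i; simp [linePt, toReal]
  ext p
  constructor
  · rintro ⟨h1, h2⟩
    refine ⟨p 2 - r, by simpa using h2, ?_⟩
    rw [linePt_pt3, h0]
    apply point_ext
    · simpa using h1.symm
    · simp
  · rintro ⟨t, ht, rfl⟩
    rw [linePt_pt3, h0]
    exact ⟨by simp, by simpa using ht⟩

lemma graphOver_proj_image (c : Set (Fin 2 → ℝ)) : proj '' graphOver H c = c := by
  ext x
  constructor
  · rintro ⟨p, hp, rfl⟩; exact hp.1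
  · intro hx; exact ⟨pt3 x (H x), ⟨by simpa using hx, by simp⟩, by simp⟩

lemma graphOver_injective : Function.Injective (graphOver H) := by
  intro c c' h
  rw [← graphOver_proj_image (H := H) c, h, graphOver_proj_image]

lemma mem_graphOver_of_proj {c : Set (Fin 2 → ℝ)} {v : Fin 3 → ℝ} (hv : v ∈ graphOver H c) :
    v = pt3 (proj v) (H (proj v)) := by
  rw [← hv.2, pt3_proj]

lemma graphOver_extreme_iff (hC : GermCurve C M V D) (hH : HasSlopes C D H S)
    (hS : IsHarmonic C M D S) {c : Set (Fin 2 → ℝ)} (hc : c ∈ C.edges) {v : Fin 3 → ℝ}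
    (hv : v ∈ graphOver H c) : v ∈ (graphOver H c).extremePoints ℝ ↔ proj v ∈ V := by
  obtain ⟨d, hd, I, hI, t, ht, ht0⟩ := hC.exists_dir_edgeAt hc hv.1
  have h1 := (graphOver_edgeAt hC hH hS hc hd hI ht ht0).base_mem_extremePoints_iff
  rw [← mem_graphOver_of_proj hv] at h1
  rw [h1, hC.vertex_iff c hc _ hv.1, hI.base_mem_extremePoints_iff]

lemma graphCurve_rational (hC : GermCurve C M V D) (hH : HasSlopes C D H S)
    (hS : IsHarmonic C M D S) : ∀ e ∈ (graphCurve C M H).edges, IsRationalEdge e := by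
  intro e he
  rcases mem_edges_graphCurve.1 he with ⟨c, hc, rfl⟩ | ⟨x, hx, rfl⟩
  · obtain ⟨x, hx⟩ := (hC.rational c hc).nonempty
    obtain ⟨d, hd, I, hI, t, ht, ht0⟩ := hC.exists_dir_edgeAt hc hx
    exact (graphOver_edgeAt hC hH hS hc hd hI ht ht0).isRationalEdge
  · exact (vray_edgeAt x _).isRationalEdge

lemma vray_ne_graphOver (hC : GermCurve C M V D) {c : Set (Fin 2 → ℝ)} (hc : c ∈ C.edges)
    (x : Fin 2 → ℝ) (r : ℝ) : vray x r ≠ graphOver H c := by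
  intro h
  have h1 := congrArg (fun s => proj '' s) h
  simp only [proj_image_vray, graphOver_proj_image] at h1
  obtain ⟨y, hy⟩ := (hC.rational c hc).nonempty
  obtain ⟨u, I, hI⟩ := (hC.rational c hc).edgeAt hy
  obtain ⟨t, ht, ht0⟩ := hI.exists_ne_zero
  have h2 := (hI.mem_iff t).2 ht
  rw [← h1] at h2 hy
  exact ht0 ((linePt_eq_self_iff _ hI.primitive.ne_zero).1 (h2.trans hy.symm))

lemma IsRationalEdge.infinite {N : ℕ} {e : Set (Fin N → ℝ)} (h : IsRationalEdge e) :
    e.Infinite := by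
  obtain ⟨p, u, I, hu, hI, hc, ⟨a, ha, b, hb, hab⟩, rfl⟩ := h
  have h1 : (Set.uIcc a b).Infinite := by
    exact Set.Icc_infinite (inf_lt_sup.2 hab)
  exact (h1.mono (hc.uIcc_subset ha hb)).image (linePt_injective p hu.ne_zero).injOn

lemma isInfiniteVertical_vray (x : Fin 2 → ℝ) (r : ℝ) : IsInfiniteVertical (vray x r) := by
  refine ⟨⟨x, proj_image_vray x r⟩, ?_⟩
  intro hb
  obtain ⟨K, hK⟩ := isBounded_iff_forall_norm_le.1 hb
  have h1 := hK (pt3 x (min r (-K - 1))) ⟨by simp, by simp⟩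
  have h2 := (norm_le_pi_norm (pt3 x (min r (-K - 1))) 2).trans h1
  rw [pt3_two, Real.norm_eq_abs] at h2
  linarith [neg_abs_le (min r (-K - 1)), min_le_right r (-K - 1)]

lemma graphCurve_balanced (hC : GermCurve C M V D) (hH : HasSlopes C D H S)
    (hS : IsHarmonic C M D S) {e : Set (Fin 3 → ℝ)} (he : e ∈ (graphCurve C M H).edges)
    {v : Fin 3 → ℝ} (hv : v ∈ e.extremePoints ℝ) : ∃ u : Set (Fin 3 → ℝ) → (Fin 3 → ℤ),
      (∀ e' ∈ (graphCurve C M H).edges, v ∈ e' → IsOutgoing v e' (u e')) ∧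
      ∑ᶠ e' ∈ {e' | e' ∈ (graphCurve C M H).edges ∧ v ∈ e'}, graphCurve C M H e' • u e' = 0 := by
  classical
  obtain ⟨hxV, hvx⟩ : proj v ∈ V ∧ v = pt3 (proj v) (H (proj v)) := by
    rcases mem_edges_graphCurve.1 he with ⟨c, hc, rfl⟩ | ⟨x, hx, rfl⟩
    · exact ⟨(graphOver_extreme_iff hC hH hS hc hv.1).1 hv, mem_graphOver_of_proj hv.1⟩
    · have := vray_extreme_eq hv
      have hpx : proj v = x := by rw [this]; simp
      rw [hpx]
      exact ⟨hC.marked_subset hx, this⟩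
  set x := proj v with hx
  have hxC := hC.vertices_subset hxV
  -- the edge of the planar curve in each direction
  have hex : ∀ d, ∃ c, d ∈ D x → c ∈ C.edges ∧ x ∈ c ∧ ∃ I, EdgeAt c x d I ∧ ∃ t ∈ I, 0 < t := by
    intro d
    by_cases hd : d ∈ D x
    · obtain ⟨c, hc, hxc, t, ht, htm⟩ := hC.edge_of_germ x hxC d hd
      obtain ⟨I, hI⟩ := hC.edgeAt_of_germ hc hxc (hC.dirs_primitive x hxC d hd) ht.ne' htm
      exact ⟨c, fun _ => ⟨hc, hxc, I, hI, t, (hI.mem_iff t).1 htm, ht⟩⟩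
    · exact ⟨∅, fun h => absurd h hd⟩
  choose c hc using hex
  have hinj : ∀ d ∈ D x, ∀ d' ∈ D x, c d = c d' → d = d' := by
    intro d hd d' hd' h
    obtain ⟨hcd, hxc, I, hI, t, ht, ht0⟩ := hc d hd
    obtain ⟨-, -, I', hI', t', ht', ht0'⟩ := hc d' hd'
    rw [← h] at hI'
    obtain ⟨s, hs, hst⟩ := hI.eq.subset ((hI'.mem_iff t').2 ht')
    have h1 : s • toReal d = t' • toReal d' := add_left_cancel hst
    rw [hC.vertex_iff _ hcd x hxc, hI.base_mem_extremePoints_iff] at hxV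
    rcases lt_trichotomy s 0 with h0 | rfl | h0
    · exact absurd ⟨s, hs, t, ht, h0, ht0⟩ hxV
    · rw [zero_smul] at h1
      rcases smul_eq_zero.1 h1.symm with h | h
      · exact absurd h ht0'.ne'
      · exact absurd h (toReal_ne_zero hI'.primitive.ne_zero)
    · refine hI.primitive.eq_of_pos hI'.primitive (r := s⁻¹ * t') (by positivity) ?_
      rw [mul_smul, ← h1, smul_smul, inv_mul_cancel₀ h0.ne', one_smul]
  have hsurj : ∀ c' ∈ C.edges, x ∈ c' → ∃ d ∈ D x, c' = c d := by
    intro c' hc' hxc'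
    obtain ⟨d, hd, I, hI, t, ht, ht0⟩ := hC.exists_dir_edgeAt hc' hxc'
    refine ⟨d, hd, ?_⟩
    obtain ⟨hcd, hxc, I', hI', t', ht', ht0'⟩ := hc d hd
    -- the two edges share an inner point
    have hm : 0 < min t t' / 2 := by positivity
    have h1 : min t t' / 2 < t := by linarith [min_le_left t t']
    have h2 : min t t' / 2 < t' := by linarith [min_le_right t t']
    have h3 := hI.ordConnected.out hI.zero_mem ht ⟨hm.le, h1.le⟩
    have h4 := hI'.ordConnected.out hI'.zero_mem ht' ⟨hm.le, h2.le⟩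
    refine hC.unique c' hc' _ hcd _ ((hI.mem_iff _).2 h3) ((hI'.mem_iff _).2 h4) ?_
    rw [hC.vertex_iff _ hc' _ ((hI.mem_iff _).2 h3), hI.mem_extremePoints_iff h3, not_not]
    exact ⟨0, hI.zero_mem, t, ht, hm, h1⟩
  let E : (Fin 2 → ℤ) → Set (Fin 3 → ℝ) := fun d => graphOver H (c d)
  have hEinj : Set.InjOn E (D x : Set (Fin 2 → ℤ)) := fun d hd d' hd' h =>
    hinj d hd d' hd' (graphOver_injective h)
  let u : Set (Fin 3 → ℝ) → Fin 3 → ℤ := fun e' =>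
    if h : ∃ d ∈ D x, e' = E d then vec3 h.choose (S x h.choose) else -vec3 0 1
  have hu : ∀ d ∈ D x, u (E d) = vec3 d (S x d) := by
    intro d hd
    have h : ∃ d' ∈ D x, E d = E d' := ⟨d, hd, rfl⟩
    have h1 : h.choose = d := hEinj h.choose_spec.1 hd h.choose_spec.2.symm
    simp only [u]
    rw [dif_pos h, h1]
  have hur : u (vray x (H x)) = -vec3 0 1 := by
    simp only [u]
    rw [dif_neg]
    rintro ⟨d, hd, h⟩
    exact vray_ne_graphOver hC (hc d hd).1 _ _ h
  clear_value u
  have hset : {e' | e' ∈ (graphCurve C M H).edges ∧ v ∈ e'} =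
      (((D x).image E ∪ if x ∈ M then {vray x (H x)} else ∅ : Finset _) : Set _) := by
    ext e'
    rw [Finset.mem_coe, Finset.mem_union, Finset.mem_image]
    constructor
    · rintro ⟨he', hve'⟩
      rcases mem_edges_graphCurve.1 he' with ⟨c', hc', rfl⟩ | ⟨y, hy, rfl⟩
      · obtain ⟨d, hd, rfl⟩ := hsurj c' hc' hve'.1
        exact Or.inl ⟨d, hd, rfl⟩
      · obtain rfl : x = y := hve'.1
        right; rw [if_pos hy]; simp
    · rintro (⟨d, hd, rfl⟩ | h)
      · refine ⟨mem_edges_graphCurve.2 (Or.inl ⟨_, (hc d hd).1, rfl⟩), (hc d hd).2.1, ?_⟩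
        rw [hvx]; simp
      · split_ifs at h with hM
        · rw [Finset.mem_singleton] at h
          subst h
          refine ⟨mem_edges_graphCurve.2 (Or.inr ⟨x, hM, rfl⟩), rfl, ?_⟩
          rw [hvx]; simp
        · simp at h
  refine ⟨u, ?_, ?_⟩
  · intro e' he' hve'
    have hmem : e' ∈ {e' | e' ∈ (graphCurve C M H).edges ∧ v ∈ e'} := ⟨he', hve'⟩
    rw [hset, Finset.mem_coe, Finset.mem_union, Finset.mem_image] at hmem
    rcases hmem with ⟨d, hd, rfl⟩ | h
    · rw [hu d hd, hvx]
      obtain ⟨hcd, hxc, I, hI, t, ht, ht0⟩ := hc d hd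
      have hg := graphOver_edgeAt hC hH hS hcd hd hI ht ht0
      exact ⟨hg.primitive, t, ht0, (hg.mem_iff t).2 ht⟩
    · split_ifs at h with hM
      · rw [Finset.mem_singleton] at h
        subst h
        rw [hur, hvx]
        refine ⟨isPrimitiveVec_vertical.neg, 1, one_pos, ?_⟩
        change linePt (pt3 x (H x)) (-vec3 0 1) 1 ∈ _
        rw [linePt_neg]
        exact ((vray_edgeAt x (H x)).mem_iff (-1)).2 (by simp)
      · simp at h
  · rw [hset, finsum_mem_coe_finset]
    have hw : ∀ e' ∈ ((D x).image E ∪ if x ∈ M then {vray x (H x)} else ∅ : Finset _),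
        graphCurve C M H e' • u e' = u e' := by
      intro e' he'
      have : e' ∈ {e' | e' ∈ (graphCurve C M H).edges ∧ v ∈ e'} := by rw [hset]; exact he'
      rw [graphCurve_of_mem this.1, one_smul]
    rw [Finset.sum_congr rfl hw, Finset.sum_union, Finset.sum_image hEinj, Finset.sum_congr rfl hu]
    · have hsumd := hC.dirs_sum x hxC
      have h1 : ∑ d ∈ D x, vec3 d (S x d) = vec3 0 (∑ d ∈ D x, S x d) := by
        apply vector_ext
        · rw [hpart_sum]; simpa using hsumd
        · simp [Finset.sum_apply]
      rw [h1]
      split_ifs with hM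
      · rw [Finset.sum_singleton, hur, hS.2 x hM, add_neg_cancel]
      · rw [Finset.sum_empty, hS.1 x hxC hM, add_zero]
        funext i; fin_cases i <;> simp [vec3]
    · rw [Finset.disjoint_left]
      intro e' he' h
      obtain ⟨d, hd, rfl⟩ := Finset.mem_image.1 he'
      split_ifs at h
      · exact vray_ne_graphOver hC (hc d hd).1 _ _ (Finset.mem_singleton.1 h).symm
      · simp at h

lemma graphCurve_isTropicalCurve (hC : GermCurve C M V D) (hH : HasSlopes C D H S)
    (hS : IsHarmonic C M D S) : IsTropicalCurve (graphCurve C M H) where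
  finite := by
    have : (graphCurve C M H).edges ⊆ graphOver H '' C.edges ∪ (fun x => vray x (H x)) '' M := by
      intro e he
      rcases mem_edges_graphCurve.1 he with ⟨c, hc, rfl⟩ | ⟨x, hx, rfl⟩
      · exact Or.inl ⟨c, hc, rfl⟩
      · exact Or.inr ⟨x, hx, rfl⟩
    exact ((hC.finite.image _).union ((hC.finite_vertices.subset hC.marked_subset).image _)).subset
      this
  rational := graphCurve_rational hC hH hS
  complex := by
    intro e he e' he' hne v hv
    have hgr : ∀ c ∈ C.edges, ∀ x ∈ M, v ∈ graphOver H c → v ∈ vray x (H x) →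
        v ∈ (graphOver H c).extremePoints ℝ ∧ v ∈ (vray x (H x)).extremePoints ℝ := by
      intro c hc x hx hvc hvr
      have hpx : proj v = x := hvr.1
      have := mem_graphOver_of_proj hvc
      rw [hpx] at this
      refine ⟨(graphOver_extreme_iff hC hH hS hc hvc).2 (hpx ▸ hC.marked_subset hx), ?_⟩
      rw [this]; exact vray_top_extreme _ _
    rcases mem_edges_graphCurve.1 he with ⟨c, hc, rfl⟩ | ⟨x, hx, rfl⟩ <;>
    rcases mem_edges_graphCurve.1 he' with ⟨c', hc', rfl⟩ | ⟨x', hx', rfl⟩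
    · have hV : proj v ∈ V := by
        by_contra hV
        exact hne (by rw [hC.unique c hc c' hc' _ hv.1.1 hv.2.1 hV])
      exact ⟨(graphOver_extreme_iff hC hH hS hc hv.1).2 hV,
        (graphOver_extreme_iff hC hH hS hc' hv.2).2 hV⟩
    · exact hgr c hc x' hx' hv.1 hv.2
    · exact (hgr c' hc' x hx hv.2 hv.1).symm
    · have : x = x' := hv.1.1.symm.trans hv.2.1
      subst this
      exact absurd rfl hne
  balanced := fun _ he _ hv => graphCurve_balanced hC hH hS he hv

/-- The graph of a harmonic function, completed by rays below the marked points, is a lift. -/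
theorem graphCurve_isLift (hC : GermCurve C M V D) (hH : HasSlopes C D H S)
    (hS : IsHarmonic C M D S) : IsLift C M (graphCurve C M H) where
  curve := graphCurve_isTropicalCurve hC hH hS
  projection := by
    ext x
    constructor
    · rintro ⟨p, hp, rfl⟩
      rcases mem_carrier_graphCurve.1 hp with h | h
      · exact h.1
      · exact hC.vertices_subset (hC.marked_subset h.1)
    · intro hx
      exact ⟨pt3 x (H x), mem_carrier_graphCurve.2 (Or.inl (by simpa using hx)), by simp⟩
  downward := by
    rintro e he ⟨⟨y, hy⟩, -⟩
    rcases mem_edges_graphCurve.1 he with ⟨c, hc, rfl⟩ | ⟨x, hx, rfl⟩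
    · rw [graphOver_proj_image] at hy
      exact absurd (hy ▸ Set.finite_singleton y) (hC.rational c hc).infinite
    · exact ⟨x, H x, rfl⟩
  vertical_iff := by
    intro e he
    rcases mem_edges_graphCurve.1 he with ⟨c, hc, rfl⟩ | ⟨x, hx, rfl⟩
    · rw [graphOver_proj_image]
      constructor
      · rintro ⟨⟨y, hy⟩, -⟩
        rw [graphOver_proj_image] at hy
        exact absurd (hy ▸ Set.finite_singleton y) (hC.rational c hc).infinite
      · intro h
        exact absurd ((hC.finite_vertices.subset hC.marked_subset).subset h)
          (hC.rational c hc).infinite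
    · rw [proj_image_vray]
      exact ⟨fun _ => Set.singleton_subset_iff.2 hx, fun _ => isInfiniteVertical_vray x _⟩
  marked := fun x hx => ⟨vray x (H x), mem_edges_graphCurve.2 (Or.inr ⟨x, hx, rfl⟩),
    isInfiniteVertical_vray x _, proj_image_vray x _⟩
  weight := by
    intro c hc x hx _
    have hxc : x ∈ c := intrinsicInterior_subset hx
    obtain ⟨d, hd, I, hI, t, ht, ht0⟩ := hC.exists_dir_edgeAt hc hxc
    have hxV : x ∉ V := by
      rw [hC.vertex_iff c hc x hxc, hI.base_mem_extremePoints_iff, not_not]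
      apply isInner_of_mem_intrinsicInterior_linePt_image x hI.primitive.ne_zero hI.nontrivial
      rwa [linePt_zero, ← hI.eq]
    have hgmem : graphOver H c ∈ (graphCurve C M H).edges :=
      mem_edges_graphCurve.2 (Or.inl ⟨c, hc, rfl⟩)
    have hset : {f | f ∈ (graphCurve C M H).edges ∧ x ∈ proj '' f} = {graphOver H c} := by
      ext f
      rw [Set.mem_singleton_iff]
      constructor
      · rintro ⟨hf, hxf⟩
        rcases mem_edges_graphCurve.1 hf with ⟨c', hc', rfl⟩ | ⟨y, hy, rfl⟩
        · rw [graphOver_proj_image] at hxf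
          rw [hC.unique c' hc' c hc x hxf hxc hxV]
        · rw [proj_image_vray] at hxf
          obtain rfl : x = y := hxf
          exact absurd (hC.marked_subset hy) hxV
      · rintro rfl
        exact ⟨hgmem, by rwa [graphOver_proj_image]⟩
    have hg := graphOver_edgeAt hC hH hS hc hd hI ht ht0
    rw [hset, finsum_mem_singleton, hC.weight_one c hc, graphCurve_of_mem hgmem, one_mul, hg.eq,
      edgeLattice_linePt _ hg.primitive hg.nontrivial]
    conv_rhs => rw [hI.eq]
    rw [horizontalCopy_linePt, edgeLattice_linePt _ (isPrimitiveVec_vec3 hI.primitive 0)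
      hI.nontrivial, relIndex_latticeWith_eq_one (hpart_vec3 _ _)]

end LiftConstruction


/-! ### Cells of tropical hypersurfaces -/

namespace TropPoly

variable {N : ℕ} (P : TropPoly N)

/-- The value of a tropical polynomial. -/
noncomputable def val (x : Fin N → ℝ) : ℝ := P.support.sup' P.nonempty fun m => P.term m x

lemma term_le_val {m : Fin N → ℤ} (hm : m ∈ P.support) (x : Fin N → ℝ) :
    P.term m x ≤ P.val x := Finset.le_sup' (fun m => P.term m x) hm

lemma mem_maxTerms_iff {m : Fin N → ℤ} {x : Fin N → ℝ} :
    m ∈ P.maxTerms x ↔ m ∈ P.support ∧ P.term m x = P.val x := by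
  constructor
  · rintro ⟨hm, h⟩
    exact ⟨hm, le_antisymm (P.term_le_val hm x) (Finset.sup'_le _ _ h)⟩
  · rintro ⟨hm, h⟩
    exact ⟨hm, fun m' hm' => h ▸ P.term_le_val hm' x⟩

lemma maxTerms_nonempty (x : Fin N → ℝ) : (P.maxTerms x).Nonempty := by
  obtain ⟨m, hm, h⟩ := P.support.exists_mem_eq_sup' P.nonempty fun m => P.term m x
  exact ⟨m, P.mem_maxTerms_iff.2 ⟨hm, h.symm⟩⟩

lemma maxTerms_finite (x : Fin N → ℝ) : (P.maxTerms x).Finite :=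
  P.support.finite_toSet.subset fun _ hm => hm.1

lemma val_eq_of_mem {m : Fin N → ℤ} {x : Fin N → ℝ} (hm : m ∈ P.maxTerms x) :
    P.val x = P.term m x := (P.mem_maxTerms_iff.1 hm).2.symm

lemma term_combo (m : Fin N → ℤ) (x y : Fin N → ℝ) {a b : ℝ} (hab : a + b = 1) :
    P.term m (a • x + b • y) = a * P.term m x + b * P.term m y := by
  unfold term
  have : ∑ i, (m i : ℝ) * (a • x + b • y) i =
      a * ∑ i, (m i : ℝ) * x i + b * ∑ i, (m i : ℝ) * y i := by
    rw [Finset.mul_sum, Finset.mul_sum, ← Finset.sum_add_distrib]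
    refine Finset.sum_congr rfl fun i _ => ?_
    simp only [Pi.add_apply, Pi.smul_apply, smul_eq_mul]; ring
  rw [this]
  linear_combination (-P.coeff m) * hab

lemma term_add (m : Fin N → ℤ) (x w : Fin N → ℝ) :
    P.term m (x + w) = P.term m x + ∑ i, (m i : ℝ) * w i := by
  unfold term
  simp only [Pi.add_apply, mul_add, Finset.sum_add_distrib]; ring

lemma continuous_term (m : Fin N → ℤ) : Continuous (P.term m) := by
  unfold term; fun_prop

lemma maxTerms_midpoint {x y : Fin N → ℝ} (h : (P.maxTerms x ∩ P.maxTerms y).Nonempty) :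
    P.maxTerms ((1 / 2 : ℝ) • x + (1 / 2 : ℝ) • y) = P.maxTerms x ∩ P.maxTerms y := by
  obtain ⟨m₀, h₁, h₂⟩ := h
  have hab : (1 / 2 : ℝ) + 1 / 2 = 1 := by norm_num
  have hval : P.val ((1 / 2 : ℝ) • x + (1 / 2 : ℝ) • y) = 1 / 2 * P.val x + 1 / 2 * P.val y := by
    apply le_antisymm
    · refine Finset.sup'_le _ _ fun m hm => ?_
      rw [P.term_combo m x y hab]
      linarith [P.term_le_val hm x, P.term_le_val hm y]
    · rw [P.val_eq_of_mem h₁, P.val_eq_of_mem h₂, ← P.term_combo m₀ x y hab]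
      exact P.term_le_val h₁.1 _
  ext m
  rw [Set.mem_inter_iff, mem_maxTerms_iff, mem_maxTerms_iff, mem_maxTerms_iff, hval,
    P.term_combo m x y hab]
  constructor
  · rintro ⟨hm, h⟩
    exact ⟨⟨hm, by linarith [P.term_le_val hm x, P.term_le_val hm y]⟩, hm,
      by linarith [P.term_le_val hm x, P.term_le_val hm y]⟩
  · rintro ⟨⟨hm, h3⟩, -, h4⟩
    exact ⟨hm, by rw [h3, h4]⟩

lemma mem_cellAt_self (x : Fin N → ℝ) : x ∈ P.cellAt x := subset_rfl (a := P.maxTerms x)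

/-- The linear functional given by an integer vector. -/
def functional (a : Fin N → ℤ) : (Fin N → ℝ) →ₗ[ℝ] ℝ where
  toFun w := ∑ i, (a i : ℝ) * w i
  map_add' v w := by simp only [Pi.add_apply, mul_add, Finset.sum_add_distrib]
  map_smul' r w := by
    simp only [Pi.smul_apply, smul_eq_mul, RingHom.id_apply, Finset.mul_sum]
    exact Finset.sum_congr rfl fun i _ => by ring

lemma functional_apply (a : Fin N → ℤ) (w : Fin N → ℝ) :
    functional a w = ∑ i, (a i : ℝ) * w i := rfl

lemma functional_single (a : Fin N → ℤ) (i : Fin N) : functional a (Pi.single i 1) = a i := by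
  classical
  rw [functional_apply]
  simp [Pi.single_apply]

lemma functional_sub (a b : Fin N → ℤ) (w : Fin N → ℝ) :
    functional (a - b) w = functional a w - functional b w := by
  simp only [functional_apply, Pi.sub_apply, Int.cast_sub, sub_mul, Finset.sum_sub_distrib]

section TwoTerms

variable {P} {r : Fin N → ℝ} {a b : Fin N → ℤ}

/-- Near a point where exactly two terms are maximal, the cell is given by their equality. -/
lemma exists_nhds_of_two (h : P.maxTerms r = {a, b}) : ∃ U : Set (Fin N → ℝ), IsOpen U ∧ r ∈ U ∧
    ∀ y ∈ U, P.term a y = P.term b y → y ∈ P.cellAt r := by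
  classical
  have ha : a ∈ P.maxTerms r := by rw [h]; simp
  have hb : b ∈ P.maxTerms r := by rw [h]; simp
  refine ⟨⋂ m ∈ P.support \ {a, b}, {y | P.term m y < P.term a y}, ?_, ?_, ?_⟩
  · exact isOpen_biInter_finset fun m _ => isOpen_lt (P.continuous_term m) (P.continuous_term a)
  · rw [Set.mem_iInter₂]
    intro m hm
    obtain ⟨hm1, hm2⟩ := Finset.mem_sdiff.1 hm
    refine lt_of_le_of_ne (ha.2 m hm1) fun heq => hm2 ?_
    have : m ∈ P.maxTerms r := ⟨hm1, fun m' hm' => heq ▸ ha.2 m' hm'⟩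
    rw [h] at this
    simpa using this
  · intro y hy hab
    rw [Set.mem_iInter₂] at hy
    have hmax : ∀ m ∈ P.support, P.term m y ≤ P.term a y := by
      intro m hm
      by_cases hm' : m ∈ ({a, b} : Finset (Fin N → ℤ))
      · rcases Finset.mem_insert.1 hm' with rfl | hm'
        · exact le_rfl
        · rw [Finset.mem_singleton.1 hm', hab]
      · have hlt : P.term m y < P.term a y := hy m (Finset.mem_sdiff.2 ⟨hm, hm'⟩)
        exact hlt.le
    change P.maxTerms r ⊆ P.maxTerms y
    rw [h]
    rintro m (rfl | rfl)
    · exact ⟨ha.1, hmax⟩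
    · exact ⟨hb.1, fun m hm => hab ▸ hmax m hm⟩

lemma term_eq_of_mem_cellAt (h : P.maxTerms r = {a, b}) {y : Fin N → ℝ} (hy : y ∈ P.cellAt r) :
    P.term a y = P.term b y := by
  have ha : a ∈ P.maxTerms y := hy (by rw [h]; simp)
  have hb : b ∈ P.maxTerms y := hy (by rw [h]; simp)
  rw [← P.val_eq_of_mem ha, ← P.val_eq_of_mem hb]

lemma vectorSpan_cellAt_of_two (h : P.maxTerms r = {a, b}) :
    vectorSpan ℝ (P.cellAt r) = LinearMap.ker (functional (a - b)) := by
  have hr := term_eq_of_mem_cellAt h (P.mem_cellAt_self r)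
  apply le_antisymm
  · rw [vectorSpan_def, Submodule.span_le]
    rintro _ ⟨y, hy, y', hy', rfl⟩
    have h1 := term_eq_of_mem_cellAt h hy
    have h2 := term_eq_of_mem_cellAt h hy'
    rw [SetLike.mem_coe, LinearMap.mem_ker, functional_sub]
    have h3 := P.term_add a y' (y - y')
    have h4 := P.term_add b y' (y - y')
    rw [add_sub_cancel] at h3 h4
    simp only [functional_apply, vsub_eq_sub]
    linarith
  · intro w hw
    rw [LinearMap.mem_ker, functional_sub, functional_apply, functional_apply] at hw
    obtain ⟨U, hU, hrU, hUc⟩ := exists_nhds_of_two h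
    have hcont : Continuous fun t : ℝ => r + t • w := by fun_prop
    have hev : ∀ᶠ t in nhdsWithin (0 : ℝ) (Set.Ioi 0), r + t • w ∈ U :=
      hcont.continuousWithinAt.eventually_mem (hU.mem_nhds (by simpa using hrU))
    obtain ⟨t, htU, ht⟩ := (hev.and (self_mem_nhdsWithin)).exists
    have ht : 0 < t := ht
    have hmem : r + t • w ∈ P.cellAt r := by
      refine hUc _ htU ?_
      rw [term_add, term_add, hr]
      have : ∀ m : Fin N → ℤ, ∑ i, (m i : ℝ) * (t • w) i = t * ∑ i, (m i : ℝ) * w i := by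
        intro m
        rw [Finset.mul_sum]
        exact Finset.sum_congr rfl fun i _ => by simp only [Pi.smul_apply, smul_eq_mul]; ring
      rw [this, this]
      rw [sub_eq_zero] at hw
      rw [hw]
    have h1 := vsub_mem_vectorSpan ℝ hmem (P.mem_cellAt_self r)
    rw [vsub_eq_sub, add_sub_cancel_left] at h1
    have h2 := Submodule.smul_mem _ t⁻¹ h1
    rwa [smul_smul, inv_mul_cancel₀ ht.ne', one_smul] at h2

lemma mem_intrinsicInterior_cellAt_of_two (h : P.maxTerms r = {a, b}) :
    r ∈ intrinsicInterior ℝ (P.cellAt r) := by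
  obtain ⟨U, hU, hrU, hUc⟩ := exists_nhds_of_two h
  refine mem_intrinsicInterior_of_nhds (P.mem_cellAt_self r) hU hrU fun y hyU hy => hUc y hyU ?_
  have h1 : y -ᵥ r ∈ vectorSpan ℝ (P.cellAt r) := by
    rw [← direction_affineSpan]
    exact AffineSubspace.vsub_mem_direction hy (subset_affineSpan ℝ _ (P.mem_cellAt_self r))
  rw [vectorSpan_cellAt_of_two h, LinearMap.mem_ker, functional_sub, functional_apply,
    functional_apply, vsub_eq_sub] at h1
  have hr := term_eq_of_mem_cellAt h (P.mem_cellAt_self r)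
  have h3 := P.term_add a r (y - r)
  have h4 := P.term_add b r (y - r)
  rw [add_sub_cancel] at h3 h4
  linarith

lemma functional_ne_zero {c : Fin N → ℤ} (hc : c ≠ 0) : functional c ≠ 0 := by
  intro h
  apply hc
  funext i
  have := LinearMap.congr_fun h (Pi.single i 1)
  rw [functional_single, LinearMap.zero_apply] at this
  exact_mod_cast this

lemma cellAt_mem_facets_of_two (h : P.maxTerms r = {a, b}) (hab : a ≠ b) :
    P.cellAt r ∈ P.facets := by
  refine ⟨⟨r, ?_, rfl⟩, ?_⟩
  · change (P.maxTerms r).Nontrivial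
    rw [h]; exact Set.nontrivial_pair hab
  · unfold setDim
    rw [vectorSpan_cellAt_of_two h]
    have h1 := Module.Dual.finrank_ker_add_one_of_ne_zero
      (functional_ne_zero (sub_ne_zero.2 hab))
    rw [h1]
    simp

/-- Two facets with independent conormal vectors span the whole space. -/
lemma ker_sup_ker_eq_top {c c' : Fin N → ℤ}
    (h : ∃ w, functional c w = 0 ∧ functional c' w ≠ 0) :
    LinearMap.ker (functional c) ⊔ LinearMap.ker (functional c') = ⊤ := by
  obtain ⟨w, hw, hw'⟩ := h
  rw [eq_top_iff]
  intro y _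
  have : y = (functional c' y / functional c' w) • w +
      (y - (functional c' y / functional c' w) • w) := by abel
  rw [this]
  refine Submodule.add_mem_sup (Submodule.smul_mem _ _ hw) ?_
  rw [LinearMap.mem_ker, map_sub, map_smul, smul_eq_mul, div_mul_cancel₀ _ hw', sub_self]

end TwoTerms

lemma mem_hypersurface_of_mem_cellAt {x y : Fin N → ℝ} (hx : x ∈ P.hypersurface)
    (hy : y ∈ P.cellAt x) : y ∈ P.hypersurface := Set.Nontrivial.mono hx (show P.maxTerms x ⊆ P.maxTerms y from hy)

end TropPoly

/-- A common cell is the intersection of the cells through a suitable one of its points. -/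
lemma exists_point_of_commonCells {N : ℕ} {P Q : TropPoly N} {c : Set (Fin N → ℝ)}
    (hc : c ∈ commonCells P Q) : ∃ r, r ∈ P.hypersurface ∧ r ∈ Q.hypersurface ∧
      c = P.cellAt r ∩ Q.cellAt r := by
  obtain ⟨hne, _, ⟨x, hx, rfl⟩, _, ⟨x', hx', rfl⟩, rfl⟩ := hc
  -- a point with as few maximal terms as possible
  obtain ⟨r, ⟨hr1, hr2⟩, hmin⟩ := (measure fun y : Fin N → ℝ =>
    (P.maxTerms y).ncard + (Q.maxTerms y).ncard).wf.has_min _ hne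
  refine ⟨r, P.mem_hypersurface_of_mem_cellAt hx hr1, Q.mem_hypersurface_of_mem_cellAt hx' hr2, ?_⟩
  apply Set.Subset.antisymm
  · rintro y ⟨hy1, hy2⟩
    have hP : P.maxTerms x ⊆ P.maxTerms r ∩ P.maxTerms y := Set.subset_inter hr1 hy1
    have hQ : Q.maxTerms x' ⊆ Q.maxTerms r ∩ Q.maxTerms y := Set.subset_inter hr2 hy2
    have hPm := P.maxTerms_midpoint ((P.maxTerms_nonempty x).mono hP)
    have hQm := Q.maxTerms_midpoint ((Q.maxTerms_nonempty x').mono hQ)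
    have h1 := hmin ((1 / 2 : ℝ) • r + (1 / 2 : ℝ) • y)
      ⟨by change P.maxTerms x ⊆ _; rw [hPm]; exact hP,
        by change Q.maxTerms x' ⊆ _; rw [hQm]; exact hQ⟩
    have h2 : ¬ ((P.maxTerms r ∩ P.maxTerms y).ncard + (Q.maxTerms r ∩ Q.maxTerms y).ncard <
        (P.maxTerms r).ncard + (Q.maxTerms r).ncard) := by
      rw [← hPm, ← hQm]; exact h1
    have h3 := Set.ncard_le_ncard (Set.inter_subset_left (s := P.maxTerms r) (t := P.maxTerms y))
      (P.maxTerms_finite r)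
    have h4 := Set.ncard_le_ncard (Set.inter_subset_left (s := Q.maxTerms r) (t := Q.maxTerms y))
      (Q.maxTerms_finite r)
    constructor
    · have := Set.eq_of_subset_of_ncard_le (Set.inter_subset_left (s := P.maxTerms r)
        (t := P.maxTerms y)) (by omega) (P.maxTerms_finite r)
      exact Set.inter_eq_left.1 this
    · have := Set.eq_of_subset_of_ncard_le (Set.inter_subset_left (s := Q.maxTerms r)
        (t := Q.maxTerms y)) (by omega) (Q.maxTerms_finite r)
      exact Set.inter_eq_left.1 this
  · rintro y ⟨hy1, hy2⟩
    exact ⟨Set.Subset.trans hr1 hy1, Set.Subset.trans hr2 hy2⟩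

/-! ### Tropical modifications of the plane -/

namespace TropPoly

lemma snoc_eq_vec3 (m : Fin 2 → ℤ) (j : ℤ) :
    (Fin.snoc (α := fun _ => ℤ) m j : Fin 3 → ℤ) = vec3 m j := by
  funext i; fin_cases i
  · rfl
  · rfl
  · rfl

variable (f g : TropPoly 2)

lemma mem_modification_support {m : Fin 3 → ℤ} : m ∈ (modification f g).support ↔
    (∃ m' ∈ f.support, m = vec3 m' 0) ∨ ∃ m' ∈ g.support, m = vec3 m' 1 := by
  unfold modification
  simp only [Finset.mem_union, Finset.mem_image, snoc_eq_vec3, eq_comm]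

lemma modification_term_zero (m : Fin 2 → ℤ) (p : Fin 3 → ℝ) :
    (modification f g).term (vec3 m 0) p = f.term m (proj p) := by
  have h1 : (fun i : Fin 2 => vec3 m 0 i.castSucc) = m := by
    funext i; fin_cases i <;> rfl
  simp only [term, modification]
  rw [if_pos (by rfl), h1, Fin.sum_univ_three, Fin.sum_univ_two]
  simp [vec3, proj]

lemma modification_term_one (m : Fin 2 → ℤ) (p : Fin 3 → ℝ) :
    (modification f g).term (vec3 m 1) p = g.term m (proj p) + p 2 := by
  have h1 : (fun i : Fin 2 => vec3 m 1 i.castSucc) = m := by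
    funext i; fin_cases i <;> rfl
  have h2 : vec3 m 1 (Fin.last 2) ≠ 0 := by
    change (1 : ℤ) ≠ 0; norm_num
  simp only [term, modification]
  rw [if_neg h2, h1, Fin.sum_univ_three, Fin.sum_univ_two]
  simp [vec3, proj]; ring

lemma mem_modification_maxTerms {m : Fin 3 → ℤ} {p : Fin 3 → ℝ} :
    m ∈ (modification f g).maxTerms p ↔
      (∃ m' ∈ f.maxTerms (proj p), m = vec3 m' 0 ∧ g.val (proj p) + p 2 ≤ f.val (proj p)) ∨
      ∃ m' ∈ g.maxTerms (proj p), m = vec3 m' 1 ∧ f.val (proj p) ≤ g.val (proj p) + p 2 := by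
  obtain ⟨mf, hmf⟩ := f.maxTerms_nonempty (proj p)
  obtain ⟨mg, hmg⟩ := g.maxTerms_nonempty (proj p)
  have hle : ∀ {v : ℝ}, (∀ m' ∈ (modification f g).support, (modification f g).term m' p ≤ v) ↔
      f.val (proj p) ≤ v ∧ g.val (proj p) + p 2 ≤ v := by
    intro v
    constructor
    · intro h
      rw [f.val_eq_of_mem hmf, g.val_eq_of_mem hmg, ← modification_term_zero f g,
        ← modification_term_one f g]
      exact ⟨h _ ((mem_modification_support f g).2 (Or.inl ⟨mf, hmf.1, rfl⟩)),
        h _ ((mem_modification_support f g).2 (Or.inr ⟨mg, hmg.1, rfl⟩))⟩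
    · rintro ⟨h1, h2⟩ m' hm'
      rcases (mem_modification_support f g).1 hm' with ⟨k, hk, rfl⟩ | ⟨k, hk, rfl⟩
      · rw [modification_term_zero]
        exact (f.term_le_val hk _).trans h1
      · rw [modification_term_one]
        linarith [g.term_le_val hk (proj p)]
  constructor
  · rintro ⟨hm, h⟩
    rw [hle] at h
    rcases (mem_modification_support f g).1 hm with ⟨k, hk, rfl⟩ | ⟨k, hk, rfl⟩
    · rw [modification_term_zero] at h
      have hk2 := f.term_le_val hk (proj p)
      exact Or.inl ⟨k, f.mem_maxTerms_iff.2 ⟨hk, le_antisymm hk2 h.1⟩, rfl, h.2.trans hk2⟩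
    · rw [modification_term_one] at h
      have hk2 := g.term_le_val hk (proj p)
      exact Or.inr ⟨k, g.mem_maxTerms_iff.2 ⟨hk, le_antisymm hk2 (by linarith)⟩, rfl,
        h.1.trans (by linarith)⟩
  · rintro (⟨k, hk, rfl, h⟩ | ⟨k, hk, rfl, h⟩)
    · refine ⟨(mem_modification_support f g).2 (Or.inl ⟨k, hk.1, rfl⟩), ?_⟩
      rw [hle, modification_term_zero, ← f.val_eq_of_mem hk]
      exact ⟨le_rfl, h⟩
    · refine ⟨(mem_modification_support f g).2 (Or.inr ⟨k, hk.1, rfl⟩), ?_⟩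
      rw [hle, modification_term_one, ← g.val_eq_of_mem hk]
      exact ⟨h, le_rfl⟩

lemma vec3_left_injective (j : ℤ) : Function.Injective fun m => vec3 m j := by
  intro a b h
  have := congrArg hpart h
  simpa using this

/-- A tropical modification is the graph of `f - g`, with downward walls over `V(f)` and upward
walls over `V(g)`. -/
lemma mem_modification_hypersurface {p : Fin 3 → ℝ} : p ∈ (modification f g).hypersurface ↔
    g.val (proj p) + p 2 = f.val (proj p) ∨
    (g.val (proj p) + p 2 < f.val (proj p) ∧ proj p ∈ f.hypersurface) ∨
    (f.val (proj p) < g.val (proj p) + p 2 ∧ proj p ∈ g.hypersurface) := by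
  change ((modification f g).maxTerms p).Nontrivial ↔ _
  rcases lt_trichotomy (g.val (proj p) + p 2) (f.val (proj p)) with h | h | h
  · have : (modification f g).maxTerms p = (fun m => vec3 m 0) '' f.maxTerms (proj p) := by
      ext m
      rw [mem_modification_maxTerms]
      constructor
      · rintro (⟨k, hk, rfl, -⟩ | ⟨k, hk, -, h'⟩)
        · exact ⟨k, hk, rfl⟩
        · linarith
      · rintro ⟨k, hk, rfl⟩
        exact Or.inl ⟨k, hk, rfl, h.le⟩
    rw [this, Set.image_nontrivial (vec3_left_injective 0)]
    exact ⟨fun h' => Or.inr (Or.inl ⟨h, h'⟩), fun h' => by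
      rcases h' with h' | h' | h'
      · linarith
      · exact h'.2
      · linarith [h'.1]⟩
  · refine iff_of_true ?_ (Or.inl h)
    obtain ⟨mf, hmf⟩ := f.maxTerms_nonempty (proj p)
    obtain ⟨mg, hmg⟩ := g.maxTerms_nonempty (proj p)
    refine ⟨vec3 mf 0, (mem_modification_maxTerms f g).2 (Or.inl ⟨mf, hmf, rfl, h.le⟩),
      vec3 mg 1, (mem_modification_maxTerms f g).2 (Or.inr ⟨mg, hmg, rfl, h.ge⟩), ?_⟩
    intro h'
    have := congrFun h' 2
    simp at this
  · have : (modification f g).maxTerms p = (fun m => vec3 m 1) '' g.maxTerms (proj p) := by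
      ext m
      rw [mem_modification_maxTerms]
      constructor
      · rintro (⟨k, hk, -, h'⟩ | ⟨k, hk, rfl, -⟩)
        · linarith
        · exact ⟨k, hk, rfl⟩
      · rintro ⟨k, hk, rfl⟩
        exact Or.inr ⟨k, hk, rfl, h.le⟩
    rw [this, Set.image_nontrivial (vec3_left_injective 1)]
    exact ⟨fun h' => Or.inr (Or.inr ⟨h, h'⟩), fun h' => by
      rcases h' with h' | h' | h'
      · linarith
      · linarith [h'.1]
      · exact h'.2⟩

lemma unit_val (x : Fin 2 → ℝ) : (unit 2).val x = 0 := by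
  have h : (0 : Fin 2 → ℤ) ∈ (unit 2).maxTerms x := by
    obtain ⟨m, hm⟩ := (unit 2).maxTerms_nonempty x
    have : m = 0 := Finset.mem_singleton.1 hm.1
    rwa [← this]
  rw [(unit 2).val_eq_of_mem h]
  simp [term, unit]

lemma unit_hypersurface : (unit 2).hypersurface = ∅ := by
  rw [Set.eq_empty_iff_forall_notMem]
  rintro x ⟨a, ha, b, hb, hab⟩
  exact hab ((Finset.mem_singleton.1 ha.1).trans (Finset.mem_singleton.1 hb.1).symm)

lemma scale_term (l : ℝ) (m : Fin 2 → ℤ) (x : Fin 2 → ℝ) :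
    (f.scale l).term m x = l + f.term m x := by
  simp only [term, scale]; ring

lemma scale_maxTerms (l : ℝ) (x : Fin 2 → ℝ) : (f.scale l).maxTerms x = f.maxTerms x := by
  ext m
  simp only [maxTerms, scale_term, Set.mem_ofPred_eq, add_le_add_iff_left]
  rfl

lemma scale_hypersurface (l : ℝ) : (f.scale l).hypersurface = f.hypersurface := by
  ext x
  change ((f.scale l).maxTerms x).Nontrivial ↔ (f.maxTerms x).Nontrivial
  rw [scale_maxTerms]

lemma scale_val (l : ℝ) (x : Fin 2 → ℝ) : (f.scale l).val x = l + f.val x := by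
  obtain ⟨m, hm⟩ := f.maxTerms_nonempty x
  rw [f.val_eq_of_mem hm, ← scale_term]
  rw [← scale_maxTerms f l] at hm
  exact val_eq_of_mem _ hm

end TropPoly


/-! ### Unimodular lattice polygons -/

section Lattice

/-- The lattice point `(i, j)`. -/
def ipt (i j : ℕ) : Fin 2 → ℤ := ![(i : ℤ), (j : ℤ)]

@[simp] lemma ipt_zero (i j : ℕ) : ipt i j 0 = i := rfl
@[simp] lemma ipt_one (i j : ℕ) : ipt i j 1 = j := rfl

lemma toReal_ipt (i j : ℕ) : toReal (ipt i j) = pt i j := by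
  funext k; fin_cases k <;> simp [toReal, ipt, pt]

lemma ipt_inj {i j i' j' : ℕ} : ipt i j = ipt i' j' ↔ i = i' ∧ j = j' := by
  constructor
  · intro h
    have h0 := congrFun h 0
    have h1 := congrFun h 1
    simp only [ipt_zero, ipt_one, Nat.cast_inj] at h0 h1
    exact ⟨h0, h1⟩
  · rintro ⟨rfl, rfl⟩; rfl

/-- Twice the oriented area of a triangle. -/
def area {R : Type*} [CommRing R] (a b c : Fin 2 → R) : R :=
  (b 0 - a 0) * (c 1 - a 1) - (b 1 - a 1) * (c 0 - a 0)

lemma area_toReal (a b c : Fin 2 → ℤ) : area (toReal a) (toReal b) (toReal c) = (area a b c : ℤ) := by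
  simp [area, toReal]

lemma area_combo (a b x y : Fin 2 → ℝ) {s t : ℝ} (hst : s + t = 1) :
    area a b (s • x + t • y) = s * area a b x + t * area a b y := by
  simp only [area, Pi.add_apply, Pi.smul_apply, smul_eq_mul]
  have : t = 1 - s := by linarith
  subst this; ring

/-- The barycentric coordinates of a point of a triangle are nonnegative. -/
lemma area_nonneg_of_mem_triangle {a b c x : Fin 2 → ℝ} (hx : x ∈ triangle a b c) (σ : ℝ)
    (h : 0 ≤ σ * area b c a) : 0 ≤ σ * area b c x := by
  have hconv : Convex ℝ {x | 0 ≤ σ * area b c x} := by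
    intro y hy z hz s t hs ht hst
    simp only [Set.mem_ofPred_eq] at hy hz ⊢
    rw [area_combo b c y z hst]
    have := mul_nonneg hs hy
    have := mul_nonneg ht hz
    linarith
  have hsub : ({a, b, c} : Set (Fin 2 → ℝ)) ⊆ {x | 0 ≤ σ * area b c x} := by
    rintro y (rfl | rfl | rfl)
    · exact h
    · simp [area]
    · simp only [Set.mem_ofPred_eq]
      have : area b y y = 0 := by simp only [area]; ring
      rw [this, mul_zero]
  exact convexHull_min hsub hconv hx

lemma triangle_rotate (a b c : Fin 2 → ℝ) : triangle a b c = triangle b c a := by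
  unfold triangle
  congr 1
  ext x; simp only [Set.mem_insert_iff, Set.mem_singleton_iff]; tauto

/-- The exponents whose convex hull is a unimodular triangle are its vertices. -/
lemma eq_vertices_of_triangle {S : Set (Fin 2 → ℤ)} {a b c : Fin 2 → ℤ}
    (h : convexHull ℝ (toReal '' S) = triangle (toReal a) (toReal b) (toReal c))
    (hu : IsUnit (area a b c)) : S = {a, b, c} := by
  have key : ∀ a b c : Fin 2 → ℤ,
      convexHull ℝ (toReal '' S) = triangle (toReal a) (toReal b) (toReal c) →
      IsUnit (area a b c) → S ⊆ {a, b, c} → a ∈ S := by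
    intro a b c h hu hS
    by_contra ha
    have hsub : toReal '' S ⊆ {x | area (toReal b) (toReal c) x = 0} := by
      rintro _ ⟨m, hm, rfl⟩
      rcases hS hm with rfl | rfl | rfl
      · exact absurd hm ha
      · simp [area]
      · simp only [Set.mem_ofPred_eq, area]; ring
    have hconv : Convex ℝ {x | area (toReal b) (toReal c) x = 0} := by
      intro y hy z hz s t hs ht hst
      simp only [Set.mem_ofPred_eq] at hy hz ⊢
      rw [area_combo _ _ y z hst, hy, hz]; ring
    have hmem : toReal a ∈ convexHull ℝ (toReal '' S) := by
      rw [h]; exact subset_convexHull ℝ _ (by simp)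
    have h1 : area (toReal b) (toReal c) (toReal a) = 0 := convexHull_min hsub hconv hmem
    rw [area_toReal] at h1
    have h2 : area b c a = area a b c := by simp only [area]; ring
    rw [h2] at h1
    exact hu.ne_zero (by exact_mod_cast h1)
  have hsub : S ⊆ {a, b, c} := by
    intro m hm
    have hmt : toReal m ∈ triangle (toReal a) (toReal b) (toReal c) := by
      rw [← h]; exact subset_convexHull ℝ _ ⟨m, hm, rfl⟩
    have hσ : area a b c * area a b c = 1 := Int.isUnit_mul_self hu
    have e1 : area b c a = area a b c := by simp only [area]; ring
    have e2 : area c a b = area a b c := by simp only [area]; ring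
    have hpos : ∀ b' c' a' : Fin 2 → ℤ, area b' c' a' = area a b c →
        toReal m ∈ triangle (toReal a') (toReal b') (toReal c') →
        0 ≤ area a b c * area b' c' m := by
      intro b' c' a' he hmem
      have := area_nonneg_of_mem_triangle hmem (area a b c : ℤ) (by
        rw [area_toReal, he]; exact mul_self_nonneg _)
      rw [area_toReal] at this
      exact_mod_cast this
    have hA := hpos b c a e1 hmt
    have hB := hpos c a b e2 (by rw [← triangle_rotate]; exact hmt)
    have hC := hpos a b c rfl (by rw [← triangle_rotate, ← triangle_rotate]; exact hmt)
    have hsum : area b c m + area c a m + area a b m = area a b c := by simp only [area]; ring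
    have hsum' : area a b c * area b c m + area a b c * area c a m + area a b c * area a b m = 1 := by
      rw [← hσ, ← hsum]; ring
    have h0 : ∀ i, area a b c * m i = area b c m * a i + area c a m * b i + area a b m * c i := by
      rw [Fin.forall_fin_two]
      constructor <;> simp only [area] <;> ring
    have h1 : ∀ i, m i = area a b c * area b c m * a i + area a b c * area c a m * b i +
        area a b c * area a b m * c i := by
      intro i
      have := h0 i
      linear_combination (-m i) * hσ + area a b c * this
    rw [Set.mem_insert_iff, Set.mem_insert_iff, Set.mem_singleton_iff]
    generalize area a b c * area b c m = A at *
    generalize area a b c * area c a m = B at *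
    generalize area a b c * area a b m = C at *
    obtain ⟨rfl, rfl, rfl⟩ | ⟨rfl, rfl, rfl⟩ | ⟨rfl, rfl, rfl⟩ :
        (A = 1 ∧ B = 0 ∧ C = 0) ∨ (A = 0 ∧ B = 1 ∧ C = 0) ∨ (A = 0 ∧ B = 0 ∧ C = 1) := by omega
    · left; funext i; rw [h1 i]; ring
    · right; left; funext i; rw [h1 i]; ring
    · right; right; funext i; rw [h1 i]; ring
  apply Set.Subset.antisymm hsub
  rintro x (rfl | rfl | rfl)
  · exact key _ _ _ h hu hsub
  · refine key x c a (by rw [h, triangle_rotate]) ?_ ?_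
    · convert hu using 1; simp only [area]; ring
    · intro m hm; have := hsub hm; simp only [Set.mem_insert_iff, Set.mem_singleton_iff] at this ⊢
      tauto
  · refine key x a b (by rw [h, ← triangle_rotate]) ?_ ?_
    · convert hu using 1; simp only [area]; ring
    · intro m hm; have := hsub hm; simp only [Set.mem_insert_iff, Set.mem_singleton_iff] at this ⊢
      tauto

lemma lattice_mem_segment {a b m : Fin 2 → ℤ} (hab : IsPrimitiveVec (b - a))
    (hm : toReal m ∈ segment ℝ (toReal a) (toReal b)) : m = a ∨ m = b := by
  rw [segment_eq_image'] at hm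
  obtain ⟨t, ⟨ht0, ht1⟩, h⟩ := hm
  simp only at h
  have hsub : ∀ x y : Fin 2 → ℤ, toReal (x - y) = toReal x - toReal y := by
    intro x y; funext i; simp [toReal]
  have h1 : toReal (m - a) = t • toReal (b - a) := by
    rw [hsub, hsub, ← h, add_sub_cancel_left]
  obtain ⟨k, hk, hka⟩ := hab.exists_int_mul h1
  rw [hk] at ht0 ht1
  have hk0 : (0 : ℤ) ≤ k := by exact_mod_cast ht0
  have hk1 : k ≤ 1 := by exact_mod_cast ht1
  obtain rfl | rfl : k = 0 ∨ k = 1 := by omega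
  · left; rw [zero_smul] at hka; exact sub_eq_zero.1 hka
  · right; rw [one_smul] at hka; exact sub_left_injective hka

/-- The exponents whose convex hull is a primitive segment are its end points. -/
lemma eq_endpoints_of_segment {S : Set (Fin 2 → ℤ)} {a b : Fin 2 → ℤ}
    (h : convexHull ℝ (toReal '' S) = segment ℝ (toReal a) (toReal b))
    (hab : IsPrimitiveVec (b - a)) : S = {a, b} := by
  have hne : a ≠ b := by
    rintro rfl; exact hab.ne_zero (sub_self a)
  have hsub : S ⊆ {a, b} := by
    intro m hm
    exact lattice_mem_segment hab (by rw [← h]; exact subset_convexHull ℝ _ ⟨m, hm, rfl⟩)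
  have key : ∀ x y : Fin 2 → ℤ, x ≠ y → S ⊆ {x, y} →
      toReal x ∈ convexHull ℝ (toReal '' S) → x ∈ S := by
    intro x y hxy hS hx
    by_contra hxS
    have : toReal '' S ⊆ {toReal y} := by
      rintro _ ⟨m, hm, rfl⟩
      rcases hS hm with rfl | rfl
      · exact absurd hm hxS
      · rfl
    have h1 := convexHull_mono this hx
    rw [convexHull_singleton] at h1
    exact hxy (toReal_injective h1)
  apply Set.Subset.antisymm hsub
  rintro x (rfl | rfl)
  · exact key x b hne hsub (by rw [h]; exact left_mem_segment ℝ _ _)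
  · exact key x a hne.symm (by rwa [Set.pair_comm]) (by rw [h]; exact right_mem_segment ℝ _ _)

lemma interior_convexHull_nonempty_of_area {S : Set (Fin 2 → ℤ)} {a b c : Fin 2 → ℤ} (ha : a ∈ S)
    (hb : b ∈ S) (hc : c ∈ S) (h : area a b c ≠ 0) :
    (interior (convexHull ℝ (toReal '' S))).Nonempty := by
  rw [interior_convexHull_nonempty_iff_affineSpan_eq_top, eq_top_iff]
  intro y _
  have hA : ((area a b c : ℤ) : ℝ) ≠ 0 := by exact_mod_cast h
  have hmem : ∀ m ∈ S, toReal m ∈ affineSpan ℝ (toReal '' S) := fun m hm =>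
    subset_affineSpan ℝ _ ⟨m, hm, rfl⟩
  have hdir : ∀ m ∈ S, toReal m -ᵥ toReal a ∈ (affineSpan ℝ (toReal '' S)).direction :=
    fun m hm => AffineSubspace.vsub_mem_direction (hmem m hm) (hmem a ha)
  have h1 := AffineSubspace.vadd_mem_of_mem_direction (Submodule.add_mem _
    (Submodule.smul_mem _ (area (toReal a) y (toReal c) / (area a b c : ℤ)) (hdir b hb))
    (Submodule.smul_mem _ (area (toReal a) (toReal b) y / (area a b c : ℤ)) (hdir c hc))) (hmem a ha)
  convert h1 using 1
  rw [← area_toReal] at hA ⊢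
  funext i
  simp only [vadd_eq_add, vsub_eq_sub, Pi.add_apply, Pi.smul_apply, Pi.sub_apply, smul_eq_mul]
  field_simp
  fin_cases i
  · simp only [area, Fin.zero_eta]; ring
  · simp only [area, Fin.mk_one]; ring

end Lattice

namespace TropPoly

variable (P : TropPoly 2)

lemma latticeLength_dualCell {p : Fin 2 → ℝ} {a b : Fin 2 → ℤ} (h : P.maxTerms p = {a, b})
    (hab : IsPrimitiveVec (b - a)) : latticeLength (P.dualCell p) = 1 := by
  unfold latticeLength dualCell
  rw [h, Set.image_pair, convexHull_pair]
  have : {m : Fin 2 → ℤ | toReal m ∈ segment ℝ (toReal a) (toReal b)} = {a, b} := by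
    ext m
    constructor
    · exact lattice_mem_segment hab
    · rintro (rfl | rfl)
      · exact left_mem_segment ℝ _ _
      · exact right_mem_segment ℝ _ _
  rw [this, Set.ncard_pair]
  rintro rfl
  exact hab.ne_zero (sub_self a)

/-- A supporting line of the dual subdivision along one of its edges supports the Newton polytope:
moving from a point of the dual edge in the direction `ν` of the outer normal, the first monomial
to become maximal on the wrong side would produce a polygon of the subdivision on that side. -/
lemma support_le_of_edge {v : Fin 2 → ℝ} {a b : Fin 2 → ℤ} (ha : a ∈ P.maxTerms v)
    (hb : b ∈ P.maxTerms v) (hab : a ≠ b) (ν : Fin 2 → ℤ) (c : ℤ)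
    (hνa : ν 0 * a 0 + ν 1 * a 1 = c) (hνb : ν 0 * b 0 + ν 1 * b 1 = c)
    (hT : ∀ x, (interior (P.dualCell x)).Nonempty →
      ∀ m ∈ P.maxTerms x, ν 0 * m 0 + ν 1 * m 1 ≤ c) :
    ∀ m ∈ P.support, ν 0 * m 0 + ν 1 * m 1 ≤ c := by
  intro m₁ hm₁
  by_contra hcon
  push Not at hcon
  let w : (Fin 2 → ℤ) → ℤ := fun m => ν 0 * m 0 + ν 1 * m 1
  let B := P.support.filter fun m => c < w m
  -- the time at which `m` catches up with `a`
  let τ : (Fin 2 → ℤ) → ℝ := fun m => (P.term a v - P.term m v) / (w m - c : ℤ)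
  obtain ⟨m, hmB, hmin⟩ := B.exists_min_image τ ⟨m₁, Finset.mem_filter.2 ⟨hm₁, hcon⟩⟩
  obtain ⟨hm, hmc⟩ := Finset.mem_filter.1 hmB
  have hpos : ∀ m' ∈ B, (0 : ℝ) < (w m' - c : ℤ) := fun m' hm' => by
    have := (Finset.mem_filter.1 hm').2
    exact_mod_cast sub_pos.2 this
  have hτ0 : 0 ≤ τ m := div_nonneg (sub_nonneg.2 (ha.2 m hm)) (hpos m hmB).le
  have hterm : ∀ m', P.term m' (v + τ m • toReal ν) = P.term m' v + τ m * w m' := by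
    intro m'
    rw [term_add, Fin.sum_univ_two]
    simp only [toReal, Pi.smul_apply, smul_eq_mul, w]
    push_cast; ring
  have hwa : w a = c := hνa
  have hwb : w b = c := hνb
  have hab' : P.term a v = P.term b v := by rw [← P.val_eq_of_mem ha, ← P.val_eq_of_mem hb]
  have hmax : ∀ m' ∈ P.support, P.term m' (v + τ m • toReal ν) ≤ P.term a v + τ m * c := by
    intro m' hm'
    rw [hterm]
    by_cases hB : c < w m'
    · have hm'B : m' ∈ B := Finset.mem_filter.2 ⟨hm', hB⟩
      have h1 := hmin m' hm'B
      simp only [τ] at h1 ⊢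
      rw [le_div_iff₀ (hpos m' hm'B)] at h1
      push_cast at h1 ⊢
      linarith
    · have h1 : (w m' : ℝ) ≤ c := by exact_mod_cast not_lt.1 hB
      have h2 := mul_le_mul_of_nonneg_left h1 hτ0
      linarith [ha.2 m' hm']
  have hmem : ∀ m' ∈ P.support, P.term m' v + τ m * w m' = P.term a v + τ m * c →
      m' ∈ P.maxTerms (v + τ m • toReal ν) := fun m' hm' he =>
    ⟨hm', fun m'' hm'' => by rw [hterm m', he]; exact hmax m'' hm''⟩
  have hma := hmem a ha.1 (by rw [hwa])
  have hmb := hmem b hb.1 (by rw [hwb, hab'])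
  have hmm := hmem m hm (by
    have h0 := (hpos m hmB).ne'
    have : τ m * ((w m - c : ℤ) : ℝ) = P.term a v - P.term m v := div_mul_cancel₀ _ h0
    push_cast at this
    linarith)
  have harea : area a b m ≠ 0 := by
    intro h0
    -- `b - a` is orthogonal to `ν`, and `m - a` is parallel to it
    have h1 : ν 0 * (b 0 - a 0) + ν 1 * (b 1 - a 1) = 0 := by linear_combination hνb - hνa
    have h2 : 0 < ν 0 * (m 0 - a 0) + ν 1 * (m 1 - a 1) := by
      have : c < ν 0 * m 0 + ν 1 * m 1 := hmc
      linarith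
    unfold area at h0
    have h3 : (b 0 - a 0) * (ν 0 * (m 0 - a 0) + ν 1 * (m 1 - a 1)) = 0 := by
      linear_combination (m 0 - a 0) * h1 + ν 1 * h0
    have h4 : (b 1 - a 1) * (ν 0 * (m 0 - a 0) + ν 1 * (m 1 - a 1)) = 0 := by
      linear_combination (m 1 - a 1) * h1 - ν 0 * h0
    apply hab
    funext i
    revert i
    rw [Fin.forall_fin_two]
    constructor
    · rcases mul_eq_zero.1 h3 with h | h <;> linarith
    · rcases mul_eq_zero.1 h4 with h | h <;> linarith
  have := hT _ (interior_convexHull_nonempty_of_area hma hmb hmm harea) m hmm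
  exact absurd this (not_le.2 hmc)

end TropPoly


/-! ### Smooth planar tropical curves -/

namespace TropPoly

/-- The hypersurface of a planar tropical polynomial is smooth: its dual subdivision has only
primitive segments and unimodular triangles, apart from points. -/
def IsSmooth (Q : TropPoly 2) : Prop := ∀ x ∈ Q.hypersurface,
  (∃ a b, Q.maxTerms x = {a, b} ∧ IsPrimitiveVec (b - a)) ∨
    ∃ a b c, Q.maxTerms x = {a, b, c} ∧ area a b c = 1

end TropPoly

/-- The direction dual to `[a, b]`; it points away from the exponents to the left of `[a, b]`. -/
def outDir (a b : Fin 2 → ℤ) : Fin 2 → ℤ := ![b 1 - a 1, a 0 - b 0]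

lemma outDir_swap (a b : Fin 2 → ℤ) : outDir b a = -outDir a b := by
  funext i; fin_cases i <;> simp [outDir]

lemma isPrimitiveVec_outDir {a b : Fin 2 → ℤ} (h : IsPrimitiveVec (b - a)) :
    IsPrimitiveVec (outDir a b) := by
  intro d hd
  refine h d ?_
  have h0 : d ∣ b 1 - a 1 := hd 0
  have h1 : d ∣ a 0 - b 0 := hd 1
  rw [Fin.forall_fin_two]
  exact ⟨(dvd_sub_comm).1 h1, h0⟩

lemma isPrimitiveVec_of_area {a b c : Fin 2 → ℤ} (h : IsUnit (area a b c)) :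
    IsPrimitiveVec (b - a) := by
  intro d hd
  refine isUnit_of_dvd_unit ?_ h
  unfold area
  exact dvd_sub (Dvd.dvd.mul_right (hd 0) _) (Dvd.dvd.mul_right (hd 1) _)

namespace TropPoly

variable (Q : TropPoly 2)

lemma term_linePt (m : Fin 2 → ℤ) (p : Fin 2 → ℝ) (d : Fin 2 → ℤ) (t : ℝ) :
    Q.term m (linePt p d t) = Q.term m p + t * (m 0 * d 0 + m 1 * d 1 : ℤ) := by
  rw [linePt, term_add, Fin.sum_univ_two]
  simp only [toReal, Pi.smul_apply, smul_eq_mul]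
  push_cast; ring

lemma term_outDir (a b c : Fin 2 → ℤ) (p : Fin 2 → ℝ) (t : ℝ) :
    Q.term c (linePt p (outDir a b) t) - Q.term a (linePt p (outDir a b) t) =
      Q.term c p - Q.term a p - t * (area a b c : ℤ) := by
  rw [term_linePt, term_linePt]
  simp only [outDir, area, Matrix.cons_val_zero, Matrix.cons_val_one]
  push_cast; ring

lemma area_self_right (a b : Fin 2 → ℤ) : area a b b = 0 := by unfold area; ring

lemma area_self_left (a b : Fin 2 → ℤ) : area a b a = 0 := by unfold area; ring

variable {Q}

section TwoTerms

variable {p : Fin 2 → ℝ} {a b : Fin 2 → ℤ}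

lemma exists_linePt_of_mem_cellAt (h : Q.maxTerms p = {a, b}) (hab : a ≠ b) {q : Fin 2 → ℝ}
    (hq : q ∈ Q.cellAt p) : ∃ t, q = linePt p (outDir a b) t := by
  have h1 := term_eq_of_mem_cellAt h hq
  have h2 := term_eq_of_mem_cellAt h (Q.mem_cellAt_self p)
  simp only [term, Fin.sum_univ_two] at h1 h2
  have hne : ((b 1 - a 1 : ℤ) : ℝ) ^ 2 + ((a 0 - b 0 : ℤ) : ℝ) ^ 2 ≠ 0 := by
    intro h0
    have e1 : ((b 1 - a 1 : ℤ) : ℝ) = 0 := by nlinarith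
    have e2 : ((a 0 - b 0 : ℤ) : ℝ) = 0 := by nlinarith
    have e1' : b 1 - a 1 = 0 := by exact_mod_cast e1
    have e2' : a 0 - b 0 = 0 := by exact_mod_cast e2
    apply hab; funext i
    revert i; rw [Fin.forall_fin_two]
    constructor <;> linarith
  refine ⟨((q 0 - p 0) * (b 1 - a 1 : ℤ) + (q 1 - p 1) * (a 0 - b 0 : ℤ)) /
    (((b 1 - a 1 : ℤ) : ℝ) ^ 2 + ((a 0 - b 0 : ℤ) : ℝ) ^ 2), ?_⟩
  funext i
  revert i; rw [Fin.forall_fin_two]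
  simp only [linePt, outDir, toReal, Pi.add_apply, Pi.smul_apply, smul_eq_mul, Matrix.cons_val_zero,
    Matrix.cons_val_one]
  constructor
  · field_simp
    push_cast
    linear_combination ((a 0 : ℝ) - b 0) * (h1 - h2)
  · field_simp
    push_cast
    linear_combination ((a 1 : ℝ) - b 1) * (h1 - h2)

lemma mem_cellAt_outDir_iff (h : Q.maxTerms p = {a, b}) (t : ℝ) :
    linePt p (outDir a b) t ∈ Q.cellAt p ↔ a ∈ Q.maxTerms (linePt p (outDir a b) t) := by
  have hb : b ∈ Q.maxTerms p := by rw [h]; simp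
  have h2 := term_eq_of_mem_cellAt h (Q.mem_cellAt_self p)
  have h3 := Q.term_outDir a b b p t
  rw [area_self_right, ← h2] at h3
  change Q.maxTerms p ⊆ _ ↔ _
  rw [h, Set.insert_subset_iff, Set.singleton_subset_iff]
  refine ⟨fun h => h.1, fun ha => ⟨ha, Q.mem_maxTerms_iff.2 ⟨hb.1, ?_⟩⟩⟩
  rw [Q.val_eq_of_mem ha]
  simp at h3; linarith

end TwoTerms

end TropPoly

section Pieces

variable {Q : TropPoly 2} {M : Set (Fin 2 → ℝ)}

lemma disjoint_openSegment_iff {p : Fin 2 → ℝ} (hp : p ∉ M) (d : Fin 2 → ℤ) (t : ℝ) :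
    Disjoint (openSegment ℝ p (linePt p d t)) M ↔
      ∀ s, (0 < s ∧ s < t ∨ t < s ∧ s < 0) → linePt p d s ∉ M := by
  have hcombo : ∀ r r' : ℝ, r + r' = 1 → r • p + r' • linePt p d t = linePt p d (r' * t) := by
    intro r r' hr
    have := linePt_combo p d (s := 0) (t := t) hr
    rwa [linePt_zero, mul_zero, zero_add] at this
  rw [Set.disjoint_left]
  constructor
  · intro h s hs
    have ht : t ≠ 0 := by
      rintro rfl; rcases hs with hs | hs <;> linarith
    have h01 : 0 < s / t ∧ s / t < 1 := by
      rcases hs with ⟨h1, h2⟩ | ⟨h1, h2⟩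
      · exact ⟨div_pos h1 (h1.trans h2), (div_lt_one (h1.trans h2)).2 h2⟩
      · exact ⟨div_pos_of_neg_of_neg h2 (h1.trans h2),
          (div_lt_one_of_neg (h1.trans h2)).2 h1⟩
    apply h
    refine ⟨1 - s / t, s / t, by linarith [h01.2], h01.1, by ring, ?_⟩
    rw [hcombo _ _ (by ring), div_mul_cancel₀ _ ht]
  · rintro h _ ⟨r, r', hr, hr', hrr, rfl⟩
    rw [hcombo r r' hrr]
    rcases lt_trichotomy t 0 with ht | rfl | ht
    · refine h _ (Or.inr ⟨?_, mul_neg_of_pos_of_neg hr' ht⟩)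
      nlinarith
    · rwa [mul_zero, linePt_zero]
    · refine h _ (Or.inl ⟨mul_pos hr' ht, ?_⟩)
      nlinarith

/-- The parameters of the points of the piece through `p` of the edge dual to `[a, b]`. -/
def pieceParams (Q : TropPoly 2) (M : Set (Fin 2 → ℝ)) (p : Fin 2 → ℝ) (a b : Fin 2 → ℤ) : Set ℝ :=
  {t | a ∈ Q.maxTerms (linePt p (outDir a b) t) ∧
    ∀ s, (0 < s ∧ s < t ∨ t < s ∧ s < 0) → linePt p (outDir a b) s ∉ M}

variable {p : Fin 2 → ℝ} {a b : Fin 2 → ℤ}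

lemma linePt_mem_edgePiece_iff (h : Q.maxTerms p = {a, b}) (hp : p ∉ M) (t : ℝ) :
    linePt p (outDir a b) t ∈ edgePiece Q M p ↔ t ∈ pieceParams Q M p a b := by
  change _ ∧ _ ↔ _ ∧ _
  rw [Q.mem_cellAt_outDir_iff h, disjoint_openSegment_iff hp]

lemma edgePiece_eq (h : Q.maxTerms p = {a, b}) (hab : a ≠ b) (hp : p ∉ M) :
    edgePiece Q M p = linePt p (outDir a b) '' pieceParams Q M p a b := by
  ext q
  constructor
  · intro hq
    obtain ⟨t, rfl⟩ := TropPoly.exists_linePt_of_mem_cellAt h hab hq.1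
    exact ⟨t, (linePt_mem_edgePiece_iff h hp t).1 hq, rfl⟩
  · rintro ⟨t, ht, rfl⟩
    exact (linePt_mem_edgePiece_iff h hp t).2 ht

lemma convex_maxTerm (Q : TropPoly 2) (a : Fin 2 → ℤ) : Convex ℝ {x | a ∈ Q.maxTerms x} := by
  intro x hx y hy r s hr hs hrs
  refine ⟨hx.1, fun m hm => ?_⟩
  rw [Q.term_combo m x y hrs, Q.term_combo a x y hrs]
  exact add_le_add (mul_le_mul_of_nonneg_left (hx.2 m hm) hr)
    (mul_le_mul_of_nonneg_left (hy.2 m hm) hs)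

lemma isClosed_maxTerm (Q : TropPoly 2) {a : Fin 2 → ℤ} (ha : a ∈ Q.support) :
    IsClosed {x | a ∈ Q.maxTerms x} := by
  have : {x | a ∈ Q.maxTerms x} = ⋂ m ∈ Q.support, {x | Q.term m x ≤ Q.term a x} := by
    ext x
    simp only [Set.mem_iInter]
    exact ⟨fun h => h.2, fun h => ⟨ha, h⟩⟩
  rw [this]
  exact isClosed_biInter fun m _ => isClosed_le (Q.continuous_term m) (Q.continuous_term a)

/-- At a regular point of a piece, the piece extends to both sides. -/
lemma exists_pieceParams_near (hM : M.Finite) (h : Q.maxTerms p = {a, b})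
    {t : ℝ} (ht : t ∈ pieceParams Q M p a b) (hab : Q.maxTerms (linePt p (outDir a b) t) = {a, b})
    (htM : linePt p (outDir a b) t ∉ M) : IsInner (pieceParams Q M p a b) t := by
  obtain ⟨U, hU, htU, hUc⟩ := TropPoly.exists_nhds_of_two hab
  have hV : IsOpen (linePt p (outDir a b) ⁻¹' (U ∩ Mᶜ)) :=
    (hU.inter hM.isClosed.isOpen_compl).preimage (continuous_linePt _ _)
  obtain ⟨δ, hδ, hball⟩ := Metric.isOpen_iff.1 hV t ⟨htU, htM⟩
  have hnear : ∀ s, |s - t| < δ → linePt p (outDir a b) s ∈ U ∧ linePt p (outDir a b) s ∉ M := by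
    intro s hs
    exact hball (by rwa [Metric.mem_ball, Real.dist_eq])
  have h2 := TropPoly.term_eq_of_mem_cellAt h (Q.mem_cellAt_self p)
  have hmem : ∀ s, |s - t| < δ → s ∈ pieceParams Q M p a b := by
    intro s hs
    constructor
    · have h3 := Q.term_outDir a b b p s
      rw [TropPoly.area_self_right, ← h2] at h3
      have h4 := hUc _ (hnear s hs).1 (by simp at h3; linarith)
      exact h4 (by rw [hab]; simp)
    · intro r hr
      by_cases hrt : 0 < r ∧ r < t ∨ t < r ∧ r < 0
      · exact ht.2 r hrt
      · by_cases hr0 : |r - t| < δ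
        · exact (hnear r hr0).2
        · -- otherwise `r` would lie strictly between `0` and `t`
          exfalso
          rw [not_or, not_and_or, not_and_or, not_lt, not_lt, not_lt, not_lt] at hrt
          rw [abs_lt] at hs hr0
          rw [not_and_or, not_lt, not_lt] at hr0
          grind
  refine ⟨t - δ / 2, hmem _ ?_, t + δ / 2, hmem _ ?_, by linarith, by linarith⟩
  · rw [abs_lt]; constructor <;> linarith
  · rw [abs_lt]; constructor <;> linarith

lemma zero_mem_pieceParams (h : Q.maxTerms p = {a, b}) : (0 : ℝ) ∈ pieceParams Q M p a b := by
  constructor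
  · rw [linePt_zero, h]; simp
  · rintro s (hs | hs) <;> linarith [hs.1, hs.2]

lemma edgePiece_edgeAt (hM : M.Finite) (h : Q.maxTerms p = {a, b})
    (hab : IsPrimitiveVec (b - a)) (hp : p ∉ M) :
    EdgeAt (edgePiece Q M p) p (outDir a b) (pieceParams Q M p a b) where
  primitive := isPrimitiveVec_outDir hab
  closed := by
    have ha : a ∈ Q.maxTerms p := by rw [h]; simp
    have h1 : IsClosed {t | a ∈ Q.maxTerms (linePt p (outDir a b) t)} :=
      (isClosed_maxTerm Q ha.1).preimage (continuous_linePt p (outDir a b))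
    refine h1.inter ?_
    have : {t : ℝ | ∀ s, (0 < s ∧ s < t ∨ t < s ∧ s < 0) → linePt p (outDir a b) s ∉ M} =
        ⋂ s ∈ {s | linePt p (outDir a b) s ∈ M}, {t | ¬ (0 < s ∧ s < t ∨ t < s ∧ s < 0)} := by
      ext t
      simp only [Set.mem_iInter, Set.mem_ofPred_eq]
      exact ⟨fun h s hs hst => h s hst hs, fun h s hst hs => h s hs hst⟩
    change IsClosed {t : ℝ | ∀ s, (0 < s ∧ s < t ∨ t < s ∧ s < 0) → linePt p (outDir a b) s ∉ M}
    rw [this]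
    refine isClosed_biInter fun s _ => ?_
    have ho : IsOpen ({_t : ℝ | 0 < s} ∩ {t | s < t} ∪ {t : ℝ | t < s} ∩ {_t | s < 0}) :=
      (isOpen_const.inter (isOpen_lt continuous_const continuous_id)).union
        ((isOpen_lt continuous_id continuous_const).inter isOpen_const)
    exact ho.isClosed_compl
  ordConnected := by
    refine ⟨fun t₁ h₁ t₂ h₂ t ht => ⟨?_, fun s hs => ?_⟩⟩
    · have h3 := convex_linePt_image p (outDir a b) (I := Set.Icc t₁ t₂) Set.ordConnected_Icc
      obtain ⟨r, r', hr, hr', hrr, hrt⟩ := (convex_Icc t₁ t₂).ordConnected.out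
        (Set.left_mem_Icc.2 (ht.1.trans ht.2)) (Set.right_mem_Icc.2 (ht.1.trans ht.2)) ht |>
        fun h => (segment_eq_Icc (ht.1.trans ht.2)).symm ▸ h
      have := convex_maxTerm Q a h₁.1 h₂.1 hr hr' hrr
      rw [linePt_combo p _ hrr] at this
      simp only [smul_eq_mul] at hrt
      rw [hrt] at this
      exact this
    · rcases hs with hs | hs
      · exact h₂.2 s (Or.inl ⟨hs.1, hs.2.trans_le ht.2⟩)
      · exact h₁.2 s (Or.inr ⟨ht.1.trans_lt hs.1, hs.2⟩)
  nontrivial := by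
    obtain ⟨s, hs, s', hs', h1, h2⟩ := exists_pieceParams_near hM h (zero_mem_pieceParams h)
      (by rw [linePt_zero]; exact h) (by rw [linePt_zero]; exact hp)
    exact ⟨s, hs, s', hs', (h1.trans h2).ne⟩
  zero_mem := zero_mem_pieceParams h
  eq := edgePiece_eq h (by rintro rfl; exact hab.ne_zero (sub_self a)) hp

/-- The vertices of the planar curve `V(Q)` marked at the points of `M`. -/
def curveVertices (Q : TropPoly 2) (M : Set (Fin 2 → ℝ)) : Set (Fin 2 → ℝ) :=
  {x | ∃ a b c, Q.maxTerms x = {a, b, c} ∧ area a b c = 1} ∪ M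

lemma IsPrimitiveVec.ne {N : ℕ} {a b : Fin N → ℤ} (h : IsPrimitiveVec (b - a)) : a ≠ b := by
  rintro rfl; exact h.ne_zero (sub_self a)

lemma ne_of_area {a b c : Fin 2 → ℤ} (h : area a b c = 1) : a ≠ b ∧ b ≠ c ∧ a ≠ c := by
  refine ⟨?_, ?_, ?_⟩
  · rintro rfl; simp [area] at h
  · rintro rfl; rw [TropPoly.area_self_right] at h; simp at h
  · rintro rfl; rw [TropPoly.area_self_left] at h; simp at h

/-- The maximal terms at a regular point of an edge are those of the edge. -/
lemma maxTerms_of_mem_cellAt (hQ : Q.IsSmooth) (h : Q.maxTerms p = {a, b}) (hab : a ≠ b)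
    {x : Fin 2 → ℝ} (hx : x ∈ Q.cellAt p) (hxV : x ∉ curveVertices Q M) :
    Q.maxTerms x = {a, b} := by
  have hsub : Q.maxTerms p ⊆ Q.maxTerms x := hx
  have hhyp : x ∈ Q.hypersurface := by
    change (Q.maxTerms x).Nontrivial
    exact Set.Nontrivial.mono (by rw [h]; exact Set.nontrivial_pair hab) hsub
  rcases hQ x hhyp with ⟨a', b', h', -⟩ | h'
  · rw [h']
    rw [h, h', Set.insert_subset_iff, Set.singleton_subset_iff] at hsub
    obtain ⟨h1, h2⟩ := hsub
    simp only [Set.mem_insert_iff, Set.mem_singleton_iff] at h1 h2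
    ext y; simp only [Set.mem_insert_iff, Set.mem_singleton_iff]
    grind
  · exact absurd (Or.inl h') hxV

lemma edgePiece_vertex_iff (hQ : Q.IsSmooth) (hM : M.Finite) (h : Q.maxTerms p = {a, b})
    (hab : IsPrimitiveVec (b - a)) (hp : p ∉ M) {x : Fin 2 → ℝ} (hx : x ∈ edgePiece Q M p) :
    x ∈ curveVertices Q M ↔ x ∈ (edgePiece Q M p).extremePoints ℝ := by
  have hE := edgePiece_edgeAt hM h hab hp
  have hx' := hx
  rw [hE.eq] at hx'
  obtain ⟨t, ht, rfl⟩ := hx'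
  rw [hE.mem_extremePoints_iff ht]
  constructor
  · rintro (⟨a', b', c', h3, harea⟩ | hxM) ⟨s, hs, s', hs', hst, hts⟩
    · -- a third term would be strictly larger beyond `x`
      obtain ⟨c, hc, hca, hcb⟩ : ∃ c ∈ Q.maxTerms (linePt p (outDir a b) t), c ≠ a ∧ c ≠ b := by
        obtain ⟨h1, h2, h4⟩ := ne_of_area harea
        rw [h3]
        by_contra hcon
        push Not at hcon
        have e1 := hcon a' (by simp)
        have e2 := hcon b' (by simp)
        have e3 := hcon c' (by simp)
        grind
      have hcp : c ∉ Q.maxTerms p := by rw [h]; simp [hca, hcb]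
      have hap : a ∈ Q.maxTerms p := by rw [h]; simp
      have hlt : Q.term c p < Q.term a p := by
        refine lt_of_le_of_ne (hap.2 c hc.1) fun he => hcp ?_
        exact ⟨hc.1, fun m hm => he ▸ hap.2 m hm⟩
      have e := Q.term_outDir a b c p t
      have e1 := Q.term_outDir a b c p s
      have e2 := Q.term_outDir a b c p s'
      have f0 := ht.1.2 c hc.1
      have f0' := hc.2 a ht.1.1
      have f1 := hs.1.2 c hc.1
      have f2 := hs'.1.2 c hc.1
      have g0 : t * (area a b c : ℤ) = Q.term c p - Q.term a p := by linarith
      have g1 : Q.term c p - Q.term a p ≤ s * (area a b c : ℤ) := by linarith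
      have g2 : Q.term c p - Q.term a p ≤ s' * (area a b c : ℤ) := by linarith
      have g3 : (t - s) * ((area a b c : ℤ) : ℝ) ≤ 0 := by linarith
      have g4 : 0 ≤ (s' - t) * ((area a b c : ℤ) : ℝ) := by linarith
      have g5 : ((area a b c : ℤ) : ℝ) = 0 :=
        le_antisymm (nonpos_of_mul_nonpos_right g3 (by linarith))
          (nonneg_of_mul_nonneg_right g4 (by linarith))
      rw [g5] at g0; linarith
    · have ht0 : t ≠ 0 := by
        rintro rfl; rw [linePt_zero] at hxM; exact hp hxM
      rcases lt_or_gt_of_ne ht0 with h0 | h0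
      · exact hs.2 t (Or.inr ⟨hst, h0⟩) hxM
      · exact hs'.2 t (Or.inl ⟨h0, hts⟩) hxM
  · intro hin
    by_contra hxV
    exact hin (exists_pieceParams_near hM h ht
      (maxTerms_of_mem_cellAt hQ h hab.ne hx.1 hxV) fun hxM => hxV (Or.inr hxM))

/-- A piece is determined by any of its regular points. -/
lemma edgePiece_eq_of_mem (hQ : Q.IsSmooth) (hM : M.Finite) (h : Q.maxTerms p = {a, b})
    (hab : IsPrimitiveVec (b - a)) (hp : p ∉ M) {x : Fin 2 → ℝ} (hx : x ∈ edgePiece Q M p)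
    (hxV : x ∉ curveVertices Q M) : edgePiece Q M p = edgePiece Q M x := by
  have hE := edgePiece_edgeAt hM h hab hp
  have hxab := maxTerms_of_mem_cellAt hQ h hab.ne hx.1 hxV
  have hxM : x ∉ M := fun hxM => hxV (Or.inr hxM)
  have hE' := edgePiece_edgeAt hM hxab hab hxM
  have hx' := hx
  rw [hE.eq] at hx'
  obtain ⟨t, ht, rfl⟩ := hx'
  exact (hE.shift ht).eq_of_vertices hE' hxV
    (fun y hy => edgePiece_vertex_iff hQ hM h hab hp hy)
    (fun y hy => edgePiece_vertex_iff hQ hM hxab hab hxM hy)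

end Pieces


section GermDirs

variable {Q : TropPoly 2} {M : Set (Fin 2 → ℝ)}

open Classical in
/-- The primitive outgoing directions of the curve `V(Q)` at its point `x`, dual to the boundary
edges (oriented counterclockwise) of the cell of the dual subdivision attached to `x`. -/
noncomputable def germDirs (Q : TropPoly 2) (x : Fin 2 → ℝ) : Finset (Fin 2 → ℤ) :=
  (((Q.maxTerms_finite x).toFinset ×ˢ (Q.maxTerms_finite x).toFinset).filter fun e =>
    e.1 ≠ e.2 ∧ ∀ c ∈ Q.maxTerms x, c ≠ e.1 → c ≠ e.2 → 0 < area e.1 e.2 c).image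
      fun e => outDir e.1 e.2

lemma mem_germDirs {x : Fin 2 → ℝ} {d : Fin 2 → ℤ} : d ∈ germDirs Q x ↔
    ∃ a ∈ Q.maxTerms x, ∃ b ∈ Q.maxTerms x, a ≠ b ∧
      (∀ c ∈ Q.maxTerms x, c ≠ a → c ≠ b → 0 < area a b c) ∧ d = outDir a b := by
  classical
  unfold germDirs
  simp only [Finset.mem_image, Finset.mem_filter, Finset.mem_product, Set.Finite.mem_toFinset,
    Prod.exists]
  constructor
  · rintro ⟨a, b, ⟨⟨ha, hb⟩, hab, h⟩, rfl⟩
    exact ⟨a, ha, b, hb, hab, h, rfl⟩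
  · rintro ⟨a, ha, b, hb, hab, h, rfl⟩
    exact ⟨a, b, ⟨⟨ha, hb⟩, hab, h⟩, rfl⟩

lemma germDirs_of_two {x : Fin 2 → ℝ} {a b : Fin 2 → ℤ} (h : Q.maxTerms x = {a, b})
    (hab : a ≠ b) : germDirs Q x = {outDir a b, outDir b a} := by
  ext d
  rw [mem_germDirs, h]
  simp only [Set.mem_insert_iff, Set.mem_singleton_iff, Finset.mem_insert, Finset.mem_singleton]
  constructor
  · rintro ⟨a', ha', b', hb', hne, -, rfl⟩
    grind
  · rintro (rfl | rfl)
    · exact ⟨a, Or.inl rfl, b, Or.inr rfl, hab, by grind, rfl⟩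
    · exact ⟨b, Or.inr rfl, a, Or.inl rfl, hab.symm, by grind, rfl⟩

lemma area_rotate {R : Type*} [CommRing R] (a b c : Fin 2 → R) : area b c a = area a b c := by
  simp only [area]; ring

lemma area_swap {R : Type*} [CommRing R] (a b c : Fin 2 → R) : area b a c = -area a b c := by
  simp only [area]; ring

lemma germDirs_of_three {x : Fin 2 → ℝ} {a b c : Fin 2 → ℤ} (h : Q.maxTerms x = {a, b, c})
    (hab : area a b c = 1) : germDirs Q x = {outDir a b, outDir b c, outDir c a} := by
  obtain ⟨h1, h2, h3⟩ := ne_of_area hab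
  have e1 : area b c a = 1 := by rw [area_rotate, hab]
  have e2 : area c a b = 1 := by rw [area_rotate, e1]
  have e3 : area b a c = -1 := by rw [area_swap, hab]
  have e4 : area c b a = -1 := by rw [area_swap, e1]
  have e5 : area a c b = -1 := by rw [area_swap, e2]
  ext d
  rw [mem_germDirs, h]
  simp only [Set.mem_insert_iff, Set.mem_singleton_iff, Finset.mem_insert, Finset.mem_singleton]
  constructor
  · rintro ⟨a', ha', b', hb', hne, hpos, rfl⟩
    rcases ha' with rfl | rfl | rfl <;> rcases hb' with rfl | rfl | rfl
    · exact absurd rfl hne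
    · exact Or.inl rfl
    · have := hpos b (by simp) h1.symm h2; omega
    · have := hpos c (by simp) h2.symm h3.symm; omega
    · exact absurd rfl hne
    · exact Or.inr (Or.inl rfl)
    · exact Or.inr (Or.inr rfl)
    · have := hpos a (by simp) h3 h1; omega
    · exact absurd rfl hne
  · rintro (rfl | rfl | rfl)
    · exact ⟨a, by simp, b, by simp, h1, by grind, rfl⟩
    · exact ⟨b, by simp, c, by simp, h2, by grind, rfl⟩
    · exact ⟨c, by simp, a, by simp, h3.symm, by grind, rfl⟩

lemma outDir_ne_zero {a b : Fin 2 → ℤ} (hab : a ≠ b) : outDir a b ≠ 0 := by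
  intro hd
  have e0 : b 1 - a 1 = 0 := congrFun hd 0
  have e1 : a 0 - b 0 = 0 := congrFun hd 1
  apply hab; funext i
  revert i; rw [Fin.forall_fin_two]
  constructor <;> linarith

lemma outDir_sum (a b c : Fin 2 → ℤ) : outDir a b + outDir b c + outDir c a = 0 := by
  funext i; fin_cases i
  · simp [outDir]
  · simp [outDir]

lemma outDir_cross (a b c : Fin 2 → ℤ) :
    outDir a b 0 * outDir b c 1 - outDir a b 1 * outDir b c 0 = area a b c := by
  simp only [outDir, area, Matrix.cons_val_zero, Matrix.cons_val_one]; ring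

/-- The three directions dual to the sides of a unimodular triangle are pairwise independent. -/
lemma outDir_ne_of_area {a b c : Fin 2 → ℤ} (h : area a b c = 1) :
    outDir a b ≠ 0 ∧ outDir a b ≠ outDir b c ∧ outDir a b ≠ -outDir b c := by
  have h1 := outDir_cross a b c
  rw [h] at h1
  refine ⟨fun h0 => ?_, fun h0 => ?_, fun h0 => ?_⟩
  · rw [h0] at h1; simp at h1
  · rw [h0] at h1; linarith
  · rw [h0] at h1; simp only [Pi.neg_apply] at h1; linarith

/-- Near a point, in the direction dual to one of the boundary edges of its dual cell, there are
regular points with just the two terms of that edge. -/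
lemma exists_germ (hM : M.Finite) {x : Fin 2 → ℝ} {a b : Fin 2 → ℤ} (ha : a ∈ Q.maxTerms x)
    (hb : b ∈ Q.maxTerms x) (hab : a ≠ b)
    (hpos : ∀ c ∈ Q.maxTerms x, c ≠ a → c ≠ b → 0 < area a b c) : ∃ t > 0,
      Q.maxTerms (linePt x (outDir a b) t) = {a, b} ∧
      ∀ s, 0 < s → s ≤ t → linePt x (outDir a b) s ∉ M := by
  classical
  have hcont := continuous_linePt x (outDir a b)
  have h1 : ∀ᶠ t in nhdsWithin (0 : ℝ) (Set.Ioi 0), ∀ m ∈ Q.support, m ∉ Q.maxTerms x →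
      Q.term m (linePt x (outDir a b) t) < Q.term a (linePt x (outDir a b) t) := by
    rw [Filter.eventually_all_finset]
    intro m hm
    by_cases hmx : m ∈ Q.maxTerms x
    · exact Filter.Eventually.of_forall fun t h => absurd hmx h
    · have hlt : Q.term m x < Q.term a x := lt_of_le_of_ne (ha.2 m hm) fun he =>
        hmx ⟨hm, fun m' hm' => he ▸ ha.2 m' hm'⟩
      have ho : IsOpen {t | Q.term m (linePt x (outDir a b) t) <
          Q.term a (linePt x (outDir a b) t)} :=
        isOpen_lt ((Q.continuous_term m).comp hcont) ((Q.continuous_term a).comp hcont)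
      have h0 := mem_nhdsWithin_of_mem_nhds (t := Set.Ioi (0 : ℝ))
        (ho.mem_nhds (show (0 : ℝ) ∈ _ by
          change Q.term m (linePt x (outDir a b) 0) < Q.term a (linePt x (outDir a b) 0)
          rwa [linePt_zero]))
      filter_upwards [h0] with t ht _ using ht
  have h2 : ∀ᶠ t in nhdsWithin (0 : ℝ) (Set.Ioi 0),
      linePt x (outDir a b) t ∈ (M \ {x})ᶜ := by
    have ho : IsOpen (M \ {x})ᶜ := (hM.subset Set.sdiff_subset).isClosed.isOpen_compl
    refine hcont.continuousWithinAt.eventually_mem (ho.mem_nhds ?_)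
    rw [linePt_zero]; simp
  obtain ⟨δ, hδ, hball⟩ := mem_nhdsGT_iff_exists_Ioo_subset.1 (h1.and h2)
  have hδ : 0 < δ := hδ
  refine ⟨δ / 2, by linarith, ?_, fun s hs hst hsM => ?_⟩
  · have ht := (hball ⟨by linarith, by linarith⟩ : δ / 2 ∈ _).1
    have hterm := fun c => Q.term_outDir a b c x (δ / 2)
    have hab : Q.term b x = Q.term a x := by rw [← Q.val_eq_of_mem ha, ← Q.val_eq_of_mem hb]
    have hle : ∀ m ∈ Q.support, Q.term m (linePt x (outDir a b) (δ / 2)) ≤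
        Q.term a (linePt x (outDir a b) (δ / 2)) ∧ (m ≠ a → m ≠ b →
        Q.term m (linePt x (outDir a b) (δ / 2)) < Q.term a (linePt x (outDir a b) (δ / 2))) := by
      intro m hm
      by_cases hmx : m ∈ Q.maxTerms x
      · have e := hterm m
        have : Q.term m x = Q.term a x := by rw [← Q.val_eq_of_mem ha, ← Q.val_eq_of_mem hmx]
        by_cases hma : m = a
        · subst hma; exact ⟨le_rfl, fun h => absurd rfl h⟩
        by_cases hmb : m = b
        · subst hmb
          rw [TropPoly.area_self_right] at e
          simp only [Int.cast_zero, mul_zero] at e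
          exact ⟨by linarith, fun _ h => absurd rfl h⟩
        · have hp : (0 : ℝ) < (area a b m : ℤ) := by exact_mod_cast hpos m hmx hma hmb
          have := mul_pos (show (0 : ℝ) < δ / 2 by linarith) hp
          exact ⟨by linarith, fun _ _ => by linarith⟩
      · exact ⟨(ht m hm hmx).le, fun _ _ => ht m hm hmx⟩
    have hbt : Q.term b (linePt x (outDir a b) (δ / 2)) =
        Q.term a (linePt x (outDir a b) (δ / 2)) := by
      have e := hterm b
      rw [TropPoly.area_self_right] at e
      simp only [Int.cast_zero, mul_zero] at e
      linarith
    ext m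
    simp only [Set.mem_insert_iff, Set.mem_singleton_iff]
    constructor
    · intro hm
      by_contra hcon
      rw [not_or] at hcon
      have := (hle m hm.1).2 hcon.1 hcon.2
      linarith [hm.2 a ha.1]
    · rintro (rfl | rfl)
      · exact ⟨ha.1, fun m hm => (hle m hm).1⟩
      · exact ⟨hb.1, fun m hm => by rw [hbt]; exact (hle m hm).1⟩
  · have hsx := (hball ⟨hs, by linarith⟩ : s ∈ _).2
    exact hsx ⟨hsM, fun h => hs.ne' ((linePt_eq_self_iff x (outDir_ne_zero hab)).1 h)⟩

/-- A vertex is determined by the three terms of its dual triangle. -/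
lemma eq_of_three_terms {a b c : Fin 2 → ℤ} (harea : area a b c = 1) {x y : Fin 2 → ℝ}
    (hx : {a, b, c} ⊆ Q.maxTerms x) (hy : {a, b, c} ⊆ Q.maxTerms y) : x = y := by
  have hmem : ∀ m ∈ ({a, b, c} : Set (Fin 2 → ℤ)), Q.val x = Q.term m x ∧
      Q.val y = Q.term m y := fun m hm => ⟨Q.val_eq_of_mem (hx hm), Q.val_eq_of_mem (hy hm)⟩
  have ha := hmem a (by simp)
  have hb := hmem b (by simp)
  have hc := hmem c (by simp)
  simp only [TropPoly.term, Fin.sum_univ_two] at ha hb hc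
  have hA : ((b 0 : ℝ) - a 0) * (c 1 - a 1) - (b 1 - a 1) * (c 0 - a 0) = 1 := by
    unfold area at harea
    exact_mod_cast harea
  have e1 : ((b 0 : ℝ) - a 0) * (y 0 - x 0) + (b 1 - a 1) * (y 1 - x 1) = 0 := by linarith
  have e2 : ((c 0 : ℝ) - a 0) * (y 0 - x 0) + (c 1 - a 1) * (y 1 - x 1) = 0 := by linarith
  funext i
  revert i; rw [Fin.forall_fin_two]
  constructor
  · linear_combination (y 0 - x 0) * hA - ((c 1 : ℝ) - a 1) * e1 + ((b 1 : ℝ) - a 1) * e2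
  · linear_combination (y 1 - x 1) * hA + ((c 0 : ℝ) - a 0) * e1 - ((b 0 : ℝ) - a 0) * e2

lemma two_terms_of_facet (hQ : Q.IsSmooth) {p : Fin 2 → ℝ} (hp : Q.cellAt p ∈ Q.facets) :
    ∃ a b, Q.maxTerms p = {a, b} ∧ IsPrimitiveVec (b - a) := by
  obtain ⟨⟨x, hx, hxp⟩, hdim⟩ := hp
  have hph : p ∈ Q.hypersurface :=
    Q.mem_hypersurface_of_mem_cellAt hx (hxp ▸ Q.mem_cellAt_self p)
  rcases hQ p hph with h | ⟨a, b, c, h, harea⟩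
  · exact h
  · -- the cell of a vertex is reduced to that vertex
    exfalso
    have hsing : Q.cellAt p = {p} := by
      ext q
      refine ⟨fun hq => ?_, fun hq => by rw [Set.mem_singleton_iff.1 hq]; exact Q.mem_cellAt_self p⟩
      exact (eq_of_three_terms harea h.symm.subset (h.symm.subset.trans hq)).symm
    rw [hsing] at hdim
    unfold setDim at hdim
    rw [vectorSpan_singleton, finrank_bot] at hdim
    omega

lemma markedCurve_set (hQ : Q.IsSmooth) (e : Set (Fin 2 → ℝ)) :
    {l | ∃ p, p ∉ M ∧ Q.cellAt p ∈ Q.facets ∧ e = edgePiece Q M p ∧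
      l = latticeLength (Q.dualCell p)} =
    {l | l = 1 ∧ ∃ p, p ∉ M ∧ (∃ a b, Q.maxTerms p = {a, b} ∧ IsPrimitiveVec (b - a)) ∧
      e = edgePiece Q M p} := by
  ext l
  constructor
  · rintro ⟨p, hpM, hp, rfl, rfl⟩
    obtain ⟨a, b, h, hab⟩ := two_terms_of_facet hQ hp
    exact ⟨Q.latticeLength_dualCell h hab, p, hpM, ⟨a, b, h, hab⟩, rfl⟩
  · rintro ⟨rfl, p, hpM, ⟨a, b, h, hab⟩, rfl⟩
    exact ⟨p, hpM, TropPoly.cellAt_mem_facets_of_two h hab.ne, rfl,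
      (Q.latticeLength_dualCell h hab).symm⟩

lemma mem_edges_markedCurve (hQ : Q.IsSmooth) {e : Set (Fin 2 → ℝ)} :
    e ∈ (markedCurve Q M).edges ↔ ∃ p, p ∉ M ∧
      (∃ a b, Q.maxTerms p = {a, b} ∧ IsPrimitiveVec (b - a)) ∧ e = edgePiece Q M p := by
  change markedCurve Q M e ≠ 0 ↔ _
  unfold markedCurve
  rw [markedCurve_set hQ]
  constructor
  · intro h
    by_contra hcon
    simp [hcon] at h
  · intro h
    simp [h]

lemma markedCurve_weight (hQ : Q.IsSmooth) {e : Set (Fin 2 → ℝ)}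
    (he : e ∈ (markedCurve Q M).edges) : markedCurve Q M e = 1 := by
  rw [mem_edges_markedCurve hQ] at he
  unfold markedCurve
  rw [markedCurve_set hQ]
  simp [he]

/-- Two points of an edge of `V(Q)` lie in the same piece as soon as they are on the same sides of
the marked points with respect to the lexicographic order. -/
lemma mem_edgePiece_of_lex {p q : Fin 2 → ℝ} {a b : Fin 2 → ℤ} (h : Q.maxTerms p = {a, b})
    (hab : a ≠ b) (hp : p ∉ M) (hq : q ∈ Q.cellAt p)
    (hlex : ∀ m ∈ M, (m 0 < p 0 ∨ m 0 = p 0 ∧ m 1 < p 1) ↔ (m 0 < q 0 ∨ m 0 = q 0 ∧ m 1 < q 1)) :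
    q ∈ edgePiece Q M p := by
  obtain ⟨t, rfl⟩ := TropPoly.exists_linePt_of_mem_cellAt h hab hq
  refine ⟨hq, ?_⟩
  rw [disjoint_openSegment_iff hp]
  intro s hs hsM
  have hl := hlex _ hsM
  have hd : outDir a b 0 ≠ 0 ∨ outDir a b 0 = 0 ∧ outDir a b 1 ≠ 0 := by
    by_contra hcon
    push Not at hcon
    by_cases h0 : outDir a b 0 = 0
    · exact outDir_ne_zero hab (by funext i; fin_cases i; exacts [h0, hcon.2 h0])
    · exact h0 (absurd h0 (by simpa using hcon.1))
  have hcmp : ∀ i, outDir a b i ≠ 0 →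
      (linePt p (outDir a b) s i < p i ∧ linePt p (outDir a b) t i < linePt p (outDir a b) s i) ∨
      (p i < linePt p (outDir a b) s i ∧
        linePt p (outDir a b) s i < linePt p (outDir a b) t i) := by
    intro i hi
    simp only [linePt, toReal, Pi.add_apply, Pi.smul_apply, smul_eq_mul]
    rcases lt_or_gt_of_ne hi with h0 | h0
    · have h0' : ((outDir a b i : ℤ) : ℝ) < 0 := by exact_mod_cast h0
      rcases hs with ⟨h1, h2⟩ | ⟨h1, h2⟩
      · left; constructor <;> nlinarith
      · right; constructor <;> nlinarith
    · have h0' : (0 : ℝ) < ((outDir a b i : ℤ) : ℝ) := by exact_mod_cast h0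
      rcases hs with ⟨h1, h2⟩ | ⟨h1, h2⟩
      · right; constructor <;> nlinarith
      · left; constructor <;> nlinarith
  rcases hd with hd | ⟨h0, hd⟩
  · have := hcmp 0 hd
    grind
  · have := hcmp 1 hd
    have e : ∀ r, linePt p (outDir a b) r 0 = p 0 := by
      intro r; simp [linePt, toReal, h0]
    rw [e, e] at hl
    grind

lemma markedCurve_finite (hQ : Q.IsSmooth) (hM : M.Finite) : (markedCurve Q M).edges.Finite := by
  let key : (Fin 2 → ℝ) → Set (Fin 2 → ℤ) × Set (Fin 2 → ℝ) := fun p =>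
    (Q.maxTerms p, {m | m ∈ M ∧ (m 0 < p 0 ∨ m 0 = p 0 ∧ m 1 < p 1)})
  have hfin : (Set.range key).Finite := by
    refine ((Q.support.finite_toSet.finite_subsets).prod hM.finite_subsets).subset ?_
    rintro _ ⟨p, rfl⟩
    exact ⟨fun _ hm => hm.1, fun _ hm => hm.1⟩
  refine Set.Finite.of_finite_image (f := fun e : Set (Fin 2 → ℝ) =>
    key '' {p | p ∉ M ∧ (∃ a b, Q.maxTerms p = {a, b} ∧ IsPrimitiveVec (b - a)) ∧
      e = edgePiece Q M p}) (hfin.finite_subsets.subset ?_) ?_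
  · rintro _ ⟨e, -, rfl⟩
    exact Set.image_subset_range _ _
  · intro e he e' he' heq
    obtain ⟨p, hpM, ⟨a, b, h, hab⟩, hep⟩ := (mem_edges_markedCurve hQ).1 he
    have hk : key p ∈ key '' {p | p ∉ M ∧
        (∃ a b, Q.maxTerms p = {a, b} ∧ IsPrimitiveVec (b - a)) ∧ e' = edgePiece Q M p} := by
      simp only at heq
      rw [← heq]
      exact ⟨p, ⟨hpM, ⟨a, b, h, hab⟩, hep⟩, rfl⟩
    obtain ⟨q, ⟨hqM, -, heq'⟩, hkq⟩ := hk
    have h1 : Q.maxTerms q = Q.maxTerms p := congrArg Prod.fst hkq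
    have h2 := congrArg Prod.snd hkq
    have hqV : q ∉ curveVertices Q M := by
      rintro (⟨a', b', c', h3, harea⟩ | hq)
      · obtain ⟨n1, n2, n3⟩ := ne_of_area harea
        have : ({a', b', c'} : Set (Fin 2 → ℤ)) = {a, b} := by rw [← h3, h1, h]
        have e1 : a' ∈ ({a, b} : Set (Fin 2 → ℤ)) := by rw [← this]; simp
        have e2 : b' ∈ ({a, b} : Set (Fin 2 → ℤ)) := by rw [← this]; simp
        have e3 : c' ∈ ({a, b} : Set (Fin 2 → ℤ)) := by rw [← this]; simp
        simp only [Set.mem_insert_iff, Set.mem_singleton_iff] at e1 e2 e3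
        grind
      · exact hqM hq
    have hmem : q ∈ edgePiece Q M p := by
      refine mem_edgePiece_of_lex h hab.ne hpM (show Q.maxTerms p ⊆ _ by rw [h1]) ?_
      intro m hm
      have := Set.ext_iff.1 h2 m
      exact ⟨fun h => (this.2 ⟨hm, h⟩).2, fun h => (this.1 ⟨hm, h⟩).2⟩
    rw [hep, heq', edgePiece_eq_of_mem hQ hM h hab hpM hmem hqV]

lemma curveVertices_finite (hM : M.Finite) : (curveVertices Q M).Finite := by
  refine Set.Finite.union ?_ hM
  refine Set.Finite.of_finite_image (f := Q.maxTerms)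
    (Q.support.finite_toSet.finite_subsets.subset ?_) ?_
  · rintro _ ⟨x, -, rfl⟩
    exact fun _ hm => hm.1
  · rintro x ⟨a, b, c, h, harea⟩ y - hxy
    exact eq_of_three_terms harea h.symm.subset (by rw [← h]; exact hxy.subset)

lemma edgePiece_subset_hypersurface {p : Fin 2 → ℝ} {a b : Fin 2 → ℤ}
    (h : Q.maxTerms p = {a, b}) (hab : a ≠ b) : edgePiece Q M p ⊆ Q.hypersurface := fun _ hq =>
  Q.mem_hypersurface_of_mem_cellAt
    (show (Q.maxTerms p).Nontrivial by rw [h]; exact Set.nontrivial_pair hab) hq.1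

lemma isPrimitiveVec_of_isSmooth (hQ : Q.IsSmooth) {x : Fin 2 → ℝ} {a b : Fin 2 → ℤ}
    (ha : a ∈ Q.maxTerms x) (hb : b ∈ Q.maxTerms x) (hab : a ≠ b) : IsPrimitiveVec (b - a) := by
  have hneg : ∀ {v w : Fin 2 → ℤ}, IsPrimitiveVec (v - w) → IsPrimitiveVec (w - v) := by
    intro v w h; rw [← neg_sub]; exact h.neg
  rcases hQ x ⟨a, ha, b, hb, hab⟩ with ⟨a', b', h, hp⟩ | ⟨a', b', c', h, harea⟩
  · rw [h] at ha hb
    rcases ha with rfl | rfl <;> rcases hb with rfl | rfl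
    exacts [absurd rfl hab, hp, hneg hp, absurd rfl hab]
  · have e1 : IsPrimitiveVec (b' - a') := isPrimitiveVec_of_area (c := c') (by simp [harea])
    have e2 : IsPrimitiveVec (c' - b') :=
      isPrimitiveVec_of_area (c := a') (by rw [area_rotate]; simp [harea])
    have e3 : IsPrimitiveVec (a' - c') :=
      isPrimitiveVec_of_area (c := b') (by rw [area_rotate, area_rotate]; simp [harea])
    rw [h] at ha hb
    rcases ha with rfl | rfl | rfl <;> rcases hb with rfl | rfl | rfl
    exacts [absurd rfl hab, e1, hneg e3, hneg e1, absurd rfl hab, e2, e3, hneg e2, absurd rfl hab]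

/-- In a smooth curve, distinct maximal terms that are weakly in counterclockwise position are
strictly so. -/
lemma area_ne_zero_of_isSmooth (hQ : Q.IsSmooth) {x : Fin 2 → ℝ} {a b c : Fin 2 → ℤ}
    (ha : a ∈ Q.maxTerms x) (hb : b ∈ Q.maxTerms x) (hc : c ∈ Q.maxTerms x) (hab : a ≠ b)
    (hca : c ≠ a) (hcb : c ≠ b) : area a b c ≠ 0 := by
  rcases hQ x ⟨a, ha, b, hb, hab⟩ with ⟨a', b', h, hp⟩ | ⟨a', b', c', h, harea⟩
  · rw [h] at ha hb hc
    simp only [Set.mem_insert_iff, Set.mem_singleton_iff] at ha hb hc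
    grind
  · have e1 : area b' c' a' = 1 := by rw [area_rotate, harea]
    have e2 : area c' a' b' = 1 := by rw [area_rotate, e1]
    have e3 : area b' a' c' = -1 := by rw [area_swap, harea]
    have e4 : area c' b' a' = -1 := by rw [area_swap, e1]
    have e5 : area a' c' b' = -1 := by rw [area_swap, e2]
    rw [h] at ha hb hc
    rcases ha with rfl | rfl | rfl <;> rcases hb with rfl | rfl | rfl <;>
      rcases hc with rfl | rfl | rfl <;>
        first
        | exact absurd rfl hab
        | exact absurd rfl hca
        | exact absurd rfl hcb
        | omega

lemma exists_edge_of_germ (hQ : Q.IsSmooth) (hM : M.Finite) {x : Fin 2 → ℝ} {d : Fin 2 → ℤ}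
    (hd : d ∈ germDirs Q x) :
    ∃ c ∈ (markedCurve Q M).edges, x ∈ c ∧ ∃ t > 0, linePt x d t ∈ c := by
  obtain ⟨a, ha, b, hb, hab, hpos, rfl⟩ := mem_germDirs.1 hd
  obtain ⟨t, ht, hmax, hfree⟩ := exists_germ hM ha hb hab hpos
  have hprim := isPrimitiveVec_of_isSmooth hQ ha hb hab
  have htM : linePt x (outDir a b) t ∉ M := hfree t ht le_rfl
  refine ⟨edgePiece Q M (linePt x (outDir a b) t), (mem_edges_markedCurve hQ).2
    ⟨_, htM, ⟨a, b, hmax, hprim⟩, rfl⟩, ?_, t, ht, ?_⟩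
  · refine ⟨show Q.maxTerms _ ⊆ Q.maxTerms x by
      rw [hmax, Set.insert_subset_iff, Set.singleton_subset_iff]; exact ⟨ha, hb⟩, ?_⟩
    have := disjoint_openSegment_iff htM (outDir a b) (-t)
    rw [linePt_linePt, add_neg_cancel, linePt_zero] at this
    rw [this]
    intro s hs
    rw [linePt_linePt]
    apply hfree <;> rcases hs with hs | hs <;> linarith [hs.1, hs.2]
  · exact (edgePiece_edgeAt hM hmax hprim htM).base_mem

lemma germDirs_sum (hQ : Q.IsSmooth) {x : Fin 2 → ℝ} (hx : x ∈ Q.hypersurface) :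
    ∑ d ∈ germDirs Q x, d = 0 := by
  rcases hQ x hx with ⟨a, b, h, hp⟩ | ⟨a, b, c, h, harea⟩
  · rw [germDirs_of_two h hp.ne, Finset.sum_pair, outDir_swap, neg_add_cancel]
    intro he
    rw [outDir_swap] at he
    have h0 : outDir b a = 0 := by
      funext i
      have := congrFun he i
      simp only [Pi.neg_apply] at this
      have h2 : outDir b a i = 0 := by linarith
      exact h2
    exact outDir_ne_zero hp.ne.symm h0
  · have n1 := (outDir_ne_of_area harea).2.1
    have n2 := (outDir_ne_of_area (show area b c a = 1 by rw [area_rotate, harea])).2.1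
    have n3 := (outDir_ne_of_area (show area c a b = 1 by rw [area_rotate, area_rotate, harea])).2.1
    rw [germDirs_of_three h harea, Finset.sum_insert (by simp [n1, n3.symm]),
      Finset.sum_pair n2, ← add_assoc, outDir_sum]

lemma germDirs_minimal (hQ : Q.IsSmooth) {x : Fin 2 → ℝ} (hx : x ∈ Q.hypersurface)
    (J : Finset (Fin 2 → ℤ)) (hJ : J ⊆ germDirs Q x) (hne : J.Nonempty) (hsum : ∑ d ∈ J, d = 0) :
    J = germDirs Q x := by
  classical
  rcases hQ x hx with ⟨a, b, h, hp⟩ | ⟨a, b, c, h, harea⟩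
  · rw [germDirs_of_two h hp.ne] at hJ ⊢
    have n1 := outDir_ne_zero hp.ne
    have n2 := outDir_ne_zero hp.ne.symm
    apply Finset.Subset.antisymm hJ
    by_cases h1 : outDir a b ∈ J <;> by_cases h2 : outDir b a ∈ J
    · exact Finset.insert_subset h1 (Finset.singleton_subset_iff.2 h2)
    · have : J = {outDir a b} := by ext d; have := @hJ d; simp at this ⊢; grind
      rw [this, Finset.sum_singleton] at hsum; exact absurd hsum n1
    · have : J = {outDir b a} := by ext d; have := @hJ d; simp at this ⊢; grind
      rw [this, Finset.sum_singleton] at hsum; exact absurd hsum n2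
    · obtain ⟨d, hd⟩ := hne
      have := hJ hd; simp at this; grind
  · have harea2 : area b c a = 1 := by rw [area_rotate, harea]
    have harea3 : area c a b = 1 := by rw [area_rotate, harea2]
    obtain ⟨z1, n1, m1⟩ := outDir_ne_of_area harea
    obtain ⟨z2, n2, m2⟩ := outDir_ne_of_area harea2
    obtain ⟨z3, n3, m3⟩ := outDir_ne_of_area harea3
    rw [germDirs_of_three h harea] at hJ ⊢
    apply Finset.Subset.antisymm hJ
    have hpair : ∀ u v : Fin 2 → ℤ, u ≠ v → u ≠ -v → J ≠ {u, v} := by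
      rintro u v huv huv' rfl
      rw [Finset.sum_pair huv] at hsum
      exact huv' (eq_neg_of_add_eq_zero_left hsum)
    have hsing : ∀ u : Fin 2 → ℤ, u ≠ 0 → J ≠ {u} := by
      rintro u hu rfl
      rw [Finset.sum_singleton] at hsum
      exact hu hsum
    have hJ' : ∀ d ∈ J, d = outDir a b ∨ d = outDir b c ∨ d = outDir c a := by
      intro d hd; simpa using hJ hd
    intro d hd
    by_cases h1 : outDir a b ∈ J <;> by_cases h2 : outDir b c ∈ J <;> by_cases h3 : outDir c a ∈ J
    · simp only [Finset.mem_insert, Finset.mem_singleton] at hd; grind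
    · exact absurd (by ext; simp; grind) (hpair _ _ n1 m1)
    · exact absurd (by ext; simp; grind) (hpair _ _ n3 m3)
    · exact absurd (by ext; simp; grind) (hsing _ z1)
    · exact absurd (by ext; simp; grind) (hpair _ _ n2 m2)
    · exact absurd (by ext; simp; grind) (hsing _ z2)
    · exact absurd (by ext; simp; grind) (hsing _ z3)
    · obtain ⟨e, he⟩ := hne
      have := hJ' e he; grind

lemma markedCurve_carrier (hQ : Q.IsSmooth) (hM : M.Finite) :
    (markedCurve Q M).carrier = Q.hypersurface := by
  ext x
  rw [mem_carrier]
  constructor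
  · rintro ⟨c, hc, hx⟩
    obtain ⟨p, hp, ⟨a, b, h, hab⟩, rfl⟩ := (mem_edges_markedCurve hQ).1 hc
    exact edgePiece_subset_hypersurface h hab.ne hx
  · intro hx
    obtain ⟨d, hd⟩ : (germDirs Q x).Nonempty := by
      rcases hQ x hx with ⟨a, b, h, hp⟩ | ⟨a, b, c, h, harea⟩
      · rw [germDirs_of_two h hp.ne]; simp
      · rw [germDirs_of_three h harea]; simp
    obtain ⟨c, hc, hxc, -⟩ := exists_edge_of_germ hQ hM hd
    exact ⟨c, hc, hxc⟩

/-- A smooth planar tropical curve with finitely many marked points is a curve with prescribed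
germs. -/
theorem markedCurve_germCurve (hQ : Q.IsSmooth) (hM : M.Finite) (hMQ : M ⊆ Q.hypersurface) :
    GermCurve (markedCurve Q M) M (curveVertices Q M) (germDirs Q) where
  finite := markedCurve_finite hQ hM
  weight_one c hc := markedCurve_weight hQ hc
  rational c hc := by
    obtain ⟨p, hp, ⟨a, b, h, hab⟩, rfl⟩ := (mem_edges_markedCurve hQ).1 hc
    exact (edgePiece_edgeAt hM h hab hp).isRationalEdge
  finite_vertices := curveVertices_finite hM
  marked_subset := Set.subset_union_right
  vertices_subset := by
    rw [markedCurve_carrier hQ hM]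
    rintro x (⟨a, b, c, h, harea⟩ | hx)
    · exact ⟨a, by rw [h]; simp, b, by rw [h]; simp, (ne_of_area harea).1⟩
    · exact hMQ hx
  vertex_iff c hc x hx := by
    obtain ⟨p, hp, ⟨a, b, h, hab⟩, rfl⟩ := (mem_edges_markedCurve hQ).1 hc
    exact edgePiece_vertex_iff hQ hM h hab hp hx
  unique c hc c' hc' x hx hx' hxV := by
    obtain ⟨p, hp, ⟨a, b, h, hab⟩, rfl⟩ := (mem_edges_markedCurve hQ).1 hc
    obtain ⟨p', hp', ⟨a', b', h', hab'⟩, rfl⟩ := (mem_edges_markedCurve hQ).1 hc'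
    rw [edgePiece_eq_of_mem hQ hM h hab hp hx hxV, edgePiece_eq_of_mem hQ hM h' hab' hp' hx' hxV]
  dirs_primitive x _ d hd := by
    obtain ⟨a, ha, b, hb, hab, -, rfl⟩ := mem_germDirs.1 hd
    exact isPrimitiveVec_outDir (isPrimitiveVec_of_isSmooth hQ ha hb hab)
  dirs_sum x hx := germDirs_sum hQ (by rwa [markedCurve_carrier hQ hM] at hx)
  dirs_minimal x hx J := germDirs_minimal hQ (by rwa [markedCurve_carrier hQ hM] at hx) J
  dirs_vertex x hx hxM d hd hd' := by
    rcases hx with ⟨a, b, c, h, harea⟩ | hx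
    · have harea2 : area b c a = 1 := by rw [area_rotate, harea]
      have harea3 : area c a b = 1 := by rw [area_rotate, harea2]
      obtain ⟨z1, n1, m1⟩ := outDir_ne_of_area harea
      obtain ⟨z2, n2, m2⟩ := outDir_ne_of_area harea2
      obtain ⟨z3, n3, m3⟩ := outDir_ne_of_area harea3
      have hz : ∀ u : Fin 2 → ℤ, u ≠ 0 → -u ≠ u := fun u hu h => hu (neg_eq_self.1 h)
      rw [germDirs_of_three h harea] at hd hd'
      simp only [Finset.mem_insert, Finset.mem_singleton] at hd hd'
      have := hz _ z1
      have := hz _ z2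
      have := hz _ z3
      have m1' := mt (neg_eq_iff_eq_neg.2) m1.symm
      have m2' := mt (neg_eq_iff_eq_neg.2) m2.symm
      have m3' := mt (neg_eq_iff_eq_neg.2) m3.symm
      have m1'' : -outDir a b ≠ outDir b c := fun h => m1 (by rw [← h, neg_neg])
      have m2'' : -outDir b c ≠ outDir c a := fun h => m2 (by rw [← h, neg_neg])
      have m3'' : -outDir c a ≠ outDir a b := fun h => m3 (by rw [← h, neg_neg])
      rcases hd with rfl | rfl | rfl <;> rcases hd' with h | h | h <;> simp_all
    · exact hxM hx
  germ_of_edge c hc x hx y hy hyx := by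
    obtain ⟨p, hp, ⟨a, b, h, hab⟩, rfl⟩ := (mem_edges_markedCurve hQ).1 hc
    have hE := edgePiece_edgeAt hM h hab hp
    -- for the right order of `a` and `b`, the direction from `x` to `y` is dual to `[a, b]`
    have key : ∀ a b : Fin 2 → ℤ, Q.maxTerms p = {a, b} → a ≠ b → ∀ t > 0,
        y = linePt x (outDir a b) t → ∃ d ∈ germDirs Q x, ∃ t > 0, y = linePt x d t := by
      intro a b h hab t ht hyt
      have hax : a ∈ Q.maxTerms x := hx.1 (by rw [h]; simp)
      have hbx : b ∈ Q.maxTerms x := hx.1 (by rw [h]; simp)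
      have hay : a ∈ Q.maxTerms y := hy.1 (by rw [h]; simp)
      refine ⟨outDir a b, mem_germDirs.2 ⟨a, hax, b, hbx, hab, fun c hc hca hcb => ?_, rfl⟩,
        t, ht, hyt⟩
      have e := Q.term_outDir a b c x t
      rw [← hyt] at e
      have h1 := hay.2 c hc.1
      have h2 := hc.2 a hax.1
      have h3 : 0 ≤ t * ((area a b c : ℤ) : ℝ) := by linarith
      have h4 : (0 : ℝ) ≤ ((area a b c : ℤ) : ℝ) := nonneg_of_mul_nonneg_right h3 ht
      have h5 : 0 ≤ area a b c := by exact_mod_cast h4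
      exact lt_of_le_of_ne h5 (area_ne_zero_of_isSmooth hQ hax hbx hc hab hca hcb).symm
    have hx' := hx
    have hy' := hy
    rw [hE.eq] at hx' hy'
    obtain ⟨s, -, hs⟩ := hx'
    obtain ⟨t, -, ht⟩ := hy'
    have hst : y = linePt x (outDir a b) (t - s) := by
      rw [← hs, linePt_linePt, add_sub_cancel, ht]
    rcases lt_trichotomy s t with hlt | rfl | hlt
    · exact key a b h hab.ne (t - s) (sub_pos.2 hlt) hst
    · rw [sub_self, linePt_zero] at hst
      exact absurd hst hyx
    · refine key b a (by rw [h, Set.pair_comm]) hab.ne.symm (s - t) (sub_pos.2 hlt) ?_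
      rw [outDir_swap, linePt_neg, neg_sub, hst]
  edge_of_germ x _ d hd := exists_edge_of_germ hQ hM hd

end GermDirs


/-! ### Convex piecewise linear functions of one variable -/

section PiecewiseLinear

open Finset

/-- The sum of the first `k` of the affine functions `t - b j`. -/
def lin (k : ℕ) (b : ℕ → ℝ) (t : ℝ) : ℝ := ∑ j ∈ range k, (t - b j)

/-- The convex piecewise linear function with breaks `b 0, ..., b (n - 1)` vanishing at `-∞`. -/
def pl (n : ℕ) (b : ℕ → ℝ) (t : ℝ) : ℝ := ∑ j ∈ range n, max 0 (t - b j)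

/-- The point `t` lies between the breaks `b (k - 1)` and `b k`. -/
def Peak (n : ℕ) (b : ℕ → ℝ) (k : ℕ) (t : ℝ) : Prop :=
  k ≤ n ∧ (∀ j < k, b j ≤ t) ∧ ∀ j, k ≤ j → j < n → t ≤ b j

/-- The breaks `b 0, ..., b (n - 1)` are increasing. -/
def Increasing (n : ℕ) (b : ℕ → ℝ) : Prop := ∀ i j, i < j → j < n → b i < b j

variable {n : ℕ} {b : ℕ → ℝ}

lemma increasing_of_succ (h : ∀ k, k + 1 < n → b k < b (k + 1)) : Increasing n b := by
  intro i j hij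
  induction j, hij using Nat.le_induction with
  | base => exact fun hj => h i hj
  | succ j hij ih => exact fun hj => (ih (by omega)).trans (h j hj)

lemma Increasing.le (h : Increasing n b) {i j : ℕ} (hij : i ≤ j) (hj : j < n) : b i ≤ b j := by
  rcases hij.lt_or_eq with h' | rfl
  · exact (h i j h' hj).le
  · exact le_rfl

lemma pl_eq_of_split {k : ℕ} (hk : k ≤ n) (t : ℝ) : pl n b t - lin k b t =
    ∑ j ∈ range n, (max 0 (t - b j) - if j < k then t - b j else 0) := by
  rw [Finset.sum_sub_distrib, pl, lin, ← Finset.sum_filter]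
  congr 2
  ext j; simp only [mem_range, mem_filter]; omega

lemma split_term_nonneg (k j : ℕ) (t : ℝ) :
    0 ≤ max 0 (t - b j) - if j < k then t - b j else 0 := by
  split_ifs
  · exact sub_nonneg.2 (le_max_right _ _)
  · rw [sub_zero]; exact le_max_left _ _

lemma lin_le_pl {k : ℕ} (hk : k ≤ n) (t : ℝ) : lin k b t ≤ pl n b t := by
  rw [← sub_nonneg, pl_eq_of_split hk]
  exact Finset.sum_nonneg fun j _ => split_term_nonneg k j t

lemma lin_eq_pl_iff {k : ℕ} (hk : k ≤ n) (t : ℝ) : lin k b t = pl n b t ↔ Peak n b k t := by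
  rw [eq_comm, ← sub_eq_zero, pl_eq_of_split hk,
    Finset.sum_eq_zero_iff_of_nonneg fun j _ => split_term_nonneg k j t]
  constructor
  · intro h
    refine ⟨hk, fun j hj => ?_, fun j hj hjn => ?_⟩
    · have := h j (mem_range.2 (by omega))
      rw [if_pos hj, sub_eq_zero, max_eq_right_iff] at this
      linarith
    · have := h j (mem_range.2 hjn)
      rw [if_neg (by omega), sub_zero, max_eq_left_iff] at this
      linarith
  · rintro ⟨-, h1, h2⟩ j hj
    split_ifs with hjk
    · rw [sub_eq_zero, max_eq_right_iff]; linarith [h1 j hjk]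
    · rw [sub_zero, max_eq_left_iff]; linarith [h2 j (by omega) (mem_range.1 hj)]

lemma Peak.pl_eq {k : ℕ} {t : ℝ} (h : Peak n b k t) : pl n b t = lin k b t :=
  ((lin_eq_pl_iff h.1 t).2 h).symm

/-- A peak all of whose later breaks are strictly larger. -/
lemma exists_peak (hb : Increasing n b) (t : ℝ) :
    ∃ k, Peak n b k t ∧ ∀ j, k ≤ j → j < n → t < b j := by
  classical
  have hex : ∃ k, k = n ∨ t < b k := ⟨n, Or.inl rfl⟩
  have hlt : ∀ j, Nat.find hex ≤ j → j < n → t < b j := by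
    intro j hj hjn
    rcases Nat.find_spec hex with h | h
    · omega
    · exact h.trans_le (hb.le hj hjn)
  refine ⟨Nat.find hex, ⟨Nat.find_min' hex (Or.inl rfl), fun j hj => ?_,
    fun j hj hjn => (hlt j hj hjn).le⟩, hlt⟩
  have := Nat.find_min hex hj
  push Not at this
  exact this.2

lemma Peak.eq_of_lt {k k' : ℕ} {t : ℝ} (h : Peak n b k t)
    (h1 : ∀ j < n, b j ≠ t) (h' : Peak n b k' t) : k = k' := by
  rcases lt_trichotomy k k' with hlt | rfl | hlt
  · exact absurd (le_antisymm (h'.2.1 k hlt) (h.2.2 k le_rfl (hlt.trans_le h'.1)))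
      (h1 k (hlt.trans_le h'.1))
  · rfl
  · exact absurd (le_antisymm (h.2.1 k' hlt) (h'.2.2 k' le_rfl (hlt.trans_le h.1)))
      (h1 k' (hlt.trans_le h.1))

/-- At a break, exactly two affine pieces meet. -/
lemma peak_at_break (hb : Increasing n b) {k : ℕ} (hk : k < n) (k' : ℕ) :
    Peak n b k' (b k) ↔ k' = k ∨ k' = k + 1 := by
  constructor
  · rintro ⟨h1, h2, h3⟩
    by_contra hcon
    rw [not_or] at hcon
    rcases lt_or_ge k' k with hlt | hge
    · exact absurd (h3 k' le_rfl (hlt.trans hk)) (not_le.2 (hb _ _ hlt hk))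
    · exact absurd (h2 (k + 1) (by omega)) (not_le.2 (hb _ _ (by omega) (by omega)))
  · rintro (rfl | rfl)
    · exact ⟨hk.le, fun j hj => (hb _ _ hj hk).le, fun j hj hjn => hb.le hj hjn⟩
    · exact ⟨hk, fun j hj => hb.le (by omega) hk, fun j hj hjn => (hb _ _ (by omega) hjn).le⟩

/-- The slope of `pl n b` to the right of `t`. -/
noncomputable def slopeR (n : ℕ) (b : ℕ → ℝ) (t : ℝ) : ℕ := #{j ∈ range n | b j ≤ t}

/-- The slope of `pl n b` to the left of `t`. -/
noncomputable def slopeL (n : ℕ) (b : ℕ → ℝ) (t : ℝ) : ℕ := #{j ∈ range n | b j < t}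

lemma pl_right {t s : ℝ} (hts : t ≤ s) (h : ∀ j < n, b j ≤ t ∨ s ≤ b j) :
    pl n b s = pl n b t + (s - t) * slopeR n b t := by
  have : pl n b s - pl n b t = ∑ j ∈ range n, if b j ≤ t then s - t else 0 := by
    rw [pl, pl, ← Finset.sum_sub_distrib]
    refine Finset.sum_congr rfl fun j hj => ?_
    rcases h j (mem_range.1 hj) with h1 | h1
    · rw [if_pos h1, max_eq_right (by linarith), max_eq_right (by linarith)]; ring
    · rw [max_eq_left (by linarith), max_eq_left (by linarith)]
      split_ifs with h2
      · linarith
      · ring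
  rw [← Finset.sum_filter, Finset.sum_const, nsmul_eq_mul] at this
  unfold slopeR
  linarith

lemma pl_left {t s : ℝ} (hts : s ≤ t) (h : ∀ j < n, t ≤ b j ∨ b j ≤ s) :
    pl n b s = pl n b t + (s - t) * slopeL n b t := by
  have : pl n b s - pl n b t = ∑ j ∈ range n, if b j < t then s - t else 0 := by
    rw [pl, pl, ← Finset.sum_sub_distrib]
    refine Finset.sum_congr rfl fun j hj => ?_
    rcases h j (mem_range.1 hj) with h1 | h1
    · rw [if_neg (by linarith), max_eq_left (by linarith), max_eq_left (by linarith)]; ring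
    · rw [max_eq_right (by linarith), max_eq_right (by linarith)]
      split_ifs with h2
      · ring
      · linarith
  rw [← Finset.sum_filter, Finset.sum_const, nsmul_eq_mul] at this
  unfold slopeL
  linarith

lemma slopeR_eq_of_ne {t : ℝ} (h : ∀ j < n, b j ≠ t) : slopeR n b t = slopeL n b t := by
  unfold slopeR slopeL
  congr 1
  ext j
  simp only [mem_filter, mem_range]
  exact ⟨fun hj => ⟨hj.1, lt_of_le_of_ne hj.2 (h j hj.1)⟩, fun hj => ⟨hj.1, hj.2.le⟩⟩

lemma slopeR_eq_of_peak {k : ℕ} {t : ℝ} (h1 : ∀ j < k, b j ≤ t) (hk : k ≤ n)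
    (h2 : ∀ j, k ≤ j → j < n → t < b j) : slopeR n b t = k := by
  unfold slopeR
  have : {j ∈ range n | b j ≤ t} = range k := by
    ext j
    simp only [mem_filter, mem_range]
    constructor
    · rintro ⟨hj, hjt⟩
      by_contra hcon
      exact absurd hjt (not_le.2 (h2 j (not_lt.1 hcon) hj))
    · exact fun hj => ⟨by omega, h1 j hj⟩
  rw [this, card_range]

lemma slopeL_eq_of_peak {k : ℕ} {t : ℝ} (h1 : ∀ j < k, b j < t) (hk : k ≤ n)
    (h2 : ∀ j, k ≤ j → j < n → t ≤ b j) : slopeL n b t = k := by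
  unfold slopeL
  have : {j ∈ range n | b j < t} = range k := by
    ext j
    simp only [mem_filter, mem_range]
    constructor
    · rintro ⟨hj, hjt⟩
      by_contra hcon
      exact absurd hjt (not_lt.2 (h2 j (not_lt.1 hcon) hj))
    · exact fun hj => ⟨by omega, h1 j hj⟩
  rw [this, card_range]

/-- The slope jumps by one at a break. -/
lemma slopeR_break (hb : Increasing n b) {k : ℕ} (hk : k < n) :
    slopeR n b (b k) = k + 1 ∧ slopeL n b (b k) = k :=
  ⟨slopeR_eq_of_peak (fun j hj => hb.le (by omega) hk) hk fun j hj hjn => hb _ _ (by omega) hjn,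
    slopeL_eq_of_peak (fun j hj => hb _ _ hj hk) hk.le fun j hj hjn => hb.le hj hjn⟩

lemma pl_eq_zero {t : ℝ} (h : ∀ j < n, t ≤ b j) : pl n b t = 0 :=
  Finset.sum_eq_zero fun j hj => max_eq_left (by linarith [h j (mem_range.1 hj)])

lemma pl_nonneg (t : ℝ) : 0 ≤ pl n b t := Finset.sum_nonneg fun _ _ => le_max_left _ _

end PiecewiseLinear

/-! ### Tropical polynomials with monomials in rows -/

namespace TropPoly

/-- The first coordinate at which the monomials `(i, j)` and `(i + 1, j)` of `R` agree. -/
def brk (R : TropPoly 2) (j i : ℕ) : ℝ := R.coeff (ipt i j) - R.coeff (ipt (i + 1) j)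

/-- The exponents of `R` are the lattice points `(k, j)` with `j < J` and `k ≤ N j`, and the breaks
of each row are increasing. -/
structure HasRows (R : TropPoly 2) (J : ℕ) (N : ℕ → ℕ) : Prop where
  mem_support_iff : ∀ m, m ∈ R.support ↔ ∃ j < J, ∃ k ≤ N j, m = ipt k j
  increasing : ∀ j < J, Increasing (N j) (R.brk j)

/-- The maximum of the monomials in the row `j`. -/
def rowVal (R : TropPoly 2) (N : ℕ → ℕ) (j : ℕ) (p : Fin 2 → ℝ) : ℝ :=
  R.coeff (ipt 0 j) + pl (N j) (R.brk j) (p 0) + j * p 1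

lemma term_ipt (R : TropPoly 2) (k j : ℕ) (p : Fin 2 → ℝ) :
    R.term (ipt k j) p = R.coeff (ipt 0 j) + lin k (R.brk j) (p 0) + j * p 1 := by
  have h : R.coeff (ipt k j) + k * p 0 = R.coeff (ipt 0 j) + lin k (R.brk j) (p 0) := by
    induction k with
    | zero => simp [lin]
    | succ k ih =>
      rw [lin, Finset.sum_range_succ]
      unfold lin at ih
      simp only [brk] at ih ⊢
      push_cast
      linarith
  simp only [term, Fin.sum_univ_two, ipt_zero, ipt_one, Int.cast_natCast]
  linarith

variable {R : TropPoly 2} {J : ℕ} {N : ℕ → ℕ}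

lemma HasRows.term_le_rowVal {k j : ℕ} (hk : k ≤ N j) (p : Fin 2 → ℝ) :
    R.term (ipt k j) p ≤ R.rowVal N j p := by
  rw [term_ipt, rowVal]
  linarith [lin_le_pl (b := R.brk j) hk (p 0)]

lemma HasRows.rowVal_le_val (hR : R.HasRows J N) {j : ℕ} (hj : j < J) (p : Fin 2 → ℝ) :
    R.rowVal N j p ≤ R.val p := by
  obtain ⟨k, hk, -⟩ := exists_peak (hR.increasing j hj) (p 0)
  have := R.term_le_val ((hR.mem_support_iff _).2 ⟨j, hj, k, hk.1, rfl⟩) p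
  rw [term_ipt, ← hk.pl_eq] at this
  exact this

lemma HasRows.val_le (hR : R.HasRows J N) {p : Fin 2 → ℝ} {v : ℝ}
    (h : ∀ j < J, R.rowVal N j p ≤ v) : R.val p ≤ v := by
  obtain ⟨m, hm⟩ := R.maxTerms_nonempty p
  obtain ⟨j, hj, k, hk, rfl⟩ := (hR.mem_support_iff _).1 hm.1
  rw [R.val_eq_of_mem hm]
  exact (HasRows.term_le_rowVal hk p).trans (h j hj)

lemma HasRows.mem_maxTerms_iff (hR : R.HasRows J N) {m : Fin 2 → ℤ} {p : Fin 2 → ℝ} :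
    m ∈ R.maxTerms p ↔ ∃ j < J, ∃ k, m = ipt k j ∧ Peak (N j) (R.brk j) k (p 0) ∧
      ∀ j' < J, R.rowVal N j' p ≤ R.rowVal N j p := by
  rw [R.mem_maxTerms_iff]
  constructor
  · rintro ⟨hm, hval⟩
    obtain ⟨j, hj, k, hk, rfl⟩ := (hR.mem_support_iff _).1 hm
    have h1 := HasRows.term_le_rowVal (R := R) hk p
    refine ⟨j, hj, k, rfl, ?_, fun j' hj' => ?_⟩
    · rw [← lin_eq_pl_iff hk]
      have h2 := hR.rowVal_le_val hj p
      have h3 : R.term (ipt k j) p = R.rowVal N j p := le_antisymm h1 (by linarith)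
      rw [term_ipt, rowVal] at h3
      linarith
    · have := hR.rowVal_le_val hj' p
      linarith
  · rintro ⟨j, hj, k, rfl, hk, h⟩
    refine ⟨(hR.mem_support_iff _).2 ⟨j, hj, k, hk.1, rfl⟩, ?_⟩
    have h3 : R.term (ipt k j) p = R.rowVal N j p := by rw [term_ipt, rowVal, hk.pl_eq]
    rw [h3]
    exact le_antisymm (hR.rowVal_le_val hj p) (hR.val_le h)

lemma HasRows.ipt_mem_maxTerms_iff (hR : R.HasRows J N) {k j : ℕ} {p : Fin 2 → ℝ} :
    ipt k j ∈ R.maxTerms p ↔ j < J ∧ Peak (N j) (R.brk j) k (p 0) ∧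
      ∀ j' < J, R.rowVal N j' p ≤ R.rowVal N j p := by
  rw [hR.mem_maxTerms_iff]
  constructor
  · rintro ⟨j', hj, k', he, h⟩
    obtain ⟨rfl, rfl⟩ := ipt_inj.1 he
    exact ⟨hj, h⟩
  · rintro ⟨hj, h⟩
    exact ⟨j, hj, k, rfl, h⟩

section Breaks

variable {i j : ℕ} {p : Fin 2 → ℝ}

lemma term_succ (R : TropPoly 2) (i j : ℕ) (p : Fin 2 → ℝ) :
    R.term (ipt (i + 1) j) p = R.term (ipt i j) p + (p 0 - R.brk j i) := by
  simp only [term, Fin.sum_univ_two, ipt_zero, ipt_one, brk]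
  push_cast; ring

lemma eq_brk (h : ipt i j ∈ R.maxTerms p) (h' : ipt (i + 1) j ∈ R.maxTerms p) :
    p 0 = R.brk j i := by
  have e := R.term_succ i j p
  have e1 := R.val_eq_of_mem h
  have e2 := R.val_eq_of_mem h'
  linarith

lemma term_lt_of_notMem {m m' : Fin 2 → ℤ} (h : m ∈ R.maxTerms p) (hm' : m' ∈ R.support)
    (h' : m' ∉ R.maxTerms p) : R.term m' p < R.term m p :=
  lt_of_le_of_ne (h.2 m' hm') fun he => h' ⟨hm', fun m'' hm'' => he ▸ h.2 m'' hm''⟩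

lemma lt_brk (h : ipt i j ∈ R.maxTerms p) (hs : ipt (i + 1) j ∈ R.support)
    (h' : ipt (i + 1) j ∉ R.maxTerms p) : p 0 < R.brk j i := by
  have e := R.term_succ i j p
  have := term_lt_of_notMem h hs h'
  linarith

lemma brk_lt (h : ipt (i + 1) j ∈ R.maxTerms p) (hs : ipt i j ∈ R.support)
    (h' : ipt i j ∉ R.maxTerms p) : R.brk j i < p 0 := by
  have e := R.term_succ i j p
  have := term_lt_of_notMem h hs h'
  linarith

end Breaks

end TropPoly


/-! ### The normal form of the configuration -/

/-- The numerical data describing, up to additive constants, the polynomials and marked points of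
the configuration: `β` and `γ` are the breaks of the rows `0` and `1` of `Q`, `β` and `φ` those of
`f`, and `σ` is the list of first coordinates of the last marked points. The numbers `u₀` and `l₀`
are the constant terms of the upper and lower boundaries of `V(Q)`, and `w₀` and `f₂` those of the
rows `1` and `2` of `f`, when `f` is normalized to have the sum of the two boundaries as its row
`0`; the line `V(g)` is at height `ε`. -/
structure Config where
  n : ℕ
  β : ℕ → ℝ
  γ : ℕ → ℝ
  φ : ℕ → ℝ
  σ : ℕ → ℝ
  u₀ : ℝ
  l₀ : ℝ
  w₀ : ℝ
  f₂ : ℝ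
  ε : ℝ

namespace Config

variable (d : Config)

/-- The second coordinate of the upper boundary of the curve `V(Q)`. -/
noncomputable def upper (t : ℝ) : ℝ := d.u₀ + pl d.n d.γ t

/-- The second coordinate of the lower boundary of the curve `V(Q)`. -/
noncomputable def lower (t : ℝ) : ℝ := d.l₀ + pl d.n d.β t - pl d.n d.γ t

/-- The row `1` of the polynomial `f`. -/
noncomputable def mid (t : ℝ) : ℝ := d.w₀ + pl d.n d.φ t

/-- The relations between the numerical data that are imposed by the configuration. The field `gap`
compares the two boundaries at `γ 0`; `w₀_lt` and `f₂_lt` say that the row `0` of `f` is the only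
maximal one at the first marked point, `mid_σ` that it agrees with the row `1` above `σ 0`, and
`f₂_lt'` that the row `2` is smaller than the row `1` above the last `σ`. -/
structure Valid : Prop where
  pos : 0 < d.n
  β_lt_γ : ∀ k < d.n, d.β k < d.γ k
  γ_lt_β : ∀ k, k + 1 < d.n → d.γ k < d.β (k + 1)
  gap : d.l₀ + (d.γ 0 - d.β 0) < d.u₀
  ε_lt : d.ε < d.l₀
  φ_lt : ∀ k, k + 1 < d.n → d.φ k < d.φ (k + 1)
  β_lt_φ : ∀ k < d.n, d.β k < d.φ 0
  w₀_lt : d.w₀ < d.l₀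
  f₂_lt : d.f₂ + d.u₀ < d.l₀
  γ_lt_σ : ∀ k < d.n, d.γ (d.n - 1) < d.σ k
  φ_lt_σ : d.φ 0 < d.σ 0
  σ_lt_φ : 1 < d.n → d.σ 0 < d.φ 1
  mid_σ : d.mid (d.σ 0) = d.lower (d.σ 0)
  σ_eq : ∀ k, 1 ≤ k → k < d.n → d.σ k = d.φ k
  f₂_lt' : d.f₂ + d.upper (d.σ (d.n - 1)) < d.mid (d.σ (d.n - 1))

/-- The polynomials `P`, `Q`, `f`, `g` and the set of marked points `M` are those described by the
numerical data `d`. -/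
structure IsModel (P Q f g : TropPoly 2) (M : Set (Fin 2 → ℝ)) : Prop where
  Q_max : ∀ m p, m ∈ Q.maxTerms p ↔
    (∃ k, m = ipt k 0 ∧ Peak d.n d.β k (p 0) ∧ p 1 ≤ d.lower (p 0)) ∨
    (∃ k, m = ipt k 1 ∧ Peak d.n d.γ k (p 0) ∧ d.lower (p 0) ≤ p 1 ∧ p 1 ≤ d.upper (p 0)) ∨
    m = ipt 0 2 ∧ d.upper (p 0) ≤ p 1
  P_max : ∀ m p, m ∈ P.maxTerms p ↔
    (∃ k, m = ipt k 0 ∧ Peak d.n d.γ k (p 0) ∧ p 1 ≤ d.upper (p 0)) ∨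
    m = ipt 0 1 ∧ d.upper (p 0) ≤ p 1
  P_val : ∃ c, ∀ p, P.val p = c + max (d.upper (p 0)) (p 1)
  f_max : ∀ m p, m ∈ f.maxTerms p ↔
    (∃ k, m = ipt k 0 ∧ Peak d.n d.β k (p 0) ∧
      d.mid (p 0) + p 1 ≤ d.lower (p 0) + d.upper (p 0) ∧
      d.f₂ + 2 * p 1 ≤ d.lower (p 0) + d.upper (p 0)) ∨
    (∃ k, m = ipt k 1 ∧ Peak d.n d.φ k (p 0) ∧
      d.lower (p 0) + d.upper (p 0) ≤ d.mid (p 0) + p 1 ∧ d.f₂ + p 1 ≤ d.mid (p 0)) ∨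
    m = ipt 0 2 ∧ d.lower (p 0) + d.upper (p 0) ≤ d.f₂ + 2 * p 1 ∧ d.mid (p 0) ≤ d.f₂ + p 1
  f_val : ∃ c, ∀ p, f.val p = c + max (d.lower (p 0) + d.upper (p 0))
    (max (d.mid (p 0) + p 1) (d.f₂ + 2 * p 1))
  g_max : ∀ m p, m ∈ g.maxTerms p ↔ m = ipt 0 0 ∧ p 1 ≤ d.ε ∨ m = ipt 0 1 ∧ d.ε ≤ p 1
  g_val : ∃ c, ∀ p, g.val p = c + max d.ε (p 1)
  marked : M = {p | ∃ k < d.n, p = ![d.β k, d.upper (d.β k)] ∨ p = ![d.σ k, d.upper (d.σ k)]}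

end Config

lemma pos_part_antitone {b c : ℝ} (hcb : c ≤ b) {T : ℝ} (hT : b ≤ T) (t : ℝ) :
    max 0 (T - b) - max 0 (T - c) ≤ max 0 (t - b) - max 0 (t - c) := by
  rw [max_eq_right (by linarith : 0 ≤ T - b), max_eq_right (by linarith : 0 ≤ T - c)]
  rcases le_total t c with h | h
  · rw [max_eq_left (by linarith : t - c ≤ 0)]
    linarith [le_max_left 0 (t - b)]
  · rw [max_eq_right (by linarith : 0 ≤ t - c)]
    linarith [le_max_right 0 (t - b)]

namespace Config

/-- The height of the curve over the upper boundary of `V(Q)`. -/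
noncomputable def top (d : Config) (t : ℝ) : ℝ := d.lower t + pl d.n d.σ t

lemma lower_le_top (d : Config) (t : ℝ) : d.lower t ≤ d.top t := by
  have := pl_nonneg (n := d.n) (b := d.σ) t
  unfold top; linarith

namespace Valid

variable {d : Config}

lemma increasing_β (hd : d.Valid) : Increasing d.n d.β := increasing_of_succ fun k hk =>
  (hd.β_lt_γ k (by omega)).trans (hd.γ_lt_β k hk)

lemma increasing_γ (hd : d.Valid) : Increasing d.n d.γ := increasing_of_succ fun k hk =>
  (hd.γ_lt_β k hk).trans (hd.β_lt_γ (k + 1) hk)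

lemma increasing_φ (hd : d.Valid) : Increasing d.n d.φ := increasing_of_succ hd.φ_lt

lemma increasing_σ (hd : d.Valid) : Increasing d.n d.σ := increasing_of_succ fun k hk => by
  rw [hd.σ_eq (k + 1) (by omega) hk]
  rcases Nat.eq_zero_or_pos k with rfl | hk0
  · exact hd.σ_lt_φ hk
  · rw [hd.σ_eq k hk0 (by omega)]; exact hd.φ_lt k hk

lemma γ_lt_σ' (hd : d.Valid) {i j : ℕ} (hi : i < d.n) (hj : j < d.n) : d.γ i < d.σ j :=
  (hd.increasing_γ.le (by omega) (by have := hd.pos; omega)).trans_lt (hd.γ_lt_σ j hj)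

lemma β_lt_σ (hd : d.Valid) {i j : ℕ} (hi : i < d.n) (hj : j < d.n) : d.β i < d.σ j :=
  (hd.β_lt_γ i hi).trans (hd.γ_lt_σ' hi hj)

lemma β_ne_γ (hd : d.Valid) {i j : ℕ} (hi : i < d.n) (hj : j < d.n) : d.β i ≠ d.γ j := by
  rcases le_or_gt i j with h | h
  · exact ((hd.β_lt_γ i hi).trans_le (hd.increasing_γ.le h hj)).ne
  · exact ((hd.γ_lt_β j (by omega)).trans_le (hd.increasing_β.le h hi)).ne'

lemma l₀_le_lower (hd : d.Valid) (t : ℝ) : d.l₀ ≤ d.lower t := by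
  have : pl d.n d.γ t ≤ pl d.n d.β t := Finset.sum_le_sum fun j hj =>
    max_le_max le_rfl (by linarith [hd.β_lt_γ j (Finset.mem_range.1 hj)])
  unfold lower
  linarith

lemma ε_lt_lower (hd : d.Valid) (t : ℝ) : d.ε < d.lower t := hd.ε_lt.trans_le (hd.l₀_le_lower t)

lemma lower_lt_upper (hd : d.Valid) (t : ℝ) : d.lower t < d.upper t := by
  obtain ⟨m, hm⟩ : ∃ m, d.n = m + 1 := ⟨d.n - 1, by have := hd.pos; omega⟩
  -- each break of the row `0`, but for the first one, is preceded by a break of the row `1`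
  have h1 : pl d.n d.β t ≤ (d.γ 0 - d.β 0) + max 0 (t - d.γ 0) + ∑ j ∈ Finset.range m,
      max 0 (t - d.γ j) := by
    rw [pl, hm, Finset.sum_range_succ']
    have h2 : ∑ j ∈ Finset.range m, max 0 (t - d.β (j + 1)) ≤
        ∑ j ∈ Finset.range m, max 0 (t - d.γ j) := Finset.sum_le_sum fun j hj =>
      max_le_max le_rfl (by linarith [hd.γ_lt_β j (by have := Finset.mem_range.1 hj; omega)])
    have h3 : max 0 (t - d.β 0) ≤ (d.γ 0 - d.β 0) + max 0 (t - d.γ 0) := by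
      have := hd.β_lt_γ 0 hd.pos
      exact max_le (by linarith [le_max_left 0 (t - d.γ 0)])
        (by linarith [le_max_right 0 (t - d.γ 0)])
    linarith
  have h4 : max 0 (t - d.γ 0) ≤ pl d.n d.γ t :=
    Finset.single_le_sum (f := fun j => max 0 (t - d.γ j)) (fun _ _ => le_max_left _ _)
      (Finset.mem_range.2 hd.pos)
  have h5 : ∑ j ∈ Finset.range m, max 0 (t - d.γ j) ≤ pl d.n d.γ t := by
    rw [pl, hm, Finset.sum_range_succ]
    linarith [le_max_left 0 (t - d.γ m)]
  have := hd.gap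
  unfold lower upper
  linarith

/-- Beyond the last break of the row `0`, the lower boundary has slope one up to the last break of
the row `1` and is constant from there on. -/
lemma lower_of_le (hd : d.Valid) : ∃ A, ∀ t, d.β (d.n - 1) ≤ t →
    d.lower t = A + t - max 0 (t - d.γ (d.n - 1)) := by
  obtain ⟨m, hm⟩ : ∃ m, d.n = m + 1 := ⟨d.n - 1, by have := hd.pos; omega⟩
  refine ⟨d.l₀ + (∑ j ∈ Finset.range m, (d.γ j - d.β j)) - d.β m, fun t ht => ?_⟩
  have hm' : d.n - 1 = m := by omega
  rw [hm'] at ht ⊢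
  have : ∑ j ∈ Finset.range m, max 0 (t - d.β j) - ∑ j ∈ Finset.range m, max 0 (t - d.γ j) =
      ∑ j ∈ Finset.range m, (d.γ j - d.β j) := by
    rw [← Finset.sum_sub_distrib]
    refine Finset.sum_congr rfl fun j hj => ?_
    have hj := Finset.mem_range.1 hj
    have h1 := hd.γ_lt_β j (by omega)
    have h2 := hd.increasing_β.le (i := j + 1) (j := m) (by omega) (by omega)
    have h3 := hd.β_lt_γ j (by omega)
    rw [max_eq_right (by linarith), max_eq_right (by linarith)]; ring
  unfold lower
  rw [pl, pl, hm, Finset.sum_range_succ, Finset.sum_range_succ,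
    max_eq_right (by linarith : 0 ≤ t - d.β m)]
  linarith

lemma lower_const (hd : d.Valid) {s t : ℝ} (hs : d.γ (d.n - 1) ≤ s) (ht : d.γ (d.n - 1) ≤ t) :
    d.lower s = d.lower t := by
  obtain ⟨A, hA⟩ := hd.lower_of_le
  have := hd.β_lt_γ (d.n - 1) (by have := hd.pos; omega)
  rw [hA s (by linarith), hA t (by linarith), max_eq_right (by linarith),
    max_eq_right (by linarith)]
  ring

lemma pl_φ_of_lt (hd : d.Valid) {t : ℝ} (ht : t ≤ d.σ 0) : pl d.n d.φ t = max 0 (t - d.φ 0) := by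
  obtain ⟨m, hm⟩ : ∃ m, d.n = m + 1 := ⟨d.n - 1, by have := hd.pos; omega⟩
  rw [pl, hm, Finset.sum_range_succ', add_eq_right]
  refine Finset.sum_eq_zero fun j hj => max_eq_left ?_
  have hj := Finset.mem_range.1 hj
  have h1 := hd.σ_lt_φ (by omega)
  have h2 := hd.increasing_φ.le (i := 1) (j := j + 1) (by omega) (by omega)
  linarith

lemma mid_lt_lower (hd : d.Valid) {t : ℝ} (ht : t < d.σ 0) : d.mid t < d.lower t := by
  have h1 : d.mid t = d.w₀ + max 0 (t - d.φ 0) := by rw [mid, hd.pl_φ_of_lt ht.le]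
  rcases le_or_gt t (d.φ 0) with h | h
  · rw [h1, max_eq_left (by linarith)]
    linarith [hd.l₀_le_lower t, hd.w₀_lt]
  · obtain ⟨A, hA⟩ := hd.lower_of_le
    have hn : d.n - 1 < d.n := by have := hd.pos; omega
    have h2 := hd.mid_σ
    rw [mid, hd.pl_φ_of_lt le_rfl, max_eq_right (by linarith)] at h2
    have h3 := hd.β_lt_φ _ hn
    have h4 := hd.γ_lt_σ 0 hd.pos
    rw [hA _ (by linarith), max_eq_right (by linarith)] at h2
    rw [h1, hA t (by linarith), max_eq_right (by linarith)]
    rcases max_choice 0 (t - d.γ (d.n - 1)) with h5 | h5 <;> rw [h5] <;> linarith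

lemma pl_σ_eq_zero (hd : d.Valid) {t : ℝ} (ht : t ≤ d.σ 0) : pl d.n d.σ t = 0 :=
  pl_eq_zero fun _ hj => ht.trans (hd.increasing_σ.le (Nat.zero_le _) hj)

lemma top_eq_lower (hd : d.Valid) {t : ℝ} (ht : t ≤ d.σ 0) : d.top t = d.lower t := by
  rw [top, hd.pl_σ_eq_zero ht, add_zero]

lemma mid_eq_top (hd : d.Valid) {t : ℝ} (ht : d.σ 0 ≤ t) : d.mid t = d.top t := by
  have hγ := hd.γ_lt_σ 0 hd.pos
  have h1 : d.lower t = d.lower (d.σ 0) := hd.lower_const (by linarith) hγ.le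
  have h2 := hd.mid_σ
  have h3 := hd.φ_lt_σ
  rw [mid, hd.pl_φ_of_lt le_rfl, max_eq_right (by linarith)] at h2
  obtain ⟨m, hm⟩ : ∃ m, d.n = m + 1 := ⟨d.n - 1, by have := hd.pos; omega⟩
  have h4 : ∑ j ∈ Finset.range m, max 0 (t - d.φ (j + 1)) =
      ∑ j ∈ Finset.range m, max 0 (t - d.σ (j + 1)) := Finset.sum_congr rfl fun j hj => by
    rw [hd.σ_eq (j + 1) (by omega) (by have := Finset.mem_range.1 hj; omega)]
  rw [top, h1, ← h2, mid, pl, pl, hm, Finset.sum_range_succ', Finset.sum_range_succ', h4,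
    max_eq_right (by linarith : 0 ≤ t - d.φ 0), max_eq_right (by linarith : 0 ≤ t - d.σ 0)]
  ring

lemma mid_le_top (hd : d.Valid) (t : ℝ) : d.mid t ≤ d.top t := by
  rcases lt_or_ge t (d.σ 0) with h | h
  · exact (hd.mid_lt_lower h).le.trans (d.lower_le_top t)
  · exact (hd.mid_eq_top h).le

lemma max_lower_mid (hd : d.Valid) (t : ℝ) : max (d.lower t) (d.mid t) = d.top t := by
  rcases lt_or_ge t (d.σ 0) with h | h
  · rw [hd.top_eq_lower h.le, max_eq_left (hd.mid_lt_lower h).le]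
  · rw [hd.mid_eq_top h, max_eq_right (d.lower_le_top t)]

lemma top_lt_upper (hd : d.Valid) (t : ℝ) : d.top t < d.upper t := by
  rcases lt_or_ge t (d.σ 0) with h | h
  · rw [hd.top_eq_lower h.le]; exact hd.lower_lt_upper t
  · have h1 : d.lower t = d.lower (d.σ 0) :=
      hd.lower_const (by linarith [hd.γ_lt_σ 0 hd.pos]) (hd.γ_lt_σ 0 hd.pos).le
    have h2 : pl d.n d.σ t + pl d.n d.γ (d.σ 0) ≤ pl d.n d.γ t := by
      rw [pl, pl, pl, ← Finset.sum_add_distrib]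
      refine Finset.sum_le_sum fun j hj => ?_
      have hj := Finset.mem_range.1 hj
      have h3 := hd.γ_lt_σ' hj hd.pos
      have h4 := hd.increasing_σ.le (Nat.zero_le j) hj
      rw [max_eq_right (by linarith : 0 ≤ d.σ 0 - d.γ j),
        max_eq_right (by linarith : 0 ≤ t - d.γ j)]
      rcases max_choice 0 (t - d.σ j) with h5 | h5 <;> rw [h5] <;> linarith
    have := hd.lower_lt_upper (d.σ 0)
    unfold top
    unfold upper at *
    linarith

lemma f₂_neg (hd : d.Valid) : d.f₂ < 0 := by
  have := hd.f₂_lt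
  have := hd.gap
  have := hd.β_lt_γ 0 hd.pos
  linarith

/-- The difference `top - upper` is at least its value at `-∞` before the first break of the row
`1`, and decreases from there on. -/
lemma f₂_add_upper_lt (hd : d.Valid) (t : ℝ) : d.f₂ + d.upper t < d.top t := by
  obtain ⟨m, hm⟩ : ∃ m, d.n = m + 1 := ⟨d.n - 1, by have := hd.pos; omega⟩
  rcases le_or_gt t (d.γ 0) with h | h
  · have h1 : pl d.n d.γ t = 0 :=
      pl_eq_zero fun _ hj => h.trans (hd.increasing_γ.le (Nat.zero_le _) hj)
    have := hd.f₂_lt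
    have := hd.l₀_le_lower t
    have := d.lower_le_top t
    rw [upper, h1]; linarith
  · have hT := hd.f₂_lt'
    have hn : d.n - 1 = m := by omega
    rw [hn] at hT
    have hσm : d.σ 0 ≤ d.σ m := hd.increasing_σ.le (Nat.zero_le m) (by omega)
    rw [hd.mid_eq_top hσm] at hT
    suffices hs : d.top (d.σ m) - d.upper (d.σ m) ≤ d.top t - d.upper t by linarith
    have key : ∀ s, d.γ 0 ≤ s → d.top s - d.upper s = d.l₀ - d.u₀ + (d.γ 0 - d.β 0) +
        (∑ j ∈ Finset.range m, (max 0 (s - d.β (j + 1)) - max 0 (s - d.γ j)) +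
        (∑ j ∈ Finset.range m, (max 0 (s - d.σ j) - max 0 (s - d.γ (j + 1))) +
        (max 0 (s - d.σ m) - max 0 (s - d.γ m)))) := by
      intro s hs
      have e1 : pl d.n d.β s = ∑ j ∈ Finset.range m, max 0 (s - d.β (j + 1)) + (s - d.β 0) := by
        rw [pl, hm, Finset.sum_range_succ', max_eq_right (a := 0) (b := s - d.β 0)]
        linarith [hd.β_lt_γ 0 hd.pos]
      have e2 : pl d.n d.γ s = ∑ j ∈ Finset.range m, max 0 (s - d.γ (j + 1)) + (s - d.γ 0) := by
        rw [pl, hm, Finset.sum_range_succ', max_eq_right (a := 0) (b := s - d.γ 0)]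
        linarith
      have e3 : pl d.n d.γ s = ∑ j ∈ Finset.range m, max 0 (s - d.γ j) + max 0 (s - d.γ m) := by
        rw [pl, hm, Finset.sum_range_succ]
      have e4 : pl d.n d.σ s = ∑ j ∈ Finset.range m, max 0 (s - d.σ j) + max 0 (s - d.σ m) := by
        rw [pl, hm, Finset.sum_range_succ]
      rw [Finset.sum_sub_distrib, Finset.sum_sub_distrib]
      unfold top lower upper
      linarith
    rw [key t h.le, key (d.σ m) (hd.γ_lt_σ' hd.pos (by omega)).le]
    refine add_le_add le_rfl (add_le_add (Finset.sum_le_sum fun j hj => ?_)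
      (add_le_add (Finset.sum_le_sum fun j hj => ?_) ?_))
    · have hj := Finset.mem_range.1 hj
      exact pos_part_antitone (hd.γ_lt_β j (by omega)).le (hd.β_lt_σ (by omega) (by omega)).le t
    · have hj := Finset.mem_range.1 hj
      exact pos_part_antitone (hd.γ_lt_σ' (by omega) (by omega)).le
        (hd.increasing_σ.le (by omega) (by omega)) t
    · exact pos_part_antitone (hd.γ_lt_σ' (by omega) (by omega)).le le_rfl t

end Valid

end Config

lemma pl_congr {n : ℕ} {b b' : ℕ → ℝ} (h : ∀ k < n, b k = b' k) (t : ℝ) : pl n b t = pl n b' t :=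
  Finset.sum_congr rfl fun j hj => by rw [h j (Finset.mem_range.1 hj)]

lemma peak_congr {n : ℕ} {b b' : ℕ → ℝ} (h : ∀ k < n, b k = b' k) (k : ℕ) (t : ℝ) :
    Peak n b k t ↔ Peak n b' k t := by
  constructor
  · rintro ⟨h1, h2, h3⟩
    exact ⟨h1, fun j hj => h j (by omega) ▸ h2 j hj, fun j hj hjn => h j hjn ▸ h3 j hj hjn⟩
  · rintro ⟨h1, h2, h3⟩
    exact ⟨h1, fun j hj => by rw [h j (by omega)]; exact h2 j hj,
      fun j hj hjn => by rw [h j hjn]; exact h3 j hj hjn⟩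

/-- The lengths of the `J` rows of the Newton polygon with vertices `(0, 0)`, `(n, 0)`,
`(n, J - 2)`, `(0, J - 1)`. -/
def width (J n j : ℕ) : ℕ := if j + 1 < J then n else 0

namespace TropPoly

lemma maxTerms_of_triangle {R : TropPoly 2} {v : Fin 2 → ℝ} {i j i' j' i'' j'' : ℕ}
    (h : R.dualCell v = triangle (pt i j) (pt i' j') (pt i'' j''))
    (hu : IsUnit (area (ipt i j) (ipt i' j') (ipt i'' j''))) :
    R.maxTerms v = {ipt i j, ipt i' j', ipt i'' j''} :=
  eq_vertices_of_triangle (by rw [toReal_ipt, toReal_ipt, toReal_ipt]; exact h) hu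

lemma maxTerms_of_segment {R : TropPoly 2} {v : Fin 2 → ℝ} {i j i' j' : ℕ}
    (h : R.dualCell v = segment ℝ (pt i j) (pt i' j'))
    (hp : IsPrimitiveVec (ipt i' j' - ipt i j)) : R.maxTerms v = {ipt i j, ipt i' j'} :=
  eq_endpoints_of_segment (by rw [toReal_ipt, toReal_ipt]; exact h) hp

lemma mem_support_of_maxTerms {R : TropPoly 2} {v : Fin 2 → ℝ} {S : Set (Fin 2 → ℤ)}
    (h : R.maxTerms v = S) {m : Fin 2 → ℤ} (hm : m ∈ S) : m ∈ R.support := by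
  rw [← h] at hm; exact hm.1

/-- A Newton polygon with the expected vertices, all of whose relevant lattice points are
exponents. -/
lemma mem_support_iff_of_bounds {R : TropPoly 2} {J n : ℕ} (hn : 0 < n)
    (h1 : ∀ m ∈ R.support, 0 ≤ m 0) (h2 : ∀ m ∈ R.support, 0 ≤ m 1)
    (h3 : ∀ m ∈ R.support, m 0 ≤ n) (h4 : ∀ m ∈ R.support, m 0 + n * m 1 ≤ n * (J - 1))
    (hin : ∀ j < J, ∀ k ≤ width J n j, ipt k j ∈ R.support) (m : Fin 2 → ℤ) :
    m ∈ R.support ↔ ∃ j < J, ∃ k ≤ width J n j, m = ipt k j := by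
  constructor
  · intro hm
    have h1 := h1 m hm
    have h2 := h2 m hm
    have h3 := h3 m hm
    have h4 := h4 m hm
    obtain ⟨i, hi⟩ := Int.eq_ofNat_of_zero_le h1
    obtain ⟨j, hj⟩ := Int.eq_ofNat_of_zero_le h2
    have hmij : m = ipt i j := by funext s; fin_cases s <;> simp [hi, hj, ipt]
    rw [hi, hj] at h4
    have hjJ : j < J := by
      by_contra hcon
      have h5 : (J : ℤ) ≤ j := by exact_mod_cast not_lt.1 hcon
      nlinarith
    refine ⟨j, hjJ, i, ?_, hmij⟩
    unfold width
    split_ifs with h5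
    · rw [hi] at h3; exact_mod_cast h3
    · have h6 : (j : ℤ) = J - 1 := by omega
      rw [h6] at h4
      have : (i : ℤ) ≤ 0 := by linarith
      exact_mod_cast this
  · rintro ⟨j, hj, k, hk, rfl⟩
    exact hin j hj k hk

/-- The row structure of a polynomial whose polygons have their vertices in the expected places,
and among them the boundary edges of the Newton polygon. -/
lemma mem_support_iff_of_vertices {R : TropPoly 2} {J n : ℕ} (hn : 0 < n) (hJ : 2 ≤ J)
    (hverts : ∀ x, (interior (R.dualCell x)).Nonempty → ∀ m ∈ R.maxTerms x,
      ∃ j < J, ∃ k ≤ width J n j, m = ipt k j)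
    (hin : ∀ j < J, ∀ k ≤ width J n j, ipt k j ∈ R.support)
    (hleft : ∃ v, ipt 0 0 ∈ R.maxTerms v ∧ ipt 0 1 ∈ R.maxTerms v)
    (hbot : ∃ v, ipt 0 0 ∈ R.maxTerms v ∧ ipt 1 0 ∈ R.maxTerms v)
    (hright : 2 < J → ∃ v, ipt n 0 ∈ R.maxTerms v ∧ ipt n 1 ∈ R.maxTerms v)
    (htop : ∃ v, ipt n (J - 2) ∈ R.maxTerms v ∧ ipt 0 (J - 1) ∈ R.maxTerms v) (m : Fin 2 → ℤ) :
    m ∈ R.support ↔ ∃ j < J, ∃ k ≤ width J n j, m = ipt k j := by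
  have hw : ∀ j, width J n j ≤ n := by intro j; unfold width; split_ifs <;> omega
  obtain ⟨v₁, a₁, b₁⟩ := hleft
  obtain ⟨v₂, a₂, b₂⟩ := hbot
  obtain ⟨v₄, a₄, b₄⟩ := htop
  have h1 : ∀ m ∈ R.support, 0 ≤ m 0 := by
    have := R.support_le_of_edge a₁ b₁ (by rw [Ne, ipt_inj]; omega) ![-1, 0] 0 (by simp) (by simp)
      (fun x hx m hm => by
        obtain ⟨j, -, k, -, rfl⟩ := hverts x hx m hm
        simp)
    intro m hm; have := this m hm; simp at this; exact this
  have h2 : ∀ m ∈ R.support, 0 ≤ m 1 := by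
    have := R.support_le_of_edge a₂ b₂ (by rw [Ne, ipt_inj]; omega) ![0, -1] 0 (by simp) (by simp)
      (fun x hx m hm => by
        obtain ⟨j, -, k, -, rfl⟩ := hverts x hx m hm
        simp)
    intro m hm; have := this m hm; simp at this; exact this
  have h4 : ∀ m ∈ R.support, m 0 + n * m 1 ≤ n * (J - 1) := by
    have e1 : ((J - 2 : ℕ) : ℤ) = J - 2 := by omega
    have e2 : ((J - 1 : ℕ) : ℤ) = J - 1 := by omega
    have := R.support_le_of_edge a₄ b₄ (by rw [Ne, ipt_inj]; omega) ![1, n] (n * (J - 1))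
      (by simp [e1]; ring) (by simp [e2])
      (fun x hx m hm => by
        obtain ⟨j, hj, k, hk, rfl⟩ := hverts x hx m hm
        simp only [Matrix.cons_val_zero, Matrix.cons_val_one, ipt_zero, ipt_one, one_mul]
        unfold width at hk
        split_ifs at hk with hj'
        · have : (j : ℤ) ≤ J - 2 := by omega
          have hk' : (k : ℤ) ≤ n := by exact_mod_cast hk
          nlinarith
        · have hk' : (k : ℤ) = 0 := by omega
          have : (j : ℤ) ≤ J - 1 := by omega
          nlinarith)
    intro m hm; have := this m hm; simpa using this
  refine mem_support_iff_of_bounds hn h1 h2 ?_ h4 hin m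
  by_cases hJ2 : 2 < J
  · obtain ⟨v₃, a₃, b₃⟩ := hright hJ2
    have := R.support_le_of_edge a₃ b₃ (by rw [Ne, ipt_inj]; omega) ![1, 0] n (by simp) (by simp)
      (fun x hx m hm => by
        obtain ⟨j, -, k, hk, rfl⟩ := hverts x hx m hm
        simpa using hk.trans (hw j))
    intro m hm; have := this m hm; simpa using this
  · intro m hm
    have h5 := h4 m hm
    have h6 := h2 m hm
    have : (J : ℤ) = 2 := by omega
    rw [this] at h5
    nlinarith

end TropPoly


/-! ### Extraction of the normal form -/

section Extraction

lemma forall_lt_two {p : ℕ → Prop} : (∀ j < 2, p j) ↔ p 0 ∧ p 1 := by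
  constructor
  · exact fun h => ⟨h 0 (by omega), h 1 (by omega)⟩
  · rintro ⟨h0, h1⟩ j hj
    interval_cases j <;> assumption

lemma forall_lt_three {p : ℕ → Prop} : (∀ j < 3, p j) ↔ p 0 ∧ p 1 ∧ p 2 := by
  constructor
  · exact fun h => ⟨h 0 (by omega), h 1 (by omega), h 2 (by omega)⟩
  · rintro ⟨h0, h1, h2⟩ j hj
    interval_cases j <;> assumption

lemma exists_lt_two {p : ℕ → Prop} : (∃ j < 2, p j) ↔ p 0 ∨ p 1 := by
  constructor
  · rintro ⟨j, hj, h⟩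
    interval_cases j
    exacts [Or.inl h, Or.inr h]
  · rintro (h | h)
    exacts [⟨0, by omega, h⟩, ⟨1, by omega, h⟩]

lemma exists_lt_three {p : ℕ → Prop} : (∃ j < 3, p j) ↔ p 0 ∨ p 1 ∨ p 2 := by
  constructor
  · rintro ⟨j, hj, h⟩
    interval_cases j
    exacts [Or.inl h, Or.inr (Or.inl h), Or.inr (Or.inr h)]
  · rintro (h | h | h)
    exacts [⟨0, by omega, h⟩, ⟨1, by omega, h⟩, ⟨2, by omega, h⟩]

lemma peak_zero {b : ℕ → ℝ} {k : ℕ} {t : ℝ} : Peak 0 b k t ↔ k = 0 :=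
  ⟨fun h => by have := h.1; omega, fun h => ⟨by omega, by intro j hj; omega, by intro j _ hj; omega⟩⟩

lemma pl_zero (b : ℕ → ℝ) (t : ℝ) : pl 0 b t = 0 := by simp [pl]

lemma isPrimitiveVec_sub_of_snd {i j i' j' : ℕ} (h : IsUnit ((j' : ℤ) - j)) :
    IsPrimitiveVec (ipt i' j' - ipt i j) := isPrimitiveVec_of_isUnit 1 h

lemma isPrimitiveVec_sub_of_fst {i j i' j' : ℕ} (h : IsUnit ((i' : ℤ) - i)) :
    IsPrimitiveVec (ipt i' j' - ipt i j) := isPrimitiveVec_of_isUnit 0 h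

lemma TropPoly.HasDualSubdivision.exists_of_mem {R : TropPoly 2} {T : Set (Set (Fin 2 → ℝ))}
    (h : R.HasDualSubdivision T) {S : Set (Fin 2 → ℝ)} (hS : S ∈ T) :
    ∃ v, R.dualCell v = S ∧ (interior (R.dualCell v)).Nonempty := by
  have h' : {S | (∃ x, R.dualCell x = S) ∧ (interior S).Nonempty} = T := h
  rw [← h'] at hS
  obtain ⟨⟨v, rfl⟩, hi⟩ := hS
  exact ⟨v, rfl, hi⟩

lemma TropPoly.HasDualSubdivision.mem_of_interior {R : TropPoly 2} {T : Set (Set (Fin 2 → ℝ))}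
    (h : R.HasDualSubdivision T) {v : Fin 2 → ℝ} (hv : (interior (R.dualCell v)).Nonempty) :
    R.dualCell v ∈ T := by
  have h' : {S | (∃ x, R.dualCell x = S) ∧ (interior S).Nonempty} = T := h
  rw [← h']
  exact ⟨⟨v, rfl⟩, hv⟩

section Terms

variable {R : TropPoly 2} {v : Fin 2 → ℝ} {k n : ℕ}

lemma maxTerms_triDelta (h : R.dualCell v = triDelta k) :
    R.maxTerms v = {ipt k 0, ipt 0 1, ipt (k + 1) 0} :=
  TropPoly.maxTerms_of_triangle (by rw [h]; simp [triDelta, pt]) (by simp [area, ipt])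

lemma maxTerms_triK (h : R.dualCell v = triK k) :
    R.maxTerms v = {ipt k 0, ipt k 1, ipt (k + 1) 0} :=
  TropPoly.maxTerms_of_triangle (by rw [h]; simp [triK, pt]) (by simp [area, ipt])

lemma maxTerms_triL (h : R.dualCell v = triL k) :
    R.maxTerms v = {ipt k 1, ipt (k + 1) 0, ipt (k + 1) 1} :=
  TropPoly.maxTerms_of_triangle (by rw [h]; simp [triL, pt]) (by simp [area, ipt])

lemma maxTerms_triM (h : R.dualCell v = triM k) :
    R.maxTerms v = {ipt k 1, ipt 0 2, ipt (k + 1) 1} :=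
  TropPoly.maxTerms_of_triangle (by rw [h]; simp [triM, pt]) (by simp [area, ipt])

lemma maxTerms_triH (h : R.dualCell v = triH n k) :
    R.maxTerms v = {ipt k 1, ipt (k + 1) 1, ipt n 0} :=
  TropPoly.maxTerms_of_triangle (by rw [h]; simp [triH, pt]) (by simp [area, ipt])

end Terms

variable {n : ℕ} {P Q f g : TropPoly 2}

lemma mem_support_iff_of_triDelta (hn : 1 ≤ n) (hD : P.HasDualSubdivision {T | ∃ k < n, T = triDelta k}) :
    ∀ m, m ∈ P.support ↔ ∃ j < 2, ∃ k ≤ width 2 n j, m = ipt k j := by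
  have hw0 : width 2 n 0 = n := by simp [width]
  have hw1 : width 2 n 1 = 0 := by simp [width]
  have hΔ : ∀ k < n, ∃ v, P.maxTerms v = {ipt k 0, ipt 0 1, ipt (k + 1) 0} := fun k hk => by
    obtain ⟨v, hv, -⟩ := hD.exists_of_mem ⟨k, hk, rfl⟩
    exact ⟨v, maxTerms_triDelta hv⟩
  obtain ⟨v, hv⟩ := hΔ 0 (by omega)
  obtain ⟨v', hv'⟩ := hΔ (n - 1) (by omega)
  rw [Nat.sub_add_cancel hn] at hv'
  refine TropPoly.mem_support_iff_of_vertices (by omega) le_rfl ?_ ?_ ⟨v, by simp [hv]⟩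
    ⟨v, by simp [hv]⟩ (by omega) ⟨v', by simp [hv']⟩
  · intro x hx m hm
    obtain ⟨k, hk, h⟩ := hD.mem_of_interior hx
    rw [maxTerms_triDelta h] at hm
    rw [exists_lt_two, hw0, hw1]
    rcases hm with rfl | rfl | rfl
    exacts [Or.inl ⟨k, hk.le, rfl⟩, Or.inr ⟨0, le_rfl, rfl⟩, Or.inl ⟨k + 1, hk, rfl⟩]
  · rw [forall_lt_two, hw0, hw1]
    refine ⟨fun k hk => ?_, fun k hk => ?_⟩
    · rcases hk.lt_or_eq with h | rfl
      · obtain ⟨v, hv⟩ := hΔ k h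
        exact TropPoly.mem_support_of_maxTerms hv (by simp)
      · exact TropPoly.mem_support_of_maxTerms hv' (by simp)
    · obtain rfl : k = 0 := by omega
      exact TropPoly.mem_support_of_maxTerms hv (by simp)

lemma mem_support_iff_of_triK (hn : 1 ≤ n)
    (hC : Q.HasDualSubdivision {T | ∃ k < n, T = triK k ∨ T = triL k ∨ T = triM k}) :
    ∀ m, m ∈ Q.support ↔ ∃ j < 3, ∃ k ≤ width 3 n j, m = ipt k j := by
  have hw0 : width 3 n 0 = n := by simp [width]
  have hw1 : width 3 n 1 = n := by simp [width]
  have hw2 : width 3 n 2 = 0 := by simp [width]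
  have hK : ∀ k < n, ∃ v, Q.maxTerms v = {ipt k 0, ipt k 1, ipt (k + 1) 0} := fun k hk => by
    obtain ⟨v, hv, -⟩ := hC.exists_of_mem ⟨k, hk, Or.inl rfl⟩
    exact ⟨v, maxTerms_triK hv⟩
  obtain ⟨v, hv⟩ := hK 0 (by omega)
  obtain ⟨v₁, h₁, -⟩ := hC.exists_of_mem ⟨n - 1, by omega, Or.inr (Or.inl rfl)⟩
  obtain ⟨v₂, h₂, -⟩ := hC.exists_of_mem ⟨n - 1, by omega, Or.inr (Or.inr rfl)⟩
  have h₁ := maxTerms_triL h₁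
  have h₂ := maxTerms_triM h₂
  rw [Nat.sub_add_cancel hn] at h₁ h₂
  refine TropPoly.mem_support_iff_of_vertices (by omega) (by omega) ?_ ?_ ⟨v, by simp [hv]⟩
    ⟨v, by simp [hv]⟩ (fun _ => ⟨v₁, by simp [h₁]⟩) ⟨v₂, by simp [h₂]⟩
  · intro x hx m hm
    obtain ⟨k, hk, h⟩ := hC.mem_of_interior hx
    rw [exists_lt_three, hw0, hw1, hw2]
    rcases h with h | h | h
    · rw [maxTerms_triK h] at hm
      rcases hm with rfl | rfl | rfl
      exacts [Or.inl ⟨k, hk.le, rfl⟩, Or.inr (Or.inl ⟨k, hk.le, rfl⟩), Or.inl ⟨k + 1, hk, rfl⟩]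
    · rw [maxTerms_triL h] at hm
      rcases hm with rfl | rfl | rfl
      exacts [Or.inr (Or.inl ⟨k, hk.le, rfl⟩), Or.inl ⟨k + 1, hk, rfl⟩,
        Or.inr (Or.inl ⟨k + 1, hk, rfl⟩)]
    · rw [maxTerms_triM h] at hm
      rcases hm with rfl | rfl | rfl
      exacts [Or.inr (Or.inl ⟨k, hk.le, rfl⟩), Or.inr (Or.inr ⟨0, le_rfl, rfl⟩),
        Or.inr (Or.inl ⟨k + 1, hk, rfl⟩)]
  · rw [forall_lt_three, hw0, hw1, hw2]
    refine ⟨fun k hk => ?_, fun k hk => ?_, fun k hk => ?_⟩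
    · rcases hk.lt_or_eq with h | rfl
      · obtain ⟨v, hv⟩ := hK k h
        exact TropPoly.mem_support_of_maxTerms hv (by simp)
      · exact TropPoly.mem_support_of_maxTerms h₁ (by simp)
    · rcases hk.lt_or_eq with h | rfl
      · obtain ⟨v, hv⟩ := hK k h
        exact TropPoly.mem_support_of_maxTerms hv (by simp)
      · exact TropPoly.mem_support_of_maxTerms h₁ (by simp)
    · obtain rfl : k = 0 := by omega
      exact TropPoly.mem_support_of_maxTerms h₂ (by simp)

lemma mem_support_iff_of_triH (hn : 1 ≤ n)
    (hF : f.HasDualSubdivision {T | ∃ k < n, T = triDelta k ∨ T = triH n k ∨ T = triM k}) :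
    ∀ m, m ∈ f.support ↔ ∃ j < 3, ∃ k ≤ width 3 n j, m = ipt k j := by
  have hw0 : width 3 n 0 = n := by simp [width]
  have hw1 : width 3 n 1 = n := by simp [width]
  have hw2 : width 3 n 2 = 0 := by simp [width]
  have hG : ∀ k < n, ∃ v, f.maxTerms v = {ipt k 0, ipt 0 1, ipt (k + 1) 0} := fun k hk => by
    obtain ⟨v, hv, -⟩ := hF.exists_of_mem ⟨k, hk, Or.inl rfl⟩
    exact ⟨v, maxTerms_triDelta hv⟩
  have hI : ∀ k < n, ∃ v, f.maxTerms v = {ipt k 1, ipt 0 2, ipt (k + 1) 1} := fun k hk => by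
    obtain ⟨v, hv, -⟩ := hF.exists_of_mem ⟨k, hk, Or.inr (Or.inr rfl)⟩
    exact ⟨v, maxTerms_triM hv⟩
  obtain ⟨v, hv⟩ := hG 0 (by omega)
  obtain ⟨v₁, h₁, -⟩ := hF.exists_of_mem ⟨n - 1, by omega, Or.inr (Or.inl rfl)⟩
  obtain ⟨v₂, h₂⟩ := hI (n - 1) (by omega)
  have h₁ := maxTerms_triH h₁
  rw [Nat.sub_add_cancel hn] at h₁ h₂
  refine TropPoly.mem_support_iff_of_vertices (by omega) (by omega) ?_ ?_ ⟨v, by simp [hv]⟩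
    ⟨v, by simp [hv]⟩ (fun _ => ⟨v₁, by simp [h₁]⟩) ⟨v₂, by simp [h₂]⟩
  · intro x hx m hm
    obtain ⟨k, hk, h⟩ := hF.mem_of_interior hx
    rw [exists_lt_three, hw0, hw1, hw2]
    rcases h with h | h | h
    · rw [maxTerms_triDelta h] at hm
      rcases hm with rfl | rfl | rfl
      exacts [Or.inl ⟨k, hk.le, rfl⟩, Or.inr (Or.inl ⟨0, by omega, rfl⟩), Or.inl ⟨k + 1, hk, rfl⟩]
    · rw [maxTerms_triH h] at hm
      rcases hm with rfl | rfl | rfl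
      exacts [Or.inr (Or.inl ⟨k, hk.le, rfl⟩), Or.inr (Or.inl ⟨k + 1, hk, rfl⟩),
        Or.inl ⟨n, le_rfl, rfl⟩]
    · rw [maxTerms_triM h] at hm
      rcases hm with rfl | rfl | rfl
      exacts [Or.inr (Or.inl ⟨k, hk.le, rfl⟩), Or.inr (Or.inr ⟨0, le_rfl, rfl⟩),
        Or.inr (Or.inl ⟨k + 1, hk, rfl⟩)]
  · rw [forall_lt_three, hw0, hw1, hw2]
    refine ⟨fun k hk => ?_, fun k hk => ?_, fun k hk => ?_⟩
    · rcases hk.lt_or_eq with h | rfl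
      · obtain ⟨v, hv⟩ := hG k h
        exact TropPoly.mem_support_of_maxTerms hv (by simp)
      · exact TropPoly.mem_support_of_maxTerms h₁ (by simp)
    · rcases hk.lt_or_eq with h | rfl
      · obtain ⟨v, hv⟩ := hI k h
        exact TropPoly.mem_support_of_maxTerms hv (by simp)
      · exact TropPoly.mem_support_of_maxTerms h₂ (by simp)
    · obtain rfl : k = 0 := by omega
      exact TropPoly.mem_support_of_maxTerms h₂ (by simp)

end Extraction


section Model

variable {d : Config} {P Q f g : TropPoly 2} {M : Set (Fin 2 → ℝ)}

lemma width_two_zero (n : ℕ) : width 2 n 0 = n := by simp [width]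
lemma width_two_one (n : ℕ) : width 2 n 1 = 0 := by simp [width]
lemma width_three_zero (n : ℕ) : width 3 n 0 = n := by simp [width]
lemma width_three_one (n : ℕ) : width 3 n 1 = n := by simp [width]
lemma width_three_two (n : ℕ) : width 3 n 2 = 0 := by simp [width]

namespace Config

lemma max_Q (hd : d.Valid) (hQ : Q.HasRows 3 (width 3 d.n)) (hβ : ∀ k < d.n, Q.brk 0 k = d.β k)
    (hγ : ∀ k < d.n, Q.brk 1 k = d.γ k) {q : ℝ} (h₀ : Q.coeff (ipt 0 0) = q + (d.u₀ + d.l₀))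
    (h₁ : Q.coeff (ipt 0 1) = q + d.u₀) (h₂ : Q.coeff (ipt 0 2) = q) (m : Fin 2 → ℤ)
    (p : Fin 2 → ℝ) : m ∈ Q.maxTerms p ↔
    (∃ k, m = ipt k 0 ∧ Peak d.n d.β k (p 0) ∧ p 1 ≤ d.lower (p 0)) ∨
    (∃ k, m = ipt k 1 ∧ Peak d.n d.γ k (p 0) ∧ d.lower (p 0) ≤ p 1 ∧ p 1 ≤ d.upper (p 0)) ∨
    m = ipt 0 2 ∧ d.upper (p 0) ≤ p 1 := by
  have r0 : Q.rowVal (width 3 d.n) 0 p = q + (d.lower (p 0) + d.upper (p 0)) := by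
    rw [TropPoly.rowVal, width_three_zero, pl_congr hβ, h₀, lower, upper]; push_cast; ring
  have r1 : Q.rowVal (width 3 d.n) 1 p = q + (d.upper (p 0) + p 1) := by
    rw [TropPoly.rowVal, width_three_one, pl_congr hγ, h₁, upper]; push_cast; ring
  have r2 : Q.rowVal (width 3 d.n) 2 p = q + 2 * p 1 := by
    rw [TropPoly.rowVal, width_three_two, pl_zero, h₂]; push_cast; ring
  have hlt := hd.lower_lt_upper (p 0)
  rw [hQ.mem_maxTerms_iff, exists_lt_three, width_three_zero, width_three_one, width_three_two]
  simp only [forall_lt_three, r0, r1, r2, peak_congr hβ, peak_congr hγ, peak_zero]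
  refine or_congr ?_ (or_congr ?_ ?_)
  · refine exists_congr fun k => and_congr_right fun _ => and_congr_right fun _ => ?_
    constructor
    · intro h; linarith [h.2.1]
    · intro h; exact ⟨le_rfl, by linarith, by linarith⟩
  · refine exists_congr fun k => and_congr_right fun _ => and_congr_right fun _ => ?_
    constructor
    · intro h; exact ⟨by linarith [h.1], by linarith [h.2.2]⟩
    · intro h; exact ⟨by linarith [h.1], le_rfl, by linarith [h.2]⟩
  · constructor
    · rintro ⟨k, rfl, rfl, h⟩; exact ⟨rfl, by linarith [h.2.1]⟩
    · rintro ⟨rfl, h⟩; exact ⟨0, rfl, rfl, by linarith, by linarith, le_rfl⟩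

lemma max_P (hP : P.HasRows 2 (width 2 d.n)) (hγ : ∀ k < d.n, P.brk 0 k = d.γ k) {c : ℝ}
    (h₀ : P.coeff (ipt 0 0) = c + d.u₀) (h₁ : P.coeff (ipt 0 1) = c) :
    (∀ m p, m ∈ P.maxTerms p ↔
      (∃ k, m = ipt k 0 ∧ Peak d.n d.γ k (p 0) ∧ p 1 ≤ d.upper (p 0)) ∨
      m = ipt 0 1 ∧ d.upper (p 0) ≤ p 1) ∧
    ∀ p, P.val p = c + max (d.upper (p 0)) (p 1) := by
  have r0 : ∀ p, P.rowVal (width 2 d.n) 0 p = c + d.upper (p 0) := fun p => by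
    rw [TropPoly.rowVal, width_two_zero, pl_congr hγ, h₀, upper]; push_cast; ring
  have r1 : ∀ p, P.rowVal (width 2 d.n) 1 p = c + p 1 := fun p => by
    rw [TropPoly.rowVal, width_two_one, pl_zero, h₁]; push_cast; ring
  refine ⟨fun m p => ?_, fun p => ?_⟩
  · rw [hP.mem_maxTerms_iff, exists_lt_two, width_two_zero, width_two_one]
    simp only [forall_lt_two, r0, r1, peak_congr hγ, peak_zero]
    refine or_congr ?_ ?_
    · refine exists_congr fun k => and_congr_right fun _ => and_congr_right fun _ => ?_
      simp
    · constructor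
      · rintro ⟨k, rfl, rfl, h⟩; exact ⟨rfl, by linarith [h.1]⟩
      · rintro ⟨rfl, h⟩; exact ⟨0, rfl, rfl, by linarith, le_rfl⟩
  · apply le_antisymm
    · refine hP.val_le ?_
      rw [forall_lt_two, r0, r1]
      exact ⟨by linarith [le_max_left (d.upper (p 0)) (p 1)],
        by linarith [le_max_right (d.upper (p 0)) (p 1)]⟩
    · have e0 := hP.rowVal_le_val (j := 0) (by omega) p
      have e1 := hP.rowVal_le_val (j := 1) (by omega) p
      rw [r0] at e0; rw [r1] at e1
      rw [← max_add_add_left]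
      exact max_le e0 e1

lemma max_f (hf : f.HasRows 3 (width 3 d.n)) (hβ : ∀ k < d.n, f.brk 0 k = d.β k)
    (hφ : ∀ k < d.n, f.brk 1 k = d.φ k) {c : ℝ} (h₀ : f.coeff (ipt 0 0) = c + (d.u₀ + d.l₀))
    (h₁ : f.coeff (ipt 0 1) = c + d.w₀) (h₂ : f.coeff (ipt 0 2) = c + d.f₂) :
    (∀ m p, m ∈ f.maxTerms p ↔
      (∃ k, m = ipt k 0 ∧ Peak d.n d.β k (p 0) ∧
        d.mid (p 0) + p 1 ≤ d.lower (p 0) + d.upper (p 0) ∧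
        d.f₂ + 2 * p 1 ≤ d.lower (p 0) + d.upper (p 0)) ∨
      (∃ k, m = ipt k 1 ∧ Peak d.n d.φ k (p 0) ∧
        d.lower (p 0) + d.upper (p 0) ≤ d.mid (p 0) + p 1 ∧ d.f₂ + p 1 ≤ d.mid (p 0)) ∨
      m = ipt 0 2 ∧ d.lower (p 0) + d.upper (p 0) ≤ d.f₂ + 2 * p 1 ∧
        d.mid (p 0) ≤ d.f₂ + p 1) ∧
    ∀ p, f.val p = c + max (d.lower (p 0) + d.upper (p 0))
      (max (d.mid (p 0) + p 1) (d.f₂ + 2 * p 1)) := by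
  have r0 : ∀ p, f.rowVal (width 3 d.n) 0 p = c + (d.lower (p 0) + d.upper (p 0)) := fun p => by
    rw [TropPoly.rowVal, width_three_zero, pl_congr hβ, h₀, lower, upper]; push_cast; ring
  have r1 : ∀ p, f.rowVal (width 3 d.n) 1 p = c + (d.mid (p 0) + p 1) := fun p => by
    rw [TropPoly.rowVal, width_three_one, pl_congr hφ, h₁, mid]; push_cast; ring
  have r2 : ∀ p, f.rowVal (width 3 d.n) 2 p = c + (d.f₂ + 2 * p 1) := fun p => by
    rw [TropPoly.rowVal, width_three_two, pl_zero, h₂]; push_cast; ring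
  refine ⟨fun m p => ?_, fun p => ?_⟩
  · rw [hf.mem_maxTerms_iff, exists_lt_three, width_three_zero, width_three_one, width_three_two]
    simp only [forall_lt_three, r0, r1, r2, peak_congr hβ, peak_congr hφ, peak_zero]
    refine or_congr ?_ (or_congr ?_ ?_)
    · refine exists_congr fun k => and_congr_right fun _ => and_congr_right fun _ => ?_
      constructor
      · intro h; exact ⟨by linarith [h.2.1], by linarith [h.2.2]⟩
      · intro h; exact ⟨le_rfl, by linarith [h.1], by linarith [h.2]⟩
    · refine exists_congr fun k => and_congr_right fun _ => and_congr_right fun _ => ?_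
      constructor
      · intro h; exact ⟨by linarith [h.1], by linarith [h.2.2]⟩
      · intro h; exact ⟨by linarith [h.1], le_rfl, by linarith [h.2]⟩
    · constructor
      · rintro ⟨k, rfl, rfl, h⟩; exact ⟨rfl, by linarith [h.1], by linarith [h.2.1]⟩
      · rintro ⟨rfl, h⟩; exact ⟨0, rfl, rfl, by linarith [h.1], by linarith [h.2], le_rfl⟩
  · apply le_antisymm
    · refine hf.val_le ?_
      rw [forall_lt_three, r0, r1, r2]
      simp only [add_le_add_iff_left]
      exact ⟨le_max_left _ _, (le_max_left _ _).trans (le_max_right _ _),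
        (le_max_right _ _).trans (le_max_right _ _)⟩
    · have e0 := hf.rowVal_le_val (j := 0) (by omega) p
      have e1 := hf.rowVal_le_val (j := 1) (by omega) p
      have e2 := hf.rowVal_le_val (j := 2) (by omega) p
      rw [r0] at e0; rw [r1] at e1; rw [r2] at e2
      rw [← max_add_add_left, ← max_add_add_left]
      exact max_le e0 (max_le e1 e2)

lemma max_g (hg : g.newtonPolytope = segment ℝ (pt 0 0) (pt 0 1)) {ε : ℝ}
    (hE : g.hypersurface = {p | p 1 = ε}) :
    (∀ m p, m ∈ g.maxTerms p ↔ m = ipt 0 0 ∧ p 1 ≤ ε ∨ m = ipt 0 1 ∧ ε ≤ p 1) ∧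
    ∃ c, ∀ p, g.val p = c + max ε (p 1) := by
  have hs : (g.support : Set (Fin 2 → ℤ)) = {ipt 0 0, ipt 0 1} :=
    eq_endpoints_of_segment (by rw [toReal_ipt, toReal_ipt]; exact hg)
      (isPrimitiveVec_sub_of_snd (by simp))
  have hs' : ∀ m, m ∈ g.support ↔ m = ipt 0 0 ∨ m = ipt 0 1 := fun m => by
    rw [← Finset.mem_coe, hs]; simp
  have t0 : ∀ p, g.term (ipt 0 0) p = g.coeff (ipt 0 0) := fun p => by
    simp [TropPoly.term, ipt]
  have t1 : ∀ p, g.term (ipt 0 1) p = g.coeff (ipt 0 1) + p 1 := fun p => by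
    simp [TropPoly.term, ipt]
  have hε : g.coeff (ipt 0 0) = g.coeff (ipt 0 1) + ε := by
    have hmem : (![0, ε] : Fin 2 → ℝ) ∈ g.hypersurface := by rw [hE]; simp
    obtain ⟨a, ha, b, hb, hab⟩ : (g.maxTerms ![0, ε]).Nontrivial := hmem
    have e := g.val_eq_of_mem ha
    rw [g.val_eq_of_mem hb] at e
    rcases (hs' a).1 ha.1 with rfl | rfl <;> rcases (hs' b).1 hb.1 with rfl | rfl
    · exact absurd rfl hab
    · rw [t0, t1] at e; simpa using e.symm
    · rw [t0, t1] at e; simpa using e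
    · exact absurd rfl hab
  refine ⟨fun m p => ?_, g.coeff (ipt 0 1), fun p => ?_⟩
  · constructor
    · rintro ⟨hm, h⟩
      have h0 := h _ ((hs' _).2 (Or.inl rfl))
      have h1 := h _ ((hs' _).2 (Or.inr rfl))
      rw [t0] at h0
      rw [t1] at h1
      rcases (hs' m).1 hm with rfl | rfl
      · rw [t0] at h1; exact Or.inl ⟨rfl, by linarith⟩
      · rw [t1] at h0; exact Or.inr ⟨rfl, by linarith⟩
    · rintro (⟨rfl, h⟩ | ⟨rfl, h⟩)
      · refine ⟨(hs' _).2 (Or.inl rfl), fun m' hm' => ?_⟩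
        rcases (hs' m').1 hm' with rfl | rfl
        · exact le_rfl
        · rw [t0, t1]; linarith
      · refine ⟨(hs' _).2 (Or.inr rfl), fun m' hm' => ?_⟩
        rcases (hs' m').1 hm' with rfl | rfl
        · rw [t0, t1]; linarith
        · exact le_rfl
  · have e0 := g.term_le_val ((hs' _).2 (Or.inl rfl)) p
    have e1 := g.term_le_val ((hs' _).2 (Or.inr rfl)) p
    rw [t0] at e0; rw [t1] at e1
    apply le_antisymm
    · refine Finset.sup'_le _ _ fun m hm => ?_
      rcases (hs' m).1 hm with rfl | rfl
      · rw [t0]; linarith [le_max_left ε (p 1)]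
      · rw [t1]; linarith [le_max_right ε (p 1)]
    · rw [← max_add_add_left]
      exact max_le (by linarith) e1

end Config

end Model

/-- The triangles of the dual subdivisions determine the exponents and the order of the breaks; the
common vertices of `V(P)` and `V(Q)` make the row `0` of `P` the upper boundary, and the positions
of the marked points relate the breaks and constant terms of `f` to those of `Q`. -/
theorem exists_model (n : ℕ) (hn : 1 ≤ n) (P Q f g : TropPoly 2) (ε : ℝ)
    (x : ℕ → Fin 2 → ℝ) (M : Set (Fin 2 → ℝ))
    (hM : M = {p | ∃ k, 1 ≤ k ∧ k ≤ 2 * n ∧ p = x k})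
    (hD : P.HasDualSubdivision {T | ∃ k < n, T = triDelta k})
    (hC : Q.HasDualSubdivision {T | ∃ k < n, T = triK k ∨ T = triL k ∨ T = triM k})
    (hDC : ∀ k < n, ∃ v, P.dualCell v = triDelta k ∧ Q.dualCell v = triM k)
    (hx_edge : ∀ k < n, Q.dualCell (x (k + 1)) = segment ℝ (pt k 1) (pt 0 2))
    (hx_first : ∀ k < n, ∃ v, Q.dualCell v = triK k ∧ x (k + 1) 0 = v 0)
    (hx_last : ∀ k, n + 1 ≤ k → k ≤ 2 * n → Q.dualCell (x k) = segment ℝ (pt 0 2) (pt n 1))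
    (hF : f.HasDualSubdivision {T | ∃ k < n, T = triDelta k ∨ T = triH n k ∨ T = triM k})
    (hg : g.newtonPolytope = segment ℝ (pt 0 0) (pt 0 1))
    (hE : g.hypersurface = {p | p 1 = ε})
    (hEC : ∀ v, (interior (Q.dualCell v)).Nonempty → ε < v 1)
    (hF_first : ∀ k < n, f.dualCell (x (k + 1)) = segment ℝ (pt k 0) (pt (k + 1) 0))
    (hF_mid : f.dualCell (x (n + 1)) = segment ℝ (pt 1 1) (pt n 0))
    (hF_last : ∀ k, 1 ≤ k → k ≤ n - 1 →
      f.dualCell (x (n + k + 1)) = segment ℝ (pt k 1) (pt (k + 1) 1)) :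
    ∃ d : Config, d.Valid ∧ d.IsModel P Q f g M := by
  have hPs := mem_support_iff_of_triDelta hn hD
  have hQs := mem_support_iff_of_triK hn hC
  have hfs := mem_support_iff_of_triH hn hF
  have hQ0 : ∀ k ≤ n, ipt k 0 ∈ Q.support := fun k hk =>
    (hQs _).2 ⟨0, by omega, k, by rwa [width_three_zero], rfl⟩
  have hQ1 : ∀ k ≤ n, ipt k 1 ∈ Q.support := fun k hk =>
    (hQs _).2 ⟨1, by omega, k, by rwa [width_three_one], rfl⟩
  have hf1 : ∀ k ≤ n, ipt k 1 ∈ f.support := fun k hk =>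
    (hfs _).2 ⟨1, by omega, k, by rwa [width_three_one], rfl⟩
  have hf2 : ipt 0 2 ∈ f.support := (hfs _).2 ⟨2, by omega, 0, by simp, rfl⟩
  -- the triangles of `Q`
  have hK : ∀ k < n, ∃ v, Q.maxTerms v = {ipt k 0, ipt k 1, ipt (k + 1) 0} ∧ x (k + 1) 0 = v 0 :=
    fun k hk => by
      obtain ⟨v, hv, h⟩ := hx_first k hk
      exact ⟨v, maxTerms_triK hv, h⟩
  have hxβ : ∀ k < n, x (k + 1) 0 = Q.brk 0 k := fun k hk => by
    obtain ⟨v, hv, h⟩ := hK k hk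
    rw [h]; exact TropPoly.eq_brk (by simp [hv]) (by simp [hv])
  have hβγ : ∀ k < n, Q.brk 0 k < Q.brk 1 k := fun k hk => by
    obtain ⟨v, hv, h⟩ := hK k hk
    rw [← hxβ k hk, h]
    exact TropPoly.lt_brk (by simp [hv]) (hQ1 _ hk) (by simp [hv, ipt_inj])
  have hγβ : ∀ k, k + 1 < n → Q.brk 1 k < Q.brk 0 (k + 1) := fun k hk => by
    obtain ⟨v, hv, -⟩ := hC.exists_of_mem ⟨k, by omega, Or.inr (Or.inl rfl)⟩
    have hv := maxTerms_triL hv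
    rw [← TropPoly.eq_brk (R := Q) (i := k) (j := 1) (p := v) (by simp [hv]) (by simp [hv])]
    exact TropPoly.lt_brk (by simp [hv]) (hQ0 _ hk) (by simp [hv, ipt_inj])
  have hQ : Q.HasRows 3 (width 3 n) := by
    refine ⟨hQs, ?_⟩
    rw [forall_lt_three, width_three_zero, width_three_one, width_three_two]
    exact ⟨increasing_of_succ fun k hk => (hβγ k (by omega)).trans (hγβ k hk),
      increasing_of_succ fun k hk => (hγβ k hk).trans (hβγ (k + 1) hk),
      fun i j _ hj => absurd hj (by omega)⟩
  have hγinc : Increasing n (Q.brk 1) := by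
    have := hQ.increasing 1 (by omega)
    rwa [width_three_one] at this
  -- the terms of `f` at the marked points
  have hf_first : ∀ k < n, f.maxTerms (x (k + 1)) = {ipt k 0, ipt (k + 1) 0} := fun k hk =>
    TropPoly.maxTerms_of_segment (hF_first k hk)
      (isPrimitiveVec_sub_of_fst (by simp))
  have hfβ : ∀ k < n, f.brk 0 k = Q.brk 0 k := fun k hk => by
    rw [← hxβ k hk]
    exact (TropPoly.eq_brk (by simp [hf_first k hk]) (by simp [hf_first k hk])).symm
  have hφ : ∀ k, k + 1 < n → f.brk 1 k < f.brk 1 (k + 1) := fun k hk => by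
    obtain ⟨v, hv, -⟩ := hF.exists_of_mem ⟨k, by omega, Or.inr (Or.inl rfl)⟩
    have hv := maxTerms_triH hv
    rw [← TropPoly.eq_brk (R := f) (i := k) (j := 1) (p := v) (by simp [hv]) (by simp [hv])]
    exact TropPoly.lt_brk (by simp [hv]) (hf1 _ hk) (by simp [hv, ipt_inj]; omega)
  have hβφ : ∀ k < n, Q.brk 0 k < f.brk 1 0 := fun k hk => by
    obtain ⟨v, hv, -⟩ := hF.exists_of_mem ⟨k, hk, Or.inl rfl⟩
    have hv := maxTerms_triDelta hv
    rw [← hfβ k hk,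
      ← TropPoly.eq_brk (R := f) (i := k) (j := 0) (p := v) (by simp [hv]) (by simp [hv])]
    exact TropPoly.lt_brk (by simp [hv]) (hf1 _ (by omega)) (by simp [hv, ipt_inj])
  have hf : f.HasRows 3 (width 3 n) := by
    refine ⟨hfs, ?_⟩
    rw [forall_lt_three, width_three_zero, width_three_one, width_three_two]
    refine ⟨increasing_of_succ fun k hk => ?_, increasing_of_succ hφ,
      fun i j _ hj => absurd hj (by omega)⟩
    rw [hfβ k (by omega), hfβ (k + 1) hk]
    exact (hβγ k (by omega)).trans (hγβ k hk)
  -- the polynomial `P`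
  have hPγ : ∀ k < n, P.brk 0 k = Q.brk 1 k := fun k hk => by
    obtain ⟨v, hv, hv'⟩ := hDC k hk
    have hv := maxTerms_triDelta hv
    have hv' := maxTerms_triM hv'
    rw [← TropPoly.eq_brk (R := P) (i := k) (j := 0) (p := v) (by simp [hv]) (by simp [hv])]
    exact TropPoly.eq_brk (by simp [hv']) (by simp [hv'])
  have hP : P.HasRows 2 (width 2 n) := by
    refine ⟨hPs, ?_⟩
    rw [forall_lt_two, width_two_zero, width_two_one]
    refine ⟨increasing_of_succ fun k hk => ?_, fun i j _ hj => absurd hj (by omega)⟩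
    rw [hPγ k (by omega), hPγ (k + 1) hk]
    exact (hγβ k hk).trans (hβγ (k + 1) hk)
  let d : Config :=
    { n := n
      β := Q.brk 0
      γ := Q.brk 1
      φ := f.brk 1
      σ := fun k => x (n + k + 1) 0
      u₀ := Q.coeff (ipt 0 1) - Q.coeff (ipt 0 2)
      l₀ := Q.coeff (ipt 0 0) - Q.coeff (ipt 0 1)
      w₀ := f.coeff (ipt 0 1) - (f.coeff (ipt 0 0) - (Q.coeff (ipt 0 0) - Q.coeff (ipt 0 2)))
      f₂ := f.coeff (ipt 0 2) - (f.coeff (ipt 0 0) - (Q.coeff (ipt 0 0) - Q.coeff (ipt 0 2)))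
      ε := ε }
  have hupper : ∀ p i, ipt i 1 ∈ Q.maxTerms p → ipt 0 2 ∈ Q.maxTerms p →
      p 1 = d.upper (p 0) := by
    intro p i h1 h2
    have e1 := (hQ.ipt_mem_maxTerms_iff.1 h1).2.2 2 (by omega)
    have e2 := (hQ.ipt_mem_maxTerms_iff.1 h2).2.2 1 (by omega)
    simp only [TropPoly.rowVal, width_three_one, width_three_two, pl_zero] at e1 e2
    push_cast at e1 e2
    change p 1 = Q.coeff (ipt 0 1) - Q.coeff (ipt 0 2) + pl n (Q.brk 1) (p 0)
    linarith
  have hQ_first : ∀ k < n, Q.maxTerms (x (k + 1)) = {ipt k 1, ipt 0 2} := fun k hk =>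
    TropPoly.maxTerms_of_segment (hx_edge k hk) (isPrimitiveVec_sub_of_snd (by simp))
  have hQ_last : ∀ k < n, Q.maxTerms (x (n + k + 1)) = {ipt 0 2, ipt n 1} := fun k hk =>
    TropPoly.maxTerms_of_segment (hx_last _ (by omega) (by omega))
      (isPrimitiveVec_sub_of_snd (by simp))
  have hx1 : ∀ k < n, x (k + 1) 1 = d.upper (Q.brk 0 k) := fun k hk => by
    rw [← hxβ k hk]
    exact hupper _ k (by simp [hQ_first k hk]) (by simp [hQ_first k hk])
  have hx2 : ∀ k < n, x (n + k + 1) 1 = d.upper (x (n + k + 1) 0) := fun k hk =>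
    hupper _ n (by simp [hQ_last k hk]) (by simp [hQ_last k hk])
  have hγσ : ∀ k < n, Q.brk 1 (n - 1) < x (n + k + 1) 0 := fun k hk => by
    have h := hQ_last k hk
    refine TropPoly.brk_lt ?_ (hQ1 _ (by omega)) (by rw [h]; simp [ipt_inj]; omega)
    rw [h, Nat.sub_add_cancel hn]; simp
  have hf_mid : f.maxTerms (x (n + 1)) = {ipt 1 1, ipt n 0} :=
    TropPoly.maxTerms_of_segment hF_mid (isPrimitiveVec_sub_of_snd (by simp))
  have hf_last : ∀ k, 1 ≤ k → k < n →
      f.maxTerms (x (n + k + 1)) = {ipt k 1, ipt (k + 1) 1} := fun k hk hkn =>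
    TropPoly.maxTerms_of_segment (hF_last k hk (by omega))
      (isPrimitiveVec_sub_of_fst (by simp))
  have hmid : ∀ p i, ipt i 1 ∈ f.maxTerms p → ipt 0 2 ∉ f.maxTerms p →
      d.f₂ + p 1 < d.mid (p 0) := by
    intro p i h1 h2
    have e1 := TropPoly.term_lt_of_notMem h1 hf2 h2
    have e2 := (hf.ipt_mem_maxTerms_iff.1 h1).2.1
    rw [width_three_one] at e2
    rw [TropPoly.term_ipt, TropPoly.term_ipt, ← e2.pl_eq] at e1
    simp only [lin, Finset.range_zero, Finset.sum_empty] at e1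
    push_cast at e1
    change f.coeff (ipt 0 2) - _ + p 1 < f.coeff (ipt 0 1) - _ + pl n (f.brk 1) (p 0)
    linarith
  -- the first marked point
  have hβ0 : pl n (Q.brk 1) (Q.brk 0 0) = 0 := pl_eq_zero fun j hj =>
    (hβγ 0 (by omega)).le.trans (hγinc.le (Nat.zero_le _) hj)
  have hγ0 : pl n (Q.brk 1) (Q.brk 1 0) = 0 := pl_eq_zero fun j hj =>
    hγinc.le (Nat.zero_le _) hj
  have hx1' : x 1 1 = d.u₀ := by
    have := hx1 0 (by omega)
    rw [zero_add] at this
    rw [this]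
    change d.u₀ + pl n (Q.brk 1) (Q.brk 0 0) = d.u₀
    rw [hβ0, add_zero]
  have hM0 : ∃ v, P.maxTerms v = {ipt 0 0, ipt 0 1, ipt 1 0} ∧
      Q.maxTerms v = {ipt 0 1, ipt 0 2, ipt 1 1} := by
    obtain ⟨v, hv, hv'⟩ := hDC 0 (by omega)
    exact ⟨v, maxTerms_triDelta hv, maxTerms_triM hv'⟩
  obtain ⟨vM, hPM, hQM⟩ := hM0
  have hvM0 : vM 0 = Q.brk 1 0 := TropPoly.eq_brk (by simp [hQM]) (by simp [hQM])
  have hvM1 : vM 1 = d.u₀ := by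
    rw [hupper vM 0 (by simp [hQM]) (by simp [hQM]), hvM0]
    change d.u₀ + pl n (Q.brk 1) (Q.brk 1 0) = d.u₀
    rw [hγ0, add_zero]
  have hf01 : d.w₀ < d.l₀ ∧ d.f₂ + d.u₀ < d.l₀ := by
    have h := hf_first 0 (by omega)
    rw [zero_add] at h
    have e1 := TropPoly.term_lt_of_notMem (R := f) (m := ipt 0 0) (p := x 1) (by simp [h])
      (hf1 0 (by omega)) (by simp [h, ipt_inj])
    have e2 := TropPoly.term_lt_of_notMem (R := f) (m := ipt 0 0) (p := x 1) (by simp [h])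
      hf2 (by simp [h, ipt_inj])
    rw [TropPoly.term_ipt, TropPoly.term_ipt] at e1 e2
    simp only [lin, Finset.range_zero, Finset.sum_empty] at e1 e2
    push_cast at e1 e2
    rw [hx1'] at e1 e2
    change f.coeff (ipt 0 1) - (f.coeff (ipt 0 0) - (Q.coeff (ipt 0 0) - Q.coeff (ipt 0 2))) <
      Q.coeff (ipt 0 0) - Q.coeff (ipt 0 1) ∧
      f.coeff (ipt 0 2) - (f.coeff (ipt 0 0) - (Q.coeff (ipt 0 0) - Q.coeff (ipt 0 2))) +
      (Q.coeff (ipt 0 1) - Q.coeff (ipt 0 2)) < Q.coeff (ipt 0 0) - Q.coeff (ipt 0 1)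
    have hu : d.u₀ = Q.coeff (ipt 0 1) - Q.coeff (ipt 0 2) := rfl
    rw [hu] at e1 e2
    constructor <;> linarith
  have hvalid : d.Valid :=
    { pos := hn
      β_lt_γ := hβγ
      γ_lt_β := hγβ
      gap := by
        have e1 := TropPoly.term_lt_of_notMem (R := Q) (m := ipt 0 2) (p := vM) (by simp [hQM])
          (hQ0 1 hn) (by simp [hQM, ipt_inj])
        rw [TropPoly.term_ipt, TropPoly.term_ipt, hvM0, hvM1] at e1
        simp only [lin, Finset.range_zero, Finset.sum_empty, Finset.range_one,
          Finset.sum_singleton] at e1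
        push_cast at e1
        change Q.coeff (ipt 0 0) - Q.coeff (ipt 0 1) + (Q.brk 1 0 - Q.brk 0 0) <
          Q.coeff (ipt 0 1) - Q.coeff (ipt 0 2)
        have hu : d.u₀ = Q.coeff (ipt 0 1) - Q.coeff (ipt 0 2) := rfl
        rw [hu] at e1
        linarith
      ε_lt := by
        obtain ⟨v, hv, hi⟩ := hC.exists_of_mem ⟨0, by omega, Or.inl rfl⟩
        have h := maxTerms_triK hv
        have e1 := hEC v hi
        have e2 := Q.val_eq_of_mem (m := ipt 0 0) (x := v) (by simp [h])
        have e3 := Q.val_eq_of_mem (m := ipt 0 1) (x := v) (by simp [h])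
        rw [TropPoly.term_ipt] at e2 e3
        simp only [lin, Finset.range_zero, Finset.sum_empty] at e2 e3
        push_cast at e2 e3
        change ε < Q.coeff (ipt 0 0) - Q.coeff (ipt 0 1)
        linarith
      φ_lt := hφ
      β_lt_φ := hβφ
      w₀_lt := hf01.1
      f₂_lt := hf01.2
      γ_lt_σ := hγσ
      φ_lt_σ := TropPoly.brk_lt (by simp [hf_mid]) (hf1 0 (by omega)) (by simp [hf_mid, ipt_inj])
      σ_lt_φ := fun h1 => TropPoly.lt_brk (by simp [hf_mid]) (hf1 2 h1)
        (by simp [hf_mid, ipt_inj])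
      mid_σ := by
        have e1 := (hf.ipt_mem_maxTerms_iff (k := 1) (j := 1).1
          (show _ ∈ f.maxTerms (x (n + 1)) by simp [hf_mid])).2.2 0 (by omega)
        have e2 := (hf.ipt_mem_maxTerms_iff (k := n) (j := 0).1
          (show _ ∈ f.maxTerms (x (n + 1)) by simp [hf_mid])).2.2 1 (by omega)
        simp only [TropPoly.rowVal, width_three_one, width_three_zero] at e1 e2
        rw [pl_congr hfβ] at e1 e2
        have e3 := hx2 0 (by omega)
        rw [add_zero] at e3
        rw [e3] at e1 e2
        push_cast at e1 e2
        change _ - (_ - (_ - _)) + pl n (f.brk 1) (x (n + 1) 0) =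
          _ - _ + pl n (Q.brk 0) (x (n + 1) 0) - pl n (Q.brk 1) (x (n + 1) 0)
        have e4 : d.upper (x (n + 1) 0) = Q.coeff (ipt 0 1) - Q.coeff (ipt 0 2) +
          pl n (Q.brk 1) (x (n + 1) 0) := rfl
        rw [e4] at e1 e2
        linarith
      σ_eq := fun k hk hkn =>
        TropPoly.eq_brk (by simp [hf_last k hk hkn]) (by simp [hf_last k hk hkn])
      f₂_lt' := by
        change d.f₂ + d.upper (x (n + (n - 1) + 1) 0) < d.mid (x (n + (n - 1) + 1) 0)
        rw [← hx2 (n - 1) (by omega)]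
        rcases Nat.lt_or_ge 1 n with h | h
        · have h' := hf_last (n - 1) (by omega) (by omega)
          exact hmid _ (n - 1) (by simp [h']) (by simp [h', ipt_inj])
        · obtain rfl : n = 1 := by omega
          exact hmid _ 1 (by simp [hf_mid]) (by simp [hf_mid, ipt_inj]) }
  obtain ⟨hg1, hg2⟩ := Config.max_g hg hE
  have hPmodel := Config.max_P (d := d) hP hPγ (c := P.coeff (ipt 0 1)) (by
    have e1 := P.val_eq_of_mem (m := ipt 0 0) (x := vM) (by simp [hPM])
    have e2 := P.val_eq_of_mem (m := ipt 0 1) (x := vM) (by simp [hPM])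
    rw [TropPoly.term_ipt] at e1 e2
    simp only [lin, Finset.range_zero, Finset.sum_empty] at e1 e2
    push_cast at e1 e2
    rw [hvM1] at e1 e2
    linarith) rfl
  have hfmodel := Config.max_f (d := d) hf hfβ (fun _ _ => rfl)
    (c := f.coeff (ipt 0 0) - (Q.coeff (ipt 0 0) - Q.coeff (ipt 0 2)))
    (by change _ = _ + (_ - _ + (_ - _)); ring)
    (by change _ = _ + (_ - _); ring) (by change _ = _ + (_ - _); ring)
  refine ⟨d, hvalid, ?_, hPmodel.1, ⟨_, hPmodel.2⟩, hfmodel.1, ⟨_, hfmodel.2⟩, hg1, hg2, ?_⟩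
  · exact Config.max_Q (d := d) hvalid hQ (fun _ _ => rfl) (fun _ _ => rfl)
      (q := Q.coeff (ipt 0 2)) (by change _ = _ + (_ - _ + (_ - _)); ring)
      (by change _ = _ + (_ - _); ring) rfl
  · have hvec : ∀ (p : Fin 2 → ℝ) a b, p = ![a, b] ↔ p 0 = a ∧ p 1 = b := by
      intro p a b
      constructor
      · rintro rfl; simp
      · rintro ⟨h0, h1⟩
        funext i; fin_cases i; exacts [h0, h1]
    rw [hM]
    ext p
    constructor
    · rintro ⟨k, hk1, hk2, rfl⟩
      rcases Nat.lt_or_ge n k with h | h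
      · refine ⟨k - n - 1, show _ < n by omega, Or.inr ?_⟩
        rw [hvec]
        have := hx2 (k - n - 1) (by omega)
        have hk : n + (k - n - 1) + 1 = k := by omega
        change x k 0 = x (n + (k - n - 1) + 1) 0 ∧ x k 1 = d.upper (x (n + (k - n - 1) + 1) 0)
        rw [hk] at this ⊢
        exact ⟨rfl, this⟩
      · refine ⟨k - 1, show _ < n by omega, Or.inl ?_⟩
        rw [hvec]
        have e1 := hxβ (k - 1) (by omega)
        have e2 := hx1 (k - 1) (by omega)
        rw [Nat.sub_add_cancel hk1] at e1 e2
        exact ⟨e1, e2⟩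
    · rintro ⟨k, hk, h | h⟩
      · have hk : k < n := hk
        refine ⟨k + 1, by omega, by omega, ?_⟩
        rw [hvec] at h
        funext i; fin_cases i
        · exact h.1.trans (hxβ k hk).symm
        · exact h.2.trans (hx1 k hk).symm
      · have hk : k < n := hk
        refine ⟨n + k + 1, by omega, by omega, ?_⟩
        rw [hvec] at h
        funext i; fin_cases i
        · exact h.1
        · exact h.2.trans (hx2 k hk).symm


/-! ### The curve in normal form -/

lemma peak_cases {n : ℕ} {b : ℕ → ℝ} (hb : Increasing n b) (t : ℝ) :
    (∃ k, (∀ k', Peak n b k' t ↔ k' = k) ∧ slopeR n b t = k ∧ slopeL n b t = k ∧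
      ∀ j < n, b j ≠ t) ∨
    ∃ k < n, t = b k ∧ (∀ k', Peak n b k' t ↔ k' = k ∨ k' = k + 1) ∧
      slopeR n b t = k + 1 ∧ slopeL n b t = k := by
  by_cases h : ∀ j < n, b j ≠ t
  · left
    obtain ⟨k, hk, hlt⟩ := exists_peak hb t
    refine ⟨k, fun k' => ⟨fun h' => h'.eq_of_lt h hk, fun h' => h' ▸ hk⟩,
      slopeR_eq_of_peak hk.2.1 hk.1 hlt, ?_, h⟩
    rw [← slopeR_eq_of_ne h, slopeR_eq_of_peak hk.2.1 hk.1 hlt]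
  · right
    push Not at h
    obtain ⟨k, hk, rfl⟩ := h
    exact ⟨k, hk, rfl, peak_at_break hb hk, slopeR_break hb hk⟩

namespace Config

/-- The position of a point `p` on the curve `V(Q)` in normal form: on one of the vertical rays, on
the lower boundary (at a regular point, or below a ray or a segment), on one of the vertical
segments, on the upper boundary (at a regular point, or above a segment). -/
inductive PointType (d : Config) (Q : TropPoly 2) (p : Fin 2 → ℝ) : Prop
  | ray (k : ℕ) (hk : k < d.n) (h0 : p 0 = d.β k) (h1 : p 1 < d.lower (p 0))
      (hmax : Q.maxTerms p = {ipt k 0, ipt (k + 1) 0})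
  | lower (k i : ℕ) (h1 : p 1 = d.lower (p 0)) (hβ : ∀ j < d.n, d.β j ≠ p 0)
      (hγ : ∀ j < d.n, d.γ j ≠ p 0) (hk : Peak d.n d.β k (p 0)) (hi : Peak d.n d.γ i (p 0))
      (hmax : Q.maxTerms p = {ipt k 0, ipt i 1})
  | lowerβ (k i : ℕ) (hk : k < d.n) (h0 : p 0 = d.β k) (h1 : p 1 = d.lower (p 0))
      (hmax : Q.maxTerms p = {ipt k 0, ipt (k + 1) 0, ipt i 1})
  | lowerγ (k i : ℕ) (hi : i < d.n) (h0 : p 0 = d.γ i) (h1 : p 1 = d.lower (p 0))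
      (hmax : Q.maxTerms p = {ipt k 0, ipt (i + 1) 1, ipt i 1})
  | seg (i : ℕ) (hi : i < d.n) (h0 : p 0 = d.γ i) (h1 : d.lower (p 0) < p 1)
      (h2 : p 1 < d.upper (p 0)) (hmax : Q.maxTerms p = {ipt i 1, ipt (i + 1) 1})
  | upper (i : ℕ) (h1 : p 1 = d.upper (p 0)) (hγ : ∀ j < d.n, d.γ j ≠ p 0)
      (hi : Peak d.n d.γ i (p 0)) (hmax : Q.maxTerms p = {ipt i 1, ipt 0 2})
  | upperγ (i : ℕ) (hi : i < d.n) (h0 : p 0 = d.γ i) (h1 : p 1 = d.upper (p 0))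
      (hmax : Q.maxTerms p = {ipt i 1, ipt (i + 1) 1, ipt 0 2})

variable {d : Config} {P Q f g : TropPoly 2} {M : Set (Fin 2 → ℝ)}

lemma IsModel.pointType (hm : d.IsModel P Q f g M) (hd : d.Valid) {p : Fin 2 → ℝ}
    (hp : p ∈ Q.hypersurface) : PointType d Q p := by
  have hlu := hd.lower_lt_upper (p 0)
  have hQ := fun m => hm.Q_max m p
  have hp : (Q.maxTerms p).Nontrivial := hp
  have hcut : ∀ S : Set (Fin 2 → ℤ), (∀ m, m ∈ Q.maxTerms p ↔ m ∈ S) → Q.maxTerms p = S :=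
    fun S h => Set.ext h
  have hsing : ∀ m, ¬ ∀ m', m' ∈ Q.maxTerms p ↔ m' = m := by
    intro m h
    rw [hcut {m} h] at hp
    exact Set.not_nontrivial_singleton hp
  rcases peak_cases hd.increasing_β (p 0) with ⟨k, hk, -, -, hβ⟩ | ⟨k, hkn, hpk, hk, -, -⟩ <;>
  rcases peak_cases hd.increasing_γ (p 0) with ⟨i, hi, -, -, hγ⟩ | ⟨i, hin, hpi, hi, -, -⟩
  · rcases lt_trichotomy (p 1) (d.lower (p 0)) with h | h | h
    · exact absurd (fun m => by rw [hQ]; simp only [hk, hi]; grind) (hsing (ipt k 0))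
    · exact .lower k i h hβ hγ ((hk k).2 rfl) ((hi i).2 rfl)
        (hcut _ fun m => by rw [hQ]; simp only [hk, hi]; grind)
    · rcases lt_trichotomy (p 1) (d.upper (p 0)) with h' | h' | h'
      · exact absurd (fun m => by rw [hQ]; simp only [hk, hi]; grind) (hsing (ipt i 1))
      · exact .upper i h' hγ ((hi i).2 rfl)
          (hcut _ fun m => by rw [hQ]; simp only [hk, hi]; grind)
      · exact absurd (fun m => by rw [hQ]; simp only [hk, hi]; grind) (hsing (ipt 0 2))
  · rcases lt_trichotomy (p 1) (d.lower (p 0)) with h | h | h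
    · exact absurd (fun m => by rw [hQ]; simp only [hk, hi]; grind) (hsing (ipt k 0))
    · exact .lowerγ k i hin hpi h (hcut _ fun m => by rw [hQ]; simp only [hk, hi]; grind)
    · rcases lt_trichotomy (p 1) (d.upper (p 0)) with h' | h' | h'
      · exact .seg i hin hpi h h' (hcut _ fun m => by rw [hQ]; simp only [hk, hi]; grind)
      · exact .upperγ i hin hpi h' (hcut _ fun m => by rw [hQ]; simp only [hk, hi]; grind)
      · exact absurd (fun m => by rw [hQ]; simp only [hk, hi]; grind) (hsing (ipt 0 2))
  · rcases lt_trichotomy (p 1) (d.lower (p 0)) with h | h | h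
    · exact .ray k hkn hpk h (hcut _ fun m => by rw [hQ]; simp only [hk, hi]; grind)
    · exact .lowerβ k i hkn hpk h (hcut _ fun m => by rw [hQ]; simp only [hk, hi]; grind)
    · rcases lt_trichotomy (p 1) (d.upper (p 0)) with h' | h' | h'
      · exact absurd (fun m => by rw [hQ]; simp only [hk, hi]; grind) (hsing (ipt i 1))
      · refine .upper i h' (fun j hj h'' => ?_) ((hi i).2 rfl)
          (hcut _ fun m => by rw [hQ]; simp only [hk, hi]; grind)
        exact hd.β_ne_γ hkn hj (hpk.symm.trans h''.symm)
      · exact absurd (fun m => by rw [hQ]; simp only [hk, hi]; grind) (hsing (ipt 0 2))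
  · exact absurd (hpk.symm.trans hpi) (hd.β_ne_γ hkn hin)

lemma area_lowerβ (k i : ℕ) : area (ipt k 0) (ipt (k + 1) 0) (ipt i 1) = 1 := by
  simp [area, ipt]

lemma area_lowerγ (k i : ℕ) : area (ipt k 0) (ipt (i + 1) 1) (ipt i 1) = 1 := by
  simp [area, ipt]

lemma area_upperγ (i : ℕ) : area (ipt i 1) (ipt (i + 1) 1) (ipt 0 2) = 1 := by
  simp [area, ipt]

lemma IsModel.isSmooth (hm : d.IsModel P Q f g M) (hd : d.Valid) : Q.IsSmooth := by
  intro p hp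
  cases hm.pointType hd hp with
  | ray k _ _ _ h => exact Or.inl ⟨_, _, h, isPrimitiveVec_sub_of_fst (by simp)⟩
  | lower k i _ _ _ _ _ h => exact Or.inl ⟨_, _, h, isPrimitiveVec_sub_of_snd (by simp)⟩
  | lowerβ k i _ _ _ h => exact Or.inr ⟨_, _, _, h, area_lowerβ k i⟩
  | lowerγ k i _ _ _ h => exact Or.inr ⟨_, _, _, h, area_lowerγ k i⟩
  | seg i _ _ _ _ h => exact Or.inl ⟨_, _, h, isPrimitiveVec_sub_of_fst (by simp)⟩
  | upper i _ _ _ h => exact Or.inl ⟨_, _, h, isPrimitiveVec_sub_of_snd (by simp)⟩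
  | upperγ i _ _ _ h => exact Or.inr ⟨_, _, _, h, area_upperγ i⟩

lemma IsModel.finite_marked (hm : d.IsModel P Q f g M) : M.Finite := by
  rw [hm.marked]
  refine (((Finset.range d.n).finite_toSet.image fun k => ![d.β k, d.upper (d.β k)]).union
    ((Finset.range d.n).finite_toSet.image fun k => ![d.σ k, d.upper (d.σ k)])).subset ?_
  rintro p ⟨k, hk, rfl | rfl⟩
  · exact Or.inl ⟨k, by simpa using hk, rfl⟩
  · exact Or.inr ⟨k, by simpa using hk, rfl⟩

/-- A point is marked if it lies on the upper boundary and its first coordinate is one of the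
numbers `β k` or `σ k`. -/
lemma IsModel.mem_marked_iff (hm : d.IsModel P Q f g M) {p : Fin 2 → ℝ} :
    p ∈ M ↔ p 1 = d.upper (p 0) ∧ ∃ k < d.n, p 0 = d.β k ∨ p 0 = d.σ k := by
  rw [hm.marked]
  constructor
  · rintro ⟨k, hk, rfl | rfl⟩
    · exact ⟨by simp, k, hk, Or.inl (by simp)⟩
    · exact ⟨by simp, k, hk, Or.inr (by simp)⟩
  · rintro ⟨h1, k, hk, h0 | h0⟩
    · refine ⟨k, hk, Or.inl ?_⟩
      rw [← h0, ← h1]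
      funext i; fin_cases i <;> rfl
    · refine ⟨k, hk, Or.inr ?_⟩
      rw [← h0, ← h1]
      funext i; fin_cases i <;> rfl

lemma IsModel.mem_hypersurface_upper (hm : d.IsModel P Q f g M) (hd : d.Valid) {p : Fin 2 → ℝ}
    (h : p 1 = d.upper (p 0)) : p ∈ Q.hypersurface := by
  obtain ⟨i, hi, -⟩ := exists_peak hd.increasing_γ (p 0)
  refine ⟨ipt i 1, (hm.Q_max _ _).2 (Or.inr (Or.inl ⟨i, rfl, hi, ?_, h.le⟩)), ipt 0 2,
    (hm.Q_max _ _).2 (Or.inr (Or.inr ⟨rfl, h.ge⟩)), by rw [Ne, ipt_inj]; omega⟩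
  rw [h]; exact (hd.lower_lt_upper _).le

lemma IsModel.mem_hypersurface_lower (hm : d.IsModel P Q f g M) (hd : d.Valid) {p : Fin 2 → ℝ}
    (h : p 1 = d.lower (p 0)) : p ∈ Q.hypersurface := by
  obtain ⟨i, hi, -⟩ := exists_peak hd.increasing_γ (p 0)
  obtain ⟨k, hk, -⟩ := exists_peak hd.increasing_β (p 0)
  refine ⟨ipt i 1, (hm.Q_max _ _).2 (Or.inr (Or.inl ⟨i, rfl, hi, h.ge, ?_⟩)), ipt k 0,
    (hm.Q_max _ _).2 (Or.inl ⟨k, rfl, hk, h.le⟩), by rw [Ne, ipt_inj]; omega⟩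
  rw [h]; exact (hd.lower_lt_upper _).le

lemma IsModel.germCurve (hm : d.IsModel P Q f g M) (hd : d.Valid) :
    GermCurve (markedCurve Q M) M (curveVertices Q M) (germDirs Q) :=
  markedCurve_germCurve (hm.isSmooth hd) hm.finite_marked fun _ hp =>
    hm.mem_hypersurface_upper hd (hm.mem_marked_iff.1 hp).1

/-! ### The height function of the lift -/

/-- The height of the lift over the curve, up to an additive constant. -/
noncomputable def height (d : Config) (p : Fin 2 → ℝ) : ℝ :=
  if d.upper (p 0) ≤ p 1 then d.top (p 0)
  else min (d.upper (p 0)) (d.lower (p 0) + d.upper (p 0) - p 1)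

open Classical in
/-- The slopes of the height function in the outgoing directions of the curve. -/
noncomputable def heightSlope (d : Config) (p : Fin 2 → ℝ) (v : Fin 2 → ℤ) : ℤ :=
  if v 0 = 0 then if ∃ i < d.n, p 0 = d.γ i then -v 1 else 0
  else if d.upper (p 0) ≤ p 1 then
    if 0 < v 0 then
      v 0 * (slopeR d.n d.β (p 0) - slopeR d.n d.γ (p 0) + slopeR d.n d.σ (p 0))
    else v 0 * (slopeL d.n d.β (p 0) - slopeL d.n d.γ (p 0) + slopeL d.n d.σ (p 0))
  else if 0 < v 0 then v 0 * slopeR d.n d.γ (p 0) else v 0 * slopeL d.n d.γ (p 0)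

lemma height_of_le_lower (hd : d.Valid) {p : Fin 2 → ℝ} (h : p 1 ≤ d.lower (p 0)) :
    d.height p = d.upper (p 0) := by
  have := hd.lower_lt_upper (p 0)
  rw [height, if_neg (by linarith), min_eq_left (by linarith)]

lemma height_upper {p : Fin 2 → ℝ} (h : p 1 = d.upper (p 0)) : d.height p = d.top (p 0) := by
  rw [height, if_pos h.ge]

lemma height_seg (hd : d.Valid) {p : Fin 2 → ℝ} {i : ℕ} (hi : i < d.n) (h0 : p 0 = d.γ i)
    (h1 : d.lower (p 0) ≤ p 1) (h2 : p 1 ≤ d.upper (p 0)) :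
    d.height p = d.lower (p 0) + d.upper (p 0) - p 1 := by
  rcases h2.lt_or_eq with h | h
  · rw [height, if_neg (by linarith), min_eq_right (by linarith)]
  · rw [height_upper h, h, hd.top_eq_lower]
    · ring
    · rw [h0]; exact (hd.γ_lt_σ' hi hd.pos).le

lemma linePt_apply {N : ℕ} (p : Fin N → ℝ) (v : Fin N → ℤ) (t : ℝ) (i : Fin N) :
    linePt p v t i = p i + t * v i := by
  simp [linePt, toReal]

/-- A break common to two consecutive monomials of a row. -/
lemma eq_of_peak_succ {n : ℕ} {b : ℕ → ℝ} {k : ℕ} {t : ℝ} (h : Peak n b k t)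
    (h' : Peak n b (k + 1) t) : t = b k :=
  le_antisymm (h.2.2 k le_rfl h'.1) (h'.2.1 k (by omega))

lemma pl_of_peak {n : ℕ} {b : ℕ → ℝ} {k : ℕ} {s t : ℝ} (hs : Peak n b k s) (ht : Peak n b k t) :
    (s ≤ t → pl n b t = pl n b s + (t - s) * slopeR n b s) ∧
    (t ≤ s → pl n b t = pl n b s + (t - s) * slopeL n b s) := by
  constructor
  · intro h
    refine pl_right h fun j hj => ?_
    rcases lt_or_ge j k with hjk | hjk
    · exact Or.inl (hs.2.1 j hjk)
    · exact Or.inr (ht.2.2 j hjk hj)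
  · intro h
    refine pl_left h fun j hj => ?_
    rcases lt_or_ge j k with hjk | hjk
    · exact Or.inr (ht.2.1 j hjk)
    · exact Or.inl (hs.2.2 j hjk hj)

section Membership

variable {p q : Fin 2 → ℝ}

lemma IsModel.row_zero (hm : d.IsModel P Q f g M) {k : ℕ} (h : ipt k 0 ∈ Q.maxTerms p) :
    Peak d.n d.β k (p 0) ∧ p 1 ≤ d.lower (p 0) := by
  rcases (hm.Q_max _ _).1 h with ⟨k', h1, h2⟩ | ⟨k', h1, -⟩ | ⟨h1, -⟩
  · rw [ipt_inj] at h1; rw [h1.1]; exact h2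
  · rw [ipt_inj] at h1; omega
  · rw [ipt_inj] at h1; omega

lemma IsModel.row_one (hm : d.IsModel P Q f g M) {k : ℕ} (h : ipt k 1 ∈ Q.maxTerms p) :
    Peak d.n d.γ k (p 0) ∧ d.lower (p 0) ≤ p 1 ∧ p 1 ≤ d.upper (p 0) := by
  rcases (hm.Q_max _ _).1 h with ⟨k', h1, -⟩ | ⟨k', h1, h2⟩ | ⟨h1, -⟩
  · rw [ipt_inj] at h1; omega
  · rw [ipt_inj] at h1; rw [h1.1]; exact h2
  · rw [ipt_inj] at h1; omega

lemma IsModel.row_two (hm : d.IsModel P Q f g M) (h : ipt 0 2 ∈ Q.maxTerms p) :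
    d.upper (p 0) ≤ p 1 := by
  rcases (hm.Q_max _ _).1 h with ⟨k', h1, -⟩ | ⟨k', h1, -⟩ | ⟨-, h2⟩
  · rw [ipt_inj] at h1; omega
  · rw [ipt_inj] at h1; omega
  · exact h2

end Membership

/-- No marked point lies on an edge strictly between two points of this edge. -/
lemma IsModel.break_outside (hm : d.IsModel P Q f g M) (hd : d.Valid) {c : Set (Fin 2 → ℝ)}
    (hc : c ∈ (markedCurve Q M).edges) (hup : ∀ q ∈ c, q 1 = d.upper (q 0)) {x y : Fin 2 → ℝ}
    (hx : x ∈ c) (hy : y ∈ c) {r : ℝ} (hr : ∃ k < d.n, r = d.β k ∨ r = d.σ k) :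
    ¬ (x 0 < r ∧ r < y 0) := by
  rintro ⟨h1, h2⟩
  have hC := hm.germCurve hd
  obtain ⟨u, I, hI⟩ := (hC.rational c hc).edgeAt hx
  let s := (r - x 0) / (y 0 - x 0)
  have hs0 : 0 < s := div_pos (by linarith) (by linarith)
  have hs1 : s < 1 := (div_lt_one (by linarith)).2 (by linarith)
  have hq : (1 - s) • x + s • y ∈ c :=
    hI.convex hx hy (by linarith) hs0.le (by ring)
  have hq0 : ((1 - s) • x + s • y) 0 = r := by
    have : s * (y 0 - x 0) = r - x 0 := div_mul_cancel₀ _ (by linarith)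
    simp only [Pi.add_apply, Pi.smul_apply, smul_eq_mul]
    linarith
  have hqM : (1 - s) • x + s • y ∈ M :=
    hm.mem_marked_iff.2 ⟨hup _ hq, by rw [hq0]; exact hr⟩
  have hext := (hC.vertex_iff c hc _ hq).1 (hC.marked_subset hqM)
  have := (mem_extremePoints.1 hext).2 x hx y hy
    ⟨1 - s, s, by linarith, hs0, by ring, rfl⟩
  have h3 := congrFun this.1 0
  rw [hq0] at h3
  linarith

lemma linear_of_outside {n : ℕ} {b : ℕ → ℝ} {s t : ℝ}
    (h : ∀ j < n, ¬ (s < b j ∧ b j < t) ∧ ¬ (t < b j ∧ b j < s)) :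
    (s ≤ t → pl n b t = pl n b s + (t - s) * slopeR n b s) ∧
    (t ≤ s → pl n b t = pl n b s + (t - s) * slopeL n b s) := by
  constructor
  · intro hst
    refine pl_right hst fun j hj => ?_
    by_contra hcon
    push Not at hcon
    exact (h j hj).1 hcon
  · intro hst
    refine pl_left hst fun j hj => ?_
    by_contra hcon
    push Not at hcon
    exact (h j hj).2 ⟨hcon.2, hcon.1⟩

lemma IsModel.hasSlopes (hm : d.IsModel P Q f g M) (hd : d.Valid) :
    HasSlopes (markedCurve Q M) (germDirs Q) d.height d.heightSlope := by
  have hC := hm.germCurve hd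
  have hQ := hm.isSmooth hd
  intro c hc x hx v hv t ht hy
  have hxC := mem_carrier.2 ⟨c, hc, hx⟩
  have hv0 := (hC.dirs_primitive x hxC v hv).ne_zero
  have hyx := linePt_apply x v t
  set y := linePt x v t with hydef
  have hyC := mem_carrier.2 ⟨c, hc, hy⟩
  obtain ⟨p, hpM, ⟨a, b, hab, hprim⟩, hcp⟩ := (mem_edges_markedCurve hQ).1 hc
  have hph : p ∈ Q.hypersurface := ⟨a, by rw [hab]; simp, b, by rw [hab]; simp, hprim.ne⟩
  have hsub : ∀ q ∈ c, Q.maxTerms p ⊆ Q.maxTerms q := fun q hq => by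
    rw [hcp] at hq; exact hq.1
  have hV : p ∉ curveVertices Q M := by
    have hpc : p ∈ c := by
      rw [hcp]; exact (edgePiece_edgeAt hm.finite_marked hab hprim hpM).base_mem
    intro hV
    have h1 := (hC.vertex_iff c hc p hpc).1 hV
    have hE := edgePiece_edgeAt hm.finite_marked hab hprim hpM
    rw [hcp, hE.base_mem_extremePoints_iff] at h1
    exact h1 (exists_pieceParams_near hm.finite_marked hab hE.zero_mem
      (by rw [linePt_zero]; exact hab) (by rw [linePt_zero]; exact hpM))
  -- on the boundary graphs, the direction is not vertical
  have hslope : ∀ φ : ℝ → ℝ, x 1 = φ (x 0) → y 1 = φ (y 0) → v 0 ≠ 0 := by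
    intro φ h1 h2 h0
    have e0 : y 0 = x 0 := by rw [hyx, h0]; simp
    have e1 : y 1 = x 1 := by rw [h2, h1, e0]
    rw [hyx] at e1
    have : (v 1 : ℝ) = 0 := by
      have : t * (v 1 : ℝ) = 0 := by linarith
      exact (mul_eq_zero.1 this).resolve_left ht.ne'
    exact hv0 (by funext i; fin_cases i; exacts [h0, by exact_mod_cast this])
  cases hm.pointType hd hph with
  | ray k hk _ _ h =>
    have hrow : ∀ q ∈ c, q 0 = d.β k ∧ q 1 ≤ d.lower (q 0) := fun q hq => by
      have h1 := hm.row_zero (hsub q hq (show ipt k 0 ∈ _ by rw [h]; simp))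
      have h2 := hm.row_zero (hsub q hq (show ipt (k + 1) 0 ∈ _ by rw [h]; simp))
      exact ⟨eq_of_peak_succ h1.1 h2.1, h1.2⟩
    have hx' := hrow x hx
    have hy' := hrow y hy
    have hv00 : v 0 = 0 := by
      have e := hyx 0
      rw [hy'.1, hx'.1] at e
      have : (v 0 : ℝ) = 0 := by
        have : t * (v 0 : ℝ) = 0 := by linarith
        exact (mul_eq_zero.1 this).resolve_left ht.ne'
      exact_mod_cast this
    rw [height_of_le_lower hd hx'.2, height_of_le_lower hd hy'.2, hy'.1, hx'.1, heightSlope,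
      if_pos hv00, if_neg]
    · simp
    · rintro ⟨i, hi, h⟩
      exact hd.β_ne_γ hk hi (hx'.1.symm.trans h)
  | seg i hi _ _ _ h =>
    have hrow : ∀ q ∈ c, q 0 = d.γ i ∧ d.lower (q 0) ≤ q 1 ∧ q 1 ≤ d.upper (q 0) := fun q hq => by
      have h1 := hm.row_one (hsub q hq (show ipt i 1 ∈ _ by rw [h]; simp))
      have h2 := hm.row_one (hsub q hq (show ipt (i + 1) 1 ∈ _ by rw [h]; simp))
      exact ⟨eq_of_peak_succ h1.1 h2.1, h1.2⟩
    have hx' := hrow x hx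
    have hy' := hrow y hy
    have hv00 : v 0 = 0 := by
      have e := hyx 0
      rw [hy'.1, hx'.1] at e
      have : (v 0 : ℝ) = 0 := by
        have : t * (v 0 : ℝ) = 0 := by linarith
        exact (mul_eq_zero.1 this).resolve_left ht.ne'
      exact_mod_cast this
    rw [height_seg hd hi hx'.1 hx'.2.1 hx'.2.2, height_seg hd hi hy'.1 hy'.2.1 hy'.2.2, hy'.1,
      hx'.1, heightSlope, if_pos hv00, if_pos ⟨i, hi, hx'.1⟩, hyx 1]
    push_cast; ring
  | lower k i _ _ _ _ _ h =>
    have hrow : ∀ q ∈ c, q 1 = d.lower (q 0) ∧ Peak d.n d.γ i (q 0) := fun q hq => by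
      have h1 := hm.row_zero (hsub q hq (show ipt k 0 ∈ _ by rw [h]; simp))
      have h2 := hm.row_one (hsub q hq (show ipt i 1 ∈ _ by rw [h]; simp))
      exact ⟨le_antisymm h1.2 h2.2.1, h2.1⟩
    have hx' := hrow x hx
    have hy' := hrow y hy
    have hv00 := hslope _ hx'.1 hy'.1
    have hlt : ¬ d.upper (x 0) ≤ x 1 := by
      rw [hx'.1]; exact not_le.2 (hd.lower_lt_upper _)
    rw [height_of_le_lower hd hx'.1.le, height_of_le_lower hd hy'.1.le, heightSlope, if_neg hv00,
      if_neg hlt, upper, upper]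
    obtain ⟨e1, e2⟩ := pl_of_peak hx'.2 hy'.2
    split_ifs with hpos
    · have hpos' : (0 : ℝ) < v 0 := by exact_mod_cast hpos
      rw [e1 (by rw [hyx]; nlinarith), hyx]; push_cast; ring
    · have hneg' : (v 0 : ℝ) ≤ 0 := by exact_mod_cast not_lt.1 hpos
      rw [e2 (by rw [hyx]; nlinarith), hyx]; push_cast; ring
  | upper i _ _ _ h =>
    have hrow : ∀ q ∈ c, q 1 = d.upper (q 0) ∧ Peak d.n d.γ i (q 0) := fun q hq => by
      have h1 := hm.row_two (hsub q hq (show ipt 0 2 ∈ _ by rw [h]; simp))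
      have h2 := hm.row_one (hsub q hq (show ipt i 1 ∈ _ by rw [h]; simp))
      exact ⟨le_antisymm h2.2.2 h1, h2.1⟩
    have hx' := hrow x hx
    have hy' := hrow y hy
    have hv00 := hslope _ hx'.1 hy'.1
    have hout := fun {r} (hr : ∃ k < d.n, r = d.β k ∨ r = d.σ k) =>
      And.intro (hm.break_outside hd hc (fun q hq => (hrow q hq).1) hx hy hr)
        (hm.break_outside hd hc (fun q hq => (hrow q hq).1) hy hx hr)
    rw [height_upper hx'.1, height_upper hy'.1, heightSlope, if_neg hv00, if_pos hx'.1.ge, top, top,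
      Config.lower, Config.lower]
    obtain ⟨e1, e2⟩ := pl_of_peak hx'.2 hy'.2
    obtain ⟨e3, e4⟩ := linear_of_outside (n := d.n) (b := d.β) (s := x 0) (t := y 0)
      fun j hj => hout ⟨j, hj, Or.inl rfl⟩
    obtain ⟨e5, e6⟩ := linear_of_outside (n := d.n) (b := d.σ) (s := x 0) (t := y 0)
      fun j hj => hout ⟨j, hj, Or.inr rfl⟩
    split_ifs with hpos
    · have hpos' : (0 : ℝ) < v 0 := by exact_mod_cast hpos
      have hle : x 0 ≤ y 0 := by rw [hyx]; nlinarith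
      rw [e1 hle, e3 hle, e5 hle, hyx]; push_cast; ring
    · have hneg' : (v 0 : ℝ) ≤ 0 := by exact_mod_cast not_lt.1 hpos
      have hle : y 0 ≤ x 0 := by rw [hyx]; nlinarith
      rw [e2 hle, e4 hle, e6 hle, hyx]; push_cast; ring
  | lowerβ k i _ _ _ h => exact absurd (Or.inl ⟨_, _, _, h, area_lowerβ k i⟩) hV
  | lowerγ k i _ _ _ h => exact absurd (Or.inl ⟨_, _, _, h, area_lowerγ k i⟩) hV
  | upperγ i _ _ _ h => exact absurd (Or.inl ⟨_, _, _, h, area_upperγ i⟩) hV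

end Config


lemma sum_germDirs_of_two {Q : TropPoly 2} {x : Fin 2 → ℝ} {a b : Fin 2 → ℤ}
    (h : Q.maxTerms x = {a, b}) (hab : a ≠ b) (S : (Fin 2 → ℤ) → ℤ) :
    ∑ v ∈ germDirs Q x, S v = S (outDir a b) + S (outDir b a) := by
  rw [germDirs_of_two h hab, Finset.sum_pair]
  intro he
  rw [outDir_swap] at he
  exact outDir_ne_zero hab.symm (neg_eq_self.1 he)

lemma sum_germDirs_of_three {Q : TropPoly 2} {x : Fin 2 → ℝ} {a b c : Fin 2 → ℤ}
    (h : Q.maxTerms x = {a, b, c}) (harea : area a b c = 1) (S : (Fin 2 → ℤ) → ℤ) :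
    ∑ v ∈ germDirs Q x, S v = S (outDir a b) + S (outDir b c) + S (outDir c a) := by
  have n1 := (outDir_ne_of_area harea).2.1
  have n2 := (outDir_ne_of_area (show area b c a = 1 by rw [area_rotate, harea])).2.1
  have n3 := (outDir_ne_of_area (show area c a b = 1 by rw [area_rotate, area_rotate, harea])).2.1
  rw [germDirs_of_three h harea, Finset.sum_insert (by simp [n1, n3.symm]), Finset.sum_pair n2,
    add_assoc]

namespace Config

variable {d : Config} {P Q f g : TropPoly 2} {M : Set (Fin 2 → ℝ)}

/-- The numbers `β k` and `σ k` are pairwise distinct, so that the sum of the two functions breaking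
there has slope jumps equal to one. -/
lemma slope_jump (hd : d.Valid) (t : ℝ) :
    ((slopeR d.n d.β t : ℤ) - slopeL d.n d.β t) + (slopeR d.n d.σ t - slopeL d.n d.σ t) =
      open Classical in if ∃ k < d.n, t = d.β k ∨ t = d.σ k then 1 else 0 := by
  classical
  rcases peak_cases hd.increasing_β t with ⟨k, -, h1, h2, h3⟩ | ⟨k, hk, h0, -, h1, h2⟩ <;>
  rcases peak_cases hd.increasing_σ t with ⟨j, -, g1, g2, g3⟩ | ⟨j, hj, g0, -, g1, g2⟩ <;>
  rw [h1, h2, g1, g2]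
  · rw [if_neg (by rintro ⟨i, hi, h | h⟩; exacts [h3 i hi h.symm, g3 i hi h.symm])]; simp
  · rw [if_pos ⟨j, hj, Or.inr g0⟩]; push_cast; ring
  · rw [if_pos ⟨k, hk, Or.inl h0⟩]; push_cast; ring
  · exact absurd (h0.symm.trans g0) (hd.β_lt_σ hk hj).ne

lemma IsModel.isHarmonic (hm : d.IsModel P Q f g M) (hd : d.Valid) :
    IsHarmonic (markedCurve Q M) M (germDirs Q) d.heightSlope := by
  classical
  have hfst : ∀ k k', ipt k 0 ≠ ipt k' 1 := fun k k' h => by rw [ipt_inj] at h; omega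
  have key : ∀ x ∈ Q.hypersurface,
      ∑ v ∈ germDirs Q x, d.heightSlope x v = if x ∈ M then 1 else 0 := by
    intro x hx
    have hnot : x 1 < d.upper (x 0) → x ∉ M := fun h hM =>
      h.ne (hm.mem_marked_iff.1 hM).1
    have hlu := hd.lower_lt_upper (x 0)
    have hβγ : ∀ k < d.n, x 0 = d.β k → ¬ ∃ i < d.n, x 0 = d.γ i := fun k hk h ⟨i, hi, h'⟩ =>
      hd.β_ne_γ hk hi (h.symm.trans h')
    cases hm.pointType hd hx with
    | ray k hk h0 h1 h =>
      rw [sum_germDirs_of_two h (by rw [Ne, ipt_inj]; omega), if_neg (hnot (by linarith))]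
      simp [heightSlope, outDir, hβγ k hk h0]
    | lower k i h1 hβ hγ hk hi h =>
      rw [sum_germDirs_of_two h (hfst _ _), if_neg (hnot (by linarith))]
      simp [heightSlope, outDir, slopeR_eq_of_ne hγ, h1, not_le.2 hlu]
    | lowerβ k i hk h0 h1 h =>
      rw [sum_germDirs_of_three h (area_lowerβ k i), if_neg (hnot (by linarith))]
      have hγ : ∀ j < d.n, d.γ j ≠ x 0 := fun j hj h => hβγ k hk h0 ⟨j, hj, h.symm⟩
      simp [heightSlope, outDir, slopeR_eq_of_ne hγ, h1, not_le.2 hlu, hβγ k hk h0]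
    | lowerγ k i hi h0 h1 h =>
      rw [sum_germDirs_of_three h (area_lowerγ k i), if_neg (hnot (by linarith))]
      have hex : ∃ j < d.n, x 0 = d.γ j := ⟨i, hi, h0⟩
      have hs := slopeR_break hd.increasing_γ hi
      rw [← h0] at hs
      simp [heightSlope, outDir, h1, not_le.2 hlu, hex, hs.1, hs.2]
    | seg i hi h0 h1 h2 h =>
      rw [sum_germDirs_of_two h (by rw [Ne, ipt_inj]; omega), if_neg (hnot h2)]
      have hex : ∃ j < d.n, x 0 = d.γ j := ⟨i, hi, h0⟩
      simp [heightSlope, outDir, hex]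
    | upper i h1 hγ hi h =>
      rw [sum_germDirs_of_two h (by rw [Ne, ipt_inj]; omega)]
      have hj := slope_jump hd (x 0)
      have hiff : x ∈ M ↔ ∃ k < d.n, x 0 = d.β k ∨ x 0 = d.σ k := by
        rw [hm.mem_marked_iff]; simp [h1]
      rw [if_congr hiff rfl rfl, ← hj]
      simp [heightSlope, outDir, slopeR_eq_of_ne hγ, h1]
      ring
    | upperγ i hi h0 h1 h =>
      have hno : ¬ ∃ k < d.n, x 0 = d.β k ∨ x 0 = d.σ k := by
        rintro ⟨k, hk, h' | h'⟩
        · exact hβγ k hk h' ⟨i, hi, h0⟩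
        · exact (hd.γ_lt_σ' hi hk).ne (h0.symm.trans h')
      rw [sum_germDirs_of_three h (area_upperγ i),
        if_neg fun hM => hno (hm.mem_marked_iff.1 hM).2]
      have hex : ∃ j < d.n, x 0 = d.γ j := ⟨i, hi, h0⟩
      have hs := slopeR_break hd.increasing_γ hi
      rw [← h0] at hs
      have hj := slope_jump hd (x 0)
      rw [if_neg hno] at hj
      simp [heightSlope, outDir, h1, hex, hs.1, hs.2]
      linarith
  constructor
  · intro x hx hxM
    rw [markedCurve_carrier (hm.isSmooth hd) hm.finite_marked] at hx
    rw [key x hx, if_neg hxM]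
  · intro x hxM
    rw [key x (hm.mem_hypersurface_upper hd (hm.mem_marked_iff.1 hxM).1), if_pos hxM]

/-- The lift of the marked curve. -/
noncomputable def liftCurve (d : Config) (Q : TropPoly 2) (M : Set (Fin 2 → ℝ)) (c : ℝ) :
    WeightedEdges 3 := graphCurve (markedCurve Q M) M fun p => d.height p + c

lemma IsModel.liftCurve_isLift (hm : d.IsModel P Q f g M) (hd : d.Valid) (c : ℝ) :
    IsLift (markedCurve Q M) M (d.liftCurve Q M c) := by
  refine graphCurve_isLift (hm.germCurve hd) (S := d.heightSlope) ?_ (hm.isHarmonic hd)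
  intro e he x hx v hv t ht hy
  change d.height (linePt x v t) + c = d.height x + c + t * _
  rw [hm.hasSlopes hd e he x hx v hv t ht hy]
  ring

end Config

/-! ### Uniqueness of the lift -/

section OneVariable

/-- A function that is affine near every point is affine. -/
lemma affine_of_locally_affine {κ R : ℝ → ℝ}
    (h : ∀ t, ∃ δ > 0, ∀ s, |s| ≤ δ → κ (t + s) = κ t + s * R t) (t : ℝ) :
    κ t = κ 0 + t * R 0 := by
  have hev : ∀ t, ∀ᶠ s in nhds t, κ s = κ t + (s - t) * R t := by
    intro t
    obtain ⟨δ, hδ, hs⟩ := h t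
    filter_upwards [Metric.ball_mem_nhds t hδ] with s hst
    rw [Metric.mem_ball, Real.dist_eq] at hst
    have := hs (s - t) hst.le
    rwa [add_sub_cancel] at this
  have hderiv : ∀ t, HasDerivAt κ (R t) t := by
    intro t
    have h1 : HasDerivAt (fun s => κ t + (s - t) * R t) (1 * R t) t :=
      (((hasDerivAt_id t).sub_const t).mul_const (R t)).const_add (κ t)
    rw [one_mul] at h1
    exact h1.congr_of_eventuallyEq (hev t)
  have hloc : IsLocallyConstant R := by
    rw [IsLocallyConstant.iff_eventually_eq]
    intro t
    filter_upwards [(hev t).eventually_nhds] with s hs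
    have h1 : HasDerivAt (fun r => κ t + (r - t) * R t) (1 * R t) s :=
      (((hasDerivAt_id s).sub_const t).mul_const (R t)).const_add (κ t)
    rw [one_mul] at h1
    exact (hderiv s).unique (h1.congr_of_eventuallyEq hs)
  have hconst : ∀ t, R t = R 0 := fun t => hloc.apply_eq_of_preconnectedSpace t 0
  have h0 : ∀ t, HasDerivAt (fun s => κ s - s * R 0) 0 t := by
    intro t
    have h1 := (hderiv t).sub ((hasDerivAt_id t).mul_const (R 0))
    rw [one_mul, hconst t, sub_self] at h1
    exact h1
  have h1 := is_const_of_deriv_eq_zero (fun t => (h0 t).differentiableAt) (fun t => (h0 t).deriv) t 0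
  simp only [zero_mul, sub_zero] at h1
  linarith

lemma eq_zero_of_bounded {a r C : ℝ} (h : ∀ t ≥ 0, a + t * r ≤ C) : r ≤ 0 := by
  by_contra hr
  push Not at hr
  have h0 := h 0 le_rfl
  have h1 := h ((C - a + 1) / r) (div_nonneg (by linarith) hr.le)
  rw [div_mul_cancel₀ _ hr.ne'] at h1
  linarith

/-- A piecewise linear function with nonnegative jumps of its slope at finitely many points and
none elsewhere is convex; if it is bounded above, it is constant. -/
lemma const_of_nonneg_jumps (B : Finset ℝ) : ∀ {κ R L : ℝ → ℝ} {C : ℝ},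
    (∀ t, ∃ δ > 0, ∀ s ∈ Set.Icc 0 δ, κ (t + s) = κ t + s * R t ∧ κ (t - s) = κ t - s * L t) →
    (∀ t, t ∉ B → R t = L t) → (∀ t, L t ≤ R t) → (∀ t, κ t ≤ C) → ∀ t, κ t = κ 0 := by
  classical
  induction B using Finset.induction_on with
  | empty =>
    intro κ R L C hgerm hRL _ hC t
    have haff := affine_of_locally_affine (κ := κ) (R := R) (by
      intro t
      obtain ⟨δ, hδ, h⟩ := hgerm t
      refine ⟨δ, hδ, fun s hs => ?_⟩
      rcases le_total 0 s with h0 | h0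
      · rw [abs_of_nonneg h0] at hs
        exact (h s ⟨h0, hs⟩).1
      · rw [abs_of_nonpos h0] at hs
        have := (h (-s) ⟨by linarith, hs⟩).2
        rw [sub_neg_eq_add, ← hRL t (Finset.notMem_empty t)] at this
        rw [this]; ring)
    have h1 : R 0 ≤ 0 := eq_zero_of_bounded (a := κ 0) (C := C) fun s _ => by
      rw [← haff]; exact hC s
    have h2 : -R 0 ≤ 0 := eq_zero_of_bounded (a := κ 0) (C := C) fun s _ => by
      have := hC (-s)
      rw [haff] at this; linarith
    have h3 : R 0 = 0 := by linarith
    rw [haff, h3, mul_zero, add_zero]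
  | insert m B hmB ih =>
    intro κ R L C hgerm hRL hle hC
    -- remove the jump `j` at `m`
    have hj : 0 ≤ R m - L m := sub_nonneg.2 (hle m)
    set j := R m - L m with hjdef
    have hconst := ih (κ := fun t => κ t - j * max 0 (t - m))
      (R := fun t => R t - if m ≤ t then j else 0) (L := fun t => L t - if m < t then j else 0)
      (C := C) ?_ ?_ ?_ ?_
    · have hκ : ∀ t, κ t = κ 0 - j * max 0 (0 - m) + j * max 0 (t - m) := fun t => by
        have := hconst t
        linarith
      have hj0 : j ≤ 0 := by
        refine eq_zero_of_bounded (a := κ 0 - j * max 0 (0 - m)) (C := C) fun t ht => ?_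
        have h1 := hC (t + m)
        rw [hκ, add_sub_cancel_right, max_eq_right ht] at h1
        linarith
      have hj0' : j = 0 := le_antisymm hj0 hj
      intro t
      rw [hκ t, hj0']; ring
    · intro t
      obtain ⟨δ, hδ, h⟩ := hgerm t
      obtain ⟨δ', hδ', h'⟩ : ∃ δ' > 0, m = t ∨ δ' ≤ |m - t| := by
        by_cases hmt : m = t
        · exact ⟨1, one_pos, Or.inl hmt⟩
        · exact ⟨|m - t|, abs_pos.2 (sub_ne_zero.2 hmt), Or.inr le_rfl⟩
      refine ⟨min δ δ', lt_min hδ hδ', fun s hs => ?_⟩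
      obtain ⟨e1, e2⟩ := h s ⟨hs.1, hs.2.trans (min_le_left _ _)⟩
      have hsδ := hs.2.trans (min_le_right _ _)
      have hs0 := hs.1
      rw [e1, e2]
      rcases lt_trichotomy m t with hmt | rfl | hmt
      · rw [abs_of_neg (by linarith)] at h'
        have : δ' ≤ t - m := by rcases h' with h' | h' <;> linarith
        rw [if_pos hmt.le, if_pos hmt, max_eq_right (by linarith), max_eq_right (by linarith),
          max_eq_right (by linarith)]
        constructor <;> ring
      · rw [if_pos le_rfl, if_neg (lt_irrefl _), max_eq_right (by linarith), max_eq_left (by linarith),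
          max_eq_left (by linarith)]
        constructor <;> ring
      · rw [abs_of_pos (by linarith)] at h'
        have : δ' ≤ m - t := by rcases h' with h' | h' <;> linarith
        rw [if_neg (by linarith), if_neg (by linarith), max_eq_left (by linarith),
          max_eq_left (by linarith), max_eq_left (by linarith)]
        constructor <;> ring
    · intro t ht
      by_cases htm : t = m
      · subst htm
        simp only [le_refl, if_true, lt_irrefl, if_false, hjdef]; ring
      · have h1 := hRL t (by simp [htm, ht])
        have h2 : m ≤ t ↔ m < t := ⟨fun h => lt_of_le_of_ne h (Ne.symm htm), le_of_lt⟩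
        simp only [h1, h2]
    · intro t
      by_cases htm : t = m
      · subst htm
        simp only [le_refl, if_true, lt_irrefl, if_false, hjdef]; linarith
      · have h2 : m ≤ t ↔ m < t := ⟨fun h => lt_of_le_of_ne h (Ne.symm htm), le_of_lt⟩
        simp only [h2]
        linarith [hle t]
    · intro t
      have : 0 ≤ j * max 0 (t - m) := mul_nonneg hj (le_max_left _ _)
      linarith [hC t]

end OneVariable


/-- A function whose graph over each edge is convex has the slopes of its germs. -/
lemma hasSlopes_of_convex {C : WeightedEdges 2} {D : (Fin 2 → ℝ) → Finset (Fin 2 → ℤ)}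
    {H : (Fin 2 → ℝ) → ℝ} {S : (Fin 2 → ℝ) → (Fin 2 → ℤ) → ℤ}
    (hgerm : ∀ x ∈ C.carrier, ∀ d ∈ D x, ∃ δ > 0, ∀ t ∈ Set.Icc 0 δ,
      linePt x d t ∈ C.carrier ∧ H (linePt x d t) = H x + t * S x d)
    (hconv : ∀ c ∈ C.edges, Convex ℝ (graphOver H c)) : HasSlopes C D H S := by
  intro c hc x hx v hv t ht hy
  obtain ⟨δ, hδ, h⟩ := hgerm x (mem_carrier.2 ⟨c, hc, hx⟩) v hv
  set r := min δ t with hr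
  have hr0 : 0 < r := lt_min hδ ht
  have h1 := (h r ⟨hr0.le, min_le_left _ _⟩).2
  have hrt : r / t ≤ 1 := (div_le_one ht).2 (min_le_right _ _)
  have h2 := hconv c hc (x := pt3 x (H x)) (by exact ⟨by simpa using hx, by simp⟩)
    (y := pt3 (linePt x v t) (H (linePt x v t))) (by exact ⟨by simpa using hy, by simp⟩)
    (a := 1 - r / t) (b := r / t) (by linarith) (by positivity) (by ring)
  have hz : proj ((1 - r / t) • pt3 x (H x) + (r / t) • pt3 (linePt x v t) (H (linePt x v t))) =
      linePt x v r := by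
    have : r / t * t = r := div_mul_cancel₀ _ ht.ne'
    funext i
    fin_cases i <;> simp [proj, pt3, linePt] <;> linear_combination (toReal v _) * this
  have h3 := h2.2
  rw [hz, h1] at h3
  simp only [Pi.add_apply, Pi.smul_apply, smul_eq_mul, pt3_two] at h3
  have h4 : r / t * (H (linePt x v t) - H x - t * S x v) = 0 := by
    have : r / t * t = r := div_mul_cancel₀ _ ht.ne'
    linear_combination h3 - (S x v : ℝ) * this
  have := (mul_eq_zero.1 h4).resolve_left (by positivity)
  linarith

namespace Config

variable {d : Config} {P Q f g : TropPoly 2} {M : Set (Fin 2 → ℝ)}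

/-- Each edge of the curve is vertical, or it lies on the lower or upper boundary, and then no
vertical segment ends in its interior. -/
lemma IsModel.edge_cases (hm : d.IsModel P Q f g M) (hd : d.Valid) {c : Set (Fin 2 → ℝ)}
    (hc : c ∈ (markedCurve Q M).edges) : (∃ r, ∀ q ∈ c, q 0 = r) ∨
      ∃ i, (∀ q ∈ c, Peak d.n d.γ i (q 0)) ∧
        ((∀ q ∈ c, q 1 = d.lower (q 0)) ∨ ∀ q ∈ c, q 1 = d.upper (q 0)) := by
  have hQ := hm.isSmooth hd
  obtain ⟨p, hpM, ⟨a, b, hab, hprim⟩, rfl⟩ := (mem_edges_markedCurve hQ).1 hc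
  have hph : p ∈ Q.hypersurface := ⟨a, by rw [hab]; simp, b, by rw [hab]; simp, hprim.ne⟩
  have hsub : ∀ q ∈ edgePiece Q M p, ∀ m, m ∈ Q.maxTerms p → m ∈ Q.maxTerms q :=
    fun q hq m h => hq.1 h
  have hseg : ∀ i, ipt i 1 ∈ Q.maxTerms p → ipt (i + 1) 1 ∈ Q.maxTerms p →
      ∃ r, ∀ q ∈ edgePiece Q M p, q 0 = r := fun i h1 h2 => ⟨d.γ i, fun q hq =>
    eq_of_peak_succ (hm.row_one (hsub q hq _ h1)).1 (hm.row_one (hsub q hq _ h2)).1⟩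
  have hray : ∀ k, ipt k 0 ∈ Q.maxTerms p → ipt (k + 1) 0 ∈ Q.maxTerms p →
      ∃ r, ∀ q ∈ edgePiece Q M p, q 0 = r := fun k h1 h2 => ⟨d.β k, fun q hq =>
    eq_of_peak_succ (hm.row_zero (hsub q hq _ h1)).1 (hm.row_zero (hsub q hq _ h2)).1⟩
  cases hm.pointType hd hph with
  | ray k _ _ _ h => exact Or.inl (hray k (by rw [h]; simp) (by rw [h]; simp))
  | lowerβ k _ _ _ _ h => exact Or.inl (hray k (by rw [h]; simp) (by rw [h]; simp))
  | seg i _ _ _ _ h => exact Or.inl (hseg i (by rw [h]; simp) (by rw [h]; simp))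
  | lowerγ _ i _ _ _ h => exact Or.inl (hseg i (by rw [h]; simp) (by rw [h]; simp))
  | upperγ i _ _ _ h => exact Or.inl (hseg i (by rw [h]; simp) (by rw [h]; simp))
  | lower k i _ _ _ _ _ h =>
    have h1 := fun q hq => hm.row_zero (hsub q hq (ipt k 0) (by rw [h]; simp))
    have h2 := fun q hq => hm.row_one (hsub q hq (ipt i 1) (by rw [h]; simp))
    exact Or.inr ⟨i, fun q hq => (h2 q hq).1,
      Or.inl fun q hq => le_antisymm (h1 q hq).2 (h2 q hq).2.1⟩
  | upper i _ _ _ h =>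
    have h1 := fun q hq => hm.row_two (hsub q hq (ipt 0 2) (by rw [h]; simp))
    have h2 := fun q hq => hm.row_one (hsub q hq (ipt i 1) (by rw [h]; simp))
    exact Or.inr ⟨i, fun q hq => (h2 q hq).1,
      Or.inr fun q hq => le_antisymm (h2 q hq).2.2 (h1 q hq)⟩

/-- An edge leaving a point of the curve in a direction that is not vertical. -/
lemma IsModel.edge_of_dir (hm : d.IsModel P Q f g M) (hd : d.Valid) {x : Fin 2 → ℝ}
    {v : Fin 2 → ℤ} (hv : v ∈ germDirs Q x) (hx : x ∈ Q.hypersurface) (hv0 : v 0 ≠ 0) :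
    ∃ c ∈ (markedCurve Q M).edges, x ∈ c ∧ ∃ r > 0, ∀ s ∈ Set.Icc 0 r, linePt x v s ∈ c ∧
      (x 1 = d.lower (x 0) → linePt x v s 1 = d.lower (linePt x v s 0)) ∧
      (x 1 = d.upper (x 0) → linePt x v s 1 = d.upper (linePt x v s 0)) ∧
      (0 < s → s < r → ∀ j < d.n, d.γ j ≠ linePt x v s 0) := by
  have hC := hm.germCurve hd
  have hlu := hd.lower_lt_upper (x 0)
  have hxC : x ∈ (markedCurve Q M).carrier := by
    rwa [markedCurve_carrier (hm.isSmooth hd) hm.finite_marked]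
  obtain ⟨c, hc, hxc, r, hr, hy⟩ := hC.edge_of_germ x hxC v hv
  obtain ⟨I, hI⟩ := hC.edgeAt_of_germ hc hxc (hC.dirs_primitive x hxC v hv) hr.ne' hy
  have hne : linePt x v r 0 ≠ x 0 := by
    have : (v 0 : ℝ) ≠ 0 := by exact_mod_cast hv0
    rw [linePt_apply]
    simp [hr.ne', this]
  rcases hm.edge_cases hd hc with ⟨z, hz⟩ | ⟨i, hi, hside⟩
  · exact absurd ((hz _ hy).trans (hz x hxc).symm) hne
  · refine ⟨c, hc, hxc, r, hr, fun s hs => ?_⟩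
    have hsc : linePt x v s ∈ c :=
      (hI.mem_iff s).2 (hI.ordConnected.out hI.zero_mem ((hI.mem_iff r).1 hy) hs)
    refine ⟨hsc, fun h => ?_, fun h => ?_, fun hs0 hsr j hj heq => ?_⟩
    · rcases hside with h' | h'
      · exact h' _ hsc
      · linarith [h' x hxc]
    · rcases hside with h' | h'
      · linarith [h' x hxc]
      · exact h' _ hsc
    · have h1 := hi x hxc
      have h2 := hi _ hy
      rw [linePt_apply] at h2 heq
      have hv0' : (v 0 : ℝ) ≠ 0 := by exact_mod_cast hv0
      rcases lt_or_ge j i with hj' | hj'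
      · have e1 := h1.2.1 j hj'
        have e2 := h2.2.1 j hj'
        rcases hv0'.lt_or_gt with h | h <;> nlinarith
      · have e1 := h1.2.2 j hj' hj
        have e2 := h2.2.2 j hj' hj
        rcases hv0'.lt_or_gt with h | h <;> nlinarith

lemma IsModel.exists_seg_edge (hm : d.IsModel P Q f g M) (hd : d.Valid) {i : ℕ} (hi : i < d.n) :
    ∃ c ∈ (markedCurve Q M).edges, ∀ q : Fin 2 → ℝ, q 0 = d.γ i → d.lower (q 0) ≤ q 1 →
      q 1 ≤ d.upper (q 0) → q ∈ c := by
  have hlu := hd.lower_lt_upper (d.γ i)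
  let p : Fin 2 → ℝ := ![d.γ i, (d.lower (d.γ i) + d.upper (d.γ i)) / 2]
  have hp0 : p 0 = d.γ i := rfl
  have hp1 : p 1 = (d.lower (d.γ i) + d.upper (d.γ i)) / 2 := rfl
  have hM : ∀ q ∈ M, q 0 ≠ d.γ i := by
    intro q hq h0
    obtain ⟨-, k, hk, h | h⟩ := hm.mem_marked_iff.1 hq
    · exact hd.β_ne_γ hk hi (h.symm.trans h0)
    · exact (hd.γ_lt_σ' hi hk).ne (h0.symm.trans h)
  have hmax : Q.maxTerms p = {ipt i 1, ipt (i + 1) 1} := by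
    ext m
    rw [hm.Q_max, hp0, hp1]
    simp only [peak_at_break hd.increasing_γ hi]
    grind
  refine ⟨edgePiece Q M p, (mem_edges_markedCurve (hm.isSmooth hd)).2
    ⟨p, fun h => hM p h rfl, ⟨_, _, hmax, isPrimitiveVec_sub_of_fst (by simp)⟩, rfl⟩,
    fun q h0 h1 h2 => ⟨?_, ?_⟩⟩
  · change Q.maxTerms p ⊆ Q.maxTerms q
    rw [hmax]
    rintro m (rfl | rfl)
    · exact (hm.Q_max _ _).2 (Or.inr (Or.inl
        ⟨_, rfl, by rw [h0, peak_at_break hd.increasing_γ hi]; simp, h1, h2⟩))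
    · exact (hm.Q_max _ _).2 (Or.inr (Or.inl
        ⟨_, rfl, by rw [h0, peak_at_break hd.increasing_γ hi]; simp, h1, h2⟩))
  · rw [Set.disjoint_left]
    rintro _ ⟨a, b, -, -, hab, rfl⟩ hz
    refine hM _ hz ?_
    simp only [Pi.add_apply, Pi.smul_apply, smul_eq_mul, hp0, h0]
    rw [← add_mul, hab, one_mul]

/-- The directions of the curve at the points of the upper boundary. -/
lemma IsModel.upper_dirs (hm : d.IsModel P Q f g M) (hd : d.Valid) {x : Fin 2 → ℝ}
    (hx : x 1 = d.upper (x 0)) :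
    ![1, (slopeR d.n d.γ (x 0) : ℤ)] ∈ germDirs Q x ∧
    ![-1, -(slopeL d.n d.γ (x 0) : ℤ)] ∈ germDirs Q x ∧
    ((∃ i < d.n, x 0 = d.γ i) → ![0, -1] ∈ germDirs Q x) ∧
    ∀ T : (Fin 2 → ℤ) → ℤ, (x 0 ∈ d.γ '' Set.Iio d.n → T ![0, -1] = 0) →
      ∑ v ∈ germDirs Q x, T v =
        T ![1, (slopeR d.n d.γ (x 0) : ℤ)] + T ![-1, -(slopeL d.n d.γ (x 0) : ℤ)] := by
  have hlu := hd.lower_lt_upper (x 0)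
  cases hm.pointType hd (hm.mem_hypersurface_upper hd hx) with
  | ray _ _ _ h1 => linarith
  | lower _ _ h1 => linarith
  | lowerβ _ _ _ _ h1 => linarith
  | lowerγ _ _ _ _ h1 => linarith
  | seg _ _ _ _ h1 => linarith
  | upper i _ hγ hi h =>
    have hne : ipt i 1 ≠ ipt 0 2 := by rw [Ne, ipt_inj]; omega
    rcases peak_cases hd.increasing_γ (x 0) with ⟨k, hk, h1, h2, -⟩ | ⟨k, hk, h0, -⟩
    · obtain rfl := (hk i).1 hi
      have e1 : outDir (ipt i 1) (ipt 0 2) = ![1, (i : ℤ)] := by simp [outDir]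
      have e2 : outDir (ipt 0 2) (ipt i 1) = ![-1, -(i : ℤ)] := by simp [outDir]
      rw [h1, h2]
      refine ⟨?_, ?_, fun ⟨j, hj, h'⟩ => absurd h'.symm (hγ j hj), fun T _ => ?_⟩
      · rw [germDirs_of_two h hne, e1]; simp
      · rw [germDirs_of_two h hne, e2]; simp
      · rw [sum_germDirs_of_two h hne, e1, e2]
    · exact absurd h0.symm (hγ k hk)
  | upperγ i hi h0 _ h =>
    have hs := slopeR_break hd.increasing_γ hi
    rw [← h0] at hs
    rw [hs.1, hs.2]
    have e1 : outDir (ipt (i + 1) 1) (ipt 0 2) = ![1, ((i + 1 : ℕ) : ℤ)] := by simp [outDir]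
    have e2 : outDir (ipt 0 2) (ipt i 1) = ![-1, -(i : ℤ)] := by simp [outDir]
    have e3 : outDir (ipt i 1) (ipt (i + 1) 1) = ![0, -1] := by simp [outDir]
    refine ⟨?_, ?_, fun _ => ?_, fun T hT => ?_⟩
    · rw [germDirs_of_three h (area_upperγ i), e1]; simp
    · rw [germDirs_of_three h (area_upperγ i), e2]; simp
    · rw [germDirs_of_three h (area_upperγ i), e3]; simp
    · rw [sum_germDirs_of_three h (area_upperγ i), e1, e2, e3, hT ⟨i, hi, h0.symm⟩, zero_add]

/-- A function on the curve whose slopes add up to zero off the marked points, and to a nonnegative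
number there, vanishes if it is bounded above on the upper boundary and vanishes on the lower one
away from the vertical segments. Its slopes on the segments are zero by harmonicity at their lower
ends, so that its restriction to the upper boundary is convex. -/
lemma IsModel.eq_zero_of_slopes (hm : d.IsModel P Q f g M) (hd : d.Valid)
    {G : (Fin 2 → ℝ) → ℝ} {T : (Fin 2 → ℝ) → (Fin 2 → ℤ) → ℤ} {A : ℝ}
    (hG : HasSlopes (markedCurve Q M) (germDirs Q) G T)
    (hT : ∀ x ∈ Q.hypersurface, x ∉ M → ∑ v ∈ germDirs Q x, T x v = 0)
    (hTM : ∀ x ∈ M, 0 ≤ ∑ v ∈ germDirs Q x, T x v)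
    (hlow : ∀ x ∈ Q.hypersurface, x 1 ≤ d.lower (x 0) → (∀ j < d.n, d.γ j ≠ x 0) → G x = 0)
    (hup : ∀ x ∈ Q.hypersurface, x 1 = d.upper (x 0) → G x ≤ A) :
    ∀ x ∈ Q.hypersurface, G x = 0 := by
  classical
  -- the lower ends of the vertical segments
  have hend : ∀ (i k : ℕ) (x : Fin 2 → ℝ), i < d.n → x 0 = d.γ i → x 1 = d.lower (x 0) →
      Q.maxTerms x = {ipt k 0, ipt (i + 1) 1, ipt i 1} →
      G x = 0 ∧ ![0, 1] ∈ germDirs Q x ∧ T x ![0, 1] = 0 := by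
    intro i k x hi h0 h1 h
    have hx := hm.mem_hypersurface_lower hd h1
    have hdirs : germDirs Q x = {outDir (ipt k 0) (ipt (i + 1) 1), ![0, 1],
        outDir (ipt i 1) (ipt k 0)} := by
      rw [germDirs_of_three h (area_lowerγ k i)]
      congr 2
      simp [outDir]
    have hdir : ∀ v ∈ germDirs Q x, v 0 ≠ 0 → G x = 0 ∧ T x v = 0 := by
      intro v hv hv0
      obtain ⟨c, hc, hxc, r, hr, hs⟩ := hm.edge_of_dir hd hv hx hv0
      have key : ∀ s, 0 < s → s < r → G x + s * T x v = 0 := by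
        intro s hs0 hsr
        obtain ⟨hsc, hl, -, hγ⟩ := hs s ⟨hs0.le, hsr.le⟩
        rw [← hG c hc x hxc v hv s hs0 hsc]
        exact hlow _ (hm.mem_hypersurface_lower hd (hl h1)) (hl h1).le (hγ hs0 hsr)
      have k1 := key (r / 2) (by linarith) (by linarith)
      have k2 := key (r / 4) (by linarith) (by linarith)
      have k3 : r * (T x v : ℝ) = 0 := by linarith
      exact ⟨by linarith, by exact_mod_cast (mul_eq_zero.1 k3).resolve_left hr.ne'⟩
    have d1 := hdir (outDir (ipt k 0) (ipt (i + 1) 1)) (by rw [hdirs]; simp) (by simp [outDir])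
    have d2 := hdir (outDir (ipt i 1) (ipt k 0)) (by rw [hdirs]; simp) (by simp [outDir])
    refine ⟨d1.1, by rw [hdirs]; simp, ?_⟩
    have e : outDir (ipt (i + 1) 1) (ipt i 1) = ![0, 1] := by simp [outDir]
    have hsum := hT x hx fun hM => by
      have := (hm.mem_marked_iff.1 hM).1
      have := hd.lower_lt_upper (x 0)
      linarith
    rw [sum_germDirs_of_three h (area_lowerγ k i), d1.2, d2.2, e] at hsum
    linarith
  -- the vertical segments
  have hseg : ∀ (i : ℕ) (q : Fin 2 → ℝ), i < d.n → q 0 = d.γ i → d.lower (q 0) ≤ q 1 →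
      q 1 ≤ d.upper (q 0) → G q = 0 := by
    intro i q hi h0 h1 h2
    obtain ⟨c, hc, hcq⟩ := hm.exists_seg_edge hd hi
    let x : Fin 2 → ℝ := ![d.γ i, d.lower (d.γ i)]
    have hx1 : x 1 = d.lower (x 0) := rfl
    have hx := hm.mem_hypersurface_lower hd hx1
    obtain ⟨e1, e2, e3⟩ : G x = 0 ∧ ![0, 1] ∈ germDirs Q x ∧ T x ![0, 1] = 0 := by
      have hlu := hd.lower_lt_upper (x 0)
      cases hm.pointType hd hx with
      | ray _ _ _ h => linarith
      | lower _ _ _ _ hγ => exact absurd rfl (hγ i hi)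
      | lowerβ k _ hk h => exact absurd h.symm (hd.β_ne_γ hk hi)
      | lowerγ k j hj h0 h1 h => exact hend j k x hj h0 h1 h
      | seg _ _ _ h => linarith
      | upper _ h => linarith
      | upperγ _ _ _ h => linarith
    have hq : q = linePt x ![0, 1] (q 1 - x 1) := by
      funext j; fin_cases j <;> simp [linePt_apply, x, h0]
    rcases (show x 1 ≤ q 1 by rw [hx1, show x 0 = q 0 from h0.symm]; exact h1).lt_or_eq with h | h
    · have := hG c hc x (hcq x rfl le_rfl (hd.lower_lt_upper _).le) _ e2 _ (sub_pos.2 h)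
        (by rw [← hq]; exact hcq q h0 h1 h2)
      rw [← hq, e1, e3] at this
      simpa using this
    · rw [hq, h, sub_self, linePt_zero, e1]
  have hsegT : ∀ x, x 1 = d.upper (x 0) → x 0 ∈ d.γ '' Set.Iio d.n → T x ![0, -1] = 0 := by
    rintro x hx1 ⟨i, hi, h0⟩
    obtain ⟨c, hc, hcq⟩ := hm.exists_seg_edge hd hi
    have hlu := hd.lower_lt_upper (x 0)
    have hq : linePt x ![0, -1] (d.upper (x 0) - d.lower (x 0)) = ![x 0, d.lower (x 0)] := by
      funext j; fin_cases j <;> simp [linePt_apply, hx1]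
    have h1 := hG c hc x (hcq x h0.symm (by linarith) hx1.le) ![0, -1]
      ((hm.upper_dirs hd hx1).2.2.1 ⟨i, hi, h0.symm⟩) _ (sub_pos.2 hlu)
      (by rw [hq]; exact hcq _ h0.symm le_rfl hlu.le)
    rw [hseg i x hi h0.symm (by linarith) hx1.le, hq,
      hseg i ![x 0, d.lower (x 0)] hi h0.symm le_rfl hlu.le, zero_add, eq_comm] at h1
    exact_mod_cast (mul_eq_zero.1 h1).resolve_left (sub_pos.2 hlu).ne'
  -- the upper boundary
  let pnt : ℝ → Fin 2 → ℝ := fun t => ![t, d.upper t]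
  have hconst := const_of_nonneg_jumps
    ((Finset.range d.n).image d.β ∪ (Finset.range d.n).image d.σ)
    (κ := fun t => G (pnt t)) (R := fun t => T (pnt t) ![1, (slopeR d.n d.γ t : ℤ)])
    (L := fun t => -T (pnt t) ![-1, -(slopeL d.n d.γ t : ℤ)]) (C := A) ?_ ?_ ?_ ?_
  · have hκ : ∀ t, G (pnt t) = 0 := fun t => by
      have h1 := hconst t
      have h2 := hconst (d.γ 0)
      have h3 := hseg 0 (pnt (d.γ 0)) hd.pos rfl (hd.lower_lt_upper _).le le_rfl
      rw [h1, ← h2, h3]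
    intro x hx
    have hκx : x 1 = d.upper (x 0) → G x = 0 := fun h => by
      have : x = pnt (x 0) := by funext j; fin_cases j; exacts [rfl, h]
      rw [this]; exact hκ _
    cases hm.pointType hd hx with
    | ray k hk h0 h1 =>
      exact hlow x hx h1.le fun j hj h => hd.β_ne_γ hk hj (h0.symm.trans h.symm)
    | lower _ _ h1 _ hγ => exact hlow x hx h1.le hγ
    | lowerβ k _ hk h0 h1 =>
      exact hlow x hx h1.le fun j hj h => hd.β_ne_γ hk hj (h0.symm.trans h.symm)
    | lowerγ k i hi h0 h1 h => exact (hend i k x hi h0 h1 h).1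
    | seg i hi h0 h1 h2 => exact hseg i x hi h0 h1.le h2.le
    | upper _ h1 => exact hκx h1
    | upperγ _ _ _ h1 => exact hκx h1
  · intro t
    have hx : (pnt t) ∈ Q.hypersurface := hm.mem_hypersurface_upper hd rfl
    have hdirs := hm.upper_dirs hd (x := pnt t) rfl
    obtain ⟨c, hc, hxc, r, hr, hs⟩ := hm.edge_of_dir hd hdirs.1 hx (by simp)
    obtain ⟨c', hc', hxc', r', hr', hs'⟩ := hm.edge_of_dir hd hdirs.2.1 hx (by simp)
    refine ⟨min r r', lt_min hr hr', fun s hsm => ?_⟩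
    obtain ⟨hs0, hsm⟩ := hsm
    rcases hs0.eq_or_lt with rfl | hs0
    · simp
    obtain ⟨h1, -, h2, -⟩ := hs s ⟨hs0.le, hsm.trans (min_le_left _ _)⟩
    obtain ⟨h1', -, h2', -⟩ := hs' s ⟨hs0.le, hsm.trans (min_le_right _ _)⟩
    have e := hG c hc _ hxc _ hdirs.1 s hs0 h1
    have e' := hG c' hc' _ hxc' _ hdirs.2.1 s hs0 h1'
    have hq : linePt (pnt t) ![1, (slopeR d.n d.γ (pnt t 0) : ℤ)] s = pnt (t + s) := by
      have h0 : linePt (pnt t) ![1, (slopeR d.n d.γ (pnt t 0) : ℤ)] s 0 = t + s := by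
        simp [linePt_apply, pnt]
      have h3 := h2 rfl
      rw [h0] at h3
      funext j; fin_cases j
      exacts [h0, h3]
    have hq' : linePt (pnt t) ![-1, -(slopeL d.n d.γ (pnt t 0) : ℤ)] s = pnt (t - s) := by
      have h0 : linePt (pnt t) ![-1, -(slopeL d.n d.γ (pnt t 0) : ℤ)] s 0 = t - s := by
        simp [linePt_apply, pnt, sub_eq_add_neg]
      have h3 := h2' rfl
      rw [h0] at h3
      funext j; fin_cases j
      exacts [h0, h3]
    rw [hq] at e
    rw [hq'] at e'
    refine ⟨e, e'.trans ?_⟩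
    push_cast
    rw [mul_neg, sub_neg_eq_add]
    rfl
  · intro t ht
    have h1 := (hm.upper_dirs hd (x := pnt t) rfl).2.2.2 (T (pnt t)) (hsegT _ rfl)
    rw [hT _ (hm.mem_hypersurface_upper hd rfl)] at h1
    · have h2 : (0 : ℝ) = T (pnt t) ![1, (slopeR d.n d.γ t : ℤ)] +
        T (pnt t) ![-1, -(slopeL d.n d.γ t : ℤ)] := by exact_mod_cast h1
      linarith
    · intro hM
      obtain ⟨-, k, hk, h | h⟩ := hm.mem_marked_iff.1 hM
      · exact ht (Finset.mem_union_left _ (Finset.mem_image.2 ⟨k, Finset.mem_range.2 hk, h.symm⟩))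
      · exact ht (Finset.mem_union_right _ (Finset.mem_image.2 ⟨k, Finset.mem_range.2 hk, h.symm⟩))
  · intro t
    have h1 := (hm.upper_dirs hd (x := pnt t) rfl).2.2.2 (T (pnt t)) (hsegT _ rfl)
    have h3 : 0 ≤ ∑ v ∈ germDirs Q (pnt t), T (pnt t) v := by
      by_cases hM : pnt t ∈ M
      · exact hTM _ hM
      · exact (hT _ (hm.mem_hypersurface_upper hd rfl) hM).ge
    rw [h1] at h3
    have h2 : (0 : ℝ) ≤ T (pnt t) ![1, (slopeR d.n d.γ t : ℤ)] +
        T (pnt t) ![-1, -(slopeL d.n d.γ t : ℤ)] := by exact_mod_cast h3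
    linarith
  · exact fun t => hup _ (hm.mem_hypersurface_upper hd rfl) rfl

end Config


namespace Config

variable {d : Config} {P Q f g : TropPoly 2} {M : Set (Fin 2 → ℝ)}

lemma IsModel.carrier_eq (hm : d.IsModel P Q f g M) (hd : d.Valid) :
    (markedCurve Q M).carrier = Q.hypersurface :=
  markedCurve_carrier (hm.isSmooth hd) hm.finite_marked

lemma mem_modification_unit {p : Fin 3 → ℝ} :
    p ∈ (TropPoly.modification P (TropPoly.unit 2)).hypersurface ↔
      p 2 = P.val (proj p) ∨ (p 2 < P.val (proj p) ∧ proj p ∈ P.hypersurface) := by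
  rw [TropPoly.mem_modification_hypersurface, TropPoly.unit_val, TropPoly.unit_hypersurface,
    zero_add]
  simp

lemma IsModel.mem_hypersurface_P (hm : d.IsModel P Q f g M) (hd : d.Valid) {p : Fin 2 → ℝ} :
    p ∈ P.hypersurface ↔
      p 1 = d.upper (p 0) ∨ (p 1 < d.upper (p 0) ∧ ∃ i < d.n, p 0 = d.γ i) := by
  change (P.maxTerms p).Nontrivial ↔ _
  constructor
  · rintro ⟨a, ha, b, hb, hab⟩
    rcases (hm.P_max _ _).1 ha with ⟨k, rfl, hk, h1⟩ | ⟨rfl, h1⟩ <;>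
    rcases (hm.P_max _ _).1 hb with ⟨k', rfl, hk', h2⟩ | ⟨rfl, h2⟩
    · rcases h1.eq_or_lt with h | h
      · exact Or.inl h
      · refine Or.inr ⟨h, ?_⟩
        by_contra hcon
        push Not at hcon
        exact hab (by rw [hk.eq_of_lt (fun j hj h => hcon j hj h.symm) hk'])
    · exact Or.inl (le_antisymm h1 h2)
    · exact Or.inl (le_antisymm h2 h1)
    · exact absurd rfl hab
  · rintro (h | ⟨h, i, hi, h0⟩)
    · obtain ⟨k, hk, -⟩ := exists_peak hd.increasing_γ (p 0)
      exact ⟨_, (hm.P_max _ _).2 (Or.inl ⟨k, rfl, hk, h.le⟩), _,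
        (hm.P_max _ _).2 (Or.inr ⟨rfl, h.ge⟩), by rw [Ne, ipt_inj]; omega⟩
    · have hp := peak_at_break hd.increasing_γ hi
      exact ⟨_, (hm.P_max _ _).2 (Or.inl ⟨i, rfl, by rw [h0, hp]; simp, h.le⟩), _,
        (hm.P_max _ _).2 (Or.inl ⟨i + 1, rfl, by rw [h0, hp]; simp, h.le⟩),
        by rw [Ne, ipt_inj]; omega⟩

/-- The lift to the modification along `P` is unique: the difference between its height function and
the given one vanishes. -/
lemma IsModel.eq_liftCurve (hm : d.IsModel P Q f g M) (hd : d.Valid) {c : ℝ}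
    (hc : ∀ p, P.val p = c + max (d.upper (p 0)) (p 1)) {L : WeightedEdges 3}
    (hL : IsLiftTo (markedCurve Q M) M
      (TropPoly.modification P (TropPoly.unit 2)).hypersurface L) :
    L = d.liftCurve Q M c := by
  have hC := hm.germCurve hd
  have hcar := hm.carrier_eq hd
  obtain ⟨H, S, hgerm, hS0, hSM, hedge, hgraph⟩ := lift_structure hC hL.1
  have hH : HasSlopes (markedCurve Q M) (germDirs Q) H S :=
    hasSlopes_of_convex hgerm fun e he => by
      obtain ⟨v, hv⟩ := (hL.1.curve.rational _ (hgraph e he)).nonempty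
      obtain ⟨u, I, hI⟩ := (hL.1.curve.rational _ (hgraph e he)).edgeAt hv
      exact hI.convex
  have hX : ∀ x ∈ Q.hypersurface, H x = P.val x ∨ H x < P.val x ∧ x ∈ P.hypersurface := by
    intro x hx
    rw [← hcar] at hx
    obtain ⟨e, he, hxe⟩ := mem_carrier.1 hx
    have h1 : pt3 x (H x) ∈ L.carrier := mem_carrier.2 ⟨_, hgraph e he, by simpa, by simp⟩
    have h2 := mem_modification_unit.1 (hL.2 h1)
    rwa [pt3_two, proj_pt3] at h2
  have hh := hm.isHarmonic hd
  have hG : HasSlopes (markedCurve Q M) (germDirs Q) (fun x => H x - (d.height x + c))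
      fun x v => S x v - d.heightSlope x v := by
    intro e he x hx v hv t ht hy
    have h1 := hH e he x hx v hv t ht hy
    have h2 := hm.hasSlopes hd e he x hx v hv t ht hy
    push_cast
    linarith
  have hSM' : ∀ x ∈ M, 1 ≤ ∑ v ∈ germDirs Q x, S x v := by
    intro x hx
    rw [(hSM x hx).2]
    have : L (vray x (H x)) ≠ 0 := (hSM x hx).1
    omega
  have hzero := hm.eq_zero_of_slopes hd hG (A := -d.f₂)
    (fun x hx hxM => by
      rw [Finset.sum_sub_distrib, hS0 x (hcar ▸ hx) hxM, hh.1 x (hcar ▸ hx) hxM, sub_zero])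
    (fun x hx => by
      rw [Finset.sum_sub_distrib, hh.2 x hx]
      linarith [hSM' x hx])
    (fun x hx h1 hγ => by
      have hlu := hd.lower_lt_upper (x 0)
      rcases hX x hx with h | ⟨-, h⟩
      · rw [h, hc, height_of_le_lower hd h1, max_eq_left (by linarith)]; ring
      · rcases (hm.mem_hypersurface_P hd).1 h with h | ⟨-, j, hj, h⟩
        · linarith
        · exact absurd h.symm (hγ j hj))
    (fun x hx h1 => by
      have h2 : H x ≤ P.val x := by
        rcases hX x hx with h | ⟨h, -⟩
        exacts [h.le, h.le]
      rw [hc, h1, max_self] at h2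
      have := hd.f₂_add_upper_lt (x 0)
      rw [height_upper h1]
      linarith)
  have hHx : ∀ x ∈ Q.hypersurface, H x = d.height x + c := fun x hx => sub_eq_zero.1 (hzero x hx)
  have hSx : ∀ x ∈ M, ∑ v ∈ germDirs Q x, S x v = 1 := by
    intro x hx
    have hxQ := hm.mem_hypersurface_upper hd (hm.mem_marked_iff.1 hx).1
    rw [← hh.2 x hx]
    refine Finset.sum_congr rfl fun v hv => ?_
    obtain ⟨e, he, hxe, t, ht, hy⟩ := hC.edge_of_germ x (hcar ▸ hxQ) v hv
    have h1 := hG e he x hxe v hv t ht hy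
    beta_reduce at h1
    rw [hzero _ (hcar ▸ mem_carrier.2 ⟨e, he, hy⟩), hzero x hxQ, zero_add, eq_comm] at h1
    exact sub_eq_zero.1 (by exact_mod_cast (mul_eq_zero.1 h1).resolve_left ht.ne')
  have hgr : ∀ e ∈ (markedCurve Q M).edges,
      graphOver H e = graphOver (fun x => d.height x + c) e := by
    intro e he
    ext p
    refine and_congr_right fun hp => ?_
    rw [hHx _ (hcar ▸ mem_carrier.2 ⟨e, he, hp⟩)]
  have hvr : ∀ x ∈ M, vray x (H x) = vray x (d.height x + c) := fun x hx => by
    rw [hHx x (hm.mem_hypersurface_upper hd (hm.mem_marked_iff.1 hx).1)]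
  have hiff : ∀ e, e ∈ (d.liftCurve Q M c).edges ↔ e ∈ L.edges := by
    intro e
    rw [liftCurve, mem_edges_graphCurve]
    constructor
    · rintro (⟨b, hb, rfl⟩ | ⟨x, hx, rfl⟩)
      · rw [← hgr b hb]; exact hgraph b hb
      · rw [← hvr x hx]; exact (hSM x hx).1
    · intro he
      rcases hedge e he with ⟨x, hx, rfl⟩ | ⟨-, b, hb, rfl⟩
      · exact Or.inr ⟨x, hx, hvr x hx⟩
      · exact Or.inl ⟨b, hb, hgr b hb⟩
  funext e
  by_cases he : e ∈ L.edges
  · rw [liftCurve, graphCurve_of_mem ((hiff e).2 he)]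
    rcases hedge e he with ⟨x, hx, rfl⟩ | ⟨h, -⟩
    · have := (hSM x hx).2
      rw [hSx x hx] at this
      exact_mod_cast this.symm
    · exact h
  · have h1 : L e = 0 := not_not.1 he
    have h2 : d.liftCurve Q M c e = 0 := not_not.1 fun h => he ((hiff e).1 h)
    rw [h1, h2]

end Config


/-! ### The intersection of the two modifications -/

namespace Config

variable {d : Config} {P Q f g : TropPoly 2} {M : Set (Fin 2 → ℝ)} {c κ e l : ℝ}

lemma Valid.lower_lt_mid (hd : d.Valid) {t : ℝ} (ht : d.σ 0 < t) : d.lower t < d.mid t := by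
  rw [hd.mid_eq_top ht.le, top]
  have : max 0 (t - d.σ 0) ≤ pl d.n d.σ t :=
    Finset.single_le_sum (f := fun j => max 0 (t - d.σ j)) (fun _ _ => le_max_left _ _)
      (Finset.mem_range.2 hd.pos)
  linarith [le_max_right 0 (t - d.σ 0)]

lemma mem_unit_maxTerms {m : Fin 2 → ℤ} {x : Fin 2 → ℝ} :
    m ∈ (TropPoly.unit 2).maxTerms x ↔ m = ipt 0 0 := by
  rw [show ipt 0 0 = 0 by funext i; fin_cases i <;> rfl]
  refine ⟨fun h => Finset.mem_singleton.1 h.1, ?_⟩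
  rintro rfl
  obtain ⟨m, hm⟩ := (TropPoly.unit 2).maxTerms_nonempty x
  rwa [← Finset.mem_singleton.1 hm.1]

/-- The terms of the modification along `P`, in the normal form of the configuration. -/
lemma IsModel.maxTerms_X (hm : d.IsModel P Q f g M)
    (hc : ∀ p, P.val p = c + max (d.upper (p 0)) (p 1)) (p : Fin 3 → ℝ) (m : Fin 3 → ℤ) :
    m ∈ (TropPoly.modification P (TropPoly.unit 2)).maxTerms p ↔
      (∃ k, m = vec3 (ipt k 0) 0 ∧ Peak d.n d.γ k (p 0) ∧ p 1 ≤ d.upper (p 0) ∧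
        p 2 ≤ c + d.upper (p 0)) ∨
      (m = vec3 (ipt 0 1) 0 ∧ d.upper (p 0) ≤ p 1 ∧ p 2 ≤ c + p 1) ∨
      m = vec3 (ipt 0 0) 1 ∧ c + d.upper (p 0) ≤ p 2 ∧ c + p 1 ≤ p 2 := by
  have e0 : proj p 0 = p 0 := rfl
  have e1 : proj p 1 = p 1 := rfl
  rw [TropPoly.mem_modification_maxTerms, TropPoly.unit_val, hc, e0, e1, zero_add]
  simp only [hm.P_max, mem_unit_maxTerms, e0, e1]
  constructor
  · rintro (⟨_, ⟨k, rfl, hk, h⟩ | ⟨rfl, h⟩, rfl, h'⟩ | ⟨_, rfl, rfl, h'⟩)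
    · rw [max_eq_left h] at h'
      exact Or.inl ⟨k, rfl, hk, h, h'⟩
    · rw [max_eq_right h] at h'
      exact Or.inr (Or.inl ⟨rfl, h, h'⟩)
    · exact Or.inr (Or.inr ⟨rfl, by linarith [le_max_left (d.upper (p 0)) (p 1)],
        by linarith [le_max_right (d.upper (p 0)) (p 1)]⟩)
  · rintro (⟨k, rfl, hk, h, h'⟩ | ⟨rfl, h, h'⟩ | ⟨rfl, h, h'⟩)
    · exact Or.inl ⟨_, Or.inl ⟨k, rfl, hk, h⟩, rfl, by rwa [max_eq_left h]⟩
    · exact Or.inl ⟨_, Or.inr ⟨rfl, h⟩, rfl, by rwa [max_eq_right h]⟩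
    · exact Or.inr ⟨_, rfl, rfl, by rw [← max_add_add_left]; exact max_le h h'⟩

/-- The terms of the modification along `f / g`, in the normal form of the configuration. The
relation between the constants is the one for which this modification contains the lift of constant
`c`. -/
lemma IsModel.maxTerms_Y (hm : d.IsModel P Q f g M)
    (hf : ∀ p, f.val p = κ + max (d.lower (p 0) + d.upper (p 0))
      (max (d.mid (p 0) + p 1) (d.f₂ + 2 * p 1)))
    (hg : ∀ p, g.val p = e + max d.ε (p 1)) (hl : l + κ = c + e) (p : Fin 3 → ℝ)
    (m : Fin 3 → ℤ) : m ∈ (TropPoly.modification (f.scale l) g).maxTerms p ↔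
      (∃ k, m = vec3 (ipt k 0) 0 ∧ Peak d.n d.β k (p 0) ∧
        d.mid (p 0) + p 1 ≤ d.lower (p 0) + d.upper (p 0) ∧
        d.f₂ + 2 * p 1 ≤ d.lower (p 0) + d.upper (p 0) ∧
        d.ε + p 2 ≤ c + d.lower (p 0) + d.upper (p 0) ∧
        p 1 + p 2 ≤ c + d.lower (p 0) + d.upper (p 0)) ∨
      (∃ k, m = vec3 (ipt k 1) 0 ∧ Peak d.n d.φ k (p 0) ∧
        d.lower (p 0) + d.upper (p 0) ≤ d.mid (p 0) + p 1 ∧ d.f₂ + p 1 ≤ d.mid (p 0) ∧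
        d.ε + p 2 ≤ c + d.mid (p 0) + p 1 ∧ p 2 ≤ c + d.mid (p 0)) ∨
      (m = vec3 (ipt 0 2) 0 ∧ d.lower (p 0) + d.upper (p 0) ≤ d.f₂ + 2 * p 1 ∧
        d.mid (p 0) ≤ d.f₂ + p 1 ∧ d.ε + p 2 ≤ c + d.f₂ + 2 * p 1 ∧ p 2 ≤ c + d.f₂ + p 1) ∨
      (m = vec3 (ipt 0 0) 1 ∧ p 1 ≤ d.ε ∧ c + d.lower (p 0) + d.upper (p 0) ≤ d.ε + p 2 ∧
        c + d.mid (p 0) + p 1 ≤ d.ε + p 2 ∧ c + d.f₂ + 2 * p 1 ≤ d.ε + p 2) ∨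
      m = vec3 (ipt 0 1) 1 ∧ d.ε ≤ p 1 ∧ c + d.lower (p 0) + d.upper (p 0) ≤ p 1 + p 2 ∧
        c + d.mid (p 0) ≤ p 2 ∧ c + d.f₂ + p 1 ≤ p 2 := by
  have e0 : proj p 0 = p 0 := rfl
  have e1 : proj p 1 = p 1 := rfl
  rw [TropPoly.mem_modification_maxTerms, TropPoly.scale_val, hf, hg, TropPoly.scale_maxTerms,
    e0, e1]
  simp only [hm.f_max, hm.g_max, e0, e1]
  constructor
  · rintro (⟨_, ⟨k, rfl, hk, h1, h2⟩ | ⟨k, rfl, hk, h1, h2⟩ | ⟨rfl, h1, h2⟩, rfl, h'⟩ |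
      ⟨_, ⟨rfl, h1⟩ | ⟨rfl, h1⟩, rfl, h'⟩)
    · left; refine ⟨k, rfl, hk, ?_⟩; grind
    · right; left; refine ⟨k, rfl, hk, ?_⟩; grind
    · right; right; left; refine ⟨rfl, ?_⟩; grind
    · right; right; right; left; refine ⟨rfl, ?_⟩; grind
    · right; right; right; right; refine ⟨rfl, ?_⟩; grind
  · rintro (⟨k, rfl, hk, h1, h2, h3, h4⟩ | ⟨k, rfl, hk, h1, h2, h3, h4⟩ | ⟨rfl, h1, h2, h3, h4⟩ |
      ⟨rfl, h1, h2, h3, h4⟩ | ⟨rfl, h1, h2, h3, h4⟩)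
    · exact Or.inl ⟨_, Or.inl ⟨k, rfl, hk, h1, h2⟩, rfl, by grind⟩
    · exact Or.inl ⟨_, Or.inr (Or.inl ⟨k, rfl, hk, h1, h2⟩), rfl, by grind⟩
    · exact Or.inl ⟨_, Or.inr (Or.inr ⟨rfl, h1, h2⟩), rfl, by grind⟩
    · exact Or.inr ⟨_, Or.inl ⟨rfl, h1⟩, rfl, by grind⟩
    · exact Or.inr ⟨_, Or.inr ⟨rfl, h1⟩, rfl, by grind⟩

/-- The third row of `f` is not maximal on the curve `V(Q)` or below it. -/
lemma Valid.row_two_lt (hd : d.Valid) {t y : ℝ} (hy : y ≤ d.upper t) :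
    d.f₂ + 2 * y < d.lower t + d.upper t ∨ d.f₂ + y < d.mid t := by
  have h := hd.f₂_add_upper_lt t
  rcases lt_or_ge t (d.σ 0) with ht | ht
  · rw [hd.top_eq_lower ht.le] at h
    left; linarith
  · rw [← hd.mid_eq_top ht] at h
    right; linarith

lemma IsModel.hypersurface_f_cases (hm : d.IsModel P Q f g M) (hd : d.Valid) {p : Fin 2 → ℝ}
    (hp : p ∈ f.hypersurface) (hy : p 1 ≤ d.upper (p 0)) :
    (d.mid (p 0) + p 1 ≤ d.lower (p 0) + d.upper (p 0) ∧ ∃ k < d.n, p 0 = d.β k) ∨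
    d.mid (p 0) + p 1 = d.lower (p 0) + d.upper (p 0) ∨
    d.lower (p 0) + d.upper (p 0) ≤ d.mid (p 0) + p 1 ∧ ∃ k < d.n, p 0 = d.φ k := by
  obtain ⟨a, ha, b, hb, hab⟩ := hp
  have h2 := hd.row_two_lt hy
  rcases (hm.f_max _ _).1 ha with ⟨k, rfl, hk, h1, -⟩ | ⟨k, rfl, hk, h1, -⟩ | ⟨rfl, h1, h1'⟩ <;>
  rcases (hm.f_max _ _).1 hb with ⟨j, rfl, hj, h3, -⟩ | ⟨j, rfl, hj, h3, -⟩ | ⟨rfl, h3, h3'⟩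
  · refine Or.inl ⟨h1, ?_⟩
    by_contra hcon
    push Not at hcon
    exact hab (by rw [hk.eq_of_lt (fun i hi h => hcon i hi h.symm) hj])
  · exact Or.inr (Or.inl (le_antisymm h1 h3))
  · grind
  · exact Or.inr (Or.inl (le_antisymm h3 h1))
  · refine Or.inr (Or.inr ⟨h1, ?_⟩)
    by_contra hcon
    push Not at hcon
    exact hab (by rw [hk.eq_of_lt (fun i hi h => hcon i hi h.symm) hj])
  all_goals grind

lemma IsModel.mem_hypersurface_g (hm : d.IsModel P Q f g M) {p : Fin 2 → ℝ}
    (hp : p ∈ g.hypersurface) : p 1 = d.ε := by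
  obtain ⟨a, ha, b, hb, hab⟩ := hp
  rcases (hm.g_max _ _).1 ha with ⟨rfl, h1⟩ | ⟨rfl, h1⟩ <;>
  rcases (hm.g_max _ _).1 hb with ⟨rfl, h2⟩ | ⟨rfl, h2⟩
  · exact absurd rfl hab
  · exact le_antisymm h1 h2
  · exact le_antisymm h2 h1
  · exact absurd rfl hab

/-- The position of a point `p` of the intersection of the two modifications: over the lower
boundary, a vertical ray, a vertical segment, the upper boundary, or below the last of these over a
marked point. -/
inductive MeetType (d : Config) (M : Set (Fin 2 → ℝ)) (c : ℝ) (p : Fin 3 → ℝ) : Prop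
  | lower (h1 : p 1 = d.lower (p 0)) (h2 : p 2 = c + d.upper (p 0))
  | ray (k : ℕ) (hk : k < d.n) (h0 : p 0 = d.β k) (h1 : p 1 < d.lower (p 0))
      (h2 : p 2 = c + d.upper (p 0))
  | seg (i : ℕ) (hi : i < d.n) (h0 : p 0 = d.γ i) (hl : d.lower (p 0) < p 1)
      (hu : p 1 < d.upper (p 0)) (h2 : p 1 + p 2 = c + d.lower (p 0) + d.upper (p 0))
  | upper (h1 : p 1 = d.upper (p 0)) (h2 : p 2 = c + d.top (p 0))
  | marked (hM : proj p ∈ M) (h1 : p 1 = d.upper (p 0)) (h2 : p 2 < c + d.top (p 0))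

lemma IsModel.meetType (hm : d.IsModel P Q f g M) (hd : d.Valid)
    (hc : ∀ p, P.val p = c + max (d.upper (p 0)) (p 1))
    (hf : ∀ p, f.val p = κ + max (d.lower (p 0) + d.upper (p 0))
      (max (d.mid (p 0) + p 1) (d.f₂ + 2 * p 1)))
    (hg : ∀ p, g.val p = e + max d.ε (p 1)) (hl : l + κ = c + e) {p : Fin 3 → ℝ}
    (hX : p ∈ (TropPoly.modification P (TropPoly.unit 2)).hypersurface)
    (hY : p ∈ (TropPoly.modification (f.scale l) g).hypersurface) : MeetType d M c p := by
  have e0 : proj p 0 = p 0 := rfl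
  have e1 : proj p 1 = p 1 := rfl
  rw [mem_modification_unit, hm.mem_hypersurface_P hd, hc, e0, e1] at hX
  rw [TropPoly.mem_modification_hypersurface, TropPoly.scale_val, TropPoly.scale_hypersurface, hf,
    hg, e0, e1] at hY
  have hlu := hd.lower_lt_upper (p 0)
  have hε := hd.ε_lt_lower (p 0)
  have hmt := hd.mid_le_top (p 0)
  have htu := hd.top_lt_upper (p 0)
  have hf₂ := hd.f₂_neg
  obtain ⟨E, hE, hE1, hE2, hE3⟩ : ∃ E, max d.ε (p 1) = E ∧ d.ε ≤ E ∧ p 1 ≤ E ∧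
      (E = d.ε ∨ E = p 1) := ⟨_, rfl, le_max_left _ _, le_max_right _ _, max_choice _ _⟩
  obtain ⟨F, hF, hF1, hF2, hF3⟩ : ∃ F, max (d.lower (p 0) + d.upper (p 0))
      (max (d.mid (p 0) + p 1) (d.f₂ + 2 * p 1)) = F ∧ d.lower (p 0) + d.upper (p 0) ≤ F ∧
      d.mid (p 0) + p 1 ≤ F ∧ (F = d.lower (p 0) + d.upper (p 0) ∨ F = d.mid (p 0) + p 1 ∨
        F = d.f₂ + 2 * p 1) :=
    ⟨_, rfl, le_max_left _ _, (le_max_left _ _).trans (le_max_right _ _), by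
      rcases max_choice (d.lower (p 0) + d.upper (p 0))
        (max (d.mid (p 0) + p 1) (d.f₂ + 2 * p 1)) with h | h
      · exact Or.inl h
      · rw [h]; exact Or.inr (max_choice _ _)⟩
  rw [hE, hF] at hY
  rcases lt_or_ge (d.upper (p 0)) (p 1) with hy | hy
  · rcases hX with hX | ⟨hX, hX' | ⟨hX', -⟩⟩
    · rw [max_eq_right hy.le] at hX
      have h1 : F < 2 * p 1 := by rcases hF3 with h | h | h <;> linarith
      rcases hY with hY | ⟨hY, -⟩ | ⟨-, hY⟩
      · linarith
      · linarith
      · linarith [hm.mem_hypersurface_g hY, e1]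
    · linarith
    · linarith
  replace hF3 : F = d.lower (p 0) + d.upper (p 0) ∨ F = d.mid (p 0) + p 1 := by
    rcases hF3 with h | h | h
    · exact Or.inl h
    · exact Or.inr h
    · rcases hd.row_two_lt hy with h' | h' <;> linarith
  rw [max_eq_left hy] at hX
  have hV := fun h => hm.hypersurface_f_cases hd (p := proj p) h hy
  rw [e0, e1] at hV
  rcases hy.lt_or_eq with hy | hy
  · rcases hX with hX | ⟨hX, hX' | ⟨-, i, hi, h0⟩⟩
    · rcases hY with hY | ⟨hY, hY'⟩ | ⟨hY, hY'⟩
      · refine .lower ?_ hX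
        rcases hE3 with h | h <;> rcases hF3 with h' | h' <;> linarith
      · have hlow : p 1 < d.lower (p 0) := by rcases hF3 with h' | h' <;> linarith
        rcases hV hY' with ⟨-, k, hk, h0⟩ | h | ⟨h, -⟩
        · exact .ray k hk h0 hlow hX
        · linarith
        · linarith
      · have := hm.mem_hypersurface_g hY'
        rw [e1] at this
        rcases hE3 with h | h <;> linarith
    · exact absurd hX' hy.ne
    · have hml := hd.mid_lt_lower (h0 ▸ hd.γ_lt_σ' hi hd.pos)
      rcases hY with hY | ⟨hY, hY'⟩ | ⟨hY, hY'⟩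
      · have h1 : p 1 + p 2 = c + d.lower (p 0) + d.upper (p 0) := by
          rcases hE3 with h | h <;> rcases hF3 with h' | h' <;> linarith
        exact .seg i hi h0 (by linarith) hy h1
      · rcases hV hY' with ⟨-, k, hk, h0'⟩ | h | ⟨h, -⟩
        · exact absurd (h0'.symm.trans h0) (hd.β_ne_γ hk hi)
        · linarith
        · linarith
      · have := hm.mem_hypersurface_g hY'
        rw [e1] at this
        rcases hE3 with h | h <;> linarith
  · have hEy : E = p 1 := by rcases hE3 with h | h <;> linarith
    have hlt := d.lower_le_top (p 0)
    have hFt : F = d.top (p 0) + p 1 := by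
      have := hd.max_lower_mid (p 0)
      rcases max_choice (d.lower (p 0)) (d.mid (p 0)) with h | h <;>
        rcases hF3 with h' | h' <;> linarith
    rcases hY with hY | ⟨hY, hY'⟩ | ⟨hY, hY'⟩
    · exact .upper hy (by linarith)
    · refine .marked (hm.mem_marked_iff.2 ⟨hy, ?_⟩) hy (by linarith)
      rw [e0]
      rcases lt_trichotomy (p 0) (d.σ 0) with ht | ht | ht
      · have := hd.mid_lt_lower ht
        rcases hV hY' with ⟨-, k, hk, h⟩ | h | ⟨h, -⟩
        · exact ⟨k, hk, Or.inl h⟩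
        · linarith
        · linarith
      · exact ⟨0, hd.pos, Or.inr ht⟩
      · have := hd.lower_lt_mid ht
        rcases hV hY' with ⟨h, -⟩ | h | ⟨-, k, hk, h⟩
        · linarith
        · linarith
        · rcases Nat.eq_zero_or_pos k with rfl | hk0
          · linarith [hd.φ_lt_σ]
          · exact ⟨k, hk, Or.inr (h.trans (hd.σ_eq k hk0 hk).symm)⟩
    · linarith [hm.mem_hypersurface_g hY', e1]

end Config


/-- Two sets of exponents consist of two exponents each, with linearly independent differences, or
the differences of the exponents of both sets span the dual space. -/
def IndependentOrSpanning (A B : Set (Fin 3 → ℤ)) : Prop :=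
  (∃ a b a' b', A = {a, b} ∧ B = {a', b'} ∧ a ≠ b ∧ ∃ w : Fin 3 → ℝ,
    TropPoly.functional (a - b) w = 0 ∧ TropPoly.functional (a' - b') w ≠ 0) ∨
  A.Nontrivial ∧ B.Nontrivial ∧ ∀ v : Fin 3 → ℝ,
    (∀ a ∈ A, ∀ b ∈ A, TropPoly.functional (a - b) v = 0) →
    (∀ a ∈ B, ∀ b ∈ B, TropPoly.functional (a - b) v = 0) → v = 0

lemma IndependentOrSpanning.nontrivial {A B : Set (Fin 3 → ℤ)} (h : IndependentOrSpanning A B) :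
    A.Nontrivial ∧ B.Nontrivial := by
  rcases h with ⟨a, b, a', b', rfl, rfl, hab, w, -, hw⟩ | h
  · refine ⟨Set.nontrivial_pair hab, Set.nontrivial_pair fun h => hw ?_⟩
    rw [h, sub_self, TropPoly.functional_apply]; simp
  · exact ⟨h.1, h.2.1⟩

lemma functional_vec3 (k j k' j' : ℕ) (s s' : ℤ) (v : Fin 3 → ℝ) :
    TropPoly.functional (vec3 (ipt k j) s - vec3 (ipt k' j') s') v =
      ((k : ℝ) - k') * v 0 + ((j : ℝ) - j') * v 1 + ((s : ℝ) - s') * v 2 := by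
  rw [TropPoly.functional_apply, Fin.sum_univ_three]
  simp [vec3, ipt]

lemma vec3_ipt_inj {k j k' j' : ℕ} {s s' : ℤ} :
    vec3 (ipt k j) s = vec3 (ipt k' j') s' ↔ k = k' ∧ j = j' ∧ s = s' := by
  constructor
  · intro h
    have h0 := congrFun h 0
    have h1 := congrFun h 1
    have h2 := congrFun h 2
    simp [vec3, ipt] at h0 h1 h2
    exact ⟨h0, h1, h2⟩
  · rintro ⟨rfl, rfl, rfl⟩; rfl

lemma point3_ext {v : Fin 3 → ℝ} (h0 : v 0 = 0) (h1 : v 1 = 0) (h2 : v 2 = 0) : v = 0 := by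
  funext i; fin_cases i <;> assumption

namespace Config

variable {d : Config} {P Q f g : TropPoly 2} {M : Set (Fin 2 → ℝ)} {c κ e l : ℝ}

lemma MeetType.independentOrSpanning (hm : d.IsModel P Q f g M) (hd : d.Valid)
    (hc : ∀ p, P.val p = c + max (d.upper (p 0)) (p 1))
    (hf : ∀ p, f.val p = κ + max (d.lower (p 0) + d.upper (p 0))
      (max (d.mid (p 0) + p 1) (d.f₂ + 2 * p 1)))
    (hg : ∀ p, g.val p = e + max d.ε (p 1)) (hl : l + κ = c + e) {p : Fin 3 → ℝ}
    (h : MeetType d M c p) : IndependentOrSpanning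
      ((TropPoly.modification P (TropPoly.unit 2)).maxTerms p)
      ((TropPoly.modification (f.scale l) g).maxTerms p) := by
  have hA := hm.maxTerms_X hc p
  have hB := hm.maxTerms_Y hf hg hl p
  generalize (TropPoly.modification P (TropPoly.unit 2)).maxTerms p = A at hA ⊢
  generalize (TropPoly.modification (f.scale l) g).maxTerms p = B at hB ⊢
  have hlu := hd.lower_lt_upper (p 0)
  have hε := hd.ε_lt_lower (p 0)
  have hmt := hd.mid_le_top (p 0)
  have hlt := d.lower_le_top (p 0)
  have htu := hd.top_lt_upper (p 0)
  have hf₂ := hd.f₂_neg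
  obtain ⟨k, hk, -⟩ := exists_peak hd.increasing_β (p 0)
  -- the second modification over the upper boundary
  have hBup : p 1 = d.upper (p 0) → p 2 ≤ c + d.top (p 0) → ∀ m, m ∈ B ↔
      (∃ k, m = vec3 (ipt k 0) 0 ∧ Peak d.n d.β k (p 0) ∧ d.mid (p 0) ≤ d.lower (p 0)) ∨
      (∃ k, m = vec3 (ipt k 1) 0 ∧ Peak d.n d.φ k (p 0) ∧ d.lower (p 0) ≤ d.mid (p 0)) ∨
      m = vec3 (ipt 0 1) 1 ∧ p 2 = c + d.top (p 0) := by
    intro h1 h2 m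
    have h3 := hd.row_two_lt h1.le
    have htop := hd.max_lower_mid (p 0)
    have htop' := max_choice (d.lower (p 0)) (d.mid (p 0))
    rw [htop] at htop'
    clear htop
    rw [hB]
    constructor
    · rintro (⟨k, rfl, hk, h1, -⟩ | ⟨k, rfl, hk, h1, -⟩ | ⟨rfl, h1, h2, -⟩ | ⟨rfl, h1, -⟩ |
        ⟨rfl, -, h1, h2, -⟩)
      · exact Or.inl ⟨k, rfl, hk, by linarith⟩
      · exact Or.inr (Or.inl ⟨k, rfl, hk, by linarith⟩)
      · rcases h3 with h3 | h3 <;> linarith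
      · linarith
      · refine Or.inr (Or.inr ⟨rfl, ?_⟩)
        rcases htop' with h | h <;> linarith
    · rintro (⟨k, rfl, hk, h4⟩ | ⟨k, rfl, hk, h4⟩ | ⟨rfl, h4⟩)
      · refine Or.inl ⟨k, rfl, hk, ?_, ?_, ?_, ?_⟩ <;> rcases htop' with h | h <;>
          rcases h3 with h3 | h3 <;> linarith
      · refine Or.inr (Or.inl ⟨k, rfl, hk, ?_, ?_, ?_, ?_⟩) <;> rcases htop' with h | h <;>
          rcases h3 with h3 | h3 <;> linarith
      · refine Or.inr (Or.inr (Or.inr (Or.inr ⟨rfl, ?_, ?_, ?_, ?_⟩))) <;>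
          rcases htop' with h | h <;> rcases h3 with h3 | h3 <;> linarith
  -- the first modification below the graph of `P` over the upper boundary
  have hAup : p 1 = d.upper (p 0) → p 2 < c + d.upper (p 0) → ∀ m, m ∈ A ↔
      (∃ k, m = vec3 (ipt k 0) 0 ∧ Peak d.n d.γ k (p 0)) ∨ m = vec3 (ipt 0 1) 0 := by
    intro h1 h2 m
    rw [hA]
    constructor
    · rintro (⟨k, rfl, hk, -⟩ | ⟨rfl, -⟩ | ⟨rfl, h, -⟩)
      · exact Or.inl ⟨k, rfl, hk⟩
      · exact Or.inr rfl
      · linarith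
    · rintro (⟨k, rfl, hk⟩ | rfl)
      · exact Or.inl ⟨k, rfl, hk, h1.le, h2.le⟩
      · exact Or.inr (Or.inl ⟨rfl, h1.ge, by linarith⟩)
  -- the graph of `P` below the upper boundary
  have hAgraph : p 1 < d.upper (p 0) → p 2 = c + d.upper (p 0) → ∀ m, m ∈ A ↔
      (∃ k, m = vec3 (ipt k 0) 0 ∧ Peak d.n d.γ k (p 0)) ∨ m = vec3 (ipt 0 0) 1 := by
    intro h1 h2 m
    rw [hA]
    constructor
    · rintro (⟨k, rfl, hk, -⟩ | ⟨rfl, h, -⟩ | ⟨rfl, -⟩)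
      · exact Or.inl ⟨k, rfl, hk⟩
      · linarith
      · exact Or.inr rfl
    · rintro (⟨k, rfl, hk⟩ | rfl)
      · exact Or.inl ⟨k, rfl, hk, h1.le, h2.le⟩
      · exact Or.inr (Or.inr ⟨rfl, h2.ge, by linarith⟩)
  -- the graph of `f / g` over the lower boundary and the vertical segments
  have hBgraph : d.lower (p 0) ≤ p 1 → p 1 < d.upper (p 0) → d.mid (p 0) < p 2 - c →
      p 1 + p 2 = c + d.lower (p 0) + d.upper (p 0) → ∀ m, m ∈ B ↔
      (∃ k, m = vec3 (ipt k 0) 0 ∧ Peak d.n d.β k (p 0)) ∨ m = vec3 (ipt 0 1) 1 := by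
    intro h1 h2 h3 h4 m
    have h5 := hd.row_two_lt h2.le
    rw [hB]
    constructor
    · rintro (⟨k, rfl, hk, -⟩ | ⟨k, rfl, hk, h6, -⟩ | ⟨rfl, h6, h7, -⟩ | ⟨rfl, h6, -⟩ | ⟨rfl, -⟩)
      · exact Or.inl ⟨k, rfl, hk⟩
      · linarith
      · rcases h5 with h5 | h5 <;> linarith
      · linarith
      · exact Or.inr rfl
    · rintro (⟨k, rfl, hk⟩ | rfl)
      · refine Or.inl ⟨k, rfl, hk, ?_, ?_, ?_, ?_⟩ <;> rcases h5 with h5 | h5 <;> linarith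
      · refine Or.inr (Or.inr (Or.inr (Or.inr ⟨rfl, ?_, ?_, ?_, ?_⟩))) <;>
          rcases h5 with h5 | h5 <;> linarith
  have hsing : ∀ {b : ℕ → ℝ} {i j : ℕ}, (∀ k', Peak d.n b k' (p 0) ↔ k' = i) →
      ∀ m, (∃ k', m = vec3 (ipt k' j) 0 ∧ Peak d.n b k' (p 0)) ↔ m = vec3 (ipt i j) 0 := by
    intro b i j hi m
    simp only [hi, exists_eq_right]
  have hpair : ∀ {b : ℕ → ℝ} {i j : ℕ}, (∀ k', Peak d.n b k' (p 0) ↔ k' = i ∨ k' = i + 1) →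
      ∀ m, (∃ k', m = vec3 (ipt k' j) 0 ∧ Peak d.n b k' (p 0)) ↔
        m = vec3 (ipt i j) 0 ∨ m = vec3 (ipt (i + 1) j) 0 := by
    intro b i j hi m
    simp only [hi, and_or_left, exists_or, exists_eq_right]
  -- at the first of the numbers `σ k`
  have hσφ : p 0 = d.σ 0 → ∃ j, j ≠ 0 ∧ ∀ k', Peak d.n d.φ k' (p 0) ↔ k' = j := by
    intro ht
    rcases peak_cases hd.increasing_φ (p 0) with ⟨j, hj, -⟩ | ⟨j, hjn, hpj, -⟩
    · refine ⟨j, ?_, hj⟩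
      rintro rfl
      linarith [((hj 0).2 rfl).2.2 0 le_rfl hd.pos, hd.φ_lt_σ]
    · rcases Nat.eq_zero_or_pos j with rfl | hj0
      · linarith [hd.φ_lt_σ]
      · have := hd.increasing_σ 0 j hj0 hjn
        rw [hd.σ_eq j hj0 hjn] at this
        linarith
  have hσ : ∀ {i}, (∀ k', Peak d.n d.γ k' (p 0) ↔ k' = i) → p 0 = d.σ 0 →
      i = d.n ∧ ∀ k', Peak d.n d.β k' (p 0) ↔ k' = d.n := by
    intro i hi ht
    have hpeak : ∀ {b : ℕ → ℝ}, (∀ j < d.n, b j < d.σ 0) → ∀ k', Peak d.n b k' (p 0) ↔ k' = d.n := by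
      intro b hb k'
      constructor
      · rintro ⟨h1, -, h3⟩
        by_contra hne
        linarith [h3 k' le_rfl (by omega), hb k' (by omega)]
      · rintro rfl
        exact ⟨le_rfl, fun j hj => by linarith [hb j hj], fun j hj hj' => by omega⟩
    exact ⟨((hi _).1 ((hpeak (fun j hj => hd.γ_lt_σ' hj hd.pos) d.n).2 rfl)).symm,
      hpeak fun j hj => hd.β_lt_σ hj hd.pos⟩
  rcases peak_cases hd.increasing_γ (p 0) with ⟨i, hi, -, -, hγ⟩ | ⟨i, hin, hpi, hi, -, -⟩
  · cases h with
    | lower h1 h2 =>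
      have hA' := hAgraph (by linarith) h2
      have hB' := hBgraph h1.ge (by linarith) (by linarith) (by linarith)
      simp only [hsing hi] at hA'
      rcases peak_cases hd.increasing_β (p 0) with ⟨j, hj, -⟩ | ⟨j, -, -, hj, -⟩
      · simp only [hsing hj] at hB'
        exact Or.inl ⟨_, _, _, _, Set.ext hA', Set.ext hB', by simp [vec3_ipt_inj], ![0, 1, 0],
          by simp [functional_vec3], by simp [functional_vec3]⟩
      · simp only [hpair hj] at hB'
        refine Or.inr ⟨⟨_, (hA' _).2 (Or.inl rfl), _, (hA' _).2 (Or.inr rfl),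
          by simp [vec3_ipt_inj]⟩, ⟨_, (hB' _).2 (Or.inl (Or.inl rfl)), _, (hB' _).2 (Or.inr rfl),
          by simp [vec3_ipt_inj]⟩, fun v hvA hvB => ?_⟩
        have e1 := hvB _ ((hB' _).2 (Or.inl (Or.inl rfl))) _ ((hB' _).2 (Or.inl (Or.inr rfl)))
        have e2 := hvA _ ((hA' _).2 (Or.inl rfl)) _ ((hA' _).2 (Or.inr rfl))
        have e3 := hvB _ ((hB' _).2 (Or.inl (Or.inl rfl))) _ ((hB' _).2 (Or.inr rfl))
        rw [functional_vec3] at e1 e2 e3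
        push_cast at e1 e2 e3
        have v0 : v 0 = 0 := by linarith
        rw [v0] at e2 e3
        exact point3_ext v0 (by linarith) (by linarith)
    | ray j hj h0 h1 h2 =>
      have hA' := hAgraph (by linarith) h2
      simp only [hsing hi] at hA'
      have hpj := peak_at_break hd.increasing_β hj
      rw [← h0] at hpj
      have h3 := hd.row_two_lt (t := p 0) (y := p 1) (by linarith)
      have hB' : ∀ m, m ∈ B ↔ m = vec3 (ipt j 0) 0 ∨ m = vec3 (ipt (j + 1) 0) 0 := by
        intro m
        rw [← hpair hpj, hB]
        constructor
        · rintro (⟨k, rfl, hk, -⟩ | ⟨k, rfl, hk, h6, -⟩ | ⟨rfl, h6, h7, -⟩ | ⟨rfl, h6, h7, -⟩ |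
            ⟨rfl, -, h6, -⟩)
          · exact ⟨k, rfl, hk⟩
          · linarith
          · rcases h3 with h3 | h3 <;> linarith
          · linarith
          · linarith
        · rintro ⟨k, rfl, hk⟩
          refine Or.inl ⟨k, rfl, hk, ?_, ?_, ?_, ?_⟩ <;> rcases h3 with h3 | h3 <;> linarith
      exact Or.inl ⟨_, _, _, _, Set.ext hA', Set.ext hB', by simp [vec3_ipt_inj], ![1, 0, i],
        by simp [functional_vec3], by simp [functional_vec3]⟩
    | seg j hj h0 => exact absurd h0.symm (hγ j hj)
    | upper h1 h2 =>
      have hA' := hAup h1 (by linarith)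
      have hB' := hBup h1 h2.le
      simp only [hsing hi] at hA'
      have key : ∀ a b, a ∈ B → b ∈ B → a ≠ b → (∀ v : Fin 3 → ℝ, i * v 0 = v 1 →
          TropPoly.functional (a - b) v = 0 → v 0 = 0) →
          (∃ j s, a = vec3 (ipt j s) 0) → IndependentOrSpanning A B := by
        rintro a b ha hb hab hv ⟨j, s, rfl⟩
        refine Or.inr ⟨⟨_, (hA' _).2 (Or.inl rfl), _, (hA' _).2 (Or.inr rfl),
          by simp [vec3_ipt_inj]⟩, ⟨_, ha, _, hb, hab⟩, fun v hvA hvB => ?_⟩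
        have e1 := hvA _ ((hA' _).2 (Or.inl rfl)) _ ((hA' _).2 (Or.inr rfl))
        have e2 := hvB _ ha _ ((hB' _).2 (Or.inr (Or.inr ⟨rfl, h2⟩)))
        rw [functional_vec3] at e1 e2
        push_cast at e1 e2
        have v0 := hv v (by linarith) (hvB _ ha _ hb)
        have v1 : v 1 = 0 := by rw [v0] at e1; linarith
        rw [v0, v1] at e2
        exact point3_ext v0 v1 (by linarith)
      rcases lt_trichotomy (p 0) (d.σ 0) with ht | ht | ht
      · have hml := hd.mid_lt_lower ht
        rcases peak_cases hd.increasing_β (p 0) with ⟨j, hj, -⟩ | ⟨j, -, -, hj, -⟩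
        · simp only [hml.le, hml.not_ge, and_true, and_false, exists_false, false_or, h2,
            hsing hj] at hB'
          exact Or.inl ⟨_, _, _, _, Set.ext hA', Set.ext hB', by simp [vec3_ipt_inj], ![0, 0, 1],
            by simp [functional_vec3], by simp [functional_vec3]⟩
        · refine key (vec3 (ipt j 0) 0) (vec3 (ipt (j + 1) 0) 0)
            ((hB' _).2 (Or.inl ⟨j, rfl, by rw [hj]; simp, hml.le⟩))
            ((hB' _).2 (Or.inl ⟨j + 1, rfl, by rw [hj]; simp, hml.le⟩)) (by simp [vec3_ipt_inj])
            (fun v _ h => ?_) ⟨j, 0, rfl⟩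
          rw [functional_vec3] at h; push_cast at h; linarith
      · obtain ⟨j, hj0, hj⟩ := hσφ ht
        obtain ⟨hi', hkn⟩ := hσ hi ht
        have hml : d.mid (p 0) = d.lower (p 0) := by rw [ht]; exact hd.mid_σ
        refine key (vec3 (ipt d.n 0) 0) (vec3 (ipt j 1) 0)
            ((hB' _).2 (Or.inl ⟨d.n, rfl, by rw [hkn], hml.le⟩))
            ((hB' _).2 (Or.inr (Or.inl ⟨j, rfl, by rw [hj], hml.ge⟩))) (by simp [vec3_ipt_inj])
            (fun v h' h => ?_) ⟨d.n, 0, rfl⟩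
        rw [functional_vec3] at h
        rw [hi'] at h'
        push_cast at h
        have : (j : ℝ) * v 0 = 0 := by linarith
        exact (mul_eq_zero.1 this).resolve_left (by exact_mod_cast hj0)
      · have hml := hd.lower_lt_mid ht
        rcases peak_cases hd.increasing_φ (p 0) with ⟨j, hj, -⟩ | ⟨j, -, -, hj, -⟩
        · simp only [hml.le, hml.not_ge, and_true, and_false, exists_false, false_or, h2,
            hsing hj] at hB'
          exact Or.inl ⟨_, _, _, _, Set.ext hA', Set.ext hB', by simp [vec3_ipt_inj], ![0, 0, 1],
            by simp [functional_vec3], by simp [functional_vec3]⟩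
        · refine key (vec3 (ipt j 1) 0) (vec3 (ipt (j + 1) 1) 0)
            ((hB' _).2 (Or.inr (Or.inl ⟨j, rfl, by rw [hj]; simp, hml.le⟩)))
            ((hB' _).2 (Or.inr (Or.inl ⟨j + 1, rfl, by rw [hj]; simp, hml.le⟩)))
            (by simp [vec3_ipt_inj]) (fun v _ h => ?_) ⟨j, 1, rfl⟩
          rw [functional_vec3] at h; push_cast at h; linarith
    | marked hM h1 h2 =>
      have hA' := hAup h1 (by linarith)
      have hB' := hBup h1 h2.le
      simp only [hsing hi] at hA'
      simp only [h2.ne, and_false, or_false] at hB'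
      obtain ⟨-, k, hk, h0⟩ := hm.mem_marked_iff.1 hM
      replace h0 : p 0 = d.β k ∨ p 0 = d.σ k := h0
      rcases lt_trichotomy (p 0) (d.σ 0) with ht | ht | ht
      · have hml := hd.mid_lt_lower ht
        rcases h0 with h0 | h0
        · have hj := peak_at_break hd.increasing_β hk
          rw [← h0] at hj
          simp only [hml.le, hml.not_ge, and_true, and_false, exists_false, or_false,
            hpair hj] at hB'
          exact Or.inl ⟨_, _, _, _, Set.ext hA', Set.ext hB', by simp [vec3_ipt_inj], ![1, i, 0],
            by simp [functional_vec3], by simp [functional_vec3]⟩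
        · linarith [hd.increasing_σ.le (Nat.zero_le k) hk]
      · obtain ⟨j, hj0, hj⟩ := hσφ ht
        obtain ⟨hi', hkn⟩ := hσ hi ht
        have hml : d.mid (p 0) = d.lower (p 0) := by rw [ht]; exact hd.mid_σ
        simp only [hml, le_refl, and_true, hsing hj, hsing hkn] at hB'
        refine Or.inl ⟨_, _, _, _, Set.ext hA', Set.ext hB', by simp [vec3_ipt_inj], ![1, i, 0],
            by simp [functional_vec3], ?_⟩
        rw [functional_vec3, hi']
        have : (j : ℝ) ≠ 0 := by exact_mod_cast hj0
        intro h
        simp at h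
        exact this (by linarith)
      · have hml := hd.lower_lt_mid ht
        rcases h0 with h0 | h0
        · linarith [hd.β_lt_σ hk hd.pos]
        · have hk0 : 1 ≤ k := Nat.one_le_iff_ne_zero.2 fun h => by rw [h0, h] at ht; linarith
          have hj := peak_at_break hd.increasing_φ hk
          rw [← hd.σ_eq k hk0 hk, ← h0] at hj
          simp only [hml.le, hml.not_ge, and_true, and_false, exists_false, false_or,
            hpair hj] at hB'
          exact Or.inl ⟨_, _, _, _, Set.ext hA', Set.ext hB', by simp [vec3_ipt_inj], ![1, i, 0],
            by simp [functional_vec3], by simp [functional_vec3]⟩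
  · have hml := hd.mid_lt_lower (hpi ▸ hd.γ_lt_σ' hin hd.pos)
    have hspan : ∀ j s : ℕ, (∀ m, m ∈ A ↔ (∃ k, m = vec3 (ipt k 0) 0 ∧ Peak d.n d.γ k (p 0)) ∨
        m = vec3 (ipt 0 j) s) → j + s = 1 → vec3 (ipt k 0) 0 ∈ B → vec3 (ipt 0 1) 1 ∈ B →
        IndependentOrSpanning A B := by
      intro j s hA' hjs hb hb'
      simp only [hpair hi] at hA'
      refine Or.inr ⟨⟨_, (hA' _).2 (Or.inl (Or.inl rfl)), _, (hA' _).2 (Or.inl (Or.inr rfl)),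
        by simp [vec3_ipt_inj]⟩, ⟨_, hb, _, hb', by simp [vec3_ipt_inj]⟩, fun v hvA hvB => ?_⟩
      have e1 := hvA _ ((hA' _).2 (Or.inl (Or.inl rfl))) _ ((hA' _).2 (Or.inl (Or.inr rfl)))
      have e2 := hvA _ ((hA' _).2 (Or.inl (Or.inl rfl))) _ ((hA' _).2 (Or.inr rfl))
      have e3 := hvB _ hb _ hb'
      rw [functional_vec3] at e1 e2 e3
      push_cast at e1 e2 e3
      have v0 : v 0 = 0 := by linarith
      rw [v0] at e2 e3
      have : j = 0 ∧ s = 1 ∨ j = 1 ∧ s = 0 := by omega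
      rcases this with ⟨rfl, rfl⟩ | ⟨rfl, rfl⟩ <;> norm_num at e2 <;>
        exact point3_ext v0 (by linarith) (by linarith)
    cases h with
    | lower h1 h2 =>
      have hB' := hBgraph h1.ge (by linarith) (by linarith) (by linarith)
      exact hspan 0 1 (hAgraph (by linarith) h2) rfl ((hB' _).2 (Or.inl ⟨k, rfl, hk⟩))
        ((hB' _).2 (Or.inr rfl))
    | ray j hj h0 => exact absurd (h0.symm.trans hpi) (hd.β_ne_γ hj hin)
    | seg j hj h0 hl hu h2 =>
      have hB' := hBgraph hl.le hu (by linarith) h2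
      have hA' : ∀ m, m ∈ A ↔ m = vec3 (ipt i 0) 0 ∨ m = vec3 (ipt (i + 1) 0) 0 := by
        intro m
        rw [← hpair hi, hA]
        constructor
        · rintro (⟨k, rfl, hk, -⟩ | ⟨rfl, h, -⟩ | ⟨rfl, h, -⟩)
          · exact ⟨k, rfl, hk⟩
          · linarith
          · linarith
        · rintro ⟨k, rfl, hk⟩
          exact Or.inl ⟨k, rfl, hk, hu.le, by linarith⟩
      rcases peak_cases hd.increasing_β (p 0) with ⟨b, hb, -⟩ | ⟨b, hbn, hpb, -⟩
      · simp only [hsing hb] at hB'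
        exact Or.inl ⟨_, _, _, _, Set.ext hA', Set.ext hB', by simp [vec3_ipt_inj], ![0, 1, 0],
          by simp [functional_vec3], by simp [functional_vec3]⟩
      · exact absurd (hpb.symm.trans hpi) (hd.β_ne_γ hbn hin)
    | upper h1 h2 =>
      have hB' := hBup h1 h2.le
      exact hspan 1 0 (hAup h1 (by linarith)) rfl ((hB' _).2 (Or.inl ⟨k, rfl, hk, hml.le⟩))
        ((hB' _).2 (Or.inr (Or.inr ⟨rfl, h2⟩)))
    | marked hM =>
      obtain ⟨-, k, hk, h | h⟩ := hm.mem_marked_iff.1 hM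
      · exact absurd (h.symm.trans hpi) (hd.β_ne_γ hk hin)
      · exact absurd (hpi.symm.trans h) (hd.γ_lt_σ' hin hk).ne

end Config


namespace Config

variable {d : Config} {P Q f g : TropPoly 2} {M : Set (Fin 2 → ℝ)} {c κ e l : ℝ}

lemma IsModel.carrier_liftCurve (hm : d.IsModel P Q f g M) (hd : d.Valid)
    (hc : ∀ p, P.val p = c + max (d.upper (p 0)) (p 1))
    (hf : ∀ p, f.val p = κ + max (d.lower (p 0) + d.upper (p 0))
      (max (d.mid (p 0) + p 1) (d.f₂ + 2 * p 1)))
    (hg : ∀ p, g.val p = e + max d.ε (p 1)) (hl : l + κ = c + e) :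
    (d.liftCurve Q M c).carrier = (TropPoly.modification P (TropPoly.unit 2)).hypersurface ∩
      (TropPoly.modification (f.scale l) g).hypersurface := by
  ext p
  rw [liftCurve, mem_carrier_graphCurve, hm.carrier_eq hd]
  have e0 : proj p 0 = p 0 := rfl
  have e1 : proj p 1 = p 1 := rfl
  constructor
  · intro hp
    suffices h : MeetType d M c p from (h.independentOrSpanning hm hd hc hf hg hl).nontrivial
    have hup : p 1 = d.upper (p 0) → p 2 = d.height (proj p) + c → MeetType d M c p :=
      fun h h' => .upper h (by rw [h', height_upper h, e0]; ring)
    have hlow : p 1 ≤ d.lower (p 0) → p 2 = d.height (proj p) + c → p 2 = c + d.upper (p 0) :=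
      fun h h' => by rw [h', height_of_le_lower hd h, e0]; ring
    rcases hp with ⟨hp, h2⟩ | ⟨hp, h2⟩
    · cases hm.pointType hd hp with
      | ray k hk h0 h1 => exact .ray k hk h0 h1 (hlow h1.le h2)
      | lower _ _ h1 => exact .lower h1 (hlow h1.le h2)
      | lowerβ _ _ _ _ h1 => exact .lower h1 (hlow h1.le h2)
      | lowerγ _ _ _ _ h1 => exact .lower h1 (hlow h1.le h2)
      | seg i hi h0 h1 h1' =>
        refine .seg i hi h0 h1 h1' ?_
        rw [h2, height_seg hd hi h0 h1.le h1'.le, e0, e1]; ring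
      | upper _ h1 => exact hup h1 h2
      | upperγ _ _ _ h1 => exact hup h1 h2
    · have h1 := (hm.mem_marked_iff.1 hp).1
      rcases h2.lt_or_eq with h2 | h2
      · rw [height_upper h1, e0] at h2
        exact .marked hp h1 (by linarith)
      · exact hup h1 h2
  · rintro ⟨hX, hY⟩
    have hlu := hd.lower_lt_upper (p 0)
    cases hm.meetType hd hc hf hg hl hX hY with
    | lower h1 h2 =>
      refine Or.inl ⟨hm.mem_hypersurface_lower hd h1, ?_⟩
      rw [height_of_le_lower hd h1.le, h2, e0]; ring
    | ray k hk h0 h1 h2 =>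
      have hpk := peak_at_break hd.increasing_β hk
      refine Or.inl ⟨⟨_, (hm.Q_max _ _).2 (Or.inl ⟨k, rfl, by rw [e0, h0, hpk]; simp, h1.le⟩), _,
        (hm.Q_max _ _).2 (Or.inl ⟨k + 1, rfl, by rw [e0, h0, hpk]; simp, h1.le⟩),
        by rw [Ne, ipt_inj]; omega⟩, ?_⟩
      rw [height_of_le_lower hd h1.le, h2, e0]; ring
    | seg i hi h0 h1 h1' h2 =>
      obtain ⟨b, hb, hbq⟩ := hm.exists_seg_edge hd hi
      refine Or.inl ⟨hm.carrier_eq hd ▸ mem_carrier.2 ⟨b, hb, hbq _ h0 h1.le h1'.le⟩, ?_⟩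
      rw [height_seg hd hi h0 h1.le h1'.le, e0, e1]; linarith
    | upper h1 h2 =>
      refine Or.inl ⟨hm.mem_hypersurface_upper hd h1, ?_⟩
      rw [height_upper h1, h2, e0]; ring
    | marked hM h1 h2 =>
      refine Or.inr ⟨hM, ?_⟩
      rw [height_upper h1, e0]; linarith

/-- The constant for which the second modification contains the lift is determined by the point of
the lift below the first vertical segment, at which `f` and `g` have unique maximal terms. -/
lemma IsModel.const_of_subset (hm : d.IsModel P Q f g M) (hd : d.Valid)
    (hf : ∀ p, f.val p = κ + max (d.lower (p 0) + d.upper (p 0))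
      (max (d.mid (p 0) + p 1) (d.f₂ + 2 * p 1)))
    (hg : ∀ p, g.val p = e + max d.ε (p 1))
    (h : (d.liftCurve Q M c).carrier ⊆ (TropPoly.modification (f.scale l) g).hypersurface) :
    l + κ = c + e := by
  let x : Fin 2 → ℝ := ![d.γ 0, d.lower (d.γ 0)]
  have hx1 : x 1 = d.lower (x 0) := rfl
  have hε := hd.ε_lt_lower (x 0)
  have hlu := hd.lower_lt_upper (x 0)
  have hml := hd.mid_lt_lower (hd.γ_lt_σ' hd.pos hd.pos)
  replace hml : d.mid (x 0) < d.lower (x 0) := hml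
  have h1 : pt3 x (d.height x + c) ∈ (d.liftCurve Q M c).carrier := by
    rw [liftCurve, mem_carrier_graphCurve, hm.carrier_eq hd, proj_pt3, pt3_two]
    exact Or.inl ⟨hm.mem_hypersurface_lower hd hx1, rfl⟩
  have h2 := h h1
  rw [TropPoly.mem_modification_hypersurface, TropPoly.scale_hypersurface, TropPoly.scale_val,
    proj_pt3, pt3_two, height_of_le_lower hd hx1.le, hf, hg] at h2
  rcases h2 with h2 | ⟨-, h2⟩ | ⟨-, h2⟩
  · have h3 := hd.row_two_lt hlu.le
    rw [hx1, max_eq_right hε.le, max_eq_left] at h2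
    · linarith
    · refine max_le (by linarith) ?_
      rcases h3 with h3 | h3 <;> linarith
  · rcases hm.hypersurface_f_cases hd h2 (by linarith) with ⟨-, k, hk, h3⟩ | h3 | ⟨h3, -⟩
    · exact absurd h3.symm (hd.β_ne_γ hk hd.pos)
    · linarith
    · linarith
  · linarith [hm.mem_hypersurface_g h2]

/-- A common cell is a transverse intersection of facets, or it is a point because the exponents
realizing the maxima on it span; the latter cells are not of top dimension. -/
lemma IsModel.transverse (hm : d.IsModel P Q f g M) (hd : d.Valid)
    (hc : ∀ p, P.val p = c + max (d.upper (p 0)) (p 1))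
    (hf : ∀ p, f.val p = κ + max (d.lower (p 0) + d.upper (p 0))
      (max (d.mid (p 0) + p 1) (d.f₂ + 2 * p 1)))
    (hg : ∀ p, g.val p = e + max d.ε (p 1)) (hl : l + κ = c + e) :
    IntersectTransversely (TropPoly.modification P (TropPoly.unit 2))
      (TropPoly.modification (f.scale l) g) := by
  intro b hb hmax
  obtain ⟨r, hX, hY, rfl⟩ := exists_point_of_commonCells hb
  have hA := hm.maxTerms_X hc
  have hB := hm.maxTerms_Y hf hg hl
  have hgood := (hm.meetType hd hc hf hg hl hX hY).independentOrSpanning hm hd hc hf hg hl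
  generalize TropPoly.modification P (TropPoly.unit 2) = X at *
  generalize TropPoly.modification (f.scale l) g = Y at *
  rcases hgood with ⟨a, a', b, b', h1, h2, haa', w, hw, hw'⟩ | ⟨-, -, hspan⟩
  · have hbb' : b ≠ b' := by
      rintro rfl
      rw [sub_self, TropPoly.functional_apply] at hw'
      simp at hw'
    refine ⟨_, TropPoly.cellAt_mem_facets_of_two h1 haa', _,
      TropPoly.cellAt_mem_facets_of_two h2 hbb', rfl,
      ⟨r, TropPoly.mem_intrinsicInterior_cellAt_of_two h1,
        TropPoly.mem_intrinsicInterior_cellAt_of_two h2⟩, ?_⟩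
    rw [TropPoly.vectorSpan_cellAt_of_two h1, TropPoly.vectorSpan_cellAt_of_two h2]
    exact TropPoly.ker_sup_ker_eq_top ⟨w, hw, hw'⟩
  · exfalso
    have hfun : ∀ (R : TropPoly 3) (q : Fin 3 → ℝ), q ∈ R.cellAt r →
        ∀ a ∈ R.maxTerms r, ∀ b ∈ R.maxTerms r, TropPoly.functional (a - b) (q - r) = 0 := by
      intro R q hq a ha b hb
      have e1 := (R.val_eq_of_mem ha).symm.trans (R.val_eq_of_mem hb)
      have e2 := (R.val_eq_of_mem (hq ha)).symm.trans (R.val_eq_of_mem (hq hb))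
      have e3 := R.term_add a r (q - r)
      have e4 := R.term_add b r (q - r)
      rw [add_sub_cancel] at e3 e4
      rw [TropPoly.functional_sub, TropPoly.functional_apply, TropPoly.functional_apply]
      linarith
    -- the cell is a point
    have hsub : (X.cellAt r ∩ Y.cellAt r).Subsingleton := by
      have h : ∀ q ∈ X.cellAt r ∩ Y.cellAt r, q = r := fun q hq =>
        sub_eq_zero.1 (hspan _ (hfun X q hq.1) (hfun Y q hq.2))
      exact fun q hq q' hq' => (h q hq).trans (h q' hq').symm
    have hdim : setDim (X.cellAt r ∩ Y.cellAt r) = 0 := by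
      unfold setDim
      rw [vectorSpan_of_subsingleton ℝ hsub, finrank_bot]
    -- over the first vertical ray, there is a common cell that is not a point
    let p : ℝ → Fin 3 → ℝ := fun s => ![d.β 0, d.lower (d.β 0) - s, c + d.upper (d.β 0)]
    have hε := hd.ε_lt_lower (d.β 0)
    have hlu := hd.lower_lt_upper (d.β 0)
    have hml := hd.mid_lt_lower (hd.β_lt_σ hd.pos hd.pos)
    have hpk := peak_at_break hd.increasing_β hd.pos
    have hf₂ := hd.row_two_lt hlu.le
    have hpA : ∀ s > 0, ∀ m, m ∈ X.maxTerms (p s) ↔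
        (∃ k, m = vec3 (ipt k 0) 0 ∧ Peak d.n d.γ k (d.β 0)) ∨ m = vec3 (ipt 0 0) 1 := by
      intro s hs m
      have e0 : p s 0 = d.β 0 := rfl
      have e1 : p s 1 = d.lower (d.β 0) - s := rfl
      have e2 : p s 2 = c + d.upper (d.β 0) := rfl
      rw [hA, e0, e1, e2]
      constructor
      · rintro (⟨k, rfl, hk, -⟩ | ⟨rfl, h, -⟩ | ⟨rfl, -⟩)
        · exact Or.inl ⟨k, rfl, hk⟩
        · linarith
        · exact Or.inr rfl
      · rintro (⟨k, rfl, hk⟩ | rfl)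
        · exact Or.inl ⟨k, rfl, hk, by linarith, le_rfl⟩
        · exact Or.inr (Or.inr ⟨rfl, le_rfl, by linarith⟩)
    have hpB : ∀ s > 0, ∀ m, m ∈ Y.maxTerms (p s) ↔
        ∃ k, m = vec3 (ipt k 0) 0 ∧ Peak d.n d.β k (d.β 0) := by
      intro s hs m
      have e0 : p s 0 = d.β 0 := rfl
      have e1 : p s 1 = d.lower (d.β 0) - s := rfl
      have e2 : p s 2 = c + d.upper (d.β 0) := rfl
      rw [hB, e0, e1, e2]
      constructor
      · rintro (⟨k, rfl, hk, -⟩ | ⟨k, rfl, hk, h6, -⟩ | ⟨rfl, h6, h7, -⟩ | ⟨rfl, h6, h7, -⟩ |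
          ⟨rfl, -, h6, -⟩)
        · exact ⟨k, rfl, hk⟩
        all_goals first | linarith | (rcases hf₂ with hf₂ | hf₂ <;> linarith)
      · rintro ⟨k, rfl, hk⟩
        refine Or.inl ⟨k, rfl, hk, ?_, ?_, ?_, ?_⟩ <;> rcases hf₂ with hf₂ | hf₂ <;> linarith
    obtain ⟨i, hi, -⟩ := exists_peak hd.increasing_γ (d.β 0)
    have hcell : X.cellAt (p 1) ∩ Y.cellAt (p 1) ∈ commonCells X Y :=
      ⟨⟨p 1, X.mem_cellAt_self _, Y.mem_cellAt_self _⟩, _, ⟨p 1,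
        ⟨_, (hpA 1 one_pos _).2 (Or.inl ⟨i, rfl, hi⟩), _, (hpA 1 one_pos _).2 (Or.inr rfl),
          by simp [vec3_ipt_inj]⟩, rfl⟩, _, ⟨p 1,
        ⟨_, (hpB 1 one_pos _).2 ⟨0, rfl, by rw [hpk]; simp⟩, _,
          (hpB 1 one_pos _).2 ⟨1, rfl, by rw [hpk]; simp⟩, by simp [vec3_ipt_inj]⟩, rfl⟩, rfl⟩
    have hmem : p 2 ∈ X.cellAt (p 1) ∩ Y.cellAt (p 1) :=
      ⟨fun m hm => (hpA 2 two_pos m).2 ((hpA 1 one_pos m).1 hm),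
        fun m hm => (hpB 2 two_pos m).2 ((hpB 1 one_pos m).1 hm)⟩
    have h0 := hmax _ hcell
    rw [hdim, Nat.le_zero, setDim, Submodule.finrank_eq_zero] at h0
    have h1 := vsub_mem_vectorSpan ℝ hmem
      (show p 1 ∈ X.cellAt (p 1) ∩ Y.cellAt (p 1) from ⟨X.mem_cellAt_self _, Y.mem_cellAt_self _⟩)
    rw [h0, Submodule.mem_bot] at h1
    have h2 := congrFun h1 1
    simp [p] at h2
    linarith

end Config



theorem mainTheorem3 (n : ℕ) (hn : 1 ≤ n)
    -- tropical polynomials defining the curves D, C, F and the horizontal line E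
    (P Q f g : TropPoly 2) (ε : ℝ)
    -- the marked points x 1, ..., x (2 * n) and the set they form
    (x : ℕ → Fin 2 → ℝ) (M : Set (Fin 2 → ℝ))
    (hM : M = {p | ∃ k, 1 ≤ k ∧ k ≤ 2 * n ∧ p = x k})
    -- the dual subdivisions of D and C
    (hD : P.HasDualSubdivision {T | ∃ k < n, T = triDelta k})
    (hC : Q.HasDualSubdivision {T | ∃ k < n, T = triK k ∨ T = triL k ∨ T = triM k})
    -- the position of D, C and the marked points
    (hDC : ∀ k < n, ∃ v, P.dualCell v = triDelta k ∧ Q.dualCell v = triM k)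
    (hx_edge : ∀ k < n, Q.dualCell (x (k + 1)) = segment ℝ (pt k 1) (pt 0 2))
    (hx_first : ∀ k < n, ∃ v, Q.dualCell v = triK k ∧ x (k + 1) 0 = v 0)
    (hx_last : ∀ k, n + 1 ≤ k → k ≤ 2 * n → Q.dualCell (x k) = segment ℝ (pt 0 2) (pt n 1))
    -- the dual subdivision of F, and the line E
    (hF : f.HasDualSubdivision {T | ∃ k < n, T = triDelta k ∨ T = triH n k ∨ T = triM k})
    (hg : g.newtonPolytope = segment ℝ (pt 0 0) (pt 0 1))
    (hE : g.hypersurface = {p | p 1 = ε})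
    -- the position of E and F with respect to C and the marked points
    (hEC : ∀ v, (interior (Q.dualCell v)).Nonempty → ε < v 1)
    (hF_first : ∀ k < n, f.dualCell (x (k + 1)) = segment ℝ (pt k 0) (pt (k + 1) 0))
    (hF_mid : f.dualCell (x (n + 1)) = segment ℝ (pt 1 1) (pt n 0))
    (hF_last : ∀ k, 1 ≤ k → k ≤ n - 1 →
      f.dualCell (x (n + k + 1)) = segment ℝ (pt k 1) (pt (k + 1) 1)) :
    ∃ L : WeightedEdges 3,
      -- L is the unique lift of the marked curve (C, x 1, ..., x (2 * n)) to X
      IsLiftTo (markedCurve Q M) M (TropPoly.modification P (TropPoly.unit 2)).hypersurface L ∧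
      (∀ L', IsLiftTo (markedCurve Q M) M
        (TropPoly.modification P (TropPoly.unit 2)).hypersurface L' → L' = L) ∧
      -- there is a constant l such that L is also a lift to the modification Y along l f / g
      (∃ l : ℝ, IsLiftTo (markedCurve Q M) M
        (TropPoly.modification (f.scale l) g).hypersurface L) ∧
      -- for such a constant, X and Y intersect transversely, and their intersection is L
      ∀ l : ℝ, IsLiftTo (markedCurve Q M) M
          (TropPoly.modification (f.scale l) g).hypersurface L →
        IntersectTransversely (TropPoly.modification P (TropPoly.unit 2))
          (TropPoly.modification (f.scale l) g) ∧
        L.carrier = (TropPoly.modification P (TropPoly.unit 2)).hypersurface ∩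
          (TropPoly.modification (f.scale l) g).hypersurface := by
  obtain ⟨d, hd, hm⟩ := exists_model n hn P Q f g ε x M hM hD hC hDC hx_edge hx_first hx_last hF hg hE
    hEC hF_first hF_mid hF_last
  obtain ⟨c, hc⟩ := hm.P_val
  obtain ⟨κ, hf⟩ := hm.f_val
  obtain ⟨e, hg'⟩ := hm.g_val
  have hlift := hm.liftCurve_isLift hd c
  have hcar : ∀ {l : ℝ}, l + κ = c + e → (d.liftCurve Q M c).carrier = _ :=
    fun hl => hm.carrier_liftCurve hd hc hf hg' hl
  have hl : c + e - κ + κ = c + e := by ring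
  refine ⟨d.liftCurve Q M c, ⟨hlift, ?_⟩, fun L hL => hm.eq_liftCurve hd hc hL,
    ⟨c + e - κ, hlift, ?_⟩, fun l hL => ?_⟩
  · rw [hcar hl]; exact Set.inter_subset_left
  · rw [hcar hl]; exact Set.inter_subset_right
  · have hl := hm.const_of_subset hd hf hg' hL.2
    exact ⟨hm.transverse hd hc hf hg' hl, hcar hl⟩
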